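/- Running times are those of deterministic word-RAM programs, where every elementary operation on words costs one step; solving a problem in time $O(\tau)$ means that a single program solves every admissible input of length $N$ in at most $C\tau$ steps with words of $O(\log(N+\tau))$ bits, $C$ a constant. Write $a=\tilde\Theta(f)$ if $f\le K a\log^{K}(f+2)$ and $a\le K f\log^{K}(f+2)$ for a constant $K$. *ST-Max-Flow* is the following problem: given a directed graph $G=(V,E)$ with $n$ nodes, $m$ edges and positive integer edge capacities, and sets $S,T\subseteq V$, output for every pair $s\in S$, $t\in T$ with $s\ne t$ the maximum value of a flow from $s$ to $t$ in $G$. *MAX-CNF-SAT* is the problem of computing the maximum number of clauses of a given CNF formula that can be satisfied simultaneously. *SETH* states that for every $\varepsilon>0$ there is an integer $k\ge 3$ such that $k$-SAT on $n$ variables and $m$ clauses cannot be solved in time $2^{(1-\varepsilon)n}\,\mathrm{poly}(m)$. **Theorem 1.** For every $\varepsilon>0$ there is $\delta=\delta(\varepsilon)>0$ such that the following holds for all $c_1,c_2\in[0,1]$. Suppose that ST-Max-Flow on sparse graphs ($m=O(n)$ and $n=O(m)$) with capacities in $\{1,\dots,n\}$ and nonempty $S,T$ with $|S|=\tilde\Theta(n^{c_1})$,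 $|T|=\tilde\Theta(n^{c_2})$ can be solved in time $O\big((|S||T|m)^{1-\varepsilon}\big)$, for every choice of the constants hidden in the $O(\cdot)$ and $\tilde\Theta(\cdot)$ that bound the inputs. Then MAX-CNF-SAT on $n'$ variables and $O(n')$ clauses can be solved in time $O(2^{(1-\delta)n'})$ (for every choice of the constant that bounds the number of clauses), and in particular SETH is false. -/

import Mathlib

/-! ### The machine model: a deterministic word RAM

Programs are structured (sequencing, branching, loops) over finitely many registers and finitely many
arrays of words with random access, all initially zero except for the input.
Every elementary instruction and every test costs one step.  A run is taken with respect to a word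
bound `W`: it may only ever hold numbers `< W` (that is, words of `log₂ W` bits), otherwise it is
stuck and does not count as a run. -/

namespace WordRAM

/-- The elementary operations on words. -/
inductive BinOp where
  | add | sub | mul | div | mod | land | lor | xor | shl | shr

/-- Their values (`sub` is truncated subtraction, division by zero gives zero). -/
def BinOp.eval : BinOp → ℕ → ℕ → ℕ
  | .add, x, y => x + y
  | .sub, x, y => x - y
  | .mul, x, y => x * y
  | .div, x, y => x / y
  | .mod, x, y => x % y
  | .land, x, y => x &&& y
  | .lor, x, y => x ||| y
  | .xor, x, y => x ^^^ y
  | .shl, x, y => x <<< y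
  | .shr, x, y => x >>> y

/-- Programs.  Registers and arrays are named by fixed natural numbers, array cells are addressed by
the content of a register. -/
inductive Program where
  /-- do nothing -/
  | skip
  /-- `reg x := k` -/
  | const (x k : ℕ)
  /-- `reg x := reg y ∘ reg z` -/
  | arith (o : BinOp) (x y z : ℕ)
  /-- `reg x := mem a [reg y]` -/
  | load (x a y : ℕ)
  /-- `mem a [reg y] := reg x` -/
  | store (a y x : ℕ)
  /-- first `p`, then `q` -/
  | seq (p q : Program)
  /-- if `reg x ≠ 0` then `p` else `q` -/
  | branch (x : ℕ) (p q : Program)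
  /-- while `reg x ≠ 0` do `p` -/
  | loop (x : ℕ) (p : Program)

/-- The contents of the registers and of the arrays. -/
structure State where
  reg : ℕ → ℕ
  mem : ℕ → ℕ → ℕ

/-- Assign the value `v` to the register `x`. -/
def State.setReg (s : State) (x v : ℕ) : State :=
  { s with reg := Function.update s.reg x v }

/-- Assign the value `v` to cell `i` of the array `a`. -/
def State.setMem (s : State) (a i v : ℕ) : State :=
  { s with mem := Function.update s.mem a (Function.update (s.mem a) i v) }

/-- `Runs W p s t s'`: with word bound `W`, program `p` started in state `s` halts after exactly
`t` steps in state `s'`. -/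
inductive Runs (W : ℕ) : Program → State → ℕ → State → Prop
  | skip (s : State) : Runs W .skip s 1 s
  | const (s : State) (x k : ℕ) (h : k < W) : Runs W (.const x k) s 1 (s.setReg x k)
  | arith (s : State) (o : BinOp) (x y z : ℕ) (h : o.eval (s.reg y) (s.reg z) < W) :
      Runs W (.arith o x y z) s 1 (s.setReg x (o.eval (s.reg y) (s.reg z)))
  | load (s : State) (x a y : ℕ) : Runs W (.load x a y) s 1 (s.setReg x (s.mem a (s.reg y)))
  | store (s : State) (a y x : ℕ) : Runs W (.store a y x) s 1 (s.setMem a (s.reg y) (s.reg x))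
  | seq {p q : Program} {s₁ s₂ s₃ : State} {t₁ t₂ : ℕ}
      (h₁ : Runs W p s₁ t₁ s₂) (h₂ : Runs W q s₂ t₂ s₃) : Runs W (.seq p q) s₁ (t₁ + t₂) s₃
  | branch_true {p q : Program} {s s' : State} {x t : ℕ} (hx : s.reg x ≠ 0)
      (h : Runs W p s t s') : Runs W (.branch x p q) s (t + 1) s'
  | branch_false {p q : Program} {s s' : State} {x t : ℕ} (hx : s.reg x = 0)
      (h : Runs W q s t s') : Runs W (.branch x p q) s (t + 1) s'
  | loop_true {p : Program} {s₁ s₂ s₃ : State} {x t₁ t₂ : ℕ} (hx : s₁.reg x ≠ 0)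
      (h₁ : Runs W p s₁ t₁ s₂) (h₂ : Runs W (.loop x p) s₂ t₂ s₃) :
      Runs W (.loop x p) s₁ (t₁ + t₂ + 1) s₃
  | loop_false {p : Program} {s : State} {x : ℕ} (hx : s.reg x = 0) :
      Runs W (.loop x p) s 1 s

/-- The initial state on a given input: the input is in array `0`, its length in register `0`,
everything else is zero. -/
def initState (input : List ℕ) : State where
  reg := fun x => if x = 0 then input.length else 0
  mem := fun a i => if a = 0 then input.getD i 0 else 0

/-- A computational problem: how instances are written as a sequence of words, and which contents of
the output array are correct for an instance. -/
structure Problem where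
  Inst : Type
  encode : Inst → List ℕ
  Correct : Inst → (ℕ → ℕ) → Prop

/-- The problem, restricted to the instances in `P`, can be solved in time `O(T)` on a word RAM:
one program solves every instance `x` in `P` in at most `C * T x` steps, using words of
`O(log (N + T x))` bits, where `N` is the length of the input and `C` is a constant.
The output is array `1` of the final state. -/
def SolvableInTime (Q : Problem) (P : Q.Inst → Prop) (T : Q.Inst → ℝ) : Prop :=
  ∃ (p : Program) (C : ℕ), ∀ x : Q.Inst, P x →
    ∃ (W t : ℕ) (s : State),
      (W : ℝ) ≤ C * ((Q.encode x).length + T x + 1) ^ C ∧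
      (Q.encode x).length < W ∧ (∀ v ∈ Q.encode x, v < W) ∧
      (t : ℝ) ≤ C * T x ∧
      Runs W p (initState (Q.encode x)) t s ∧
      Q.Correct x (s.mem 1)

end WordRAM

/-! ### Maximum flow between sources and sinks -/

namespace MaxFlow

/-- A directed graph on `n` nodes with natural numbers as edge capacities, given by the list of its
edges `(u, v, capacity)`, together with a set `S` of sources and a set `T` of sinks. -/
structure Instance where
  n : ℕ
  edges : List (Fin n × Fin n × ℕ)
  edges_nodup : (edges.map fun e => (e.1, e.2.1)).Nodup
  loopless : ∀ e ∈ edges, e.1 ≠ e.2.1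
  S : List (Fin n)
  S_nodup : S.Nodup
  T : List (Fin n)
  T_nodup : T.Nodup

/-- The capacity of the pair `(u, v)`; it is zero if `(u, v)` is not an edge. -/
def Instance.cap (G : Instance) (u v : Fin G.n) : ℕ :=
  ((G.edges.filter fun e => e.1 = u ∧ e.2.1 = v).map fun e => e.2.2).sum

/-- Feasible flows from `s` to `t`. -/
def Instance.IsFlow (G : Instance) (s t : Fin G.n) (f : Fin G.n → Fin G.n → ℝ) : Prop :=
  (∀ u v, 0 ≤ f u v ∧ f u v ≤ G.cap u v) ∧
    ∀ v, v ≠ s → v ≠ t → ∑ u, f u v = ∑ u, f v u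

/-- The amount that a flow ships out of `s`. -/
def Instance.flowValue (G : Instance) (s : Fin G.n) (f : Fin G.n → Fin G.n → ℝ) : ℝ :=
  ∑ v, f s v - ∑ v, f v s

/-- `r` is the maximum flow that can be shipped from `s` to `t`. -/
def Instance.IsMaxFlow (G : Instance) (s t : Fin G.n) (r : ℝ) : Prop :=
  IsGreatest {r : ℝ | ∃ f, G.IsFlow s t f ∧ r = G.flowValue s f} r

/-- The input: `n`, `|E|`, `|S|`, `|T|`, then the edges with their capacities, then `S`, then `T`. -/
def Instance.encode (G : Instance) : List ℕ :=
  [G.n, G.edges.length, G.S.length, G.T.length] ++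
    G.edges.flatMap (fun e => [(e.1 : ℕ), (e.2.1 : ℕ), e.2.2]) ++
    G.S.map (fun v => (v : ℕ)) ++ G.T.map (fun v => (v : ℕ))

/-- ST-Max-Flow: report the maximum flow value for all pairs in `S × T` (row by row; a maximum flow
from a node to itself is meaningless and nothing is asked about it). -/
def STMaxFlow : WordRAM.Problem where
  Inst := Instance
  encode := Instance.encode
  Correct G out :=
    ∀ (i : Fin G.S.length) (j : Fin G.T.length), G.S.get i ≠ G.T.get j →
      G.IsMaxFlow (G.S.get i) (G.T.get j) (out (i * G.T.length + j) : ℝ)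

/-- `a = Θ̃(f)` with witness `K` for the constant factors and for the exponent of the logarithm. -/
def ThetaTilde (K : ℕ) (a f : ℝ) : Prop :=
  f ≤ K * a * Real.log (f + 2) ^ K ∧ a ≤ K * f * Real.log (f + 2) ^ K

/-- Sparse instances with `n` nodes, `m` edges where `n / K ≤ m ≤ K n`, capacities in `{1, …, n}`,
and nonempty sets `S`, `T` of sizes `Θ̃(n ^ c₁)`, `Θ̃(n ^ c₂)`. -/
def Instance.Sparse (c₁ c₂ : ℝ) (K : ℕ) (G : Instance) : Prop :=
  G.edges.length ≤ K * G.n ∧ G.n ≤ K * G.edges.length ∧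
  (∀ e ∈ G.edges, 1 ≤ e.2.2 ∧ e.2.2 ≤ G.n) ∧
  G.S ≠ [] ∧ G.T ≠ [] ∧
  ThetaTilde K G.S.length ((G.n : ℝ) ^ c₁) ∧
  ThetaTilde K G.T.length ((G.n : ℝ) ^ c₂)

end MaxFlow

/-! ### Satisfiability -/

namespace SAT

/-- CNF formulas in the variables `0, …, n - 1`.  A literal is a variable with the truth value that
satisfies it; a clause is a list of literals without repetition. -/
structure CNF where
  n : ℕ
  clauses : List (List (Fin n × Bool))
  clause_nodup : ∀ c ∈ clauses, c.Nodup

/-- An assignment satisfies a clause. -/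
def SatisfiesClause {n : ℕ} (a : Fin n → Bool) (c : List (Fin n × Bool)) : Prop :=
  ∃ l ∈ c, a l.1 = l.2

open Classical in
/-- The number of clauses that an assignment satisfies. -/
noncomputable def CNF.numSatisfied (F : CNF) (a : Fin F.n → Bool) : ℕ :=
  F.clauses.countP fun c => SatisfiesClause a c

/-- The input: the numbers of variables and of clauses, then each clause as its number of literals
followed by its literals (`2 v + 1` for the positive and `2 v` for the negative literal). -/
def CNF.encode (F : CNF) : List ℕ :=
  [F.n, F.clauses.length] ++
    F.clauses.flatMap fun c => c.length :: c.map fun l => 2 * (l.1 : ℕ) + l.2.toNat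

/-- MAX-CNF-SAT: the maximum number of clauses that can be satisfied. -/
noncomputable def MaxCNFSAT : WordRAM.Problem where
  Inst := CNF
  encode := CNF.encode
  Correct F out := IsGreatest (Set.range F.numSatisfied) (out 0)

/-- CNF-SAT: decide satisfiability. -/
def CNFSAT : WordRAM.Problem where
  Inst := CNF
  encode := CNF.encode
  Correct F out := out 0 ≠ 0 ↔ ∃ a : Fin F.n → Bool, ∀ c ∈ F.clauses, SatisfiesClause a c

/-- kSAT on `n` variables and `m` clauses can be solved in time `2 ^ ((1 - ε) n) poly(m)`. -/
def KSATSolvable (k : ℕ) (ε : ℝ) : Prop :=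
  ∃ d : ℕ, WordRAM.SolvableInTime CNFSAT
    (fun F : CNF => ∀ c ∈ F.clauses, c.length ≤ k)
    (fun F : CNF => (2 : ℝ) ^ ((1 - ε) * (F.n : ℝ)) * ((F.clauses.length : ℝ) + 1) ^ d)

/-- The Strong Exponential Time Hypothesis. -/
def SETH : Prop :=
  ∀ ε : ℝ, 0 < ε → ∃ k : ℕ, 3 ≤ k ∧ ¬ KSATSolvable k ε

end SAT

/-!
The theorem is a fine-grained reduction from MAX-CNF-SAT to flows between sources and sinks,
together with a word-RAM program that carries it out. Take an integer `q ≥ 3` with `1 / q ≤ ε` and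
`δ = 1 / (2 q)`.

If `(1 + c₁ + c₂) (1 - ε) < 1`, no program as in the hypothesis exists, since it would run in
sublinear time: it leaves an input cell untouched (`Runs.exists_untouched`), although in a sparse
graph made of paths of length two every single capacity affects the maximum flow (`fan_maxFlow`).
Thus `1 ≤ (1 + c₁ + c₂) (1 - ε)` may be assumed (`one_le_exponent`).

Divide the `n` variables into three parts with `n₁`, `n₂`, `n₃` variables. The sources of the graph
`Gadget` are the partial assignments to the first part, the sinks those to the second part, and
every partial assignment `z` to the third part has a gate of capacity `B` and a row of cells, one
for each clause. A source `x` reaches the cells of the clauses that `x` satisfies without using a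
gate; a gate `z` reaches the cells of its row whose clauses `z` does not satisfy; and a cell is
connected to a sink `y` if `y` does not satisfy its clause. With `cnt` the number of clauses
satisfied by `x` and not by `y`, the maximum flow from `x` to `y` is at most `N₃ (cnt + B)`, where
`N₃ = 2 ^ n₃`, and it attains this value if and only if every `z` leaves at least `B` clauses
unsatisfied by all of `x`, `y`, `z` (`Gadget.maxFlow_eq_iff`). So if `B - 1` is the smallest number
of clauses that have to remain unsatisfied, then some pair has a flow below `N₃ (cnt + B)`, and
trying all `z` with a single such pair gives an optimal assignment.

With a share of `1 / (1 + c₁ + c₂)` for `n₃`, and after padding with isolated sources and sinks, the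
graph is sparse, has `O(2 ^ n₃)` nodes up to factors polynomial in the number of clauses, and has
source and sink sets of the required sizes (`exists_sizes`, `Gadget.Balanced.sparse`). The product
`|S| |T| m` is then about `2 ^ n`, so that the flow program needs `2 ^ ((1 - 1 / q) n)` steps, up to
such factors (`right_guess`). Half of the gain `1 / q` absorbs the factors that are polynomial in
`n` (`exists_pow_le_rpow`).

The exponents `c₁`, `c₂` are arbitrary real numbers and the optimum is unknown, so the program goes
through all guesses of the sizes and of `B`, which are polynomially many. For a wrong guess, the
flow program may run forever, use up the memory or give wrong answers. It is therefore simulated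
with a time limit, in a part of the memory that no other round uses (`limited`, `limited_cost`), and
it only serves to propose a pair: an assignment counts only after its satisfied clauses have been
counted (`verify_spec`). So the best value found is always attained, and the right guess makes it
optimal (`round_spec`, `mainCmd_spec`). For the failure of SETH, the same program decides
satisfiability of a formula by comparing the optimum with the number of clauses; its running time is
polynomial in the number of clauses, whatever that number is, so no sparsification is needed.

Word-RAM programs are written in a small imperative language (`Exp`, `Cmd`) with a compiler that is
proved correct (`Cmd.comp_runs`). A bound for the words that occur is read off the text of a
command: each register and each array gets an exponent of a fixed number `X` (`Exp.ub`, `Good`).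
-/

namespace WordRAM

/-! ### A small imperative language -/

/-- Expressions over registers and array cells.  `pow e` is `2 ^ e`, where the exponent is truncated
at the content of register `1`, so that no evaluation can leave the word range. -/
inductive Exp where
  | lit (k : ℕ)
  | var (x : ℕ)
  | idx (a : ℕ) (e : Exp)
  | bin (o : BinOp) (e f : Exp)
  | min (e f : Exp)
  | pow (e : Exp)

/-- The value of an expression. -/
def Exp.eval (s : State) : Exp → ℕ
  | .lit k => k
  | .var x => s.reg x
  | .idx a e => s.mem a (e.eval s)
  | .bin o e f => o.eval (e.eval s) (f.eval s)
  | .min e f => Min.min (e.eval s) (f.eval s)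
  | .pow e => 2 ^ Min.min (e.eval s) (s.reg 1)

/-- Code that puts the value of an expression into register `d`, using only registers from `d`
on. -/
def Exp.comp : Exp → ℕ → Program
  | .lit k, d => .const d k
  | .var x, d => .arith .land d x x
  | .idx a e, d => .seq (e.comp d) (.load d a d)
  | .bin o e f, d => .seq (e.comp d) (.seq (f.comp (d + 1)) (.arith o d d (d + 1)))
  | .min e f, d => .seq (e.comp d) (.seq (f.comp (d + 1))
      (.seq (.arith .sub (d + 1) d (d + 1)) (.arith .sub d d (d + 1))))
  | .pow e, d => .seq (e.comp d) (.seq (.arith .sub (d + 1) d 1) (.seq (.arith .sub d d (d + 1))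
      (.seq (.const (d + 1) 1) (.arith .shl d (d + 1) d))))

/-- The number of steps of the code of an expression. -/
def Exp.size : Exp → ℕ
  | .lit _ => 1
  | .var _ => 1
  | .idx _ e => e.size + 1
  | .bin _ e f => e.size + (f.size + 1)
  | .min e f => e.size + (f.size + 2)
  | .pow e => e.size + 4

/-- Every constant, register value and intermediate result is below `W`, and only registers
below `D` are read. -/
def Exp.Ok (D W : ℕ) (s : State) : Exp → Prop
  | .lit k => k < W
  | .var x => x < D ∧ s.reg x < W
  | .idx _ e => e.Ok D W s
  | .bin o e f => e.Ok D W s ∧ f.Ok D W s ∧ o.eval (e.eval s) (f.eval s) < W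
  | .min e f => e.Ok D W s ∧ f.Ok D W s ∧ e.eval s < W
  | .pow e => 1 < D ∧ e.Ok D W s ∧ e.eval s < W ∧ 1 < W ∧ 2 ^ Min.min (e.eval s) (s.reg 1) < W

/-- Agreement on the arrays and on the registers below `D`. -/
def Agree (D : ℕ) (s s' : State) : Prop :=
  s.mem = s'.mem ∧ ∀ r < D, s.reg r = s'.reg r

theorem Agree.refl (D : ℕ) (s : State) : Agree D s s := ⟨rfl, fun _ _ => rfl⟩

theorem Agree.trans {D : ℕ} {s₁ s₂ s₃ : State} (h : Agree D s₁ s₂) (h' : Agree D s₂ s₃) :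
    Agree D s₁ s₃ := ⟨h.1.trans h'.1, fun r hr => (h.2 r hr).trans (h'.2 r hr)⟩

theorem Agree.mono {D D' : ℕ} {s₁ s₂ : State} (hD : D ≤ D') (h : Agree D' s₁ s₂) :
    Agree D s₁ s₂ := ⟨h.1, fun r hr => h.2 r (by omega)⟩

@[simp] theorem State.setReg_mem (s : State) (x v : ℕ) : (s.setReg x v).mem = s.mem := rfl

theorem State.setReg_reg (s : State) (x v r : ℕ) :
    (s.setReg x v).reg r = if r = x then v else s.reg r := by
  simp [State.setReg, Function.update_apply]

@[simp] theorem State.setReg_reg_self (s : State) (x v : ℕ) : (s.setReg x v).reg x = v := by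
  simp [State.setReg]

@[simp] theorem State.setReg_reg_ne (s : State) {x v r : ℕ} (h : r ≠ x) :
    (s.setReg x v).reg r = s.reg r := by
  simp [State.setReg, h]

@[simp] theorem State.setMem_reg (s : State) (a i v : ℕ) : (s.setMem a i v).reg = s.reg := rfl

theorem State.setMem_mem (s : State) (a i v b j : ℕ) :
    (s.setMem a i v).mem b j = if b = a ∧ j = i then v else s.mem b j := by
  by_cases hb : b = a
  · subst hb
    by_cases hj : j = i <;> simp [State.setMem, hj]
  · simp [State.setMem, hb]

theorem Agree.setReg_right {D d v : ℕ} {s₁ s₂ : State} (hd : D ≤ d) (h : Agree D s₁ s₂) :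
    Agree D s₁ (s₂.setReg d v) :=
  ⟨h.1, fun r hr => by rw [State.setReg_reg_ne _ (by omega)]; exact h.2 r hr⟩

theorem Agree.setReg {D : ℕ} {s₁ s₂ : State} (h : Agree D s₁ s₂) (x v : ℕ) :
    Agree D (s₁.setReg x v) (s₂.setReg x v) :=
  ⟨h.1, fun r hr => by simp only [State.setReg_reg, h.2 r hr]⟩

theorem Agree.setMem {D : ℕ} {s₁ s₂ : State} (h : Agree D s₁ s₂) (a i v : ℕ) :
    Agree D (s₁.setMem a i v) (s₂.setMem a i v) :=
  ⟨by simp [State.setMem, h.1], h.2⟩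

/-- An expression only depends on the arrays and on the registers below `D`. -/
theorem Exp.eval_congr {D W : ℕ} {s s' : State} (h : Agree D s s') :
    ∀ e : Exp, e.Ok D W s → e.eval s' = e.eval s ∧ e.Ok D W s'
  | .lit k, hk => ⟨rfl, hk⟩
  | .var x, hx => ⟨(h.2 x hx.1).symm, hx.1, by rw [← h.2 x hx.1]; exact hx.2⟩
  | .idx a e, he => by
      have := e.eval_congr h he
      exact ⟨by simp [Exp.eval, this.1, h.1], this.2⟩
  | .bin o e f, ⟨he, hf, hv⟩ => by
      have h1 := e.eval_congr h he
      have h2 := f.eval_congr h hf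
      exact ⟨by simp [Exp.eval, h1.1, h2.1], h1.2, h2.2, by rw [h1.1, h2.1]; exact hv⟩
  | .min e f, ⟨he, hf, hv⟩ => by
      have h1 := e.eval_congr h he
      have h2 := f.eval_congr h hf
      exact ⟨by simp [Exp.eval, h1.1, h2.1], h1.2, h2.2, by rw [h1.1]; exact hv⟩
  | .pow e, ⟨hD, he, hv⟩ => by
      have h1 := e.eval_congr h he
      exact ⟨by simp [Exp.eval, h1.1, h.2 1 hD], hD, h1.2, by rw [h1.1, ← h.2 1 hD]; exact hv⟩

/-- The code of an expression computes its value and leaves everything but the registers from `d` on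
unchanged. -/
theorem Exp.comp_runs (D W : ℕ) : ∀ (e : Exp) (d : ℕ) (s : State), D ≤ d → e.Ok D W s →
    ∃ s', Runs W (e.comp d) s e.size s' ∧ s'.reg d = e.eval s ∧ Agree d s s'
  | .lit k, d, s, _, h => ⟨_, .const s d k h, by simp [Exp.eval],
      (Agree.refl d s).setReg_right le_rfl⟩
  | .var x, d, s, _, h => by
      have hx : BinOp.eval .land (s.reg x) (s.reg x) = s.reg x := by simp [BinOp.eval]
      exact ⟨_, .arith s .land d x x (by rw [hx]; exact h.2), by simp [Exp.eval, hx],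
        (Agree.refl d s).setReg_right le_rfl⟩
  | .idx a e, d, s, hd, h => by
      obtain ⟨s₁, r₁, v₁, a₁⟩ := e.comp_runs D W d s hd h
      refine ⟨_, .seq r₁ (.load s₁ d a d), ?_, a₁.setReg_right le_rfl⟩
      simp [Exp.eval, v₁, a₁.1]
  | .bin o e f, d, s, hd, ⟨he, hf, hv⟩ => by
      obtain ⟨s₁, r₁, v₁, a₁⟩ := e.comp_runs D W d s hd he
      obtain ⟨hf', hfk⟩ := f.eval_congr (a₁.mono hd) hf
      obtain ⟨s₂, r₂, v₂, a₂⟩ := f.comp_runs D W (d + 1) s₁ (by omega) hfk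
      have h1 : s₂.reg d = e.eval s := by rw [← a₂.2 d (by omega), v₁]
      have h2 : s₂.reg (d + 1) = f.eval s := by rw [v₂, hf']
      refine ⟨_, .seq r₁ (.seq r₂ (.arith s₂ o d d (d + 1) (by rw [h1, h2]; exact hv))), ?_, ?_⟩
      · simp [Exp.eval, h1, h2]
      · exact (a₁.trans (a₂.mono (by omega))).setReg_right le_rfl
  | .min e f, d, s, hd, ⟨he, hf, hv⟩ => by
      obtain ⟨s₁, r₁, v₁, a₁⟩ := e.comp_runs D W d s hd he
      obtain ⟨hf', hfk⟩ := f.eval_congr (a₁.mono hd) hf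
      obtain ⟨s₂, r₂, v₂, a₂⟩ := f.comp_runs D W (d + 1) s₁ (by omega) hfk
      have h1 : s₂.reg d = e.eval s := by rw [← a₂.2 d (by omega), v₁]
      have h2 : s₂.reg (d + 1) = f.eval s := by rw [v₂, hf']
      refine ⟨_, .seq r₁ (.seq r₂ (.seq (.arith s₂ .sub (d + 1) d (d + 1) ?_)
        (.arith _ .sub d d (d + 1) ?_))), ?_, ?_⟩
      · simp only [BinOp.eval, h1]; omega
      · simp only [BinOp.eval, State.setReg_reg]; simp [h1]; omega
      · simp only [BinOp.eval, State.setReg_reg]; simp [h1, h2, Exp.eval]; omega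
      · exact ((a₁.trans (a₂.mono (by omega))).setReg_right (by omega)).setReg_right le_rfl
  | .pow e, d, s, hd, ⟨hD, he, hv, hW, hp⟩ => by
      obtain ⟨s₁, r₁, v₁, a₁⟩ := e.comp_runs D W d s hd he
      have h0 : s₁.reg 1 = s.reg 1 := (a₁.2 1 (by omega)).symm
      have hm : e.eval s - (e.eval s - s.reg 1) = Min.min (e.eval s) (s.reg 1) := by omega
      refine ⟨_, .seq r₁ (.seq (.arith s₁ .sub (d + 1) d 1 ?_) (.seq (.arith _ .sub d d (d + 1) ?_)
        (.seq (.const _ (d + 1) 1 hW) (.arith _ .shl d (d + 1) d ?_)))), ?_, ?_⟩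
      · simp only [BinOp.eval, v₁]; omega
      · simp only [BinOp.eval, State.setReg_reg]; simp [v₁]; omega
      · simp [BinOp.eval, v₁, h0, hm, Nat.shiftLeft_eq]; exact hp
      · simp [BinOp.eval, v₁, h0, hm, Nat.shiftLeft_eq, Exp.eval]
      · exact (((a₁.setReg_right (by omega)).setReg_right le_rfl).setReg_right
          (by omega)).setReg_right le_rfl

/-- Commands.  `loopFor x e c` runs `c` with `x = 0, 1, …` up to the initial value of `e`;
`whl x c` runs `c` as long as the register `x` and the fuel register `2` are nonzero, and every
round costs one unit of fuel. -/
inductive Cmd where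
  | skip
  | set (x : ℕ) (e : Exp)
  | put (a : ℕ) (i v : Exp)
  | seq (c c' : Cmd)
  | ite (e : Exp) (c c' : Cmd)
  | loopFor (x : ℕ) (e : Exp) (c : Cmd)
  | whl (x : ℕ) (c : Cmd)

/-- `k` rounds of `g`, which is told the number of the round. -/
def forIter (g : ℕ → State → State) : ℕ → State → State
  | 0, s => s
  | k + 1, s => g k (forIter g k s)

/-- The total cost of `k` rounds. -/
def forCost (g : ℕ → State → State) (w : ℕ → State → ℕ) : ℕ → State → ℕ
  | 0, _ => 0
  | k + 1, s => forCost g w k s + w k (forIter g k s)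

/-- At most `n` rounds of `g`, each costing one unit of fuel, as long as register `x` and the fuel
are nonzero. -/
def whIter (x : ℕ) (g : State → State) : ℕ → State → State
  | 0, s => s
  | n + 1, s => if s.reg x = 0 ∨ s.reg 2 = 0 then s else
      whIter x g n (g (s.setReg 2 (s.reg 2 - 1)))

/-- The total cost of the rounds of `whIter`. -/
def whCost (x : ℕ) (g : State → State) (w : State → ℕ) : ℕ → State → ℕ
  | 0, _ => 0
  | n + 1, s => if s.reg x = 0 ∨ s.reg 2 = 0 then 0 else
      w (s.setReg 2 (s.reg 2 - 1)) + whCost x g w n (g (s.setReg 2 (s.reg 2 - 1)))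

/-- The effect of a command. -/
def Cmd.exec : Cmd → State → State
  | .skip, s => s
  | .set x e, s => s.setReg x (e.eval s)
  | .put a i v, s => s.setMem a (i.eval s) (v.eval s)
  | .seq c c', s => c'.exec (c.exec s)
  | .ite e c c', s => if e.eval s ≠ 0 then c.exec s else c'.exec s
  | .loopFor x e c, s => forIter (fun i s => c.exec (s.setReg x i)) (e.eval s) s
  | .whl x c, s => whIter x c.exec (s.reg 2) s

/-- An upper bound for the number of steps of a command. -/
def Cmd.cost : Cmd → State → ℕ
  | .skip, _ => 1
  | .set _ e, _ => e.size + 1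
  | .put _ i v, _ => i.size + v.size + 1
  | .seq c c', s => c.cost s + c'.cost (c.exec s)
  | .ite e c c', s => e.size + 1 + (if e.eval s ≠ 0 then c.cost s else c'.cost s)
  | .loopFor x e c, s => e.size + 3 + forCost (fun i s => c.exec (s.setReg x i))
      (fun i s => c.cost (s.setReg x i) + 6) (e.eval s) s
  | .whl x c, s => 6 + whCost x c.exec (fun s => c.cost s + 9) (s.reg 2) s

/-- The code of a command, with registers from `d` on for intermediate results. -/
def Cmd.comp : Cmd → ℕ → Program
  | .skip, _ => .skip
  | .set x e, d => .seq (e.comp d) (.arith .land x d d)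
  | .put a i v, d => .seq (i.comp d) (.seq (v.comp (d + 1)) (.store a d (d + 1)))
  | .seq c c', d => .seq (c.comp d) (c'.comp d)
  | .ite e c c', d => .seq (e.comp d) (.branch d (c.comp d) (c'.comp d))
  | .loopFor x e c, d => .seq (e.comp d) (.seq (.const (d + 1) 0) (.loop d
      (.seq (.arith .land x (d + 1) (d + 1)) (.seq (c.comp (d + 3)) (.seq (.const (d + 2) 1)
        (.seq (.arith .sub d d (d + 2)) (.arith .add (d + 1) (d + 1) (d + 2))))))))
  | .whl x c, d => .seq ((Exp.min (.var x) (.var 2)).comp d) (.loop d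
      (.seq (.const d 1) (.seq (.arith .sub 2 2 d) (.seq (c.comp d)
        ((Exp.min (.var x) (.var 2)).comp d)))))

/-- The fuel never increases. -/
def Cmd.Tame : Cmd → Prop
  | .skip => True
  | .set x e => x = 2 → e = .lit 0
  | .put _ _ _ => True
  | .seq c c' => c.Tame ∧ c'.Tame
  | .ite _ c c' => c.Tame ∧ c'.Tame
  | .loopFor x _ c => x ≠ 2 ∧ c.Tame
  | .whl _ c => c.Tame

theorem forIter_inv {g : ℕ → State → State} {k : ℕ} {s : State} (I : ℕ → State → Prop)
    (h0 : I 0 s) (hs : ∀ i < k, ∀ s, I i s → I (i + 1) (g i s)) : I k (forIter g k s) := by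
  induction k with
  | zero => exact h0
  | succ k ih => exact hs k (by omega) _ (ih fun i hi => hs i (by omega))

theorem whIter_inv {x : ℕ} {g : State → State} (I : State → Prop)
    (hs : ∀ s, s.reg x ≠ 0 → s.reg 2 ≠ 0 → I s → I (g (s.setReg 2 (s.reg 2 - 1)))) :
    ∀ (n : ℕ) (s : State), I s → I (whIter x g n s)
  | 0, _, h => h
  | n + 1, s, h => by
      unfold whIter
      split_ifs with hc
      · exact h
      · push Not at hc
        exact whIter_inv I hs n _ (hs s hc.1 hc.2 h)

/-- Since the fuel never increases, its initial value bounds the total number of rounds of all `whl`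
loops, nested ones included. -/
theorem Cmd.Tame.exec_le : ∀ {c : Cmd}, c.Tame → ∀ s, (c.exec s).reg 2 ≤ s.reg 2
  | .skip, _, _ => le_rfl
  | .set x e, h, s => by
      by_cases hx : x = 2
      · subst hx; simp [Cmd.exec, h rfl, Exp.eval]
      · simp [Cmd.exec, State.setReg_reg_ne _ (Ne.symm hx)]
  | .put a i v, _, s => le_rfl
  | .seq c c', h, s => (h.2.exec_le _).trans (h.1.exec_le s)
  | .ite e c c', h, s => by
      simp only [Cmd.exec]
      split_ifs
      · exact h.1.exec_le s
      · exact h.2.exec_le s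
  | .loopFor x e c, h, s => by
      refine forIter_inv (fun _ s' => s'.reg 2 ≤ s.reg 2) le_rfl fun i _ s' hs' => ?_
      refine (h.2.exec_le _).trans ?_
      rwa [State.setReg_reg_ne _ (Ne.symm h.1)]
  | .whl x c, h, s => by
      refine whIter_inv (fun s' => s'.reg 2 ≤ s.reg 2) (fun s' _ _ hs' => ?_) _ _ le_rfl
      refine (Cmd.Tame.exec_le (c := c) h _).trans ?_
      simp; omega

/-! ### Static control of the size of words -/

/-- An exponent `k` such that the value of the expression is at most `X ^ k`, given such exponents
for the registers and for the arrays. -/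
def Exp.ub (cls acl : ℕ → ℕ) : Exp → ℕ
  | .lit k => k
  | .var x => cls x
  | .idx a _ => acl a
  | .bin o e f => match o with
    | .add | .lor | .xor => max (e.ub cls acl) (f.ub cls acl) + 1
    | .mul => e.ub cls acl + f.ub cls acl
    | _ => e.ub cls acl
  | .min _ f => f.ub cls acl
  | .pow _ => 1

/-- All subexpressions stay below `X ^ E`, and only registers below `D` are used. -/
def Exp.Wf (D : ℕ) (cls acl : ℕ → ℕ) (E : ℕ) : Exp → Prop
  | .lit k => k ≤ E
  | .var x => x < D ∧ cls x ≤ E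
  | .idx a e => acl a ≤ E ∧ e.Wf D cls acl E
  | .bin o e f => o ≠ .shl ∧ (Exp.bin o e f).ub cls acl ≤ E ∧ e.Wf D cls acl E ∧ f.Wf D cls acl E
  | .min e f => e.Wf D cls acl E ∧ f.Wf D cls acl E
  | .pow e => 1 ≤ E ∧ 1 < D ∧ e.Wf D cls acl E

/-- All registers and array cells respect their exponents, and so does the width in register `1`. -/
structure Good (X : ℕ) (cls acl : ℕ → ℕ) (s : State) : Prop where
  two_le : 2 ≤ X
  reg_le : ∀ r, s.reg r ≤ X ^ cls r
  mem_le : ∀ a i, s.mem a i ≤ X ^ acl a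
  width_le : 2 ^ s.reg 1 ≤ X

theorem or_le_add (x y : ℕ) : x ||| y ≤ x + y := by
  induction x using Nat.binaryRec' generalizing y with
  | zero => simp
  | bit b n _ ih =>
    obtain ⟨c, m, rfl⟩ : ∃ c m, y = Nat.bit c m := ⟨y.bodd, y.div2, (Nat.bit_bodd_div2 y).symm⟩
    have := ih m
    rw [Nat.lor_bit]
    cases b <;> cases c <;> simp [Nat.bit_val] <;> omega

theorem xor_le_add (x y : ℕ) : x ^^^ y ≤ x + y := by
  refine le_trans ?_ (or_le_add x y)
  refine Nat.le_of_testBit fun i => ?_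
  simp only [Nat.testBit_xor, Nat.testBit_or]
  cases x.testBit i <;> cases y.testBit i <;> simp

theorem pow_max_add {X x y a b : ℕ} (hX : 2 ≤ X) (hx : x ≤ X ^ a) (hy : y ≤ X ^ b) :
    x + y ≤ X ^ (max a b + 1) := by
  have h1 : x ≤ X ^ max a b := hx.trans (Nat.pow_le_pow_right (by omega) (le_max_left _ _))
  have h2 : y ≤ X ^ max a b := hy.trans (Nat.pow_le_pow_right (by omega) (le_max_right _ _))
  have h3 : 2 * X ^ max a b ≤ X ^ (max a b + 1) := by
    rw [pow_succ, mul_comm]; exact Nat.mul_le_mul_left _ hX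
  omega

/-- The static exponent of an expression is correct. -/
theorem Exp.eval_le {D X E : ℕ} {cls acl : ℕ → ℕ} {s : State} (hs : Good X cls acl s) :
    ∀ e : Exp, e.Wf D cls acl E → e.eval s ≤ X ^ e.ub cls acl
  | .lit k, _ => (Nat.lt_two_pow_self.le).trans (Nat.pow_le_pow_left hs.two_le k)
  | .var x, _ => hs.reg_le x
  | .idx a e, _ => hs.mem_le a _
  | .bin o e f, ⟨ho, _, he, hf⟩ => by
      have h1 := e.eval_le hs he
      have h2 := f.eval_le hs hf
      cases o with
      | add => exact pow_max_add hs.two_le h1 h2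
      | sub => exact (Nat.sub_le _ _).trans h1
      | mul => simp only [Exp.ub, pow_add]; exact Nat.mul_le_mul h1 h2
      | div => exact (Nat.div_le_self _ _).trans h1
      | mod => exact (Nat.mod_le _ _).trans h1
      | land => exact Nat.and_le_left.trans h1
      | lor => exact (or_le_add _ _).trans (pow_max_add hs.two_le h1 h2)
      | xor => exact (xor_le_add _ _).trans (pow_max_add hs.two_le h1 h2)
      | shl => exact absurd rfl ho
      | shr => exact (Nat.shiftRight_le _ _).trans h1
  | .min e f, ⟨_, hf⟩ => (min_le_right _ _).trans (f.eval_le hs hf)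
  | .pow e, _ => by
      simp only [Exp.eval, Exp.ub, pow_one]
      exact (Nat.pow_le_pow_right (by norm_num) (min_le_right _ _)).trans hs.width_le

theorem Exp.Wf.ub_le {D E : ℕ} {cls acl : ℕ → ℕ} :
    ∀ {e : Exp}, e.Wf D cls acl E → e.ub cls acl ≤ E
  | .lit _, h => h
  | .var _, h => h.2
  | .idx _ _, h => h.1
  | .bin _ _ _, h => h.2.1
  | .min _ _, h => h.2.ub_le
  | .pow _, h => h.1

theorem Exp.Wf.eval_lt {D X E : ℕ} {cls acl : ℕ → ℕ} {s : State} (hs : Good X cls acl s) {e : Exp}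
    (he : e.Wf D cls acl E) : e.eval s < X ^ E + 1 :=
  Nat.lt_succ_of_le ((e.eval_le hs he).trans
    (Nat.pow_le_pow_right (by have := hs.two_le; omega) he.ub_le))

theorem Exp.Wf.ok {D X E : ℕ} {cls acl : ℕ → ℕ} {s : State} (hs : Good X cls acl s) :
    ∀ {e : Exp}, e.Wf D cls acl E → e.Ok D (X ^ E + 1) s
  | .lit k, h => Exp.Wf.eval_lt (D := D) hs (e := .lit k) h
  | .var x, h => ⟨h.1, Exp.Wf.eval_lt hs (e := .var x) h⟩
  | .idx a e, h => Exp.Wf.ok hs (e := e) h.2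
  | .bin o e f, h => ⟨h.2.2.1.ok hs, h.2.2.2.ok hs, Exp.Wf.eval_lt hs (e := .bin o e f) h⟩
  | .min e f, h => ⟨h.1.ok hs, h.2.ok hs, h.1.eval_lt hs⟩
  | .pow e, h => by
      refine ⟨h.2.1, h.2.2.ok hs, h.2.2.eval_lt hs, ?_, Exp.Wf.eval_lt hs (e := .pow e) h⟩
      have h1 := hs.two_le
      have h2 : X ^ 1 ≤ X ^ E := Nat.pow_le_pow_right (by omega) h.1
      rw [pow_one] at h2
      omega

/-- Static well-formedness: every assignment respects the exponents, the width register is never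
assigned, and the bodies of `whl` do not increase the fuel. -/
def Cmd.Wf (D : ℕ) (cls acl : ℕ → ℕ) (E : ℕ) : Cmd → Prop
  | .skip => True
  | .set x e => x < D ∧ x ≠ 1 ∧ e.Wf D cls acl E ∧ e.ub cls acl ≤ cls x
  | .put a i v => i.Wf D cls acl E ∧ v.Wf D cls acl E ∧ v.ub cls acl ≤ acl a
  | .seq c c' => c.Wf D cls acl E ∧ c'.Wf D cls acl E
  | .ite e c c' => e.Wf D cls acl E ∧ c.Wf D cls acl E ∧ c'.Wf D cls acl E
  | .loopFor x e c => x < D ∧ x ≠ 1 ∧ e.Wf D cls acl E ∧ e.ub cls acl ≤ cls x ∧ c.Wf D cls acl E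
  | .whl x c => x < D ∧ 2 < D ∧ 1 ≤ E ∧ cls x ≤ E ∧ cls 2 ≤ E ∧ c.Wf D cls acl E ∧ c.Tame

theorem Good.setReg {X : ℕ} {cls acl : ℕ → ℕ} {s : State} (hs : Good X cls acl s) {x v : ℕ}
    (hx : x ≠ 1) (hv : v ≤ X ^ cls x) : Good X cls acl (s.setReg x v) where
  two_le := hs.two_le
  reg_le r := by
    rw [State.setReg_reg]
    split_ifs with h
    · rw [h]; exact hv
    · exact hs.reg_le r
  mem_le := hs.mem_le
  width_le := by rw [State.setReg_reg_ne _ (Ne.symm hx)]; exact hs.width_le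

theorem Good.setMem {X : ℕ} {cls acl : ℕ → ℕ} {s : State} (hs : Good X cls acl s) {a i v : ℕ}
    (hv : v ≤ X ^ acl a) : Good X cls acl (s.setMem a i v) where
  two_le := hs.two_le
  reg_le := hs.reg_le
  mem_le b j := by
    rw [State.setMem_mem]
    split_ifs with h
    · rw [h.1]; exact hv
    · exact hs.mem_le b j
  width_le := hs.width_le

theorem Good.exp_le {X D E : ℕ} {cls acl : ℕ → ℕ} {s : State} (hs : Good X cls acl s) {e : Exp}
    (he : e.Wf D cls acl E) {k : ℕ} (hk : e.ub cls acl ≤ k) : e.eval s ≤ X ^ k :=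
  (e.eval_le hs he).trans (Nat.pow_le_pow_right (by have := hs.two_le; omega) hk)

theorem Good.fuel {X : ℕ} {cls acl : ℕ → ℕ} {s : State} (hs : Good X cls acl s) :
    Good X cls acl (s.setReg 2 (s.reg 2 - 1)) :=
  hs.setReg (by norm_num) ((Nat.sub_le _ _).trans (hs.reg_le 2))

/-- Every command that passes the static check keeps all registers and cells within their exponents.
-/
theorem Cmd.Wf.good {D X E : ℕ} {cls acl : ℕ → ℕ} : ∀ {c : Cmd}, c.Wf D cls acl E → ∀ {s : State},
    Good X cls acl s → Good X cls acl (c.exec s)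
  | .skip, _, _, hs => hs
  | .set x e, h, s, hs => hs.setReg h.2.1 (hs.exp_le h.2.2.1 h.2.2.2)
  | .put a i v, h, s, hs => hs.setMem (hs.exp_le h.2.1 h.2.2)
  | .seq c c', h, s, hs => h.2.good (h.1.good hs)
  | .ite e c c', h, s, hs => by
      simp only [Cmd.exec]
      split_ifs
      · exact h.2.1.good hs
      · exact h.2.2.good hs
  | .loopFor x e c, h, s, hs => by
      refine forIter_inv (fun _ s' => Good X cls acl s') hs fun i hi s' hs' => ?_
      exact h.2.2.2.2.good (hs'.setReg h.2.1
        (hi.le.trans (hs.exp_le h.2.2.1 h.2.2.2.1)))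
  | .whl x c, h, s, hs =>
      whIter_inv (fun s' => Good X cls acl s') (fun s' _ _ hs' => h.2.2.2.2.2.1.good hs'.fuel)
        _ _ hs

/-- Compilation is correct: on a state that respects the exponents, the code of a well-formed
command computes its effect within its cost, using words of `log₂ (X ^ E)` bits. -/
theorem Cmd.comp_runs {D X E : ℕ} {cls acl : ℕ → ℕ} : ∀ (c : Cmd), c.Wf D cls acl E →
    ∀ (d : ℕ) (s s₀ : State), D ≤ d → Good X cls acl s → Agree D s s₀ →
    ∃ t ≤ c.cost s, ∃ s₁, Runs (X ^ E + 1) (c.comp d) s₀ t s₁ ∧ Agree D (c.exec s) s₁ ∧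
      ∀ r, D ≤ r → r < d → s₁.reg r = s₀.reg r
  | .skip, _, d, s, s₀, _, _, ha => ⟨1, le_rfl, s₀, .skip s₀, ha, fun _ _ _ => rfl⟩
  | .set x e, h, d, s, s₀, hd, hs, ha => by
      obtain ⟨he, hk⟩ := e.eval_congr ha (h.2.2.1.ok hs)
      obtain ⟨s₁, r₁, v₁, a₁⟩ := e.comp_runs D _ d s₀ hd hk
      have hv : BinOp.eval .land (s₁.reg d) (s₁.reg d) = e.eval s := by
        simp [BinOp.eval, v₁, he]
      refine ⟨e.size + 1, le_rfl, _, .seq r₁ (.arith s₁ .land x d d ?_), ?_, fun r hr hrd => ?_⟩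
      · rw [hv]; exact h.2.2.1.eval_lt hs
      · rw [hv]; exact (ha.trans (a₁.mono hd)).setReg x _
      · have := h.1
        rw [State.setReg_reg_ne _ (by omega), a₁.2 r hrd]
  | .put a i v, h, d, s, s₀, hd, hs, ha => by
      obtain ⟨hi, hik⟩ := i.eval_congr ha (h.1.ok hs)
      obtain ⟨s₁, r₁, v₁, a₁⟩ := i.comp_runs D _ d s₀ hd hik
      have ha₁ := ha.trans (a₁.mono hd)
      obtain ⟨hv, hvk⟩ := v.eval_congr ha₁ (h.2.1.ok hs)
      obtain ⟨s₂, r₂, v₂, a₂⟩ := v.comp_runs D _ (d + 1) s₁ (by omega) hvk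
      refine ⟨i.size + (v.size + 1), by simp [Cmd.cost]; omega, _,
        .seq r₁ (.seq r₂ (.store s₂ a d (d + 1))), ?_, fun r hr hrd => ?_⟩
      · rw [v₂, ← a₂.2 d (by omega), v₁, hi, hv]
        exact (ha₁.trans (a₂.mono (by omega))).setMem _ _ _
      · simp [← a₂.2 r (by omega), a₁.2 r hrd]
  | .seq c c', h, d, s, s₀, hd, hs, ha => by
      obtain ⟨t₁, ht₁, s₁, r₁, a₁, f₁⟩ := c.comp_runs h.1 d s s₀ hd hs ha
      obtain ⟨t₂, ht₂, s₂, r₂, a₂, f₂⟩ := c'.comp_runs h.2 d _ s₁ hd (h.1.good hs) a₁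
      exact ⟨t₁ + t₂, add_le_add ht₁ ht₂, s₂, .seq r₁ r₂, a₂,
        fun r hr hrd => (f₂ r hr hrd).trans (f₁ r hr hrd)⟩
  | .ite e c c', h, d, s, s₀, hd, hs, ha => by
      obtain ⟨he, hk⟩ := e.eval_congr ha (h.1.ok hs)
      obtain ⟨s₁, r₁, v₁, a₁⟩ := e.comp_runs D _ d s₀ hd hk
      have ha₁ := ha.trans (a₁.mono hd)
      by_cases hc : e.eval s ≠ 0
      · obtain ⟨t₂, ht₂, s₂, r₂, a₂, f₂⟩ := c.comp_runs h.2.1 d s s₁ hd hs ha₁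
        refine ⟨_, ?_, s₂, .seq r₁ (.branch_true (by rw [v₁, he]; exact hc) r₂), ?_,
          fun r hr hrd => (f₂ r hr hrd).trans (a₁.2 r hrd).symm⟩
        · simp only [Cmd.cost, if_pos hc]; omega
        · simpa only [Cmd.exec, if_pos hc] using a₂
      · obtain ⟨t₂, ht₂, s₂, r₂, a₂, f₂⟩ := c'.comp_runs h.2.2 d s s₁ hd hs ha₁
        refine ⟨_, ?_, s₂, .seq r₁ (.branch_false (by rw [v₁, he]; simpa using hc) r₂), ?_,
          fun r hr hrd => (f₂ r hr hrd).trans (a₁.2 r hrd).symm⟩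
        · simp only [Cmd.cost, if_neg hc]; omega
        · simpa only [Cmd.exec, if_neg hc] using a₂
  | .loopFor x e c, h, d, s, s₀, hd, hs, ha => by
      obtain ⟨hxD, hx1, hew, hxe, hc⟩ := h
      obtain ⟨he, hk⟩ := e.eval_congr ha (hew.ok hs)
      obtain ⟨s₁, r₁, v₁, a₁⟩ := e.comp_runs D _ d s₀ hd hk
      have ha₁ := ha.trans (a₁.mono hd)
      set W := X ^ E + 1 with hW
      have hkW : e.eval s < W := hew.eval_lt hs
      have hX := hs.two_le
      set k := e.eval s with hkdef
      set g : ℕ → State → State := fun i s => c.exec (s.setReg x i) with hg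
      set w : ℕ → State → ℕ := fun i s => c.cost (s.setReg x i) + 6 with hw
      have hgood : ∀ i ≤ k, Good X cls acl (forIter g i s) := fun i hi =>
        forIter_inv (fun _ s' => Good X cls acl s') hs fun j hj s' hs' =>
          hc.good (hs'.setReg hx1 ((by omega : j ≤ k).trans (hs.exp_le hew hxe)))
      set body := Program.seq (.arith .land x (d + 1) (d + 1)) (.seq (c.comp (d + 3))
        (.seq (.const (d + 2) 1)
          (.seq (.arith .sub d d (d + 2)) (.arith .add (d + 1) (d + 1) (d + 2))))) with hbody
      have main : ∀ j i, i + j = k → ∀ u, Agree D (forIter g i s) u → u.reg d = j →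
          u.reg (d + 1) = i → ∃ t, t + forCost g w i s ≤ forCost g w k s + 1 ∧
          ∃ u', Runs W (.loop d body) u t u' ∧
          Agree D (forIter g k s) u' ∧ ∀ r, D ≤ r → r < d → u'.reg r = u.reg r := by
        intro j
        induction j with
        | zero =>
          intro i hi u hu hud hud1
          have hik : i = k := by omega
          subst hik
          exact ⟨1, by omega, u, .loop_false hud, hu, fun _ _ _ => rfl⟩
        | succ j ih =>
          intro i hi u hu hud hud1
          have hgi := hgood i (by omega)
          have hl : BinOp.eval .land (u.reg (d + 1)) (u.reg (d + 1)) = i := by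
            simp [BinOp.eval, hud1]
          have hgi' : Good X cls acl ((forIter g i s).setReg x i) :=
            hgi.setReg hx1 ((by omega : i ≤ k).trans (hs.exp_le hew hxe))
          obtain ⟨t₂, ht₂, u₂, r₂, a₂, f₂⟩ := c.comp_runs hc (d + 3) _ (u.setReg x i) (by omega)
            hgi' (hu.setReg x i)
          have e0 : u₂.reg d = j + 1 := by
            rw [f₂ d hd (by omega), State.setReg_reg_ne _ (by omega), hud]
          have e1 : u₂.reg (d + 1) = i := by
            rw [f₂ (d + 1) (by omega) (by omega), State.setReg_reg_ne _ (by omega), hud1]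
          have hW1 : 1 < W := by omega
          set u₃ := u₂.setReg (d + 2) 1 with hu₃
          have e3 : BinOp.eval .sub (u₃.reg d) (u₃.reg (d + 2)) = j := by
            simp [BinOp.eval, hu₃, e0]
          set u₄ := u₃.setReg d j with hu₄
          have e4 : BinOp.eval .add (u₄.reg (d + 1)) (u₄.reg (d + 2)) = i + 1 := by
            simp [BinOp.eval, hu₄, hu₃, e1]
          obtain ⟨t₅, ht₅, u₅, r₅, a₅, f₅⟩ := ih (i + 1) (by omega) (u₄.setReg (d + 1) (i + 1))
            (((a₂.setReg_right (by omega)).setReg_right hd).setReg_right (by omega))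
            (by simp [hu₄]) (by simp)
          refine ⟨(1 + (t₂ + (1 + (1 + 1)))) + t₅ + 1, ?_, u₅, .loop_true (by omega)
            (.seq (s₂ := u.setReg x i) ?_ (.seq r₂ (.seq (.const u₂ (d + 2) 1 hW1)
              (.seq (s₂ := u₄) ?_ (s₃ := u₄.setReg (d + 1) (i + 1)) ?_)))) r₅, a₅, ?_⟩
          · have hfc : forCost g w (i + 1) s =
                forCost g w i s + (c.cost ((forIter g i s).setReg x i) + 6) := rfl
            omega
          · have := Runs.arith (W := W) u .land x (d + 1) (d + 1) (by rw [hl]; omega)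
            rwa [hl] at this
          · have := Runs.arith (W := W) u₃ .sub d d (d + 2) (by rw [e3]; omega)
            rwa [e3] at this
          · have := Runs.arith (W := W) u₄ .add (d + 1) (d + 1) (d + 2) (by rw [e4]; omega)
            rwa [e4] at this
          · intro r hr hrd
            rw [f₅ r hr hrd, State.setReg_reg_ne _ (by omega), hu₄,
              State.setReg_reg_ne _ (by omega), hu₃, State.setReg_reg_ne _ (by omega),
              f₂ r hr (by omega), State.setReg_reg_ne _ (by omega)]
      obtain ⟨t, ht, u', ru, au, fu⟩ := main k 0 (by omega) (s₁.setReg (d + 1) 0)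
        (ha₁.setReg_right (by omega)) (by simp [v₁, he]) (by simp)
      refine ⟨e.size + (1 + t), ?_, u', .seq r₁ (.seq (.const s₁ (d + 1) 0 (by omega)) ru), au,
        fun r hr hrd => ?_⟩
      · simp only [forCost] at ht
        change e.size + (1 + t) ≤ e.size + 3 + forCost g w k s
        omega
      · rw [fu r hr hrd, State.setReg_reg_ne _ (by omega), a₁.2 r hrd]
  | .whl x c, h, d, s, s₀, hd, hs, ha => by
      obtain ⟨hxD, h2D, hE, hxE, h2E, hc, htame⟩ := h
      set W := X ^ E + 1 with hW
      have hmw : (Exp.min (.var x) (.var 2)).Wf D cls acl E := ⟨⟨hxD, hxE⟩, h2D, h2E⟩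
      have hX := hs.two_le
      have hW1 : 1 < W := by
        have : X ^ 1 ≤ X ^ E := Nat.pow_le_pow_right (by omega) hE
        rw [pow_one] at this
        omega
      set m := Exp.min (.var x) (.var 2) with hm
      set w : State → ℕ := fun s => c.cost s + 9 with hw
      have main : ∀ n s, Good X cls acl s → s.reg 2 ≤ n → ∀ u, Agree D s u →
          u.reg d = m.eval s → ∃ t ≤ whCost x c.exec w n s + 1, ∃ u',
          Runs W (.loop d (.seq (.const d 1) (.seq (.arith .sub 2 2 d) (.seq (c.comp d)
            (m.comp d))))) u t u' ∧ Agree D (whIter x c.exec n s) u' ∧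
            ∀ r, D ≤ r → r < d → u'.reg r = u.reg r := by
        intro n
        induction n with
        | zero =>
          intro s hs hn u hu hud
          refine ⟨1, by omega, u, .loop_false ?_, hu, fun _ _ _ => rfl⟩
          rw [hud]; simp [hm, Exp.eval]; omega
        | succ n ih =>
          intro s hs hn u hu hud
          by_cases hz : s.reg x = 0 ∨ s.reg 2 = 0
          · refine ⟨1, by omega, u, .loop_false ?_, ?_, fun _ _ _ => rfl⟩
            · rw [hud]; simp [hm, Exp.eval]; omega
            · simpa only [whIter, if_pos hz] using hu
          · have e2 : (u.setReg d 1).reg 2 = s.reg 2 := by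
              rw [State.setReg_reg_ne _ (by omega), hu.2 2 h2D]
            have e3 : BinOp.eval .sub ((u.setReg d 1).reg 2) ((u.setReg d 1).reg d) =
                s.reg 2 - 1 := by
              rw [e2]; simp [BinOp.eval]
            have h2lt : s.reg 2 < W := Exp.Wf.eval_lt (D := D) hs (e := .var 2) ⟨h2D, h2E⟩
            have hs' := hs.fuel
            obtain ⟨t₂, ht₂, u₂, r₂, a₂, f₂⟩ := c.comp_runs hc d _
              ((u.setReg d 1).setReg 2 (s.reg 2 - 1)) hd hs' ((hu.setReg_right hd).setReg 2 _)
            have hs₂ := hc.good hs'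
            obtain ⟨he, hk⟩ := m.eval_congr a₂ (hmw.ok hs₂)
            obtain ⟨u₃, r₃, v₃, a₃⟩ := m.comp_runs D _ d u₂ hd hk
            have hle := htame.exec_le (s.setReg 2 (s.reg 2 - 1))
            simp only [State.setReg_reg_self] at hle
            obtain ⟨t₄, ht₄, u₄, r₄, a₄, f₄⟩ := ih _ hs₂ (by omega) u₃ (a₂.trans (a₃.mono hd))
              (by rw [v₃, he])
            refine ⟨(1 + (1 + (t₂ + m.size))) + t₄ + 1, ?_, u₄, .loop_true ?_
              (.seq (.const u d 1 hW1) (.seq (s₂ := (u.setReg d 1).setReg 2 (s.reg 2 - 1)) ?_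
                (.seq r₂ r₃))) r₄, ?_, ?_⟩
            · have : m.size = 4 := rfl
              simp only [whCost, if_neg hz]
              have hwv : w (s.setReg 2 (s.reg 2 - 1)) = c.cost (s.setReg 2 (s.reg 2 - 1)) + 9 := rfl
              omega
            · rw [hud]; simp [hm, Exp.eval]; omega
            · have := Runs.arith (W := W) (u.setReg d 1) .sub 2 2 d (by rw [e3]; omega)
              rwa [e3] at this
            · simpa only [whIter, if_neg hz] using a₄
            · intro r hr hrd
              rw [f₄ r hr hrd, ← a₃.2 r hrd, f₂ r hr hrd, State.setReg_reg_ne _ (by omega),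
                State.setReg_reg_ne _ (by omega)]
      obtain ⟨he, hk⟩ := m.eval_congr ha (hmw.ok hs)
      obtain ⟨s₁, r₁, v₁, a₁⟩ := m.comp_runs D _ d s₀ hd hk
      obtain ⟨t, ht, u', ru, au, fu⟩ := main (s.reg 2) s hs le_rfl s₁ (ha.trans (a₁.mono hd))
        (by rw [v₁, he])
      refine ⟨m.size + t, ?_, u', .seq r₁ ru, au, fun r hr hrd => ?_⟩
      · have : m.size = 4 := rfl
        change m.size + t ≤ 6 + whCost x c.exec w (s.reg 2) s
        omega
      · rw [fu r hr hrd, a₁.2 r hrd]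

/-! ### Frames and static running times -/

/-- The command does not assign the register `r`. -/
def Cmd.NoReg (r : ℕ) : Cmd → Prop
  | .skip => True
  | .set x _ => r ≠ x
  | .put _ _ _ => True
  | .seq c c' => c.NoReg r ∧ c'.NoReg r
  | .ite _ c c' => c.NoReg r ∧ c'.NoReg r
  | .loopFor x _ c => r ≠ x ∧ c.NoReg r
  | .whl _ c => r ≠ 2 ∧ c.NoReg r

/-- The command does not write to the array `a`. -/
def Cmd.NoArr (a : ℕ) : Cmd → Prop
  | .skip => True
  | .set _ _ => True
  | .put b _ _ => a ≠ b
  | .seq c c' => c.NoArr a ∧ c'.NoArr a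
  | .ite _ c c' => c.NoArr a ∧ c'.NoArr a
  | .loopFor _ _ c => c.NoArr a
  | .whl _ c => c.NoArr a

theorem Cmd.NoReg.exec {r : ℕ} : ∀ {c : Cmd}, c.NoReg r → ∀ s, (c.exec s).reg r = s.reg r
  | .skip, _, _ => rfl
  | .set x e, h, s => by simp [Cmd.exec, State.setReg_reg_ne _ h]
  | .put a i v, _, s => rfl
  | .seq c c', h, s => (h.2.exec _).trans (h.1.exec s)
  | .ite e c c', h, s => by
      simp only [Cmd.exec]
      split_ifs
      · exact h.1.exec s
      · exact h.2.exec s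
  | .loopFor x e c, h, s => by
      refine forIter_inv (fun _ s' => s'.reg r = s.reg r) rfl fun i _ s' hs' => ?_
      rw [h.2.exec, State.setReg_reg_ne _ h.1, hs']
  | .whl x c, h, s => by
      refine whIter_inv (fun s' => s'.reg r = s.reg r) (fun s' _ _ hs' => ?_) _ _ rfl
      rw [Cmd.NoReg.exec (c := c) h.2, State.setReg_reg_ne _ h.1, hs']

theorem Cmd.NoArr.exec {a : ℕ} : ∀ {c : Cmd}, c.NoArr a → ∀ s, (c.exec s).mem a = s.mem a
  | .skip, _, _ => rfl
  | .set x e, h, s => rfl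
  | .put b i v, h, s => by
      funext j
      simp only [Cmd.exec, State.setMem_mem]
      exact if_neg fun hc => h hc.1
  | .seq c c', h, s => (h.2.exec _).trans (h.1.exec s)
  | .ite e c c', h, s => by
      simp only [Cmd.exec]
      split_ifs
      · exact h.1.exec s
      · exact h.2.exec s
  | .loopFor x e c, h, s => by
      refine forIter_inv (fun _ s' => s'.mem a = s.mem a) rfl fun i _ s' hs' => ?_
      rw [Cmd.NoArr.exec (c := c) h, State.setReg_mem, hs']
  | .whl x c, h, s => by
      refine whIter_inv (fun s' => s'.mem a = s.mem a) (fun s' _ _ hs' => ?_) _ _ rfl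
      rw [Cmd.NoArr.exec (c := c) h, State.setReg_mem, hs']

/-- The expression reads only registers from the list `V`. -/
def Exp.Over (V : List ℕ) : Exp → Prop
  | .lit _ => True
  | .var x => x ∈ V
  | .idx _ _ => False
  | .bin _ e f => e.Over V ∧ f.Over V
  | .min e f => e.Over V ∧ f.Over V
  | .pow _ => False

/-- The registers in `V` are never assigned, and they determine all numbers of rounds. -/
def Cmd.Stable (V : List ℕ) : Cmd → Prop
  | .skip => True
  | .set x _ => x ∉ V
  | .put _ _ _ => True
  | .seq c c' => c.Stable V ∧ c'.Stable V
  | .ite _ c c' => c.Stable V ∧ c'.Stable V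
  | .loopFor x e c => x ∉ V ∧ e.Over V ∧ c.Stable V
  | .whl _ _ => False

/-- An upper bound for the cost of a command in which the number of rounds of each loop is read
off the initial state. -/
def Cmd.tb (s : State) : Cmd → ℕ
  | .skip => 1
  | .set _ e => e.size + 1
  | .put _ i v => i.size + v.size + 1
  | .seq c c' => c.tb s + c'.tb s
  | .ite e c c' => e.size + 1 + (c.tb s + c'.tb s)
  | .loopFor _ e c => e.size + 3 + e.eval s * (c.tb s + 6)
  | .whl _ _ => 0

theorem Exp.Over.eval_eq {V : List ℕ} {s s' : State} (h : ∀ r ∈ V, s'.reg r = s.reg r) :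
    ∀ {e : Exp}, e.Over V → e.eval s' = e.eval s
  | .lit _, _ => rfl
  | .var x, hx => h x hx
  | .bin _ e f, he => by
      simp only [Exp.eval, Exp.Over.eval_eq h he.1, Exp.Over.eval_eq h he.2]
  | .min e f, he => by
      simp only [Exp.eval, Exp.Over.eval_eq h he.1, Exp.Over.eval_eq h he.2]

theorem Cmd.Stable.noReg {V : List ℕ} {r : ℕ} (hr : r ∈ V) :
    ∀ {c : Cmd}, c.Stable V → c.NoReg r
  | .skip, _ => trivial
  | .set _ _, h => fun hx => h (hx ▸ hr)
  | .put _ _ _, _ => trivial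
  | .seq _ _, h => ⟨h.1.noReg hr, h.2.noReg hr⟩
  | .ite _ _ _, h => ⟨h.1.noReg hr, h.2.noReg hr⟩
  | .loopFor _ _ _, h => ⟨fun hx => h.1 (hx ▸ hr), h.2.2.noReg hr⟩

theorem forCost_le {g : ℕ → State → State} {w : ℕ → State → ℕ} {k b : ℕ} {s : State}
    (I : ℕ → State → Prop) (h0 : I 0 s)
    (hs : ∀ i < k, ∀ s, I i s → I (i + 1) (g i s) ∧ w i s ≤ b) : forCost g w k s ≤ k * b := by
  induction k with
  | zero => simp [forCost]
  | succ k ih =>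
    have h1 := ih fun i hi => hs i (by omega)
    have h2 := (hs k (by omega) _ (forIter_inv I h0 fun i hi s h => (hs i (by omega) s h).1)).2
    simp only [forCost, add_mul, one_mul]
    omega

/-- The cost of a command without `whl` whose loop bounds are fixed registers can be read off any
state that agrees on these registers. -/
theorem Cmd.Stable.cost_le {V : List ℕ} {s : State} : ∀ {c : Cmd}, c.Stable V → ∀ {s' : State},
    (∀ r ∈ V, s'.reg r = s.reg r) → c.cost s' ≤ c.tb s
  | .skip, _, _, _ => le_rfl
  | .set _ _, _, _, _ => le_rfl
  | .put _ _ _, _, _, _ => le_rfl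
  | .seq c c', h, s', hs => add_le_add (h.1.cost_le hs)
      (h.2.cost_le fun r hr => ((h.1.noReg hr).exec s').trans (hs r hr))
  | .ite e c c', h, s', hs => by
      have h1 := h.1.cost_le hs
      have h2 := h.2.cost_le hs
      simp only [Cmd.cost, Cmd.tb]
      split_ifs <;> omega
  | .loopFor x e c, h, s', hs => by
      simp only [Cmd.cost, Cmd.tb]
      rw [h.2.1.eval_eq hs]
      refine Nat.add_le_add_left (forCost_le (fun _ u => ∀ r ∈ V, u.reg r = s.reg r) hs
        fun i _ u hu => ?_) _
      have hu' : ∀ r ∈ V, (u.setReg x i).reg r = s.reg r := fun r hr => by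
        rw [State.setReg_reg_ne _ (by rintro rfl; exact h.1 hr), hu r hr]
      exact ⟨fun r hr => ((h.2.2.noReg hr).exec _).trans (hu' r hr),
        Nat.add_le_add_right (h.2.2.cost_le hu') 6⟩

/-! ### Running a program with a time limit -/

/-- Exponents of the registers: loop counters that code several numbers, and addresses and node
numbers derived from them, are larger than the others. -/
def regCls (r : ℕ) : ℕ :=
  if r = 9 then 24 else if r = 4 then 30 else if r = 28 ∨ r = 29 ∨ r = 36 ∨ r = 37 then 10 else 1

/-- Exponents of the arrays. -/
def arrCls (a : ℕ) : ℕ := if a < 3 then 1 else 30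

/-- A bound for the registers and for the constants of a program. -/
def Program.bnd : Program → ℕ
  | .skip => 0
  | .const x k => max (x + 1) k
  | .arith _ x y z => max (x + 1) (max (y + 1) (z + 1))
  | .load x _ y => max (x + 1) (y + 1)
  | .store _ y x => max (x + 1) (y + 1)
  | .seq p q => max p.bnd q.bnd
  | .branch x p q => max (x + 1) (max p.bnd q.bnd)
  | .loop x p => max (x + 1) p.bnd

/-- The result of an arithmetic instruction.  A shift is a multiplication by a power of two with
truncated exponent. -/
def arithExp (o : BinOp) (y z : ℕ) : Exp :=
  match o with
  | .shl => .bin .mul (.var (64 + y)) (.pow (.var (64 + z)))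
  | o => .bin o (.var (64 + y)) (.var (64 + z))

/-- A program as a command that simulates it with a time limit.  Register `x` is kept in register
`64 + x`, cell `i` of the array `a` in cell `base + i` of the array `a + 3`, where register `4`
holds `base`.  Register `2` holds the fuel; it is set to zero when a value exceeds the bound in
register `3`. -/
def limited : Program → Cmd
  | .skip => .skip
  | .const x k => .set (64 + x) (.min (.lit k) (.var 3))
  | .arith o x y z => .seq
      (.ite (.bin .sub (arithExp o y z) (.var 3)) (.set 2 (.lit 0)) .skip)
      (.set (64 + x) (.min (arithExp o y z) (.var 3)))
  | .load x a y => .set (64 + x)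
      (.min (.idx (a + 3) (.bin .add (.var 4) (.var (64 + y)))) (.var 3))
  | .store a y x => .put (a + 3) (.bin .add (.var 4) (.min (.var (64 + y)) (.var 3)))
      (.var (64 + x))
  | .seq p q => .seq (limited p) (limited q)
  | .branch x p q => .ite (.var (64 + x)) (limited p) (limited q)
  | .loop x p => .whl (64 + x) (limited p)

theorem limited_tame : ∀ p : Program, (limited p).Tame
  | .skip => trivial
  | .const x k => fun h => by omega
  | .arith o x y z => ⟨⟨fun _ => rfl, trivial⟩, fun h => by omega⟩
  | .load x a y => fun h => by omega
  | .store a y x => trivial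
  | .seq p q => ⟨limited_tame p, limited_tame q⟩
  | .branch x p q => ⟨limited_tame p, limited_tame q⟩
  | .loop x p => limited_tame p

theorem limited_noReg {r : ℕ} (hr : r < 64) (h2 : r ≠ 2) : ∀ p : Program, (limited p).NoReg r
  | .skip => trivial
  | .const x k => by simp only [limited, Cmd.NoReg]; omega
  | .arith o x y z => by
      simp only [limited, Cmd.NoReg]
      exact ⟨⟨h2, trivial⟩, by omega⟩
  | .load x a y => by simp only [limited, Cmd.NoReg]; omega
  | .store a y x => trivial
  | .seq p q => ⟨limited_noReg hr h2 p, limited_noReg hr h2 q⟩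
  | .branch x p q => ⟨limited_noReg hr h2 p, limited_noReg hr h2 q⟩
  | .loop x p => ⟨h2, limited_noReg hr h2 p⟩

theorem limited_noArr {a : ℕ} (ha : a < 3) : ∀ p : Program, (limited p).NoArr a
  | .skip => trivial
  | .const x k => trivial
  | .arith o x y z => by simp [limited, Cmd.NoArr]
  | .load x a y => trivial
  | .store b y x => by simp only [limited, Cmd.NoArr]; omega
  | .seq p q => ⟨limited_noArr ha p, limited_noArr ha q⟩
  | .branch x p q => ⟨limited_noArr ha p, limited_noArr ha q⟩
  | .loop x p => limited_noArr (a := a) ha p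

theorem regCls_hi (x : ℕ) : regCls (64 + x) = 1 := by
  unfold regCls
  rw [if_neg (by omega), if_neg (by omega), if_neg (by omega)]

theorem regCls_two : regCls 2 = 1 := rfl

theorem regCls_three : regCls 3 = 1 := rfl

theorem regCls_four : regCls 4 = 30 := rfl

theorem arrCls_hi (a : ℕ) : arrCls (a + 3) = 30 := by
  unfold arrCls
  rw [if_neg (by omega)]

theorem arithExp_wf {D E y z : ℕ} (hE : 40 ≤ E) (hy : 64 + y < D) (hz : 64 + z < D) (o : BinOp) :
    (arithExp o y z).Wf D regCls arrCls E := by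
  cases o <;> simp [arithExp, Exp.Wf, Exp.ub, regCls_hi] <;> omega

/-- The simulation passes the static check whatever the simulated program does, because every value
is truncated at register `3` before it is stored. -/
theorem limited_wf {D E : ℕ} (hE : 40 ≤ E) : ∀ p : Program, 65 + p.bnd ≤ D → p.bnd ≤ E →
    (limited p).Wf D regCls arrCls E
  | .skip, _, _ => trivial
  | .const x k, h, h' => by
      simp only [Program.bnd] at h h'
      simp [limited, Cmd.Wf, Exp.Wf, Exp.ub, regCls_hi, regCls_three]; omega
  | .arith o x y z, h, h' => by
      simp only [Program.bnd] at h h'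
      have := arithExp_wf (D := D) hE (by omega : 64 + y < D) (by omega : 64 + z < D) o
      have hub := this.ub_le
      simp only [limited, Cmd.Wf, Exp.Wf, this]
      simp [Exp.ub, regCls_hi, regCls_three]; omega
  | .load x a y, h, h' => by
      simp only [Program.bnd] at h h'
      simp [limited, Cmd.Wf, Exp.Wf, Exp.ub, regCls_hi, arrCls_hi, regCls_three, regCls_four]; omega
  | .store a y x, h, h' => by
      simp only [Program.bnd] at h h'
      simp [limited, Cmd.Wf, Exp.Wf, Exp.ub, regCls_hi, arrCls_hi, regCls_three, regCls_four]; omega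
  | .seq p q, h, h' => by
      simp only [Program.bnd] at h h'
      exact ⟨limited_wf hE p (by omega) (by omega), limited_wf hE q (by omega) (by omega)⟩
  | .branch x p q, h, h' => by
      simp only [Program.bnd] at h h'
      refine ⟨⟨by omega, by rw [regCls_hi]; omega⟩, limited_wf hE p (by omega) (by omega),
        limited_wf hE q (by omega) (by omega)⟩
  | .loop x p, h, h' => by
      simp only [Program.bnd] at h h'
      exact ⟨by omega, by omega, by omega, by rw [regCls_hi]; omega,
        by rw [regCls_two]; omega, limited_wf hE p (by omega) (by omega), limited_tame p⟩

/-- The simulation only touches the cells of its own window. -/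
theorem limited_local {a i : ℕ} : ∀ (p : Program) (s : State),
    (i < s.reg 4 ∨ s.reg 4 + s.reg 3 < i) → ((limited p).exec s).mem a i = s.mem a i
  | .skip, _, _ => rfl
  | .const _ _, _, _ => rfl
  | .arith o x y z, s, _ => by
      simp only [limited, Cmd.exec]
      split_ifs <;> rfl
  | .load _ _ _, _, _ => rfl
  | .store b y x, s, h => by
      simp only [limited, Cmd.exec, State.setMem_mem, Exp.eval, BinOp.eval]
      exact if_neg fun hc => by omega
  | .seq p q, s, h => by
      have h4 := (limited_noReg (r := 4) (by norm_num) (by norm_num) p).exec s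
      have h3 := (limited_noReg (r := 3) (by norm_num) (by norm_num) p).exec s
      exact (limited_local q _ (by rw [h4, h3]; exact h)).trans (limited_local p s h)
  | .branch x p q, s, h => by
      simp only [limited, Cmd.exec]
      split_ifs
      · exact limited_local p s h
      · exact limited_local q s h
  | .loop x p, s, h => by
      refine (whIter_inv (fun u => u.reg 4 = s.reg 4 ∧ u.reg 3 = s.reg 3 ∧
        u.mem a i = s.mem a i) (fun u _ _ hu => ?_) _ _ ⟨rfl, rfl, rfl⟩).2.2
      have h4 := (limited_noReg (r := 4) (by norm_num) (by norm_num) p).exec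
        (u.setReg 2 (u.reg 2 - 1))
      have h3 := (limited_noReg (r := 3) (by norm_num) (by norm_num) p).exec
        (u.setReg 2 (u.reg 2 - 1))
      rw [State.setReg_reg_ne _ (by norm_num)] at h3 h4
      refine ⟨h4.trans hu.1, h3.trans hu.2.1, ?_⟩
      rw [limited_local p _ (by
        rw [State.setReg_reg_ne _ (by norm_num), State.setReg_reg_ne _ (by norm_num), hu.1, hu.2.1]
        exact h)]
      exact hu.2.2

/-- If the cost of a round is linear in the fuel that it uses, then so is the cost of a loop: the
unit of fuel charged for each round pays for the additive constant. -/
theorem whCost_le {x c : ℕ} {g : State → State} {w : State → ℕ} (hg : ∀ s, (g s).reg 2 ≤ s.reg 2)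
    (hw : ∀ s, w s ≤ c * (s.reg 2 - (g s).reg 2) + c) : ∀ (n : ℕ) (s : State),
    (whIter x g n s).reg 2 ≤ s.reg 2 ∧
      whCost x g w n s ≤ c * (s.reg 2 - (whIter x g n s).reg 2)
  | 0, s => ⟨le_rfl, by simp [whCost]⟩
  | n + 1, s => by
      unfold whIter whCost
      split_ifs with hc
      · simp
      · push Not at hc
        set u := s.setReg 2 (s.reg 2 - 1) with hu
        have hu2 : u.reg 2 = s.reg 2 - 1 := by simp [hu]
        obtain ⟨h1, h2⟩ := whCost_le (x := x) hg hw n (g u)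
        have h3 := hg u
        have h4 := hw u
        refine ⟨by omega, ?_⟩
        set r := (whIter x g n (g u)).reg 2
        have h5 : s.reg 2 - r = (u.reg 2 - (g u).reg 2) + 1 + ((g u).reg 2 - r) := by omega
        rw [h5, mul_add, mul_add, mul_one]
        omega

/-- The time limit works: the cost of a simulation is linear in the fuel that it uses up. -/
theorem limited_cost : ∀ p : Program, ∃ c : ℕ, ∀ s,
    (limited p).cost s ≤ c * (s.reg 2 - ((limited p).exec s).reg 2) + c
  | .skip => ⟨1, fun s => by simp [limited, Cmd.cost]⟩
  | .const x k => ⟨_, fun s => Nat.le_add_left _ _⟩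
  | .arith o x y z => by
      refine ⟨_, fun s => le_trans ?_ (Nat.le_add_left
        (((arithExp o y z).size + 1) + 1 + 3 + (((arithExp o y z).size + 3) + 1)) _)⟩
      simp only [limited, Cmd.cost, Exp.size]
      split_ifs <;> omega
  | .load x a y => ⟨_, fun s => Nat.le_add_left _ _⟩
  | .store a y x => ⟨_, fun s => Nat.le_add_left _ _⟩
  | .seq p q => by
      obtain ⟨c, hc⟩ := limited_cost p
      obtain ⟨d, hd⟩ := limited_cost q
      refine ⟨c + d, fun s => ?_⟩
      have h1 := (limited_tame p).exec_le s
      have h2 := (limited_tame q).exec_le ((limited p).exec s)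
      have h3 := hc s
      have h4 := hd ((limited p).exec s)
      simp only [limited, Cmd.cost, Cmd.exec]
      set f := s.reg 2
      set f₁ := ((limited p).exec s).reg 2
      set f₂ := ((limited q).exec ((limited p).exec s)).reg 2
      have h5 : c * (f - f₁) ≤ c * (f - f₂) := Nat.mul_le_mul_left _ (by omega)
      have h6 : d * (f₁ - f₂) ≤ d * (f - f₂) := Nat.mul_le_mul_left _ (by omega)
      rw [add_mul]
      omega
  | .branch x p q => by
      obtain ⟨c, hc⟩ := limited_cost p
      obtain ⟨d, hd⟩ := limited_cost q
      refine ⟨c + d + 2, fun s => ?_⟩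
      simp only [limited, Cmd.cost, Cmd.exec, Exp.size]
      split_ifs
      · have := hc s
        rw [add_mul, add_mul]; omega
      · have := hd s
        rw [add_mul, add_mul]; omega
  | .loop x p => by
      obtain ⟨c, hc⟩ := limited_cost p
      refine ⟨c + 9, fun s => ?_⟩
      have := (whCost_le (x := 64 + x) (c := c + 9) (w := fun s => (limited p).cost s + 9)
        (limited_tame p).exec_le (fun s => by
          have := hc s
          rw [add_mul]; omega) (s.reg 2) s).2
      simp only [limited, Cmd.cost, Cmd.exec]
      omega

/-- The bound for the number of rounds does not matter if it is at least the fuel. -/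
theorem whIter_fuel {x : ℕ} {g : State → State} (hg : ∀ s, (g s).reg 2 ≤ s.reg 2) :
    ∀ (n m : ℕ) (s : State), s.reg 2 ≤ n → s.reg 2 ≤ m → whIter x g n s = whIter x g m s
  | 0, 0, _, _, _ => rfl
  | 0, m + 1, s, h, _ => by simp [whIter, Nat.le_zero.mp h]
  | n + 1, 0, s, _, h => by simp [whIter, Nat.le_zero.mp h]
  | n + 1, m + 1, s, hn, hm => by
      unfold whIter
      split_ifs with hc
      · rfl
      · push Not at hc
        have h1 := hg (s.setReg 2 (s.reg 2 - 1))
        simp only [State.setReg_reg_self] at h1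
        exact whIter_fuel hg n m _ (by omega) (by omega)

/-- All registers and array cells hold numbers below `W`. -/
def Bounded (W : ℕ) (σ : State) : Prop :=
  (∀ x, σ.reg x < W) ∧ ∀ a i, σ.mem a i < W

/-- The state `σ` of a program with registers below `R` is represented in the state `s` of its
simulation. -/
structure Rep (R X : ℕ) (σ s : State) : Prop where
  reg : ∀ x < R, s.reg (64 + x) = σ.reg x
  mem : ∀ a, ∀ i < X, s.mem (a + 3) (s.reg 4 + i) = σ.mem a i

theorem Bounded.setReg {W x v : ℕ} {σ : State} (h : Bounded W σ) (hv : v < W) :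
    Bounded W (σ.setReg x v) :=
  ⟨fun r => by rw [State.setReg_reg]; split_ifs; exacts [hv, h.1 r], h.2⟩

theorem Bounded.setMem {W a i v : ℕ} {σ : State} (h : Bounded W σ) (hv : v < W) :
    Bounded W (σ.setMem a i v) :=
  ⟨h.1, fun b j => by rw [State.setMem_mem]; split_ifs; exacts [hv, h.2 b j]⟩

theorem Rep.setReg {R X x v v' : ℕ} {σ s : State} (h : Rep R X σ s) (hv : v' = v) :
    Rep R X (σ.setReg x v) (s.setReg (64 + x) v') where
  reg y hy := by simp only [State.setReg_reg, Nat.add_left_cancel_iff, h.reg y hy, hv]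
  mem a i hi := by
    rw [State.setReg_reg_ne _ (by omega)]
    exact h.mem a i hi

theorem Rep.fuel {R X v : ℕ} {σ s : State} (h : Rep R X σ s) : Rep R X σ (s.setReg 2 v) where
  reg y hy := by rw [State.setReg_reg_ne _ (by omega)]; exact h.reg y hy
  mem a i hi := by
    rw [State.setReg_reg_ne _ (by omega)]
    exact h.mem a i hi

/-- As long as the result is a word, shifting with a truncated exponent is the same as shifting. -/
theorem arithExp_eval {R w X W : ℕ} {σ s : State} (h : Rep R X σ s) (hW : W ≤ X) (hX : X = 2 ^ w)
    (hs : s.reg 1 = w) {y z : ℕ} (hy : y < R) (hz : z < R) {o : BinOp}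
    (ho : o.eval (σ.reg y) (σ.reg z) < W) :
    (arithExp o y z).eval s = o.eval (σ.reg y) (σ.reg z) := by
  cases o
  case shl =>
    simp only [arithExp, Exp.eval, BinOp.eval, h.reg y hy, h.reg z hz, hs, Nat.shiftLeft_eq] at ho ⊢
    by_cases hzw : σ.reg z ≤ w
    · rw [min_eq_left hzw]
    · have h0 : σ.reg y = 0 := by
        by_contra hne
        have h1 : 2 ^ w ≤ 2 ^ σ.reg z := Nat.pow_le_pow_right (by norm_num) (by omega)
        have h2 : 1 * 2 ^ σ.reg z ≤ σ.reg y * 2 ^ σ.reg z :=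
          Nat.mul_le_mul_right _ (by omega)
        omega
      simp [h0]
  all_goals simp [arithExp, Exp.eval, h.reg y hy, h.reg z hz]

/-- A run of a program is faithfully simulated if the fuel exceeds its length. -/
theorem limited_runs {R w X W : ℕ} (hW : W ≤ X) (hX : X = 2 ^ w) {p : Program} {σ σ' : State}
    {t : ℕ}
    (hr : Runs W p σ t σ') : p.bnd ≤ R → Bounded W σ → ∀ s, Rep R X σ s → s.reg 1 = w →
    s.reg 3 = X → t < s.reg 2 →
    Bounded W σ' ∧ Rep R X σ' ((limited p).exec s) ∧ s.reg 2 ≤ ((limited p).exec s).reg 2 + t := by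
  induction hr with
  | skip σ => intro _ hb s h _ _ _; exact ⟨hb, h, Nat.le_add_right _ _⟩
  | const σ x k hk =>
    intro _ hb s h _ h3 _
    refine ⟨hb.setReg hk, h.setReg ?_, ?_⟩
    · simp only [Exp.eval, h3]; omega
    · simp only [limited, Cmd.exec]
      rw [State.setReg_reg_ne _ (by omega)]; omega
  | arith σ o x y z ho =>
    intro hR hb s h h1 h3 _
    simp only [Program.bnd] at hR
    have he := arithExp_eval h hW hX h1 (by omega : y < R) (by omega : z < R) ho
    have hz : ¬ BinOp.eval .sub (o.eval (σ.reg y) (σ.reg z)) X ≠ 0 := by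
      change ¬ (o.eval (σ.reg y) (σ.reg z) - X ≠ 0)
      omega
    refine ⟨hb.setReg ho, ?_, ?_⟩
    · simp only [limited, Cmd.exec, Exp.eval, he, h3]
      rw [if_neg hz, he, h3]
      exact h.setReg (by omega)
    · simp only [limited, Cmd.exec, Exp.eval, he, h3]
      rw [if_neg hz, State.setReg_reg_ne _ (by omega)]; omega
  | load σ x a y =>
    intro hR hb s h h1 h3 _
    simp only [Program.bnd] at hR
    have h5 := hb.1 y
    have h6 := hb.2 a (σ.reg y)
    refine ⟨hb.setReg h6, h.setReg ?_, ?_⟩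
    · simp only [Exp.eval, BinOp.eval, h.reg y (by omega), h3, h.mem a _ (by omega : σ.reg y < X)]
      omega
    · simp only [limited, Cmd.exec]
      rw [State.setReg_reg_ne _ (by omega)]; omega
  | store σ a y x =>
    intro hR hb s h h1 h3 _
    simp only [Program.bnd] at hR
    have h5 := hb.1 y
    have h6 := hb.1 x
    refine ⟨hb.setMem h6, ⟨fun z hz => h.reg z hz, fun b i hi => ?_⟩, Nat.le_add_right _ _⟩
    simp only [limited, Cmd.exec, Exp.eval, BinOp.eval, State.setMem_mem, State.setMem_reg,
      h.reg y (by omega), h.reg x (by omega), h3, min_eq_left (by omega : σ.reg y ≤ X),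
      Nat.add_right_cancel_iff, Nat.add_left_cancel_iff, h.mem b i hi]
  | @seq p q σ₁ σ₂ σ₃ t₁ t₂ _ _ ih₁ ih₂ =>
    intro hR hb s h h1 h3 hf
    simp only [Program.bnd] at hR
    obtain ⟨b₁, r₁, f₁⟩ := ih₁ (by omega) hb s h h1 h3 (by omega)
    obtain ⟨b₂, r₂, f₂⟩ := ih₂ (by omega) b₁ _ r₁
      (((limited_noReg (by norm_num) (by norm_num) p).exec s).trans h1)
      (((limited_noReg (by norm_num) (by norm_num) p).exec s).trans h3) (by omega)
    exact ⟨b₂, r₂, by simp only [limited, Cmd.exec]; omega⟩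
  | @branch_true p q σ σ' x t hx _ ih =>
    intro hR hb s h h1 h3 hf
    simp only [Program.bnd] at hR
    obtain ⟨b₁, r₁, f₁⟩ := ih (by omega) hb s h h1 h3 (by omega)
    simp only [limited, Cmd.exec, Exp.eval, h.reg x (by omega), if_pos hx]
    exact ⟨b₁, r₁, by omega⟩
  | @branch_false p q σ σ' x t hx _ ih =>
    intro hR hb s h h1 h3 hf
    simp only [Program.bnd] at hR
    obtain ⟨b₁, r₁, f₁⟩ := ih (by omega) hb s h h1 h3 (by omega)
    simp only [limited, Cmd.exec, Exp.eval, h.reg x (by omega)]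
    rw [if_neg (by simpa using hx)]
    exact ⟨b₁, r₁, by omega⟩
  | @loop_true p σ₁ σ₂ σ₃ x t₁ t₂ hx _ _ ih₁ ih₂ =>
    intro hR hb s h h1 h3 hf
    have hR' := hR
    simp only [Program.bnd] at hR'
    set u := s.setReg 2 (s.reg 2 - 1) with hu
    have hu2 : u.reg 2 = s.reg 2 - 1 := by simp [hu]
    have hu1 : u.reg 1 = w := by rw [hu, State.setReg_reg_ne _ (by norm_num), h1]
    have hu3 : u.reg 3 = X := by rw [hu, State.setReg_reg_ne _ (by norm_num), h3]
    obtain ⟨b₁, r₁, f₁⟩ := ih₁ (by omega) hb u h.fuel hu1 hu3 (by omega)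
    obtain ⟨b₂, r₂, f₂⟩ := ih₂ hR b₁ _ r₁
      (((limited_noReg (by norm_num) (by norm_num) p).exec u).trans hu1)
      (((limited_noReg (by norm_num) (by norm_num) p).exec u).trans hu3) (by omega)
    have hle := (limited_tame p).exec_le u
    have key : (limited (.loop x p)).exec s =
        (limited (.loop x p)).exec ((limited p).exec u) := by
      obtain ⟨n, hn⟩ : ∃ n, s.reg 2 = n + 1 := ⟨s.reg 2 - 1, by omega⟩
      simp only [limited, Cmd.exec]
      rw [hn, whIter, if_neg (by rw [h.reg x (by omega)]; omega)]
      exact whIter_fuel (limited_tame p).exec_le _ _ _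
        (by change ((limited p).exec u).reg 2 ≤ n; omega) le_rfl
    rw [key]
    exact ⟨b₂, r₂, by omega⟩
  | @loop_false p σ x hx =>
    intro hR hb s h h1 h3 hf
    simp only [Program.bnd] at hR
    have key : (limited (.loop x p)).exec s = s := by
      obtain ⟨n, hn⟩ : ∃ n, s.reg 2 = n + 1 := ⟨s.reg 2 - 1, by omega⟩
      simp only [limited, Cmd.exec]
      rw [hn, whIter, if_pos (by rw [h.reg x (by omega)]; omega)]
    rw [key]
    exact ⟨hb, h, by omega⟩

end WordRAM

namespace MaxFlow

open Finset

/-! ### Flows and cuts in terms of the list of edges -/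

theorem sum_map_range {R : Type*} [AddCommMonoid R] (n : ℕ) (f : ℕ → R) :
    ((List.range n).map f).sum = ∑ i ∈ range n, f i := by
  induction n with
  | zero => simp
  | succ n ih => rw [List.range_succ, List.map_append, List.sum_append, ih, sum_range_succ]; simp

theorem sum_map_flatMap {R α β : Type*} [AddCommMonoid R] (l : List α) (f : α → List β)
    (h : β → R) : ((l.flatMap f).map h).sum = (l.map fun x => ((f x).map h).sum).sum := by
  induction l with
  | nil => simp
  | cons x l ih => simp [ih]

theorem sum_edges {N : Type*} {n : ℕ} (ν : N → Fin n) (w : N × N × ℕ → ℝ)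
    (h : Fin n → Fin n → ℝ) (E : List (N × N × ℕ)) :
    ∑ u, ∑ v, (E.map fun e => if ν e.1 = u ∧ ν e.2.1 = v then w e else 0).sum * h u v =
      (E.map fun e => w e * h (ν e.1) (ν e.2.1)).sum := by
  induction E with
  | nil => simp
  | cons e E ih =>
    simp only [List.map_cons, List.sum_cons, add_mul, sum_add_distrib, ih]
    congr 1
    rw [sum_eq_single (ν e.1), sum_eq_single (ν e.2.1)]
    · simp
    · intro v _ hv
      rw [if_neg fun hc => hv hc.2.symm, zero_mul]
    · simp
    · intro u _ hu
      refine sum_eq_zero fun v _ => ?_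
      rw [if_neg fun hc => hu hc.1.symm, zero_mul]
    · simp

section

variable {G : Instance} {N : Type*} {ν : N → Fin G.n} {E : List (N × N × ℕ)}

theorem Instance.cap_eq (hE : G.edges = E.map fun e => (ν e.1, ν e.2.1, e.2.2)) (u v : Fin G.n) :
    G.cap u v = (E.map fun e => if ν e.1 = u ∧ ν e.2.1 = v then e.2.2 else 0).sum := by
  unfold Instance.cap
  rw [hE]
  clear hE
  induction E with
  | nil => rfl
  | cons e E ih =>
    rw [List.map_cons, List.filter_cons]
    by_cases h : ν e.1 = u ∧ ν e.2.1 = v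
    · simp only [h, and_self, decide_true, if_true, List.map_cons, List.sum_cons]
      rw [ih]
    · simp only [h, decide_false, List.map_cons, List.sum_cons, if_false, zero_add]
      rw [← ih]
      simp

theorem Instance.cap_cast (hE : G.edges = E.map fun e => (ν e.1, ν e.2.1, e.2.2))
    (u v : Fin G.n) : (G.cap u v : ℝ) =
      (E.map fun e => if ν e.1 = u ∧ ν e.2.1 = v then (e.2.2 : ℝ) else 0).sum := by
  rw [Instance.cap_eq hE, Nat.cast_list_sum, List.map_map]
  congr 2
  funext e
  simp

/-- Conservation in the form of an identity for all node potentials: if the tension of every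
potential along the edge flow `φ` is that of `val` units shipped from `s` to `t`, then there is a
flow of value `val`. -/
theorem Instance.exists_flow (hE : G.edges = E.map fun e => (ν e.1, ν e.2.1, e.2.2))
    {s t : Fin G.n} (hst : s ≠ t) (φ : N → N → ℝ) (val : ℝ) (h0 : ∀ e ∈ E, 0 ≤ φ e.1 e.2.1)
    (h1 : ∀ e ∈ E, φ e.1 e.2.1 ≤ e.2.2)
    (hπ : ∀ π : Fin G.n → ℝ, (E.map fun e => φ e.1 e.2.1 * (π (ν e.2.1) - π (ν e.1))).sum =
      val * (π t - π s)) :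
    ∃ f, G.IsFlow s t f ∧ val = G.flowValue s f := by
  set f : Fin G.n → Fin G.n → ℝ := fun u v =>
    (E.map fun e => if ν e.1 = u ∧ ν e.2.1 = v then φ e.1 e.2.1 else 0).sum with hf
  have key : ∀ x, ∑ u, f u x - ∑ u, f x u =
      val * ((if t = x then 1 else 0) - (if s = x then 1 else 0)) := by
    intro x
    rw [← hπ fun y => if y = x then 1 else 0]
    have := sum_edges ν (fun e => φ e.1 e.2.1)
      (fun u v => (if v = x then 1 else 0) - (if u = x then 1 else 0)) E
    rw [← this]
    simp only [mul_sub, sum_sub_distrib]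
    congr 1
    · simp [hf]
    · simp [hf]
  refine ⟨f, ⟨fun u v => ⟨?_, ?_⟩, fun v hs ht => ?_⟩, ?_⟩
  · refine List.sum_nonneg fun y hy => ?_
    obtain ⟨e, he, rfl⟩ := List.mem_map.mp hy
    split_ifs
    · exact h0 e he
    · exact le_rfl
  · rw [Instance.cap_cast hE]
    refine List.sum_le_sum fun e he => ?_
    split_ifs
    · exact h1 e he
    · exact le_rfl
  · have := key v
    rw [if_neg (Ne.symm ht), if_neg (Ne.symm hs)] at this
    linarith
  · have := key s
    rw [if_neg (Ne.symm hst), if_pos rfl] at this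
    unfold Instance.flowValue
    linarith

/-- Weak duality: the value of a flow is at most the capacity of a cut, in terms of the list of
edges. -/
theorem Instance.flowValue_le_cut (hE : G.edges = E.map fun e => (ν e.1, ν e.2.1, e.2.2))
    {s t : Fin G.n} {f : Fin G.n → Fin G.n → ℝ} (hf : G.IsFlow s t f) (X : Fin G.n → Prop)
    [DecidablePred X] (hs : X s) (ht : ¬ X t) :
    G.flowValue s f ≤
      (E.map fun e => if X (ν e.1) ∧ ¬ X (ν e.2.1) then (e.2.2 : ℝ) else 0).sum := by
  have h1 : G.flowValue s f =
      ∑ u, ∑ v, f u v * ((if X u then 1 else 0) - (if X v then 1 else 0)) := by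
    have h2 : ∑ u, ∑ v, f u v * ((if X u then 1 else 0) - (if X v then 1 else 0)) =
        ∑ u, (if X u then 1 else 0) * (∑ v, f u v - ∑ v, f v u) := by
      simp only [mul_sub, sum_sub_distrib]
      congr 1
      · exact sum_congr rfl fun u _ => by rw [mul_sum]; exact sum_congr rfl fun v _ => mul_comm _ _
      · rw [sum_comm]
        exact sum_congr rfl fun u _ => by rw [mul_sum]; exact sum_congr rfl fun v _ => mul_comm _ _
    rw [h2, sum_eq_single s]
    · simp [hs, Instance.flowValue]
    · intro u _ hu
      by_cases hX : X u
      · have : u ≠ t := fun h => ht (h ▸ hX)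
        rw [hf.2 u hu this]; simp
      · simp [hX]
    · simp
  have h2 := sum_edges ν (fun e => (e.2.2 : ℝ)) (fun u v => if X u ∧ ¬ X v then 1 else 0) E
  calc G.flowValue s f = _ := h1
    _ ≤ ∑ u, ∑ v, (G.cap u v : ℝ) * (if X u ∧ ¬ X v then 1 else 0) := by
        refine sum_le_sum fun u _ => sum_le_sum fun v _ => ?_
        have := hf.1 u v
        by_cases hu : X u <;> by_cases hv : X v <;> simp [hu, hv] <;> linarith
    _ = _ := by
        simp only [Instance.cap_cast hE]
        rw [h2]
        simp

end

/-! ### The graph of three families of partial assignments -/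

/-- The nodes of the graph: sources, sinks, a hub, for every `γ` of the third family a gate and for
every clause `c` a cell, and for every clause a node `pos c` (behind the sources satisfying `c`)
and a node `unm c` (before the sinks not satisfying `c`).  The nodes `hole c` and `dhole c` are
dead ends. -/
inductive Node where
  | src (i : ℕ)
  | snk (j : ℕ)
  | hub
  | hole (c : ℕ)
  | pos (c : ℕ)
  | unm (c : ℕ)
  | dhole (c : ℕ)
  | gate (y : ℕ)
  | cell (y c : ℕ)

/-- The parameters of the graph: families of `N₁`, `N₂`, `N₃` partial assignments and `M` clauses,
where `a x c`, `b x c`, `g x c` tell whether the member `x` of the respective family satisfies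
clause `c`; numbers `S₁`, `S₂` of sources and sinks, and a threshold `B`. -/
structure Gadget where
  (N₁ N₂ N₃ S₁ S₂ M B : ℕ)
  (a b g : ℕ → ℕ → Bool)

namespace Gadget

variable (P : Gadget)

/-- The number of nodes. -/
def size : ℕ := P.S₁ + P.S₂ + 1 + 4 * P.M + P.N₃ + P.N₃ * P.M

/-- The numbering of the nodes. -/
def code : Node → ℕ
  | .src i => i
  | .snk j => P.S₁ + j
  | .hub => P.S₁ + P.S₂
  | .hole c => P.S₁ + P.S₂ + 1 + c
  | .pos c => P.S₁ + P.S₂ + 1 + c + P.M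
  | .unm c => P.S₁ + P.S₂ + 1 + 2 * P.M + c
  | .dhole c => P.S₁ + P.S₂ + 1 + 2 * P.M + c + P.M
  | .gate y => P.S₁ + P.S₂ + 1 + 4 * P.M + y
  | .cell y c => P.S₁ + P.S₂ + 1 + 4 * P.M + P.N₃ + y * P.M + c

/-- The nodes of the graph. -/
def Valid : Node → Prop
  | .src i => i < P.S₁
  | .snk j => j < P.S₂
  | .hub => True
  | .hole c => c < P.M
  | .pos c => c < P.M
  | .unm c => c < P.M
  | .dhole c => c < P.M
  | .gate y => y < P.N₃
  | .cell y c => y < P.N₃ ∧ c < P.M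

/-- The edges with their capacities. -/
def edges : List (Node × Node × ℕ) :=
  (List.range P.N₁).flatMap (fun x => (.src x, .hub, P.size) ::
    (List.range P.M).map fun c => (.src x, if P.a x c then .pos c else .hole c, P.size)) ++
  ((List.range P.N₃).flatMap (fun y => (.hub, .gate y, P.B) ::
    (List.range P.M).flatMap fun c => [(.gate y, if P.g y c then .hole c else .cell y c, 1),
      (.pos c, .cell y c, 1), (.cell y c, .unm c, 1)]) ++
  (List.range P.N₂).flatMap fun x =>
    (List.range P.M).map fun c => (if P.b x c then .dhole c else .unm c, .snk x, P.size))

theorem size_pos : 0 < P.size := by unfold size; omega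

/-- The node with a given name. -/
def node (v : Node) : Fin P.size := ⟨P.code v % P.size, Nat.mod_lt _ P.size_pos⟩

theorem code_lt {v : Node} (hv : P.Valid v) : P.code v < P.size := by
  unfold size
  cases v with
  | cell y c =>
    have h : (y + 1) * P.M ≤ P.N₃ * P.M := Nat.mul_le_mul_right _ hv.1
    have := hv.2
    simp only [code]
    rw [add_mul] at h
    omega
  | _ => simp only [Valid] at hv; simp only [code]; omega

theorem node_val {v : Node} (hv : P.Valid v) : (P.node v : ℕ) = P.code v :=
  Nat.mod_eq_of_lt (P.code_lt hv)

theorem code_inj {u v : Node} (hu : P.Valid u) (hv : P.Valid v) (h : P.code u = P.code v) :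
    u = v := by
  cases u <;> cases v <;> simp only [code] at h <;> simp only [Valid] at hu hv
  case cell.cell y c y' c' =>
    have hM : 0 < P.M := by omega
    have h' : c + P.M * y = c' + P.M * y' := by
      rw [mul_comm P.M, mul_comm P.M]; omega
    have h1 : (c + P.M * y) % P.M = (c' + P.M * y') % P.M := by rw [h']
    have h2 : (c + P.M * y) / P.M = (c' + P.M * y') / P.M := by rw [h']
    rw [Nat.add_mul_mod_self_left, Nat.add_mul_mod_self_left, Nat.mod_eq_of_lt hu.2,
      Nat.mod_eq_of_lt hv.2] at h1
    rw [Nat.add_mul_div_left _ _ hM, Nat.add_mul_div_left _ _ hM, Nat.div_eq_of_lt hu.2,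
      Nat.div_eq_of_lt hv.2] at h2
    subst h1
    congr 1
    omega
  all_goals first
    | (exfalso; omega)
    | (congr 1 <;> omega)

theorem node_inj {u v : Node} (hu : P.Valid u) (hv : P.Valid v) (h : P.node u = P.node v) :
    u = v :=
  P.code_inj hu hv (by rw [← P.node_val hu, ← P.node_val hv, h])

theorem mem_edges {e : Node × Node × ℕ} : e ∈ P.edges ↔
    (∃ x < P.N₁, e = (.src x, .hub, P.size) ∨
      ∃ c < P.M, e = (.src x, if P.a x c then .pos c else .hole c, P.size)) ∨
    (∃ y < P.N₃, e = (.hub, .gate y, P.B) ∨ ∃ c < P.M,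
      e = (.gate y, if P.g y c then .hole c else .cell y c, 1) ∨
      e = (.pos c, .cell y c, 1) ∨ e = (.cell y c, .unm c, 1)) ∨
    (∃ x < P.N₂, ∃ c < P.M, e = (if P.b x c then .dhole c else .unm c, .snk x, P.size)) := by
  simp only [edges, List.mem_append, List.mem_flatMap, List.mem_range, List.mem_cons,
    List.mem_map, List.not_mem_nil, or_false, eq_comm]

theorem valid_of_mem (h₁ : P.N₁ ≤ P.S₁) (h₂ : P.N₂ ≤ P.S₂) {e : Node × Node × ℕ}
    (he : e ∈ P.edges) : P.Valid e.1 ∧ P.Valid e.2.1 ∧ e.1 ≠ e.2.1 := by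
  rcases P.mem_edges.mp he with ⟨x, hx, rfl | ⟨c, hc, rfl⟩⟩ |
    ⟨y, hy, rfl | ⟨c, hc, rfl | rfl | rfl⟩⟩ | ⟨x, hx, c, hc, rfl⟩ <;> dsimp only <;>
    (try split_ifs) <;> simp [Valid] <;> try omega

theorem nodup_flatMap_range {α : Type*} {n : ℕ} {f : ℕ → List α} (h : ∀ i < n, (f i).Nodup)
    (h' : ∀ i < n, ∀ j < n, i ≠ j → ∀ x ∈ f i, x ∉ f j) : ((List.range n).flatMap f).Nodup := by
  refine List.nodup_flatMap.mpr ⟨fun i hi => h i (List.mem_range.mp hi), ?_⟩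
  refine List.Nodup.pairwise_of_forall_ne List.nodup_range fun i hi j hj hij => ?_
  exact fun x hx hx' => h' i (List.mem_range.mp hi) j (List.mem_range.mp hj) hij x hx hx'

theorem edges_nodup : (P.edges.map fun e => (e.1, e.2.1)).Nodup := by
  simp only [edges, List.map_append, List.map_flatMap, List.map_cons, List.map_map]
  refine List.Nodup.append ?_ (List.Nodup.append ?_ ?_ ?_) ?_
  · refine nodup_flatMap_range (fun x _ => List.nodup_cons.mpr ⟨?_, ?_⟩) ?_
    · simp only [List.mem_map, Function.comp, not_exists, not_and]
      intro c _; split_ifs <;> simp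
    · refine (List.nodup_range).map fun c c' h => ?_
      simp only [Function.comp] at h
      split_ifs at h <;> simp at h <;> exact h
    · intro x _ y _ hxy e he he'
      simp only [List.mem_cons, List.mem_map, Function.comp] at he he'
      have h1 : e.1 = .src x := by rcases he with rfl | ⟨c, -, rfl⟩ <;> rfl
      have h2 : e.1 = .src y := by rcases he' with rfl | ⟨c, -, rfl⟩ <;> rfl
      rw [h1] at h2
      exact hxy (by simpa using h2)
  · refine nodup_flatMap_range (fun y _ => List.nodup_cons.mpr ⟨?_, ?_⟩) ?_
    · simp
    · refine nodup_flatMap_range (fun c _ => ?_) ?_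
      · split_ifs <;> simp
      · intro c _ c' _ hcc e he he'
        simp only [List.map_nil, List.mem_cons, List.not_mem_nil, or_false] at he he'
        rcases he with rfl | rfl | rfl <;> rcases he' with h | h | h <;>
          (try split_ifs at h) <;> simp at h <;> omega
    · intro y _ y' _ hyy e he he'
      simp only [List.mem_cons, List.mem_flatMap, List.map_nil, List.not_mem_nil, or_false]
        at he he'
      rcases he with rfl | ⟨c, -, rfl | rfl | rfl⟩ <;>
        rcases he' with h | ⟨c', -, h | h | h⟩ <;>
          (try split_ifs at h) <;> simp at h <;> omega
  · refine nodup_flatMap_range (fun x _ => (List.nodup_range).map fun c c' h => ?_) ?_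
    · simp only [Function.comp] at h
      split_ifs at h <;> simp at h <;> exact h
    · intro x _ y _ hxy e he he'
      simp only [List.mem_map, Function.comp] at he he'
      have h1 : e.2 = .snk x := by obtain ⟨c, -, rfl⟩ := he; rfl
      have h2 : e.2 = .snk y := by obtain ⟨c, -, rfl⟩ := he'; rfl
      rw [h1] at h2
      exact hxy (by simpa using h2)
  · intro e he he'
    simp only [List.mem_flatMap, List.mem_cons, List.mem_map, Function.comp, List.map_nil,
      List.not_mem_nil, or_false] at he he'
    obtain ⟨x, -, c, -, rfl⟩ := he'
    obtain ⟨y, -, h | ⟨c', -, h | h | h⟩⟩ := he <;> (try split_ifs at h) <;> simp at h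
  · intro e he he'
    simp only [List.mem_append, List.mem_flatMap, List.mem_cons, List.mem_map, Function.comp,
      List.map_nil, List.not_mem_nil, or_false] at he he'
    obtain ⟨x, hx⟩ : ∃ x, e.1 = .src x := by
      obtain ⟨x, -, rfl | ⟨c, -, rfl⟩⟩ := he <;> exact ⟨x, rfl⟩
    rcases he' with ⟨y, -, rfl | ⟨c, -, rfl | rfl | rfl⟩⟩ | ⟨y, -, c, -, rfl⟩ <;>
      dsimp only at hx <;> (try split_ifs at hx) <;> simp at hx

/-- The graph as an instance of the flow problem. -/
def inst (h₁ : P.N₁ ≤ P.S₁) (h₂ : P.N₂ ≤ P.S₂) : Instance where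
  n := P.size
  edges := P.edges.map fun e => (P.node e.1, P.node e.2.1, e.2.2)
  edges_nodup := by
    have : (P.edges.map fun e => (P.node e.1, P.node e.2.1, e.2.2)).map (fun e => (e.1, e.2.1)) =
        (P.edges.map fun e => (e.1, e.2.1)).map fun e => (P.node e.1, P.node e.2) := by
      simp [List.map_map, Function.comp_def]
    rw [this]
    refine List.Nodup.map_on ?_ P.edges_nodup
    rintro u hu v hv huv
    obtain ⟨e, he, rfl⟩ := List.mem_map.mp hu
    obtain ⟨e', he', rfl⟩ := List.mem_map.mp hv
    have h := P.valid_of_mem h₁ h₂ he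
    have h' := P.valid_of_mem h₁ h₂ he'
    simp only [Prod.mk.injEq] at huv ⊢
    exact ⟨P.node_inj h.1 h'.1 huv.1, P.node_inj h.2.1 h'.2.1 huv.2⟩
  loopless := by
    intro e he
    obtain ⟨e', he', rfl⟩ := List.mem_map.mp he
    have h := P.valid_of_mem h₁ h₂ he'
    exact fun hc => h.2.2 (P.node_inj h.1 h.2.1 hc)
  S := (List.range P.S₁).map fun i => P.node (.src i)
  S_nodup := List.Nodup.map_on (fun i hi j hj h => by
    simpa using P.node_inj (u := .src i) (v := .src j) (List.mem_range.mp hi)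
      (List.mem_range.mp hj) h) List.nodup_range
  T := (List.range P.S₂).map fun i => P.node (.snk i)
  T_nodup := List.Nodup.map_on (fun i hi j hj h => by
    simpa using P.node_inj (u := .snk i) (v := .snk j) (List.mem_range.mp hi)
      (List.mem_range.mp hj) h) List.nodup_range

end Gadget

end MaxFlow

namespace MaxFlow

open Finset

namespace Gadget

variable (P : Gadget)

/-! ### The maximum flow between two partial assignments -/

/-- The number of clauses that `x` satisfies and `y` does not. -/
def cnt (x y : ℕ) : ℕ := #{c ∈ range P.M | P.a x c = true ∧ P.b y c = false}

/-- The clauses that none of `x`, `y`, `z` satisfies. -/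
def unsat (x y z : ℕ) : Finset ℕ :=
  {c ∈ range P.M | P.a x c = false ∧ P.b y c = false ∧ P.g z c = false}

theorem sum_edges_eq {R : Type*} [AddCommMonoid R] (h : Node × Node × ℕ → R) :
    (P.edges.map h).sum =
      (∑ x ∈ range P.N₁, (h (.src x, .hub, P.size) +
        ∑ c ∈ range P.M, h (.src x, if P.a x c then .pos c else .hole c, P.size))) +
      ((∑ y ∈ range P.N₃, (h (.hub, .gate y, P.B) +
        ∑ c ∈ range P.M, (h (.gate y, if P.g y c then .hole c else .cell y c, 1) +
          (h (.pos c, .cell y c, 1) + h (.cell y c, .unm c, 1))))) +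
      ∑ x ∈ range P.N₂, ∑ c ∈ range P.M,
        h (if P.b x c then .dhole c else .unm c, .snk x, P.size)) := by
  simp only [edges, List.map_append, List.sum_append, sum_map_flatMap, List.map_cons,
    List.sum_cons, List.map_map, sum_map_range, Function.comp_def, List.map_nil, List.sum_nil,
    add_zero]

/-- The flow that routes one unit through every cell `(y, c)` with `χ y c = 1` via the gate of `y`,
and one unit through every cell whose clause is satisfied by `x₀` only. -/
def routing (x₀ y₀ : ℕ) (χ : ℕ → ℕ → ℝ) (pd : ℕ → ℝ) : Node → Node → ℝ
  | .src i, .hub => if i = x₀ then P.N₃ * P.B else 0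
  | .src i, .pos c => if i = x₀ then P.N₃ * pd c else 0
  | .hub, .gate _ => P.B
  | .gate y, .cell _ c => χ y c
  | .pos c, .cell _ _ => pd c
  | .cell y c, .unm _ => χ y c + pd c
  | .unm c, .snk j => if j = y₀ then ∑ y ∈ range P.N₃, (χ y c + pd c) else 0
  | _, _ => 0

/-- If every member `z` of the third family leaves at least `B` clauses unsatisfied, choose exactly
`B` of them and send one unit from the gate of `z` through each of their cells. The cells of the
clauses that `x₀` satisfies and `y₀` does not carry one more unit each, directly from `x₀`. -/
theorem exists_flow {h₁ : P.N₁ ≤ P.S₁} {h₂ : P.N₂ ≤ P.S₂} {x₀ y₀ : ℕ} (hx : x₀ < P.N₁)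
    (hy : y₀ < P.N₂) (hB : ∀ z < P.N₃, P.B ≤ #(P.unsat x₀ y₀ z)) :
    ∃ f, (P.inst h₁ h₂).IsFlow (P.node (.src x₀)) (P.node (.snk y₀)) f ∧
      ((P.N₃ * (P.cnt x₀ y₀ + P.B) : ℕ) : ℝ) =
        (P.inst h₁ h₂).flowValue (P.node (.src x₀)) f := by
  have hch : ∀ z, ∃ s : Finset ℕ, z < P.N₃ → s ⊆ P.unsat x₀ y₀ z ∧ #s = P.B := by
    intro z
    by_cases hz : z < P.N₃
    · obtain ⟨s, hs⟩ := exists_subset_card_eq (hB z hz)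
      exact ⟨s, fun _ => hs⟩
    · exact ⟨∅, fun h => absurd h hz⟩
  choose s hs using hch
  set χ : ℕ → ℕ → ℝ := fun z c => if c ∈ s z then 1 else 0 with hχ
  set pd : ℕ → ℝ := fun c => if P.a x₀ c = true ∧ P.b y₀ c = false then 1 else 0 with hpd
  have mem_s : ∀ z < P.N₃, ∀ c ∈ s z, c < P.M ∧ P.a x₀ c = false ∧ P.b y₀ c = false ∧
      P.g z c = false := fun z hz c hc => by
    have := (hs z hz).1 hc
    simpa [unsat] using this
  have χ_sum : ∀ z < P.N₃, ∑ c ∈ range P.M, χ z c = P.B := by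
    intro z hz
    rw [← (hs z hz).2, hχ]
    simp only [sum_boole]
    congr 2
    ext c
    simp only [mem_filter, mem_range]
    exact ⟨fun h => h.2, fun h => ⟨(mem_s z hz c h).1, h⟩⟩
  have pd_sum : ∑ c ∈ range P.M, pd c = P.cnt x₀ y₀ := by
    simp only [hpd, sum_boole, cnt]
  have χ_nonneg : ∀ z c, 0 ≤ χ z c := fun z c => by simp only [hχ]; split_ifs <;> norm_num
  have pd_nonneg : ∀ c, 0 ≤ pd c := fun c => by simp only [hpd]; split_ifs <;> norm_num
  have pd_le : ∀ c, pd c ≤ 1 := fun c => by simp only [hpd]; split_ifs <;> norm_num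
  have le_one : ∀ z < P.N₃, ∀ c, χ z c + pd c ≤ 1 := by
    intro z hz c
    simp only [hχ, hpd]
    by_cases hc : c ∈ s z
    · have := mem_s z hz c hc
      simp [hc, this]
    · simp only [if_neg hc]; split_ifs <;> norm_num
  have χ_le : ∀ z < P.N₃, ∀ c, χ z c ≤ 1 := fun z hz c => by
    have := le_one z hz c
    have := pd_nonneg c
    linarith
  have χ_g : ∀ z < P.N₃, ∀ c, P.g z c = true → χ z c = 0 := fun z hz c hg => by
    simp only [hχ]
    rw [if_neg fun hc => by simp [(mem_s z hz c hc).2.2.2] at hg]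
  have sum_b : ∀ c, P.b y₀ c = true → ∀ z < P.N₃, χ z c + pd c = 0 := fun c hb z hz => by
    have h1 : χ z c = 0 := by
      simp only [hχ]
      rw [if_neg fun hc => by simp [(mem_s z hz c hc).2.2.1] at hb]
    simp [h1, hpd, hb]
  have N3_le : (P.N₃ : ℝ) ≤ P.size := by
    have : P.N₃ ≤ P.size := by unfold size; omega
    exact_mod_cast this
  have NB_le : (P.N₃ * P.B : ℝ) ≤ P.size := by
    have : P.N₃ * P.B ≤ P.size := by
      rcases Nat.eq_zero_or_pos P.N₃ with h | h
      · simp [h]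
      · have h1 : P.B ≤ P.M := (hB 0 h).trans ((card_filter_le _ _).trans (by simp))
        have := Nat.mul_le_mul_left P.N₃ h1
        unfold size; omega
    exact_mod_cast this
  refine Instance.exists_flow (G := P.inst h₁ h₂) (ν := P.node) (E := P.edges) rfl ?_
    (P.routing x₀ y₀ χ pd) _ ?_ ?_ ?_
  · intro h
    have := P.node_inj (u := .src x₀) (v := .snk y₀) (hx.trans_le h₁) (hy.trans_le h₂) h
    simp at this
  · intro e he
    rcases P.mem_edges.mp he with ⟨x, hx, rfl | ⟨c, hc, rfl⟩⟩ |
      ⟨y, hy, rfl | ⟨c, hc, rfl | rfl | rfl⟩⟩ | ⟨x, hx, c, hc, rfl⟩ <;> dsimp only <;>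
      (try split_ifs) <;> simp only [routing] <;> (try split_ifs) <;>
      first
        | positivity
  · intro e he
    rcases P.mem_edges.mp he with ⟨x, hx, rfl | ⟨c, hc, rfl⟩⟩ |
      ⟨y, hy, rfl | ⟨c, hc, rfl | rfl | rfl⟩⟩ | ⟨x, hx, c, hc, rfl⟩ <;> dsimp only <;>
      (try split_ifs) <;> simp only [routing] <;> (try split_ifs) <;>
      first
        | positivity
        | exact le_rfl
        | exact NB_le
        | exact (mul_le_of_le_one_right (Nat.cast_nonneg _) (pd_le _)).trans N3_le
        | (simp only [Nat.cast_one]; first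
            | exact χ_le _ hy _
            | exact pd_le _
            | exact le_one _ hy _)
        | (refine le_trans (sum_le_sum fun z hz => le_one z (mem_range.mp hz) c) ?_
           simpa using N3_le)
  · intro π
    rw [P.sum_edges_eq]
    set ρ : Node → ℝ := fun v => π (P.node v) with hρ
    have b1 : ∀ x ∈ range P.N₁, (P.routing x₀ y₀ χ pd (.src x) .hub * (ρ .hub - ρ (.src x)) +
        ∑ c ∈ range P.M, P.routing x₀ y₀ χ pd (.src x) (if P.a x c then .pos c else .hole c) *
          (ρ (if P.a x c then .pos c else .hole c) - ρ (.src x))) =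
        if x = x₀ then ∑ z ∈ range P.N₃, ∑ c ∈ range P.M, (χ z c * (ρ .hub - ρ (.src x₀)) +
          pd c * (ρ (.pos c) - ρ (.src x₀))) else 0 := by
      intro x _
      by_cases hxx : x = x₀
      · subst hxx
        simp only [if_true, sum_add_distrib, ← sum_mul]
        rw [sum_congr rfl fun z hz => χ_sum z (mem_range.mp hz)]
        simp only [sum_const, card_range, nsmul_eq_mul, mul_sum]
        congr 1
        · simp [routing]
        · refine sum_congr rfl fun c _ => ?_
          cases ha : P.a x c <;> simp [routing, hpd, ha]
      · rw [if_neg hxx]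
        have : ∀ c, P.routing x₀ y₀ χ pd (.src x) (if P.a x c then .pos c else .hole c) = 0 := by
          intro c
          split_ifs <;> simp [routing, hxx]
        rw [sum_eq_zero fun c _ => by rw [this c, zero_mul]]
        simp [routing, hxx]
    have b2 : ∀ z ∈ range P.N₃, (P.routing x₀ y₀ χ pd .hub (.gate z) * (ρ (.gate z) - ρ .hub) +
        ∑ c ∈ range P.M, (P.routing x₀ y₀ χ pd (.gate z) (if P.g z c then .hole c else .cell z c) *
            (ρ (if P.g z c then .hole c else .cell z c) - ρ (.gate z)) +
          (P.routing x₀ y₀ χ pd (.pos c) (.cell z c) * (ρ (.cell z c) - ρ (.pos c)) +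
          P.routing x₀ y₀ χ pd (.cell z c) (.unm c) * (ρ (.unm c) - ρ (.cell z c))))) =
        ∑ c ∈ range P.M, (χ z c * (ρ (.cell z c) - ρ .hub) + pd c * (ρ (.cell z c) - ρ (.pos c)) +
          (χ z c + pd c) * (ρ (.unm c) - ρ (.cell z c))) := by
      intro z hz
      have hz := mem_range.mp hz
      have : P.routing x₀ y₀ χ pd .hub (.gate z) = ∑ c ∈ range P.M, χ z c := by
        rw [χ_sum z hz]; rfl
      rw [this, sum_mul, ← sum_add_distrib]
      refine sum_congr rfl fun c _ => ?_
      cases hg : P.g z c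
      · simp only [routing, Bool.false_eq_true, if_false]; ring
      · simp only [routing, if_true, χ_g z hz c hg]; ring
    have b3 : ∀ x ∈ range P.N₂, (∑ c ∈ range P.M,
        P.routing x₀ y₀ χ pd (if P.b x c then .dhole c else .unm c) (.snk x) *
          (ρ (.snk x) - ρ (if P.b x c then .dhole c else .unm c))) =
        if x = y₀ then ∑ z ∈ range P.N₃, ∑ c ∈ range P.M,
          (χ z c + pd c) * (ρ (.snk y₀) - ρ (.unm c)) else 0 := by
      intro x _
      by_cases hxx : x = y₀
      · subst hxx
        rw [if_pos rfl, sum_comm (s := range P.N₃)]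
        simp only [← sum_mul]
        refine sum_congr rfl fun c _ => ?_
        cases hb : P.b x c
        · simp [routing]
        · rw [sum_congr rfl fun z hz => sum_b c hb z (mem_range.mp hz)]
          simp [routing]
      · rw [if_neg hxx]
        refine sum_eq_zero fun c _ => ?_
        split_ifs <;> simp [routing, hxx]
    have h3 := sum_congr rfl b3
    rw [sum_ite_eq', if_pos (mem_range.mpr hy)] at h3
    have h1 := sum_congr rfl b1
    rw [sum_ite_eq', if_pos (mem_range.mpr hx)] at h1
    refine (congrArg₂ (· + ·) h1 (congrArg₂ (· + ·) (sum_congr rfl b2) h3)).trans ?_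
    have hval : ((P.N₃ * (P.cnt x₀ y₀ + P.B) : ℕ) : ℝ) =
        ∑ z ∈ range P.N₃, ∑ c ∈ range P.M, (pd c + χ z c) := by
      simp only [sum_add_distrib, pd_sum]
      rw [sum_congr rfl fun z hz => χ_sum z (mem_range.mp hz)]
      simp only [sum_const, card_range, nsmul_eq_mul]
      push_cast; ring
    rw [hval]
    simp only [← sum_add_distrib, sum_mul]
    refine sum_congr rfl fun z _ => sum_congr rfl fun c _ => ?_
    simp only [hρ]
    ring

/-- The node set of a cut between `x₀` and `y₀`; `O` is the set of gates on the side of the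
source. -/
def side (x₀ y₀ : ℕ) (O : ℕ → Prop) : Node → Prop
  | .src i => i = x₀
  | .snk j => j ≠ y₀
  | .hub => True
  | .hole _ => True
  | .pos c => P.a x₀ c = true
  | .unm c => P.b y₀ c = true
  | .dhole _ => False
  | .gate y => O y
  | .cell y c => P.b y₀ c = true ∨ O y ∧ (P.a x₀ c = true ∨ P.g y c = false)

open Classical in
/-- The cut that puts the gates in `O` on the side of the source: a member `z` contributes its
number of unsatisfied clauses if its gate is in `O`, and the capacity `B` of its gate otherwise,
besides the `cnt` cells fed directly from `x₀`. -/
theorem flow_le {h₁ : P.N₁ ≤ P.S₁} {h₂ : P.N₂ ≤ P.S₂} {x₀ y₀ : ℕ} (hx : x₀ < P.N₁)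
    (hy : y₀ < P.N₂) (O : ℕ → Prop) {r : ℝ}
    (hr : (P.inst h₁ h₂).IsMaxFlow (P.node (.src x₀)) (P.node (.snk y₀)) r) :
    r ≤ ((∑ z ∈ range P.N₃, if O z then P.cnt x₀ y₀ + #(P.unsat x₀ y₀ z)
      else P.cnt x₀ y₀ + P.B : ℕ) : ℝ) := by
  obtain ⟨f, hf, rfl⟩ := hr.1
  set X : Fin P.size → Prop := fun w => ∃ v, P.Valid v ∧ P.node v = w ∧ P.side x₀ y₀ O v with hX
  have hXv : ∀ v, P.Valid v → (X (P.node v) ↔ P.side x₀ y₀ O v) := fun v hv =>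
    ⟨fun ⟨u, hu, huv, hs⟩ => P.node_inj hu hv huv ▸ hs, fun hs => ⟨v, hv, rfl, hs⟩⟩
  have h := Instance.flowValue_le_cut (G := P.inst h₁ h₂) (ν := P.node) (E := P.edges) rfl hf X
    ((hXv (.src x₀) (hx.trans_le h₁)).mpr rfl)
    (fun hc => (hXv (.snk y₀) (hy.trans_le h₂)).mp hc rfl)
  refine h.trans (le_of_eq ?_)
  have h' : (P.edges.map fun e => if X (P.node e.1) ∧ ¬ X (P.node e.2.1) then (e.2.2 : ℝ) else 0) =
      P.edges.map fun e =>
        if P.side x₀ y₀ O e.1 ∧ ¬ P.side x₀ y₀ O e.2.1 then (e.2.2 : ℝ) else 0 :=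
    List.map_congr_left fun e he => by
      have hv := P.valid_of_mem h₁ h₂ he
      rw [hXv _ hv.1, hXv _ hv.2.1]
  rw [h', P.sum_edges_eq]
  have b1 : ∀ x ∈ range P.N₁, ((if P.side x₀ y₀ O (.src x) ∧ ¬ P.side x₀ y₀ O .hub then
      (P.size : ℝ) else 0) + ∑ c ∈ range P.M,
      if P.side x₀ y₀ O (.src x) ∧ ¬ P.side x₀ y₀ O (if P.a x c then .pos c else .hole c) then
        (P.size : ℝ) else 0) = 0 := by
    intro x _
    simp only [side, not_true_eq_false, and_false, if_false, zero_add]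
    refine sum_eq_zero fun c _ => if_neg ?_
    rintro ⟨rfl, hn⟩
    cases ha : P.a x c <;> simp [ha] at hn
  have b3 : ∀ x ∈ range P.N₂, (∑ c ∈ range P.M,
      if P.side x₀ y₀ O (if P.b x c then .dhole c else .unm c) ∧ ¬ P.side x₀ y₀ O (.snk x) then
        (P.size : ℝ) else 0) = 0 := by
    intro x _
    refine sum_eq_zero fun c _ => if_neg ?_
    rintro ⟨hn, hx⟩
    simp only [side, not_not] at hx
    subst hx
    cases hb : P.b x c <;> simp [hb, side] at hn
  refine (congrArg₂ (· + ·) (sum_congr rfl b1) (congrArg₂ (· + ·) rfl (sum_congr rfl b3))).trans ?_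
  simp only [sum_const_zero, zero_add, add_zero, Nat.cast_sum]
  refine sum_congr rfl fun z _ => ?_
  have hcnt : (P.cnt x₀ y₀ : ℝ) =
      ∑ c ∈ range P.M, if P.a x₀ c = true ∧ P.b y₀ c = false then 1 else 0 := by
    simp only [cnt, sum_boole]
  have huns : (#(P.unsat x₀ y₀ z) : ℝ) = ∑ c ∈ range P.M,
      if P.a x₀ c = false ∧ P.b y₀ c = false ∧ P.g z c = false then 1 else 0 := by
    simp only [unsat, sum_boole]
  by_cases hO : O z
  · simp only [hO, if_true, Nat.cast_add, hcnt, huns, ← sum_add_distrib]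
    simp only [side, hO, not_true_eq_false, and_false, if_false, zero_add]
    refine sum_congr rfl fun c _ => ?_
    cases ha : P.a x₀ c <;> cases hb : P.b y₀ c <;> cases hg : P.g z c <;> simp [hO, ha, hb, hg]
  · simp only [hO, if_false, Nat.cast_add, hcnt]
    rw [add_comm]
    congr 1
    · refine sum_congr rfl fun c _ => ?_
      cases ha : P.a x₀ c <;> cases hb : P.b y₀ c <;> cases hg : P.g z c <;> simp [side, hO, ha, hb]
    · simp [side, hO]

/-- The flow from `x₀` to `y₀` attains the value `N₃ (cnt + B)` of the trivial cut if and only if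
no member of the third family leaves fewer than `B` clauses unsatisfied. -/
theorem maxFlow_eq_iff {h₁ : P.N₁ ≤ P.S₁} {h₂ : P.N₂ ≤ P.S₂} {x₀ y₀ : ℕ} (hx : x₀ < P.N₁)
    (hy : y₀ < P.N₂) {r : ℕ}
    (hr : (P.inst h₁ h₂).IsMaxFlow (P.node (.src x₀)) (P.node (.snk y₀)) r) :
    r = P.N₃ * (P.cnt x₀ y₀ + P.B) ↔ ∀ z < P.N₃, P.B ≤ #(P.unsat x₀ y₀ z) := by
  constructor
  · intro h z hz
    by_contra hlt
    have h1 := P.flow_le hx hy (fun y => y = z) hr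
    have h2 : r ≤ ∑ y ∈ range P.N₃, if y = z then P.cnt x₀ y₀ + #(P.unsat x₀ y₀ y)
        else P.cnt x₀ y₀ + P.B := by
      convert Nat.cast_le.mp h1
    have h3 : (∑ y ∈ range P.N₃, if y = z then P.cnt x₀ y₀ + #(P.unsat x₀ y₀ y)
        else P.cnt x₀ y₀ + P.B) < ∑ y ∈ range P.N₃, (P.cnt x₀ y₀ + P.B) := by
      refine sum_lt_sum (fun y _ => ?_) ⟨z, mem_range.mpr hz, by simp; omega⟩
      split_ifs with hyz
      · subst hyz; omega
      · exact le_rfl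
    rw [sum_const, card_range, smul_eq_mul] at h3
    omega
  · intro h
    obtain ⟨f, hf, hv⟩ := P.exists_flow (h₁ := h₁) (h₂ := h₂) hx hy h
    have h1 := P.flow_le hx hy (fun _ => False) hr
    have h2 := hr.2 ⟨f, hf, rfl⟩
    rw [← hv] at h2
    simp only [if_false, sum_const, card_range, smul_eq_mul] at h1
    exact le_antisymm (Nat.cast_le.mp h1) (Nat.cast_le.mp h2)

end Gadget

end MaxFlow

namespace WordRAM

/-! ### The program of the reduction

Register `1` holds the number `w` of bits of `X = 2 ^ w`, and the registers from `64` on belong to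
the flow program. Array `0` is the input, array `1` the output and array `2` the table of
occurrences of literals; arrays `3` and `4` are the input and the output of the flow program. -/

notation "rFuel" => 2
notation "rX" => 3
notation "rBase" => 4
notation "rNn" => 5
notation "rMm" => 6
notation "rL" => 7
notation "rQ" => 8
notation "rG" => 9
notation "rn₁" => 10
notation "rn₂" => 11
notation "rn₃" => 12
notation "re₁" => 13
notation "re₂" => 14
notation "rB" => 15
notation "rN₁" => 16
notation "rN₂" => 17
notation "rN₃" => 18
notation "rS₁" => 19
notation "rS₂" => 20
notation "rPtr" => 21
notation "rFl" => 22
notation "rI" => 23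
notation "rU" => 24
notation "rV" => 25
notation "rY" => 26
notation "rC" => 27
notation "rSize" => 28
notation "rO" => 29
notation "rCnt" => 30
notation "rCand" => 31
notation "rCa" => 32
notation "rCb" => 33
notation "rBest" => 34
notation "rLen" => 35
notation "rJ" => 36
notation "rPos" => 37
notation "rFl₂" => 38
notation "rFl₃" => 39
notation "rLo" => 40
notation "rZero" => 41

instance : Add Exp := ⟨.bin .add⟩
instance : Sub Exp := ⟨.bin .sub⟩
instance : Mul Exp := ⟨.bin .mul⟩
instance : Div Exp := ⟨.bin .div⟩
instance : Mod Exp := ⟨.bin .mod⟩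
instance : AndOp Exp := ⟨.bin .land⟩
instance : ShiftRight Exp := ⟨.bin .shr⟩

theorem Exp.add_def (e f : Exp) : e + f = .bin .add e f := rfl
theorem Exp.sub_def (e f : Exp) : e - f = .bin .sub e f := rfl
theorem Exp.mul_def (e f : Exp) : e * f = .bin .mul e f := rfl
theorem Exp.div_def (e f : Exp) : e / f = .bin .div e f := rfl
theorem Exp.mod_def (e f : Exp) : e % f = .bin .mod e f := rfl
theorem Exp.and_def (e f : Exp) : e &&& f = .bin .land e f := rfl
theorem Exp.shr_def (e f : Exp) : e >>> f = .bin .shr e f := rfl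

infixr:60 " ;; " => Cmd.seq
prefix:max "‡" => Exp.var
prefix:max "♮" => Exp.lit

/-- Whether the partial assignment coded by the register `x`, to the variables from register `lo`
on, as many as register `len` says, satisfies the clause in register `rC`; the result goes to the
register `out`.  Array `2` is the table of occurrences of literals in clauses. -/
def satCmd (out x lo len : ℕ) : Cmd :=
  .set out ♮0 ;;
  .loopFor rI ‡len (.ite (.idx 2 (‡rC * (♮2 * ‡rNn) + (♮2 * (‡lo + ‡rI) + ((‡x >>> ‡rI) &&& ♮1))))
    (.set out ♮1) .skip)

/-- Reading the number of variables and of clauses, and the bit length of the latter. -/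
def prologue : Cmd :=
  .set rNn (.idx 0 ♮0) ;; .set rMm (.idx 0 ♮1) ;;
  .loopFor rI ‡rMm (.ite (‡rMm >>> ‡rI) (.set rL (.min (‡rI + ♮1) ‡rMm)) .skip)

/-- Filling the table of occurrences. -/
def parse : Cmd :=
  .set rPos ♮2 ;;
  .loopFor rC ‡rMm (.set rLen (.idx 0 ‡rPos) ;; .set rPos (.min (‡rPos + ♮1) ‡rX) ;;
    .loopFor rJ (♮2 * ‡rNn) (.ite (‡rLen - ‡rJ)
      (.put 2 (‡rC * (♮2 * ‡rNn) + .idx 0 ‡rPos) ♮1 ;; .set rPos (.min (‡rPos + ♮1) ‡rX))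
      .skip))

/-- Appending a word to the input of the flow program. -/
def emit (e : Exp) : Cmd := .put 3 (‡rBase + ‡rPtr) e ;; .set rPtr (.min (‡rPtr + ♮1) ‡rX)

/-- Appending an edge. -/
def emitEdge (u v c : Exp) : Cmd := emit u ;; emit v ;; emit c

/-- The number of the gate in register `rY`. -/
def gateExp : Exp := ‡rO + ♮1 + ♮4 * ‡rMm + ‡rY

/-- The number of the cell of the gate in register `rY` and the clause in register `rC`. -/
def cellExp : Exp := ‡rO + ♮1 + ♮4 * ‡rMm + ‡rN₃ + ‡rY * ‡rMm + ‡rC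

/-- Appending the graph to the empty input of the flow program. -/
def writeGraph : Cmd :=
  (emit ‡rSize ;; emit (‡rN₁ * (♮1 + ‡rMm) + (‡rN₃ * (♮1 + ♮3 * ‡rMm) + ‡rN₂ * ‡rMm)) ;;
    emit ‡rS₁ ;; emit ‡rS₂) ;;
  (.loopFor rU ‡rN₁ (emitEdge ‡rU ‡rO ‡rSize ;;
    .loopFor rC ‡rMm (satCmd rFl rU rZero rn₁ ;;
      emitEdge ‡rU (‡rO + ♮1 + ‡rC + ‡rFl * ‡rMm) ‡rSize)) ;;
  .loopFor rY ‡rN₃ (emitEdge ‡rO gateExp ‡rB ;;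
    .loopFor rC ‡rMm (satCmd rFl rY rLo rn₃ ;;
      (emitEdge gateExp (‡rFl * (‡rO + ♮1 + ‡rC) + (♮1 - ‡rFl) * cellExp) ♮1 ;;
      emitEdge (‡rO + ♮1 + ‡rC + ‡rMm) cellExp ♮1 ;;
      emitEdge cellExp (‡rO + ♮1 + ♮2 * ‡rMm + ‡rC) ♮1))) ;;
  .loopFor rV ‡rN₂ (.loopFor rC ‡rMm (satCmd rFl rV rn₁ rn₂ ;;
      emitEdge (‡rO + ♮1 + ♮2 * ‡rMm + ‡rC + ‡rFl * ‡rMm) (‡rS₁ + ‡rV) ‡rSize))) ;;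
  .loopFor rU ‡rS₁ (emit ‡rU) ;;
  .loopFor rV ‡rS₂ (emit (‡rS₁ + ‡rV))

/-- Writing down the graph. -/
def build : Cmd := .set rPtr ♮0 ;; writeGraph

/-- Clearing the registers below `R` of the flow program. -/
def clear : ℕ → Cmd
  | 0 => .skip
  | R + 1 => clear R ;; .set (64 + R) ♮0

/-- Looking for a pair whose reported flow differs from the value of the trivial cut. -/
def search : Cmd :=
  .set rCand ♮0 ;;
  .loopFor rU ‡rN₁ (.loopFor rV ‡rN₂ (.set rCnt ♮0 ;;
    .loopFor rC ‡rMm (satCmd rFl rU rZero rn₁ ;; satCmd rFl₂ rV rn₁ rn₂ ;;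
      .set rCnt (.min (‡rCnt + ‡rFl * (♮1 - ‡rFl₂)) ‡rMm)) ;;
    .ite ((.idx 4 (‡rBase + (‡rU * ‡rS₂ + ‡rV)) - ‡rN₃ * (‡rCnt + ‡rB)) +
        (‡rN₃ * (‡rCnt + ‡rB) - .idx 4 (‡rBase + (‡rU * ‡rS₂ + ‡rV))))
      (.set rCand ♮1 ;; .set rCa ‡rU ;; .set rCb ‡rV) .skip))

/-- Trying all extensions of the pair that was found. -/
def verify : Cmd :=
  .ite ‡rCand (.loopFor rY ‡rN₃ (.set rCnt ♮0 ;;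
    .loopFor rC ‡rMm (satCmd rFl rCa rZero rn₁ ;; satCmd rFl₂ rCb rn₁ rn₂ ;;
      satCmd rFl₃ rY rLo rn₃ ;;
      .ite (‡rFl + ‡rFl₂ + ‡rFl₃) (.set rCnt (.min (‡rCnt + ♮1) ‡rMm)) .skip) ;;
    .ite (‡rCnt - ‡rBest) (.set rBest ‡rCnt) .skip)) .skip

/-- Decoding a guess of the sizes of the families and of the numbers of sources and sinks. -/
def decode : Cmd :=
  .set rn₁ (.min (‡rG % ‡rQ) ‡rQ) ;;
  .set rn₂ (.min ((‡rG / ‡rQ) % ‡rQ) ‡rQ) ;;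
  .set re₁ (.min ((‡rG / (‡rQ * ‡rQ)) % ‡rQ) ‡rQ) ;;
  .set re₂ (.min ((‡rG / (‡rQ * ‡rQ * ‡rQ)) % ‡rQ) ‡rQ) ;;
  .set rB (.min (‡rG / (‡rQ * ‡rQ * ‡rQ * ‡rQ) + ♮1) ‡rMm) ;;
  .set rn₃ (‡rNn - (‡rn₁ + ‡rn₂))

/-- Zero if and only if the guess is admissible. -/
def guard (q : ℕ) : Exp :=
  (‡rn₁ + ‡rn₂ - ‡rNn) + (‡rn₁ - ‡rn₃) + (‡rn₂ - ‡rn₃) + (‡rn₁ - ‡re₁) + (‡rn₂ - ‡re₂) +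
    (‡re₁ - (‡rn₃ + ‡rL)) + (‡re₂ - (‡rn₃ + ‡rL)) + (‡rn₃ - (‡rNn - ‡rNn / ♮q))

/-- Computing the sizes. -/
def sizes : Cmd :=
  .set rN₁ (.pow ‡rn₁) ;; .set rN₂ (.pow ‡rn₂) ;; .set rN₃ (.pow ‡rn₃) ;;
  .set rS₁ (.pow ‡re₁) ;; .set rS₂ (.pow ‡re₂) ;;
  .set rLo (.min (‡rn₁ + ‡rn₂) ‡rNn) ;; .set rZero ♮0 ;;
  .set rO (‡rS₁ + ‡rS₂) ;;
  .set rSize (‡rS₁ + ‡rS₂ + ♮1 + ♮4 * ‡rMm + ‡rN₃ + ‡rN₃ * ‡rMm) ;;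
  .set rBase (‡rG * (♮2 * ‡rX))

/-- Preparing the registers and the time limit of the flow program. -/
def launch (q b R : ℕ) : Cmd :=
  clear R ;; .set 64 ‡rPtr ;; .set rFuel (.pow (‡rNn - ‡rNn / ♮q + (♮3 * ‡rL + ♮b)))

/-- One call of the flow program `p`. -/
def round (p : Program) (q b : ℕ) : Cmd :=
  decode ;; .ite (guard q) .skip
    (sizes ;; build ;; launch q b (p.bnd + 1) ;; limited p ;; search ;; verify)

/-- The main part of the program. -/
def mainCmd (p : Program) (q b : ℕ) : Cmd :=
  .set rX (.pow ‡1) ;; .set rQ (.min (‡rNn + ‡rL + ♮2) ‡rX) ;; parse ;;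
  .loopFor rG (‡rQ * ‡rQ * ‡rQ * ‡rQ * ‡rMm) (round p q b)

theorem satCmd_wf {D E : ℕ} (hD : 65 ≤ D) (hE : 60 ≤ E) {out x lo len : ℕ}
    (ho : out < D ∧ regCls out = 1 ∧ out ≠ 1) (hx : x < D ∧ regCls x = 1)
    (hlo : lo < D ∧ regCls lo = 1) (hlen : len < D ∧ regCls len = 1) :
    (satCmd out x lo len).Wf D regCls arrCls E := by
  simp only [satCmd, Cmd.Wf, Exp.Wf, Exp.ub, Exp.add_def, Exp.mul_def, Exp.and_def, Exp.shr_def,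
    ho.2.1, hx.2, hlo.2, hlen.2]
  simp [regCls, arrCls]
  omega

theorem prologue_wf {D E : ℕ} (hD : 65 ≤ D) (hE : 60 ≤ E) : prologue.Wf D regCls arrCls E := by
  simp [prologue, Cmd.Wf, Exp.Wf, Exp.ub, Exp.add_def, Exp.shr_def, regCls, arrCls]
  omega

theorem parse_wf {D E : ℕ} (hD : 65 ≤ D) (hE : 60 ≤ E) : parse.Wf D regCls arrCls E := by
  simp [parse, Cmd.Wf, Exp.Wf, Exp.ub, Exp.add_def, Exp.mul_def, Exp.sub_def, regCls, arrCls]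
  omega

theorem build_wf {D E : ℕ} (hD : 65 ≤ D) (hE : 60 ≤ E) : build.Wf D regCls arrCls E := by
  have h1 : (satCmd rFl rU rZero rn₁).Wf D regCls arrCls E := by
    apply satCmd_wf hD hE <;> simp [regCls] <;> omega
  have h2 : (satCmd rFl rY rLo rn₃).Wf D regCls arrCls E := by
    apply satCmd_wf hD hE <;> simp [regCls] <;> omega
  have h3 : (satCmd rFl rV rn₁ rn₂).Wf D regCls arrCls E := by
    apply satCmd_wf hD hE <;> simp [regCls] <;> omega
  simp [build, writeGraph, emit, emitEdge, gateExp, cellExp, Cmd.Wf, Exp.Wf, Exp.ub,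
    Exp.add_def, Exp.mul_def, Exp.sub_def, regCls, arrCls, h1, h2, h3]
  omega

theorem search_wf {D E : ℕ} (hD : 65 ≤ D) (hE : 60 ≤ E) : search.Wf D regCls arrCls E := by
  have h1 : (satCmd rFl rU rZero rn₁).Wf D regCls arrCls E := by
    apply satCmd_wf hD hE <;> simp [regCls] <;> omega
  have h2 : (satCmd rFl₂ rV rn₁ rn₂).Wf D regCls arrCls E := by
    apply satCmd_wf hD hE <;> simp [regCls] <;> omega
  simp [search, Cmd.Wf, Exp.Wf, Exp.ub, Exp.add_def, Exp.mul_def,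
    Exp.sub_def, regCls, arrCls, h1, h2]
  omega

theorem verify_wf {D E : ℕ} (hD : 65 ≤ D) (hE : 60 ≤ E) : verify.Wf D regCls arrCls E := by
  have h1 : (satCmd rFl rCa rZero rn₁).Wf D regCls arrCls E := by
    apply satCmd_wf hD hE <;> simp [regCls] <;> omega
  have h2 : (satCmd rFl₂ rCb rn₁ rn₂).Wf D regCls arrCls E := by
    apply satCmd_wf hD hE <;> simp [regCls] <;> omega
  have h3 : (satCmd rFl₃ rY rLo rn₃).Wf D regCls arrCls E := by
    apply satCmd_wf hD hE <;> simp [regCls] <;> omega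
  simp [verify, Cmd.Wf, Exp.Wf, Exp.ub, Exp.add_def,
    Exp.sub_def, regCls, h1, h2, h3]
  omega

theorem clear_wf {D E : ℕ} (hE : 60 ≤ E) : ∀ {R : ℕ}, 64 + R ≤ D →
    (clear R).Wf D regCls arrCls E
  | 0, _ => trivial
  | R + 1, h => ⟨clear_wf hE (by omega), by omega, by omega, Nat.zero_le _, Nat.zero_le _⟩

theorem round_wf {D E q b : ℕ} {p : Program} (hD : 65 + p.bnd ≤ D) (hE : 60 + q + b + p.bnd ≤ E) :
    (round p q b).Wf D regCls arrCls E := by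
  refine ⟨?_, ?_, trivial, ?_, build_wf (by omega) (by omega),
    ⟨clear_wf (by omega) (by omega), ?_⟩, limited_wf (by omega) p hD (by omega),
    search_wf (by omega) (by omega), verify_wf (by omega) (by omega)⟩
  · simp [decode, Cmd.Wf, Exp.Wf, Exp.ub, Exp.add_def, Exp.mul_def, Exp.sub_def, Exp.div_def,
      Exp.mod_def, regCls]
    omega
  · simp [guard, Exp.Wf, Exp.ub, Exp.add_def, Exp.sub_def, Exp.div_def, regCls]
    omega
  · simp [sizes, Cmd.Wf, Exp.Wf, Exp.ub, Exp.add_def, Exp.mul_def, regCls]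
    omega
  · simp [Cmd.Wf, Exp.Wf, Exp.ub, Exp.sub_def, Exp.div_def, regCls]
    omega

theorem mainCmd_wf {D E q b : ℕ} {p : Program} (hD : 65 + p.bnd ≤ D)
    (hE : 60 + q + b + p.bnd ≤ E) : (mainCmd p q b).Wf D regCls arrCls E := by
  have h1 := round_wf hD hE
  have h2 := parse_wf (D := D) (E := E) (by omega) (by omega)
  simp [mainCmd, Cmd.Wf, h1, h2, Exp.Wf, Exp.ub, Exp.add_def, Exp.mul_def, regCls]
  omega

/-! ### Partial knowledge of a state -/

/-- The registers listed in `A` have the listed values, and array `2` is `τ`. -/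
def Knows (A : List (ℕ × ℕ)) (τ : ℕ → ℕ) (s : State) : Prop :=
  (∀ p ∈ A, s.reg p.1 = p.2) ∧ s.mem 2 = τ

theorem Knows.get {A : List (ℕ × ℕ)} {τ : ℕ → ℕ} {s : State} (h : Knows A τ s) {r v : ℕ}
    (hm : (r, v) ∈ A) : s.reg r = v := h.1 _ hm

theorem Knows.cons {A : List (ℕ × ℕ)} {τ : ℕ → ℕ} {s : State} (h : Knows A τ s) {r v : ℕ}
    (hr : s.reg r = v) : Knows ((r, v) :: A) τ s :=
  ⟨fun p hp => by rcases List.mem_cons.mp hp with rfl | hp; exacts [hr, h.1 p hp], h.2⟩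

theorem Knows.tail {A : List (ℕ × ℕ)} {τ : ℕ → ℕ} {s : State} {p : ℕ × ℕ}
    (h : Knows (p :: A) τ s) : Knows A τ s :=
  ⟨fun q hq => h.1 q (List.mem_cons_of_mem _ hq), h.2⟩

theorem Knows.exec {A : List (ℕ × ℕ)} {τ : ℕ → ℕ} {s : State} (h : Knows A τ s) {c : Cmd}
    (hA : ∀ p ∈ A, c.NoReg p.1) (h2 : c.NoArr 2) : Knows A τ (c.exec s) :=
  ⟨fun p hp => ((hA p hp).exec s).trans (h.1 p hp), (h2.exec s).trans h.2⟩

theorem Knows.setReg {A : List (ℕ × ℕ)} {τ : ℕ → ℕ} {s : State} (h : Knows A τ s) {x : ℕ}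
    (hx : x ∉ A.map Prod.fst) (v : ℕ) : Knows ((x, v) :: A) τ (s.setReg x v) := by
  refine Knows.cons (s := s.setReg x v) ⟨fun p hp => ?_, h.2⟩ (State.setReg_reg_self _ _ _)
  have hpx : p.1 ≠ x := fun hc => hx (hc ▸ List.mem_map_of_mem hp)
  rw [State.setReg_reg_ne _ hpx]
  exact h.1 p hp

/-- Whether the partial assignment `x` to the variables `lo, …, lo + len - 1` satisfies clause `c`,
where `τ` is the table of occurrences for `n` variables. -/
def satN (τ : ℕ → ℕ) (n x lo len c : ℕ) : Bool :=
  decide (∃ i < len, τ (c * (2 * n) + (2 * (lo + i) + ((x >>> i) &&& 1))) ≠ 0)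

theorem satCmd_noReg {out x lo len r : ℕ} (h : r ≠ out) (h' : r ≠ rI) :
    (satCmd out x lo len).NoReg r := ⟨h, h', h, trivial⟩

theorem satCmd_noArr {out x lo len a : ℕ} : (satCmd out x lo len).NoArr a :=
  ⟨trivial, trivial, trivial⟩

/-- `satCmd` evaluates `satN`, provided that the register for the result and the loop counter are
not among those it reads. -/
theorem satCmd_spec {out x lo len : ℕ} (ho : out ∉ [rI, x, lo, len, rC, rNn])
    (hI : rI ∉ [x, lo, len]) (s : State) : ((satCmd out x lo len).exec s).reg out =
      if satN (s.mem 2) (s.reg rNn) (s.reg x) (s.reg lo) (s.reg len) (s.reg rC) then 1 else 0 := by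
  simp only [List.mem_cons, List.not_mem_nil, or_false, not_or] at ho hI
  obtain ⟨o1, o2, o3, o4, o5, o6⟩ := ho
  obtain ⟨i1, i2, i3⟩ := hI
  set u := s.setReg out 0 with hu
  set P : ℕ → Prop := fun i => s.mem 2 (s.reg rC * (2 * s.reg rNn) +
    (2 * (s.reg lo + i) + ((s.reg x >>> i) &&& 1))) ≠ 0 with hP
  have key := forIter_inv (g := fun i s => (Cmd.ite (.idx 2 (‡rC * (♮2 * ‡rNn) +
      (♮2 * (‡lo + ‡rI) + ((‡x >>> ‡rI) &&& ♮1)))) (.set out ♮1) .skip).exec (s.setReg rI i))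
    (k := s.reg len) (s := u)
    (fun k v => (∀ r, r ≠ out → r ≠ rI → v.reg r = s.reg r) ∧ v.mem = s.mem ∧
      v.reg out = if ∃ i < k, P i then 1 else 0)
    ⟨fun r h _ => by simp [hu, h], rfl, by simp [hu]⟩ (by
      rintro i hi v ⟨h1, h2, h3⟩
      have hev : (Exp.idx 2 (‡rC * (♮2 * ‡rNn) + (♮2 * (‡lo + ‡rI) +
          ((‡x >>> ‡rI) &&& ♮1)))).eval (v.setReg rI i) ≠ 0 ↔ P i := by
        simp only [Exp.and_def, Exp.shr_def, Exp.eval, BinOp.eval, 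
          State.setReg_mem, h2, State.setReg_reg_self]
        rw [State.setReg_reg_ne _ (by norm_num), State.setReg_reg_ne _ (by norm_num),
          State.setReg_reg_ne _ (Ne.symm i2), State.setReg_reg_ne _ (Ne.symm i1),
          h1 _ (Ne.symm o5) (by norm_num), h1 _ (Ne.symm o6) (by norm_num),
          h1 _ (Ne.symm o3) (Ne.symm i2), h1 _ (Ne.symm o2) (Ne.symm i1)]
      have hex : (∃ j < i + 1, P j) ↔ (∃ j < i, P j) ∨ P i := by
        constructor
        · rintro ⟨j, hj, hp⟩
          rcases Nat.lt_succ_iff_lt_or_eq.mp hj with h | rfl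
          exacts [Or.inl ⟨j, h, hp⟩, Or.inr hp]
        · rintro (⟨j, hj, hp⟩ | hp)
          exacts [⟨j, by omega, hp⟩, ⟨i, by omega, hp⟩]
      simp only [Cmd.exec, hev]
      by_cases hp : P i
      · rw [if_pos hp, if_pos (hex.mpr (Or.inr hp))]
        refine ⟨fun r hr hr' => ?_, h2, by simp [Exp.eval]⟩
        simp [hr, hr', h1 r hr hr']
      · rw [if_neg hp]
        refine ⟨fun r hr hr' => ?_, h2, ?_⟩
        · simp [hr', h1 r hr hr']
        · rw [State.setReg_reg_ne _ o1, h3]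
          simp only [hex, hp, or_false])
  have hlen : (Exp.var len).eval u = s.reg len := by
    simp [Exp.eval, hu, Ne.symm o4]
  have : ((satCmd out x lo len).exec s).reg out = if ∃ i < s.reg len, P i then 1 else 0 := by
    simp only [satCmd, Cmd.exec]
    rw [← hlen] at key
    rw [← hlen]
    exact key.2.2
  rw [this, satN]
  simp [hP]

/-- `satCmd` in terms of what is known about the state. -/
theorem Knows.satCmd {A : List (ℕ × ℕ)} {τ : ℕ → ℕ} {s : State} (h : Knows A τ s)
    {out x lo len n xv lov lenv c : ℕ} (ho : out ∉ [rI, x, lo, len, rC, rNn])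
    (hI : rI ∉ [x, lo, len]) (hoA : out ∉ A.map Prod.fst) (hIA : rI ∉ A.map Prod.fst)
    (hn : (rNn, n) ∈ A) (hx : (x, xv) ∈ A) (hlo : (lo, lov) ∈ A) (hlen : (len, lenv) ∈ A)
    (hc : (rC, c) ∈ A) :
    Knows ((out, if satN τ n xv lov lenv c then 1 else 0) :: A) τ
      ((WordRAM.satCmd out x lo len).exec s) := by
  refine (h.exec (fun p hp => satCmd_noReg ?_ ?_) satCmd_noArr).cons ?_
  · rintro rfl; exact hoA (List.mem_map_of_mem hp)
  · intro h'; exact hIA (h' ▸ List.mem_map_of_mem hp)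
  · rw [satCmd_spec ho hI, h.get hn, h.get hx, h.get hlo, h.get hlen, h.get hc, h.2]

/-! ### Writing lists -/

/-- The window of array `3` at `base` holds the list `l`, followed by zeros, and register `rPtr`
holds its length. -/
def Buf (base : ℕ) (s : State) (l : List ℕ) : Prop :=
  s.reg rPtr = l.length ∧ ∀ i, s.mem 3 (base + i) = l.getD i 0

/-- In every state with the knowledge `A` and `τ`, the command appends the list `l` to the window
and preserves the knowledge. -/
def Emits (A : List (ℕ × ℕ)) (τ : ℕ → ℕ) (base X : ℕ) (c : Cmd) (l : List ℕ) : Prop :=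
  ∀ s pre, Knows A τ s → Buf base s pre → pre.length + l.length ≤ X →
    Knows A τ (c.exec s) ∧ Buf base (c.exec s) (pre ++ l)

section

variable {A : List (ℕ × ℕ)} {τ : ℕ → ℕ} {base X : ℕ}

theorem Emits.seq {c c' : Cmd} {l l' : List ℕ} (h : Emits A τ base X c l)
    (h' : Emits A τ base X c' l') : Emits A τ base X (c ;; c') (l ++ l') := by
  intro s pre hs hb hX
  rw [List.length_append] at hX
  obtain ⟨h1, h2⟩ := h s pre hs hb (by omega)
  obtain ⟨h3, h4⟩ := h' _ _ h1 h2 (by rw [List.length_append]; omega)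
  exact ⟨h3, by rwa [← List.append_assoc]⟩

theorem emits_emit (hbase : (rBase, base) ∈ A) (hX : (rX, X) ∈ A) (hp : rPtr ∉ A.map Prod.fst)
    {e : Exp} {v : ℕ} (he : ∀ s, Knows A τ s → e.eval s = v) :
    Emits A τ base X (emit e) [v] := by
  intro s pre hs hb hl
  simp only [List.length_cons, List.length_nil, zero_add] at hl
  have hne : (emit e).NoArr 2 := ⟨show 2 ≠ 3 by norm_num, trivial⟩
  refine ⟨hs.exec (fun p hp' => ⟨trivial, fun h => hp (h ▸ List.mem_map_of_mem hp')⟩) hne, ?_, ?_⟩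
  · simp only [emit, Cmd.exec, State.setReg_reg_self, Exp.eval, Exp.add_def, BinOp.eval,
      State.setMem_reg, hb.1, hs.get hX, List.length_append, List.length_cons, List.length_nil]
    omega
  · intro i
    simp only [emit, Cmd.exec, State.setReg_mem, State.setMem_mem, Exp.eval, Exp.add_def,
      BinOp.eval, hb.1, hs.get hbase, true_and, Nat.add_left_cancel_iff, he s hs, hb.2 i]
    split_ifs with hi
    · subst hi; simp
    · rcases Nat.lt_or_gt_of_ne hi with h | h
      · rw [List.getD_append _ _ _ _ h]
      · rw [List.getD_append_right _ _ _ _ h.le, List.getD_eq_default _ _ h.le,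
          List.getD_eq_default]
        simp only [List.length_cons, List.length_nil]
        omega

theorem emits_loop {x k : ℕ} {e : Exp} {c : Cmd} {f : ℕ → List ℕ} (hx : x ∉ A.map Prod.fst)
    (hxp : x ≠ rPtr) (he : ∀ s, Knows A τ s → e.eval s = k)
    (hc : ∀ i < k, Emits ((x, i) :: A) τ base X c (f i)) :
    Emits A τ base X (.loopFor x e c) ((List.range k).flatMap f) := by
  intro s pre hs hb hl
  simp only [Cmd.exec, he s hs]
  clear he
  induction k with
  | zero => simpa [forIter] using ⟨hs, hb⟩
  | succ k ih =>
    rw [List.range_succ, List.flatMap_append, List.length_append] at hl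
    obtain ⟨h1, h2⟩ := ih (fun i hi => hc i (by omega)) (by omega)
    rw [List.range_succ, List.flatMap_append, ← List.append_assoc]
    simp only [List.flatMap_cons, List.flatMap_nil, List.append_nil] at hl ⊢
    obtain ⟨h3, h4⟩ := hc k (by omega) _ _ (h1.setReg hx k)
      ⟨by rw [State.setReg_reg_ne _ (Ne.symm hxp)]; exact h2.1, h2.2⟩
      (by rw [List.length_append]; omega)
    exact ⟨h3.tail, h4⟩

theorem Emits.pre {c c' : Cmd} {l : List ℕ} {p : ℕ × ℕ}
    (hK : ∀ s, Knows A τ s → Knows (p :: A) τ (c.exec s)) (h1 : c.NoReg rPtr) (h2 : c.NoArr 3)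
    (h : Emits (p :: A) τ base X c' l) : Emits A τ base X (c ;; c') l := by
  intro s pre hs hb hl
  obtain ⟨h3, h4⟩ := h _ pre (hK s hs)
    ⟨(h1.exec s).trans hb.1, fun i => by rw [h2.exec]; exact hb.2 i⟩ hl
  exact ⟨h3.tail, h4⟩

theorem emits_edge (hbase : (rBase, base) ∈ A) (hX : (rX, X) ∈ A) (hp : rPtr ∉ A.map Prod.fst)
    {e₁ e₂ e₃ : Exp} {v₁ v₂ v₃ : ℕ} (h₁ : ∀ s, Knows A τ s → e₁.eval s = v₁)
    (h₂ : ∀ s, Knows A τ s → e₂.eval s = v₂) (h₃ : ∀ s, Knows A τ s → e₃.eval s = v₃) :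
    Emits A τ base X (emitEdge e₁ e₂ e₃) [v₁, v₂, v₃] :=
  (emits_emit hbase hX hp h₁).seq ((emits_emit hbase hX hp h₂).seq (emits_emit hbase hX hp h₃))

end

end WordRAM

namespace MaxFlow.Gadget

open WordRAM

variable (P : Gadget)

/-- The words of an edge. -/
def word (e : Node × Node × ℕ) : List ℕ := [P.code e.1, P.code e.2.1, e.2.2]

theorem length_edges : P.edges.length =
    P.N₁ * (1 + P.M) + (P.N₃ * (1 + 3 * P.M) + P.N₂ * P.M) := by
  have := P.sum_edges_eq (fun _ => (1 : ℕ))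
  simp only [List.map_const', List.sum_replicate, smul_eq_mul, mul_one, Finset.sum_const,
    Finset.card_range] at this
  rw [this]
  ring

theorem _root_.MaxFlow.Instance.encode_eq (G : Instance) : G.encode =
    [G.n, G.edges.length, G.S.length, G.T.length] ++
      G.edges.flatMap (fun e => [(e.1 : ℕ), (e.2.1 : ℕ), e.2.2]) ++ G.S.map Fin.val ++
      G.T.map Fin.val := by
  simp only [Instance.encode, List.bind_eq_flatMap, List.pure_def,
    List.map_eq_flatMap, List.flatMap_singleton']

/-- The encoding of the graph as the list of words that `build` writes. -/
theorem inst_encode (h₁ : P.N₁ ≤ P.S₁) (h₂ : P.N₂ ≤ P.S₂) : (P.inst h₁ h₂).encode =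
    [P.size, P.N₁ * (1 + P.M) + (P.N₃ * (1 + 3 * P.M) + P.N₂ * P.M), P.S₁, P.S₂] ++
      (P.edges.flatMap P.word ++ ((List.range P.S₁).flatMap (fun i => [i]) ++
      (List.range P.S₂).flatMap fun i => [P.S₁ + i])) := by
  have e1 : (P.edges.map fun e => (P.node e.1, P.node e.2.1, e.2.2)).flatMap
      (fun e : Fin P.size × Fin P.size × ℕ => [(e.1 : ℕ), (e.2.1 : ℕ), e.2.2]) =
      P.edges.flatMap P.word := by
    rw [List.flatMap_map]
    refine List.flatMap_congr fun e he => ?_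
    have h := P.valid_of_mem h₁ h₂ he
    rw [P.node_val h.1, P.node_val h.2.1]
    rfl
  have e2 : ((List.range P.S₁).map fun i => P.node (.src i)).map Fin.val =
      (List.range P.S₁).flatMap (fun i => [i]) := by
    rw [List.map_map, ← List.map_eq_flatMap (f := fun i => i)]
    exact List.map_congr_left fun i hi => P.node_val (v := .src i) (List.mem_range.mp hi)
  have e3 : ((List.range P.S₂).map fun i => P.node (.snk i)).map Fin.val =
      (List.range P.S₂).flatMap (fun i => [P.S₁ + i]) := by
    rw [List.map_map, ← List.map_eq_flatMap (f := fun i => P.S₁ + i)]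
    exact List.map_congr_left fun i hi => P.node_val (v := .snk i) (List.mem_range.mp hi)
  rw [Instance.encode_eq]
  change [P.size, (P.edges.map fun e => (P.node e.1, P.node e.2.1, e.2.2)).length,
    ((List.range P.S₁).map fun i => P.node (.src i)).length,
    ((List.range P.S₂).map fun i => P.node (.snk i)).length] ++
    (P.edges.map fun e => (P.node e.1, P.node e.2.1, e.2.2)).flatMap
      (fun e : Fin P.size × Fin P.size × ℕ => [(e.1 : ℕ), (e.2.1 : ℕ), e.2.2]) ++
    ((List.range P.S₁).map fun i => P.node (.src i)).map Fin.val ++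
    ((List.range P.S₂).map fun i => P.node (.snk i)).map Fin.val = _
  rw [e1, e2, e3, List.length_map, List.length_map, List.length_map, List.length_range,
    List.length_range, P.length_edges]
  simp only [List.append_assoc]

/-- The registers that describe the graph. -/
def consts (n n₁ n₂ n₃ X base : ℕ) : List (ℕ × ℕ) :=
  [(rX, X), (rBase, base), (rNn, n), (rMm, P.M), (rn₁, n₁), (rn₂, n₂), (rn₃, n₃), (rB, P.B),
    (rN₁, P.N₁), (rN₂, P.N₂), (rN₃, P.N₃), (rS₁, P.S₁), (rS₂, P.S₂), (rSize, P.size),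
    (rO, P.S₁ + P.S₂), (rLo, n₁ + n₂), (rZero, 0)]

/-- The graph for the families of all partial assignments to `n₁`, `n₂` and `n₃` variables. -/
def ofTable (τ : ℕ → ℕ) (n n₁ n₂ n₃ e₁ e₂ M B : ℕ) : Gadget where
  N₁ := 2 ^ n₁
  N₂ := 2 ^ n₂
  N₃ := 2 ^ n₃
  S₁ := 2 ^ e₁
  S₂ := 2 ^ e₂
  M := M
  B := B
  a x c := satN τ n x 0 n₁ c
  b x c := satN τ n x n₁ n₂ c
  g x c := satN τ n x (n₁ + n₂) n₃ c

/-- `build` writes the encoding of the graph into a window that contains only zeros. -/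
theorem emits_build {τ : ℕ → ℕ} {n n₁ n₂ n₃ e₁ e₂ M B X base : ℕ}
    (hP : P = ofTable τ n n₁ n₂ n₃ e₁ e₂ M B) (h₁ : P.N₁ ≤ P.S₁) (h₂ : P.N₂ ≤ P.S₂) {s : State}
    (hs : Knows (P.consts n n₁ n₂ n₃ X base) τ s) (h0 : ∀ i, s.mem 3 (base + i) = 0)
    (hX : (P.inst h₁ h₂).encode.length ≤ X) :
    Knows (P.consts n n₁ n₂ n₃ X base) τ (build.exec s) ∧
      Buf base (build.exec s) (P.inst h₁ h₂).encode := by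
  have hb : Buf base ((Cmd.set rPtr ♮0).exec s) [] :=
    ⟨by simp [Cmd.exec, Exp.eval], fun i => by simp [Cmd.exec, h0]⟩
  have hs' : Knows (P.consts n n₁ n₂ n₃ X base) τ ((Cmd.set rPtr ♮0).exec s) :=
    hs.exec (by simp [consts, Cmd.NoReg]) trivial
  rw [inst_encode] at hX ⊢
  suffices h : Emits (P.consts n n₁ n₂ n₃ X base) τ base X writeGraph
      ([P.size, P.N₁ * (1 + P.M) + (P.N₃ * (1 + 3 * P.M) + P.N₂ * P.M), P.S₁, P.S₂] ++
      (P.edges.flatMap P.word ++ ((List.range P.S₁).flatMap (fun i => [i]) ++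
      (List.range P.S₂).flatMap fun i => [P.S₁ + i]))) from
    h _ [] hs' hb (by simpa using hX)
  have ha : ∀ x c, P.a x c = satN τ n x 0 n₁ c := fun x c => by rw [hP]; rfl
  have hbb : ∀ x c, P.b x c = satN τ n x n₁ n₂ c := fun x c => by rw [hP]; rfl
  have hg : ∀ x c, P.g x c = satN τ n x (n₁ + n₂) n₃ c := fun x c => by rw [hP]; rfl
  refine Emits.seq ?_ (Emits.seq ?_ (Emits.seq ?_ ?_))
  · refine Emits.seq (l := [_]) ?_ (Emits.seq (l := [_]) ?_ (Emits.seq (l := [_]) ?_ ?_)) <;>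
      refine emits_emit (by simp [consts]) (by simp [consts]) (by simp [consts]) fun s hs => ?_ <;>
      simp [Knows, consts] at hs <;>
      simp [Exp.eval, BinOp.eval, hs]
  · unfold edges
    rw [List.flatMap_append, List.flatMap_append, List.flatMap_assoc, List.flatMap_assoc,
      List.flatMap_assoc]
    refine Emits.seq ?_ (Emits.seq ?_ ?_)
    · refine emits_loop (by simp [consts]) (by norm_num)
        (fun s hs => by simp [Knows, consts] at hs; simp [Exp.eval, hs]) fun x hx => ?_
      rw [List.flatMap_cons, List.flatMap_map]
      refine Emits.seq ?_ (emits_loop (by simp [consts]) (by norm_num)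
        (fun s hs => by simp [Knows, consts] at hs; simp [Exp.eval, hs]) fun c hc => ?_)
      · refine emits_edge (by simp [consts]) (by simp [consts]) (by simp [consts]) ?_ ?_ ?_ <;>
          intro s hs <;> simp [Knows, consts] at hs <;>
          simp [Exp.eval, hs, code]
      · refine Emits.pre (fun s hs => hs.satCmd (by simp) (by simp) (by simp [consts])
          (by simp [consts]) (by simp [consts]; rfl) (by simp [consts]; rfl)
          (by simp [consts]; rfl) (by simp [consts]; rfl) (by simp [consts]; rfl))
          (satCmd_noReg (by norm_num) (by norm_num)) satCmd_noArr ?_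
        refine emits_edge (by simp [consts]) (by simp [consts]) (by simp [consts]) ?_ ?_ ?_ <;>
          intro s hs <;> simp [Knows, consts] at hs <;>
          simp [Exp.eval, BinOp.eval, hs, ha] <;>
          (try split_ifs) <;> simp [code]
    · refine emits_loop (by simp [consts]) (by norm_num)
        (fun s hs => by simp [Knows, consts] at hs; simp [Exp.eval, hs]) fun y hy => ?_
      rw [List.flatMap_cons, List.flatMap_assoc]
      refine Emits.seq ?_ (emits_loop (by simp [consts]) (by norm_num)
        (fun s hs => by simp [Knows, consts] at hs; simp [Exp.eval, hs]) fun c hc => ?_)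
      · refine emits_edge (by simp [consts]) (by simp [consts]) (by simp [consts]) ?_ ?_ ?_ <;>
          intro s hs <;> simp [Knows, consts] at hs <;>
          simp [Exp.eval, BinOp.eval, gateExp, Exp.add_def, Exp.mul_def, hs, code]
      · refine Emits.pre (fun s hs => hs.satCmd (by simp) (by simp) (by simp [consts])
          (by simp [consts]) (by simp [consts]; rfl) (by simp [consts]; rfl)
          (by simp [consts]; rfl) (by simp [consts]; rfl) (by simp [consts]; rfl))
          (satCmd_noReg (by norm_num) (by norm_num)) satCmd_noArr ?_
        simp only [List.flatMap_cons, List.flatMap_nil, List.append_nil]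
        refine Emits.seq ?_ (Emits.seq ?_ ?_) <;>
          refine emits_edge (by simp [consts]) (by simp [consts]) (by simp [consts]) ?_ ?_ ?_ <;>
          intro s hs <;> simp [Knows, consts] at hs <;>
          simp [Exp.eval, BinOp.eval, gateExp, cellExp, Exp.add_def, Exp.mul_def, Exp.sub_def,
            hs, hg] <;>
          (try split_ifs) <;> simp [code]
    · refine emits_loop (by simp [consts]) (by norm_num)
        (fun s hs => by simp [Knows, consts] at hs; simp [Exp.eval, hs]) fun x hx => ?_
      rw [List.flatMap_map]
      refine emits_loop (by simp [consts]) (by norm_num)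
        (fun s hs => by simp [Knows, consts] at hs; simp [Exp.eval, hs]) fun c hc => ?_
      refine Emits.pre (fun s hs => hs.satCmd (by simp) (by simp) (by simp [consts])
        (by simp [consts]) (by simp [consts]; rfl) (by simp [consts]; rfl)
        (by simp [consts]; rfl) (by simp [consts]; rfl) (by simp [consts]; rfl))
        (satCmd_noReg (by norm_num) (by norm_num)) satCmd_noArr ?_
      refine emits_edge (by simp [consts]) (by simp [consts]) (by simp [consts]) ?_ ?_ ?_ <;>
        intro s hs <;> simp [Knows, consts] at hs <;>
        simp [Exp.eval, BinOp.eval, hs, hbb] <;>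
        (try split_ifs) <;> simp [code]
  · refine emits_loop (by simp [consts]) (by norm_num)
      (fun s hs => by simp [Knows, consts] at hs; simp [Exp.eval, hs]) fun x hx => ?_
    refine emits_emit (by simp [consts]) (by simp [consts]) (by simp [consts]) fun s hs => ?_
    simp [Knows, consts] at hs
    simp [Exp.eval, hs]
  · refine emits_loop (by simp [consts]) (by norm_num)
      (fun s hs => by simp [Knows, consts] at hs; simp [Exp.eval, hs]) fun x hx => ?_
    refine emits_emit (by simp [consts]) (by simp [consts]) (by simp [consts]) fun s hs => ?_
    simp [Knows, consts] at hs
    simp [Exp.eval, BinOp.eval, hs]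

end MaxFlow.Gadget

namespace WordRAM

/-! ### Reading the formula -/

/-- The prologue computes the bit length `L` of the number of clauses; the upper bound for `2 ^ L`
keeps the sizes that depend on `L` linear in this number. -/
theorem prologue_spec (s : State) (h0 : s.reg rL = 0) : ∃ L : ℕ, s.mem 0 1 < 2 ^ L ∧
    2 ^ L ≤ 2 * s.mem 0 1 + 1 ∧ (prologue.exec s).reg rNn = s.mem 0 0 ∧
    (prologue.exec s).reg rMm = s.mem 0 1 ∧ (prologue.exec s).reg rL = L := by
  set M := s.mem 0 1 with hM
  set u := (s.setReg rNn (s.mem 0 0)).setReg rMm M with hu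
  have key := forIter_inv (g := fun i s => (Cmd.ite (‡rMm >>> ‡rI)
      (.set rL (.min (‡rI + ♮1) ‡rMm)) .skip).exec (s.setReg rI i)) (k := M) (s := u)
    (fun k v => v.reg rNn = s.mem 0 0 ∧ v.reg rMm = M ∧
      v.reg rL ≤ k ∧ (v.reg rL = 0 ∨ 2 ^ (v.reg rL) ≤ 2 * M) ∧ (2 ^ k ≤ M → k = v.reg rL) ∧
      (M < 2 ^ k → M < 2 ^ v.reg rL))
    ⟨by simp [hu], by simp [hu],
      by simp [hu, h0], by simp [hu, h0],
      by simp [hu, h0], by simp [hu, h0]⟩ (by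
      rintro i hi v ⟨h1, h2, h3, h4, h5, h6⟩
      have hsh : M >>> i ≠ 0 ↔ 2 ^ i ≤ M := by
        rw [Nat.shiftRight_eq_div_pow, ne_eq, Nat.div_eq_zero_iff]
        have : 0 < 2 ^ i := by positivity
        omega
      have hp : 2 ^ (i + 1) = 2 * 2 ^ i := by ring
      simp only [Cmd.exec, Exp.eval, Exp.shr_def, BinOp.eval, State.setReg_reg]
      simp only [show (rMm : ℕ) = rI ↔ False by norm_num, h2, if_false, if_true]
      by_cases hc : 2 ^ i ≤ M
      · rw [if_pos (hsh.mpr hc)]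
        have hmin : min (i + 1) M = i + 1 := by omega
        simp only [State.setReg_reg, hmin]
        refine ⟨by simpa using h1, by simpa using h2, by simp, by simp; omega, by simp, by simp⟩
      · rw [if_neg (fun h => hc (hsh.mp h))]
        simp only [State.setReg_reg]
        refine ⟨by simpa using h1, by simpa using h2, by simp; omega, by simpa using h4, ?_, ?_⟩
        · intro h; simp; omega
        · intro _; simpa using h6 (by omega))
  have hM' : M < 2 ^ M := Nat.lt_two_pow_self
  have hev : prologue.exec s = forIter (fun i s => (Cmd.ite (‡rMm >>> ‡rI)
      (.set rL (.min (‡rI + ♮1) ‡rMm)) .skip).exec (s.setReg rI i)) M u := by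
    simp [prologue, Cmd.exec, Exp.eval, hu, hM]
  rw [hev]
  obtain ⟨k1, k2, -, k4, -, k6⟩ := key
  refine ⟨_, k6 hM', ?_, k1, k2, rfl⟩
  rcases k4 with h | h
  · rw [h]; simp
  · omega

theorem getD_flatMap_take {α : Type*} (p : List ℕ) (f : α → List ℕ) (l : List α) {c i : ℕ}
    (hc : c < l.length) (hi : i < (f l[c]).length) :
    (p ++ l.flatMap f).getD (p.length + ((l.take c).flatMap f).length + i) 0 =
      (f l[c]).getD i 0 := by
  have hl : l.flatMap f = (l.take c).flatMap f ++ (f l[c] ++ (l.drop (c + 1)).flatMap f) := by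
    conv_lhs => rw [← List.take_append_drop c l, List.drop_eq_getElem_cons hc]
    rw [List.flatMap_append, List.flatMap_cons]
  rw [hl, ← List.append_assoc, ← List.length_append, List.getD_append_right _ _ _ _ (by omega),
    Nat.add_sub_cancel_left, List.getD_append _ _ _ _ hi]

/-- Reading a formula whose clauses are given as lists of literals below `2 n`, each preceded by
its length, fills the table of occurrences. -/
theorem parse_spec {n X : ℕ} {K : List (List ℕ)} {p : List ℕ} (hp : p.length = 2)
    (hK : ∀ c ∈ K, c.length ≤ 2 * n)
    {s : State} (hn : s.reg rNn = n) (hM : s.reg rMm = K.length) (hX : s.reg rX = X)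
    (h0 : ∀ i, s.mem 0 i = (p ++ K.flatMap fun c => c.length :: c).getD i 0)
    (hl : (p ++ K.flatMap fun c => c.length :: c).length ≤ X) (h2 : ∀ i, s.mem 2 i = 0) (i : ℕ) :
    (parse.exec s).mem 2 i ≠ 0 ↔ ∃ c, ∃ h : c < K.length, ∃ l ∈ K[c], i = c * (2 * n) + l := by
  set W : List ℕ → List ℕ := fun c => c.length :: c with hW
  have hnoX : parse.NoReg rX := by simp [parse, Cmd.NoReg]
  set u := s.setReg rPos 2 with hu
  set body : Cmd := .set rLen (.idx 0 ‡rPos) ;; .set rPos (.min (‡rPos + ♮1) ‡rX) ;;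
    .loopFor rJ (♮2 * ‡rNn) (.ite (‡rLen - ‡rJ)
      (.put 2 (‡rC * (♮2 * ‡rNn) + .idx 0 ‡rPos) ♮1 ;; .set rPos (.min (‡rPos + ♮1) ‡rX))
      .skip) with hbody
  have hlen : ∀ k ≤ K.length, p.length + ((K.take k).flatMap W).length ≤ X := by
    intro k hk
    have : K.flatMap W = (K.take k).flatMap W ++ (K.drop k).flatMap W := by
      rw [← List.flatMap_append, List.take_append_drop]
    rw [this] at hl
    simp only [List.length_append] at hl
    omega
  have key := forIter_inv (g := fun i s => body.exec (s.setReg rC i)) (k := K.length) (s := u)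
    (fun k v => v.reg rNn = n ∧ v.reg rX = X ∧ v.mem 0 = s.mem 0 ∧
      v.reg rPos = p.length + ((K.take k).flatMap W).length ∧
      ∀ i, v.mem 2 i ≠ 0 ↔ ∃ c, ∃ h : c < K.length, c < k ∧ ∃ l ∈ K[c], i = c * (2 * n) + l)
    ⟨by simp [hu, hn], by simp [hu, hX], rfl,
      by simp [hu, hp], by simp [hu, h2]⟩ (by
      rintro k hk v ⟨v1, v2, v3, v4, v5⟩
      have hlen' := hlen (k + 1) hk
      have htake : (K.take (k + 1)).flatMap W = (K.take k).flatMap W ++ W K[k] := by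
        rw [List.take_add_one, List.flatMap_append, List.getElem?_eq_getElem hk]
        simp
      rw [htake, List.length_append] at hlen'
      have hWl : (W K[k]).length = K[k].length + 1 := by simp [hW]
      have hread : ∀ i < (W K[k]).length, s.mem 0 (p.length + ((K.take k).flatMap W).length + i) =
          (W K[k]).getD i 0 := fun i hi => by
        rw [h0]; exact getD_flatMap_take p W K hk hi
      set q := p.length + ((K.take k).flatMap W).length with hq
      set v' := ((v.setReg rC k).setReg rLen K[k].length).setReg rPos (q + 1) with hv'
      have hm0 : s.mem 0 q = K[k].length := by simpa [hW] using hread 0 (by omega)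
      have e1 : body.exec (v.setReg rC k) = (Cmd.loopFor rJ (♮2 * ‡rNn) (.ite (‡rLen - ‡rJ)
          (.put 2 (‡rC * (♮2 * ‡rNn) + .idx 0 ‡rPos) ♮1 ;; .set rPos (.min (‡rPos + ♮1) ‡rX))
          .skip)).exec v' := by
        have hmin : min (q + 1) X = q + 1 := by omega
        simp [hbody, Cmd.exec, Exp.eval, Exp.add_def, BinOp.eval, hv', hmin, hm0, v2, v3, v4]
      have key2 := forIter_inv (g := fun i s => (Cmd.ite (‡rLen - ‡rJ)
          (.put 2 (‡rC * (♮2 * ‡rNn) + .idx 0 ‡rPos) ♮1 ;; .set rPos (.min (‡rPos + ♮1) ‡rX))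
          .skip).exec (s.setReg rJ i)) (k := 2 * n) (s := v')
        (fun j z => z.reg rNn = n ∧ z.reg rX = X ∧ z.mem 0 = s.mem 0 ∧ z.reg rC = k ∧
          z.reg rLen = K[k].length ∧ z.reg rPos = q + 1 + min j K[k].length ∧
          ∀ i, z.mem 2 i ≠ 0 ↔ (∃ c, ∃ h : c < K.length, c < k ∧ ∃ l ∈ K[c], i = c * (2 * n) + l) ∨
            ∃ l ∈ K[k].take j, i = k * (2 * n) + l)
        ⟨by simp [hv', v1], by simp [hv', v2],
          by simp [hv', v3], by simp [hv'], by simp [hv'],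
          by simp [hv'], by intro i; simp only [hv', State.setReg_mem, v5]; simp⟩ (by
          rintro j hj z ⟨z1, z2, z3, z4, z5, z6, z7⟩
          have hev : (‡rLen - ‡rJ : Exp).eval (z.setReg rJ j) = K[k].length - j := by
            simp [Exp.eval, Exp.sub_def, BinOp.eval, z5]
          by_cases hjl : j < K[k].length
          · have hr : s.mem 0 (q + 1 + j) = K[k][j] := by
              have := hread (j + 1) (by omega)
              rw [show q + (j + 1) = q + 1 + j by omega] at this
              rw [this]
              simp [hW, hjl]
            have hmin : min (q + 1 + j + 1) X = q + 1 + j + 1 := by omega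
            have hmj : min j K[k].length = j := by omega
            rw [hmj] at z6
            have e4 : (Cmd.ite (‡rLen - ‡rJ) (.put 2 (‡rC * (♮2 * ‡rNn) + .idx 0 ‡rPos) ♮1 ;;
                .set rPos (.min (‡rPos + ♮1) ‡rX)) .skip).exec (z.setReg rJ j) =
                ((z.setReg rJ j).setMem 2 (k * (2 * n) + K[k][j]) 1).setReg rPos
                  (q + 1 + j + 1) := by
              simp only [Cmd.exec, hev]
              rw [if_pos (by omega)]
              simp [Exp.eval, BinOp.eval, z1, z2, z3, z4, z6, hr, hmin]
            rw [e4]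
            refine ⟨by simpa using z1, by simpa using z2, ?_, by simpa using z4, by simpa using z5,
              by simp; omega, fun i => ?_⟩
            · funext i; simp [State.setMem_mem, z3]
            · have htk : K[k].take (j + 1) = K[k].take j ++ [K[k][j]] := by
                rw [List.take_add_one, List.getElem?_eq_getElem hjl]; simp
              simp only [State.setReg_mem, State.setMem_mem, true_and, htk, List.mem_append,
                List.mem_singleton]
              split_ifs with hi
              · exact ⟨fun _ => Or.inr ⟨_, Or.inr rfl, hi⟩, fun _ => by norm_num⟩
              · rw [z7 i]
                refine or_congr Iff.rfl ⟨fun ⟨l, h1, h2⟩ => ⟨l, Or.inl h1, h2⟩, ?_⟩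
                rintro ⟨l, h1 | rfl, h2⟩
                exacts [⟨l, h1, h2⟩, absurd h2 hi]
          · simp only [Cmd.exec, hev]
            rw [if_neg (by omega)]
            have hmj : min (j + 1) K[k].length = min j K[k].length := by omega
            have htk : K[k].take (j + 1) = K[k].take j := by
              rw [List.take_of_length_le (by omega), List.take_of_length_le (by omega)]
            rw [hmj, htk]
            exact ⟨by simpa using z1, by simpa using z2, z3, by simpa using z4, by simpa using z5,
              by simpa using z6, z7⟩)
      have e2 : (♮2 * ‡rNn : Exp).eval v' = 2 * n := by
        simp [Exp.eval, BinOp.eval, hv', v1]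
      have e3 : body.exec (v.setReg rC k) = forIter (fun i s => (Cmd.ite (‡rLen - ‡rJ)
          (.put 2 (‡rC * (♮2 * ‡rNn) + .idx 0 ‡rPos) ♮1 ;; .set rPos (.min (‡rPos + ♮1) ‡rX))
          .skip).exec (s.setReg rJ i)) (2 * n) v' := by
        rw [e1, ← e2]; rfl
      rw [e3]
      obtain ⟨z1, z2, z3, -, -, z6, z7⟩ := key2
      have hKk := hK _ (List.getElem_mem hk)
      refine ⟨z1, z2, z3, ?_, fun i => ?_⟩
      · rw [z6, htake, List.length_append]; omega
      · rw [z7 i, List.take_of_length_le hKk]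
        constructor
        · rintro (⟨c, h, hc, h'⟩ | h')
          · exact ⟨c, h, by omega, h'⟩
          · exact ⟨k, hk, by omega, h'⟩
        · rintro ⟨c, h, hc, h'⟩
          rcases Nat.lt_succ_iff_lt_or_eq.mp hc with h1 | rfl
          exacts [Or.inl ⟨c, h, h1, h'⟩, Or.inr h'])
  have hev : parse.exec s = forIter (fun i s => body.exec (s.setReg rC i)) K.length u := by
    have : (Exp.var rMm).eval u = K.length := by simp [Exp.eval, hu, hM]
    rw [← this]; rfl
  rw [hev, key.2.2.2.2]
  exact ⟨fun ⟨c, h, _, h'⟩ => ⟨c, h, h'⟩, fun ⟨c, h, h'⟩ => ⟨c, h, h, h'⟩⟩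

end WordRAM

namespace SAT

open WordRAM Finset

/-! ### Assignments and their parts -/

/-- The clauses as lists of words. -/
def CNF.words (F : CNF) : List (List ℕ) :=
  F.clauses.map fun c => c.map fun l => 2 * (l.1 : ℕ) + l.2.toNat

theorem CNF.length_words (F : CNF) : F.words.length = F.clauses.length := List.length_map _

theorem CNF.encode_eq (F : CNF) : F.encode =
    [F.n, F.clauses.length] ++ F.words.flatMap fun c => c.length :: c := by
  simp [CNF.encode, CNF.words, List.flatMap_map]

theorem CNF.words_length_le (F : CNF) : ∀ c ∈ F.words, c.length ≤ 2 * F.n := by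
  intro c hc
  obtain ⟨d, hd, rfl⟩ := List.mem_map.mp hc
  rw [List.length_map]
  have := (F.clause_nodup d hd).length_le_card
  simpa [mul_comm] using this

theorem CNF.words_lt (F : CNF) : ∀ c ∈ F.words, ∀ l ∈ c, l < 2 * F.n := by
  intro c hc l hl
  obtain ⟨d, hd, rfl⟩ := List.mem_map.mp hc
  obtain ⟨x, hx, rfl⟩ := List.mem_map.mp hl
  have h1 := x.1.2
  have h2 := Bool.toNat_lt x.2
  omega

/-- `τ` is the table of occurrences of the literals of `F`. -/
def CNF.IsTable (F : CNF) (τ : ℕ → ℕ) : Prop :=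
  ∀ i, τ i ≠ 0 ↔ ∃ c, ∃ h : c < F.words.length, ∃ l ∈ F.words[c], i = c * (2 * F.n) + l

/-- The position of a literal in the table determines the clause, the variable and the sign. -/
theorem CNF.IsTable.iff {F : CNF} {τ : ℕ → ℕ} (h : F.IsTable τ) {c v : ℕ}
    (hc : c < F.clauses.length) (hv : v < F.n) (b : Bool) :
    τ (c * (2 * F.n) + (2 * v + b.toNat)) ≠ 0 ↔ ((⟨v, hv⟩, b) : Fin F.n × Bool) ∈ F.clauses[c] := by
  rw [h]
  have hb := Bool.toNat_lt b
  constructor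
  · rintro ⟨d, hd, l, hl, he⟩
    have hl2 := F.words_lt _ (List.getElem_mem hd) l hl
    have hcd : c = d := by
      have e1 : (c * (2 * F.n) + (2 * v + b.toNat)) / (2 * F.n) = c := by
        rw [mul_comm, Nat.mul_add_div (by omega), Nat.div_eq_of_lt (by omega), add_zero]
      have e2 : (d * (2 * F.n) + l) / (2 * F.n) = d := by
        rw [mul_comm, Nat.mul_add_div (by omega), Nat.div_eq_of_lt (by omega), add_zero]
      rw [← e1, he, e2]
    subst hcd
    simp only [CNF.words, List.getElem_map, List.mem_map] at hl
    obtain ⟨x, hx, rfl⟩ := hl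
    have hb' := Bool.toNat_lt x.2
    have h1 : x.1 = ⟨v, hv⟩ := Fin.ext (by simp only; omega)
    have h2 : x.2 = b := by
      have : x.2.toNat = b.toNat := by omega
      cases hx2 : x.2 <;> cases b <;> simp_all
    rw [← h1, ← h2]
    exact hx
  · intro hx
    refine ⟨c, by rwa [F.length_words], 2 * v + b.toNat, ?_, rfl⟩
    simp only [CNF.words, List.getElem_map]
    exact List.mem_map.mpr ⟨_, hx, rfl⟩

theorem CNF.IsTable.satN_iff {F : CNF} {τ : ℕ → ℕ} (h : F.IsTable τ) {c lo len x : ℕ}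
    (hc : c < F.clauses.length) (hlo : lo + len ≤ F.n) :
    satN τ F.n x lo len c = true ↔ ∃ l ∈ F.clauses[c], lo ≤ (l.1 : ℕ) ∧ (l.1 : ℕ) < lo + len ∧
      l.2 = x.testBit (l.1 - lo) := by
  have hbit : ∀ i, (x >>> i) &&& 1 = (x.testBit i).toNat := fun i => by
    rw [Nat.and_one_is_mod, Nat.toNat_testBit, Nat.shiftRight_eq_div_pow]
  rw [satN, decide_eq_true_iff]
  constructor
  · rintro ⟨i, hi, hne⟩
    rw [hbit, h.iff hc (by omega)] at hne
    exact ⟨_, hne, by simp, by simpa using hi, by simp⟩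
  · rintro ⟨⟨v, b⟩, hl, h1, h2, h3⟩
    simp only at h1 h2 h3
    refine ⟨v - lo, by omega, ?_⟩
    rw [hbit, show lo + (v - lo) = v by omega, ← h3, h.iff hc v.2]
    exact hl

/-- The assignment with three given parts. -/
def CNF.join (F : CNF) (n₁ n₂ x y z : ℕ) : Fin F.n → Bool := fun v =>
  if (v : ℕ) < n₁ then x.testBit v else if (v : ℕ) < n₁ + n₂ then y.testBit (v - n₁)
  else z.testBit (v - (n₁ + n₂))

/-- Every assignment is composed of three partial assignments, coded by the binary digits of
numbers. -/
theorem CNF.exists_join (F : CNF) {n₁ n₂ n₃ : ℕ} (hn : n₁ + n₂ + n₃ = F.n) (a : Fin F.n → Bool) :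
    ∃ x < 2 ^ n₁, ∃ y < 2 ^ n₂, ∃ z < 2 ^ n₃, F.join n₁ n₂ x y z = a := by
  refine ⟨Nat.ofBits fun i : Fin n₁ => a ⟨i, by omega⟩, Nat.ofBits_lt_two_pow _,
    Nat.ofBits fun i : Fin n₂ => a ⟨n₁ + i, by omega⟩, Nat.ofBits_lt_two_pow _,
    Nat.ofBits fun i : Fin n₃ => a ⟨n₁ + n₂ + i, by omega⟩, Nat.ofBits_lt_two_pow _, ?_⟩
  funext v
  have hv := v.2
  unfold CNF.join
  split_ifs with h1 h2
  · rw [Nat.testBit_ofBits_lt _ _ h1]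
  · rw [Nat.testBit_ofBits_lt _ _ (by omega)]
    congr 1; ext; simp only; omega
  · rw [Nat.testBit_ofBits_lt _ _ (by omega)]
    congr 1; ext; simp only; omega

/-- An assignment satisfies a clause if and only if one of its three parts does. -/
theorem CNF.IsTable.satisfies_join {F : CNF} {τ : ℕ → ℕ} (h : F.IsTable τ) {c n₁ n₂ n₃ : ℕ}
    (hn : n₁ + n₂ + n₃ = F.n) (hc : c < F.clauses.length) (x y z : ℕ) :
    SatisfiesClause (F.join n₁ n₂ x y z) F.clauses[c] ↔ satN τ F.n x 0 n₁ c = true ∨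
      satN τ F.n y n₁ n₂ c = true ∨ satN τ F.n z (n₁ + n₂) n₃ c = true := by
  rw [h.satN_iff hc (by omega), h.satN_iff hc (by omega), h.satN_iff hc (by omega), SatisfiesClause]
  constructor
  · rintro ⟨l, hl, hs⟩
    have hv := l.1.2
    unfold CNF.join at hs
    split_ifs at hs with h1 h2
    · exact Or.inl ⟨l, hl, by omega, by omega, by simpa using hs.symm⟩
    · exact Or.inr (Or.inl ⟨l, hl, by omega, by omega, hs.symm⟩)
    · exact Or.inr (Or.inr ⟨l, hl, by omega, by omega, hs.symm⟩)
  · rintro (⟨l, hl, h1, h2, h3⟩ | ⟨l, hl, h1, h2, h3⟩ | ⟨l, hl, h1, h2, h3⟩) <;>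
      refine ⟨l, hl, ?_⟩ <;> unfold CNF.join
    · rw [if_pos (by omega), h3]; simp
    · rw [if_neg (by omega), if_pos (by omega), h3]
    · rw [if_neg (by omega), if_neg (by omega), h3]

theorem countP_eq_count {α : Type*} (l : List α) (p : α → Bool) (q : ℕ → Prop) [DecidablePred q]
    (h : ∀ c (hc : c < l.length), p l[c] = true ↔ q c) : l.countP p = Nat.count q l.length := by
  induction l using List.reverseRecOn with
  | nil => simp
  | append_singleton l a ih =>
    rw [List.countP_append, ih fun c hc => by
      rw [← h c (by simp; omega), List.getElem_append_left hc]]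
    have := h l.length (by simp)
    rw [List.getElem_append_right le_rfl] at this
    simp only [Nat.sub_self, List.getElem_cons_zero] at this
    simp only [List.length_append, List.length_singleton, Nat.count_succ, ← this, List.countP_cons,
      List.countP_nil, zero_add]

/-- The number of clauses that a triple of partial assignments satisfies. -/
def satCount (τ : ℕ → ℕ) (n M n₁ n₂ n₃ x y z : ℕ) : ℕ :=
  Nat.count (fun c => satN τ n x 0 n₁ c = true ∨ satN τ n y n₁ n₂ c = true ∨
    satN τ n z (n₁ + n₂) n₃ c = true) M

theorem CNF.IsTable.numSatisfied_join {F : CNF} {τ : ℕ → ℕ} (h : F.IsTable τ) {n₁ n₂ n₃ : ℕ}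
    (hn : n₁ + n₂ + n₃ = F.n) (x y z : ℕ) : F.numSatisfied (F.join n₁ n₂ x y z) =
      satCount τ F.n F.clauses.length n₁ n₂ n₃ x y z := by
  classical
  refine countP_eq_count _ _ _ fun c hc => ?_
  rw [← h.satisfies_join hn hc, decide_eq_true_iff]

theorem satCount_add_unsat (P : MaxFlow.Gadget) {τ : ℕ → ℕ} {n n₁ n₂ n₃ e₁ e₂ M B : ℕ}
    (hP : P = .ofTable τ n n₁ n₂ n₃ e₁ e₂ M B) (x y z : ℕ) :
    satCount τ n M n₁ n₂ n₃ x y z + #(P.unsat x y z) = M := by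
  have hu : P.unsat x y z = {c ∈ range M | satN τ n x 0 n₁ c = false ∧ satN τ n y n₁ n₂ c = false ∧
      satN τ n z (n₁ + n₂) n₃ c = false} := by rw [hP]; rfl
  rw [hu, satCount, Nat.count_eq_card_filter_range]
  conv_rhs => rw [← card_range M, ← card_filter_add_card_filter_not (s := range M)
    (fun c => satN τ n x 0 n₁ c = true ∨ satN τ n y n₁ n₂ c = true ∨
      satN τ n z (n₁ + n₂) n₃ c = true)]
  congr 2
  ext c
  simp

end SAT

namespace MaxFlow.Gadget

open WordRAM Finset

/-! ### Looking for a good pair and completing it -/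

/-- Whether the reported flow for a pair differs from the value of the trivial cut; `μ` holds the
reported values from `base` on. -/
def Bad (P : Gadget) (μ : ℕ → ℕ) (base u v : ℕ) : Prop :=
  μ (base + (u * P.S₂ + v)) ≠ P.N₃ * (P.cnt u v + P.B)

theorem search_noReg {r : ℕ} (h : r ∉ [rCand, rU, rV, rCnt, rC, rFl, rI, rFl₂, rCa, rCb]) :
    search.NoReg r := by
  simp only [List.mem_cons, List.not_mem_nil, or_false, not_or] at h
  simp [search, satCmd, Cmd.NoReg, h]

theorem search_noArr {a : ℕ} : search.NoArr a := by simp [search, satCmd, Cmd.NoArr]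

theorem verify_noReg {r : ℕ} (h : r ∉ [rY, rCnt, rC, rFl, rI, rFl₂, rFl₃, rBest]) :
    verify.NoReg r := by
  simp only [List.mem_cons, List.not_mem_nil, or_false, not_or] at h
  simp [verify, satCmd, Cmd.NoReg, h]

theorem verify_noArr {a : ℕ} : verify.NoArr a := by simp [verify, satCmd, Cmd.NoArr]

/-- `search` returns a pair whose reported flow differs from the value of the trivial cut, if there
is one. Nothing is assumed about the reported values. -/
theorem search_spec (P : Gadget) {τ : ℕ → ℕ} {n n₁ n₂ n₃ e₁ e₂ M B X base : ℕ}
    (hP : P = ofTable τ n n₁ n₂ n₃ e₁ e₂ M B) {s : State}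
    (hs : Knows (P.consts n n₁ n₂ n₃ X base) τ s) :
    ((search.exec s).reg rCand ≠ 0 → (search.exec s).reg rCa < P.N₁ ∧
      (search.exec s).reg rCb < P.N₂ ∧
      P.Bad (s.mem 4) base ((search.exec s).reg rCa) ((search.exec s).reg rCb)) ∧
    ((search.exec s).reg rCand = 0 → ∀ u < P.N₁, ∀ v < P.N₂, ¬ P.Bad (s.mem 4) base u v) := by
  set A := P.consts n n₁ n₂ n₃ X base with hA
  set μ := s.mem 4 with hμ
  -- the invariant for a predicate that holds for the pairs that have been inspected
  set I : (ℕ → ℕ → Prop) → State → Prop := fun D s => s.mem 4 = μ ∧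
    (s.reg rCand ≠ 0 → s.reg rCa < P.N₁ ∧ s.reg rCb < P.N₂ ∧
      P.Bad μ base (s.reg rCa) (s.reg rCb)) ∧
    (s.reg rCand = 0 → ∀ u v, D u v → ¬ P.Bad μ base u v) with hI
  have hIreg : ∀ (D s s'), I D s → s'.mem 4 = s.mem 4 → s'.reg rCand = s.reg rCand →
      s'.reg rCa = s.reg rCa → s'.reg rCb = s.reg rCb → I D s' := by
    intro D s s' h h1 h2 h3 h4
    simp only [hI, h1, h2, h3, h4]
    exact h
  set body : Cmd := satCmd rFl rU rZero rn₁ ;; satCmd rFl₂ rV rn₁ rn₂ ;;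
      .set rCnt (.min (‡rCnt + ‡rFl * (♮1 - ‡rFl₂)) ‡rMm) with hbody
  set e : Exp := (.idx 4 (‡rBase + (‡rU * ‡rS₂ + ‡rV)) - ‡rN₃ * (‡rCnt + ‡rB)) +
        (‡rN₃ * (‡rCnt + ‡rB) - .idx 4 (‡rBase + (‡rU * ‡rS₂ + ‡rV))) with he
  -- counting the clauses that only the first part satisfies
  have count : ∀ u v s, Knows ((rV, v) :: (rU, u) :: A) τ s → ∀ D, I D s →
      Knows ((rV, v) :: (rU, u) :: A) τ ((Cmd.set rCnt ♮0 ;; .loopFor rC ‡rMm body).exec s) ∧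
      I D ((Cmd.set rCnt ♮0 ;; .loopFor rC ‡rMm body).exec s) ∧
      ((Cmd.set rCnt ♮0 ;; .loopFor rC ‡rMm body).exec s).reg rCnt = P.cnt u v := by
    intro u v s hk D hD
    have hkn : Knows ((rV, v) :: (rU, u) :: A) τ
        ((Cmd.set rCnt ♮0 ;; .loopFor rC ‡rMm body).exec s) :=
      hk.exec (by simp [hA, consts, Cmd.NoReg, hbody, satCmd])
        (by simp [Cmd.NoArr, hbody, satCmd])
    refine ⟨hkn, ?_, ?_⟩
    · refine hIreg D s _ hD ?_ ?_ ?_ ?_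
      · exact Cmd.NoArr.exec (by simp [Cmd.NoArr, hbody, satCmd]) s
      all_goals exact Cmd.NoReg.exec (by simp [Cmd.NoReg, hbody, satCmd]) s
    · have key := forIter_inv (g := fun i s => body.exec (s.setReg rC i)) (k := P.M)
        (s := s.setReg rCnt 0) (fun k z => Knows ((rV, v) :: (rU, u) :: A) τ z ∧
          z.reg rCnt = Nat.count (fun c => P.a u c = true ∧ P.b v c = false) k)
        ⟨(hk.setReg (x := rCnt) (by simp [hA, consts]) 0).tail, by simp⟩ (by
          rintro c hc z ⟨z1, z2⟩
          have z3 := z1.setReg (x := rC) (by simp [hA, consts]) c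
          have z4 := z3.satCmd (out := rFl) (x := rU) (lo := rZero) (len := rn₁) (by simp)
            (by simp) (by simp [hA, consts]) (by simp [hA, consts])
            (by simp [hA, consts]; rfl) (by simp [hA, consts]; rfl) (by simp [hA, consts]; rfl)
            (by simp [hA, consts]; rfl) (by simp [hA, consts]; rfl)
          have z5 := z4.satCmd (out := rFl₂) (x := rV) (lo := rn₁) (len := rn₂) (by simp)
            (by simp) (by simp [hA, consts]) (by simp [hA, consts])
            (by simp [hA, consts]; rfl) (by simp [hA, consts]; rfl) (by simp [hA, consts]; rfl)
            (by simp [hA, consts]; rfl) (by simp [hA, consts]; rfl)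
          have z6 : ((satCmd rFl₂ rV rn₁ rn₂).exec ((satCmd rFl rU rZero rn₁).exec
              (z.setReg rC c))).reg rCnt = z.reg rCnt := by
            rw [(satCmd_noReg (by norm_num) (by norm_num)).exec,
              (satCmd_noReg (by norm_num) (by norm_num)).exec, State.setReg_reg_ne _ (by norm_num)]
          have hle : Nat.count (fun c => P.a u c = true ∧ P.b v c = false) (c + 1) ≤ P.M :=
            (Nat.count_le _).trans hc
          refine ⟨(z5.setReg (x := rCnt) (by simp [hA, consts]) _).tail.tail.tail.tail, ?_⟩
          simp only [hbody, Cmd.exec, State.setReg_reg_self]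
          rw [Nat.count_succ] at hle ⊢
          have f1 := z5.get List.mem_cons_self
          have f2 := z5.get (List.mem_cons_of_mem _ List.mem_cons_self)
          have f3 := z5.get (r := rMm) (by simp [hA, consts]; rfl)
          have ha : P.a u c = satN τ n u 0 n₁ c := by rw [hP]; rfl
          have hb : P.b v c = satN τ n v n₁ n₂ c := by rw [hP]; rfl
          simp only [Exp.eval, Exp.sub_def, BinOp.eval, f1, f2, f3, z6,
            z2, ha, hb] at hle ⊢
          cases h1 : satN τ n u 0 n₁ c <;> cases h2 : satN τ n v n₁ n₂ c <;>
            simp [h1, h2] at hle ⊢ <;> omega)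
      have hev : (Cmd.set rCnt ♮0 ;; .loopFor rC ‡rMm body).exec s =
          forIter (fun i s => body.exec (s.setReg rC i)) P.M (s.setReg rCnt 0) := by
        have : (Exp.var rMm).eval (s.setReg rCnt 0) = P.M := by
          simp [Exp.eval, hk.get (r := rMm) (v := P.M) (by simp [hA, consts])]
        rw [← this]; rfl
      rw [hev, key.2, Nat.count_eq_card_filter_range]
      rfl
  -- after a pair has been inspected, the invariant holds for it as well
  set inner : Cmd := (Cmd.set rCnt ♮0 ;; .loopFor rC ‡rMm body) ;;
    .ite e (.set rCand ♮1 ;; .set rCa ‡rU ;; .set rCb ‡rV) .skip with hinner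
  have pair : ∀ u v s, u < P.N₁ → v < P.N₂ → Knows ((rV, v) :: (rU, u) :: A) τ s → ∀ D, I D s →
      Knows ((rV, v) :: (rU, u) :: A) τ (inner.exec s) ∧
      I (fun u' v' => D u' v' ∨ u' = u ∧ v' = v) (inner.exec s) := by
    intro u v s hu hv hk D hD
    refine ⟨hk.exec (by simp [hA, consts, Cmd.NoReg, hinner, hbody, satCmd])
        (by simp [Cmd.NoArr, hinner, hbody, satCmd]), ?_⟩
    obtain ⟨h1, h2, h3⟩ := count u v s hk D hD
    set z := (Cmd.set rCnt ♮0 ;; .loopFor rC ‡rMm body).exec s with hz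
    have hev : e.eval z ≠ 0 ↔ P.Bad μ base u v := by
      have g1 := h1.get (r := rBase) (v := base) (by simp [hA, consts])
      have g2 := h1.get (r := rU) (v := u) (by simp)
      have g3 := h1.get (r := rV) (v := v) (by simp)
      have g4 := h1.get (r := rS₂) (v := P.S₂) (by simp [hA, consts])
      have g5 := h1.get (r := rN₃) (v := P.N₃) (by simp [hA, consts])
      have g6 := h1.get (r := rB) (v := P.B) (by simp [hA, consts])
      simp only [he, Exp.eval, Exp.add_def, Exp.mul_def, Exp.sub_def, BinOp.eval, g1, g2, g3, g4,
        g5, g6, h3, h2.1, Bad]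
      omega
    have hex : inner.exec s = if e.eval z ≠ 0 then
        ((Cmd.set rCand ♮1 ;; .set rCa ‡rU ;; .set rCb ‡rV) : Cmd).exec z else z := rfl
    rw [hex]
    by_cases hb : P.Bad μ base u v
    · rw [if_pos (hev.mpr hb)]
      have g2 := h1.get (r := rU) (v := u) (by simp)
      have g3 := h1.get (r := rV) (v := v) (by simp)
      simp [hI, Cmd.exec, Exp.eval, g2, g3, h2.1, hu, hv, hb]
    · rw [if_neg fun h => hb (hev.mp h)]
      refine ⟨h2.1, h2.2.1, fun h0 u' v' hd => ?_⟩
      rcases hd with hd | ⟨rfl, rfl⟩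
      exacts [h2.2.2 h0 _ _ hd, hb]
  have hV : ∀ s : State, Knows A τ s → (Exp.var rN₂).eval s = P.N₂ := fun s h =>
    h.get (by simp [hA, consts])
  -- the same for all pairs with first member `u`
  have row : ∀ u s, u < P.N₁ → Knows ((rU, u) :: A) τ s → ∀ D, I D s →
      Knows ((rU, u) :: A) τ ((Cmd.loopFor rV ‡rN₂ inner).exec s) ∧
      I (fun u' v' => D u' v' ∨ u' = u ∧ v' < P.N₂) ((Cmd.loopFor rV ‡rN₂ inner).exec s) := by
    intro u s hu hk D hD
    simp only [Cmd.exec]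
    rw [hV s hk.tail]
    refine forIter_inv (fun k z => Knows ((rU, u) :: A) τ z ∧
      I (fun u' v' => D u' v' ∨ u' = u ∧ v' < k) z) ⟨hk, by simpa using hD⟩ ?_
    rintro v hv z ⟨z1, z2⟩
    obtain ⟨z3, z4⟩ := pair u v _ hu hv (z1.setReg (x := rV) (by simp [hA, consts]) v) _
      (hIreg _ z _ z2 rfl (by simp) (by simp) (by simp))
    refine ⟨z3.tail, z4.1, z4.2.1, fun h0 u' v' hd => z4.2.2 h0 u' v' ?_⟩
    rcases hd with hd | ⟨h1, h2⟩
    · exact Or.inl (Or.inl hd)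
    · rcases Nat.lt_succ_iff_lt_or_eq.mp h2 with h | h
      exacts [Or.inl (Or.inr ⟨h1, h⟩), Or.inr ⟨h1, h⟩]
  have hU : (Exp.var rN₁).eval (s.setReg rCand 0) = P.N₁ := by
    simp [Exp.eval, hs.get (r := rN₁) (v := P.N₁) (by simp [hA, consts])]
  have hev : search.exec s = forIter (fun i s => (Cmd.loopFor rV ‡rN₂ inner).exec (s.setReg rU i))
      P.N₁ (s.setReg rCand 0) := by
    rw [← hU]; rfl
  have fin := forIter_inv (g := fun i s => (Cmd.loopFor rV ‡rN₂ inner).exec (s.setReg rU i))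
    (k := P.N₁) (s := s.setReg rCand 0) (fun k z => Knows A τ z ∧
      I (fun u' v' => u' < k ∧ v' < P.N₂) z)
    ⟨(hs.setReg (x := rCand) (by simp [hA, consts]) 0).tail, by simp [hI, hμ]⟩ (by
      rintro u hu z ⟨z1, z2⟩
      obtain ⟨z3, z4⟩ := row u _ hu (z1.setReg (x := rU) (by simp [hA, consts]) u) _
        (hIreg _ z _ z2 rfl (by simp) (by simp) (by simp))
      refine ⟨z3.tail, z4.1, z4.2.1, fun h0 u' v' hd => z4.2.2 h0 u' v' ?_⟩
      rcases Nat.lt_succ_iff_lt_or_eq.mp hd.1 with h | h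
      exacts [Or.inl ⟨h, hd.2⟩, Or.inr ⟨h, hd.2⟩])
  rw [hev]
  exact ⟨fin.2.2.1, fun h u hu v hv => fin.2.2.2 h u v ⟨hu, hv⟩⟩

/-- `verify` raises the best value to the number of clauses satisfied by the best extension of the
proposed pair, and it never records a value that no assignment attains. -/
theorem verify_spec (P : Gadget) {τ : ℕ → ℕ} {n n₁ n₂ n₃ e₁ e₂ M B X base : ℕ}
    (hP : P = ofTable τ n n₁ n₂ n₃ e₁ e₂ M B) {s : State}
    (hs : Knows (P.consts n n₁ n₂ n₃ X base) τ s) :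
    s.reg rBest ≤ (verify.exec s).reg rBest ∧
    (s.reg rCand ≠ 0 → ∀ z < P.N₃, SAT.satCount τ n M n₁ n₂ n₃ (s.reg rCa) (s.reg rCb) z ≤
      (verify.exec s).reg rBest) ∧
    ((verify.exec s).reg rBest = s.reg rBest ∨ s.reg rCand ≠ 0 ∧ ∃ z < P.N₃,
      (verify.exec s).reg rBest = SAT.satCount τ n M n₁ n₂ n₃ (s.reg rCa) (s.reg rCb) z) := by
  by_cases h0 : s.reg rCand = 0
  · have : verify.exec s = s := by simp [verify, Cmd.exec, Exp.eval, h0]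
    rw [this]
    exact ⟨le_rfl, fun h => absurd h0 h, Or.inl rfl⟩
  have hPM : P.M = M := by rw [hP]; rfl
  set x := s.reg rCa with hx
  set y := s.reg rCb with hy
  set A := (rCa, x) :: (rCb, y) :: P.consts n n₁ n₂ n₃ X base with hA
  have hsA : Knows A τ s := (hs.cons (r := rCb) hy.symm).cons (r := rCa) hx.symm
  set val : ℕ → ℕ := SAT.satCount τ n M n₁ n₂ n₃ x y with hval
  set body : Cmd := satCmd rFl rCa rZero rn₁ ;; satCmd rFl₂ rCb rn₁ rn₂ ;;
      satCmd rFl₃ rY rLo rn₃ ;;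
      .ite (‡rFl + ‡rFl₂ + ‡rFl₃) (.set rCnt (.min (‡rCnt + ♮1) ‡rMm)) .skip with hbody
  have count : ∀ z s, Knows ((rY, z) :: A) τ s →
      ((Cmd.set rCnt ♮0 ;; .loopFor rC ‡rMm body).exec s).reg rCnt = val z := by
    intro z s hk
    have key := forIter_inv (g := fun i s => body.exec (s.setReg rC i)) (k := M)
      (s := s.setReg rCnt 0) (fun k u => Knows ((rY, z) :: A) τ u ∧
        u.reg rCnt = SAT.satCount τ n k n₁ n₂ n₃ x y z)
      ⟨(hk.setReg (x := rCnt) (by simp [hA, consts]) 0).tail, by simp [SAT.satCount]⟩ (by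
        rintro c hc u ⟨z1, z2⟩
        have z3 := z1.setReg (x := rC) (by simp [hA, consts]) c
        have z4 := z3.satCmd (out := rFl) (x := rCa) (lo := rZero) (len := rn₁) (by simp)
          (by simp) (by simp [hA, consts]) (by simp [hA, consts])
          (by simp [hA, consts]; rfl) (by simp [hA, consts]; rfl) (by simp [hA, consts]; rfl)
          (by simp [hA, consts]; rfl) (by simp [hA, consts]; rfl)
        have z5 := z4.satCmd (out := rFl₂) (x := rCb) (lo := rn₁) (len := rn₂) (by simp)
          (by simp) (by simp [hA, consts]) (by simp [hA, consts])
          (by simp [hA, consts]; rfl) (by simp [hA, consts]; rfl) (by simp [hA, consts]; rfl)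
          (by simp [hA, consts]; rfl) (by simp [hA, consts]; rfl)
        have z6 := z5.satCmd (out := rFl₃) (x := rY) (lo := rLo) (len := rn₃) (by simp)
          (by simp) (by simp [hA, consts]) (by simp [hA, consts])
          (by simp [hA, consts]; rfl) (by simp [hA, consts]; rfl) (by simp [hA, consts]; rfl)
          (by simp [hA, consts]; rfl) (by simp [hA, consts]; rfl)
        have z7 : ((satCmd rFl₃ rY rLo rn₃).exec ((satCmd rFl₂ rCb rn₁ rn₂).exec
            ((satCmd rFl rCa rZero rn₁).exec (u.setReg rC c)))).reg rCnt = u.reg rCnt := by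
          rw [(satCmd_noReg (by norm_num) (by norm_num)).exec,
            (satCmd_noReg (by norm_num) (by norm_num)).exec,
            (satCmd_noReg (by norm_num) (by norm_num)).exec, State.setReg_reg_ne _ (by norm_num)]
        have hle : SAT.satCount τ n (c + 1) n₁ n₂ n₃ x y z ≤ M := (Nat.count_le _).trans hc
        refine ⟨Knows.exec z3.tail (by simp [hA, consts, Cmd.NoReg, hbody, satCmd]) ?_, ?_⟩
        · simp [Cmd.NoArr, hbody, satCmd]
        · set z' := (satCmd rFl₃ rY rLo rn₃).exec ((satCmd rFl₂ rCb rn₁ rn₂).exec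
            ((satCmd rFl rCa rZero rn₁).exec (u.setReg rC c))) with hz'
          have f1 := z6.get (List.mem_cons_of_mem _ (List.mem_cons_of_mem _ List.mem_cons_self))
          have f2 := z6.get (List.mem_cons_of_mem _ List.mem_cons_self)
          have f3 := z6.get List.mem_cons_self
          have f4 := z6.get (r := rMm) (v := M) (by simp [hA, consts, hPM])
          have hex : body.exec (u.setReg rC c) = if (‡rFl + ‡rFl₂ + ‡rFl₃ : Exp).eval z' ≠ 0 then
            (Cmd.set rCnt (.min (‡rCnt + ♮1) ‡rMm)).exec z' else z' := rfl
          rw [hex]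
          simp only [SAT.satCount, Nat.count_succ] at z2 hle ⊢
          simp only [Cmd.exec, Exp.eval, BinOp.eval, f1, f2, f3, f4, z7, z2]
          cases h1 : satN τ n x 0 n₁ c <;> cases h2 : satN τ n y n₁ n₂ c <;>
            cases h3 : satN τ n z (n₁ + n₂) n₃ c <;> simp [h1, h2, h3, z7, z2] at hle ⊢ <;> omega)
    have hev : (Cmd.set rCnt ♮0 ;; .loopFor rC ‡rMm body).exec s =
        forIter (fun i s => body.exec (s.setReg rC i)) M (s.setReg rCnt 0) := by
      have : (Exp.var rMm).eval (s.setReg rCnt 0) = M := by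
        simp [Exp.eval, hk.get (r := rMm) (v := M) (by simp [hA, consts, hPM])]
      rw [← this]; rfl
    rw [hev, key.2]
  set inner : Cmd := (Cmd.set rCnt ♮0 ;; .loopFor rC ‡rMm body) ;;
    .ite (‡rCnt - ‡rBest) (.set rBest ‡rCnt) .skip with hinner
  have key := forIter_inv (g := fun i s => inner.exec (s.setReg rY i)) (k := P.N₃) (s := s)
    (fun k u => Knows A τ u ∧ s.reg rBest ≤ u.reg rBest ∧ (∀ z < k, val z ≤ u.reg rBest) ∧
      (u.reg rBest = s.reg rBest ∨ ∃ z < k, u.reg rBest = val z))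
    ⟨hsA, le_rfl, by simp, Or.inl rfl⟩ (by
      rintro z hz u ⟨u1, u2, u3, u4⟩
      have v1 := u1.setReg (x := rY) (by simp [hA, consts]) z
      refine ⟨Knows.exec (v1.tail) (by simp [hA, consts, Cmd.NoReg, hinner, hbody, satCmd]) ?_, ?_⟩
      · simp [Cmd.NoArr, hinner, hbody, satCmd]
      have hc := count z _ v1
      set u' := (Cmd.set rCnt ♮0 ;; .loopFor rC ‡rMm body).exec (u.setReg rY z) with hu'
      have hb : u'.reg rBest = u.reg rBest := by
        rw [hu', Cmd.NoReg.exec (r := rBest) (by simp [Cmd.NoReg, hbody, satCmd]),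
          State.setReg_reg_ne _ (by norm_num)]
      have hex : inner.exec (u.setReg rY z) = if (‡rCnt - ‡rBest : Exp).eval u' ≠ 0 then
          u'.setReg rBest (u'.reg rCnt) else u' := rfl
      have hval : (inner.exec (u.setReg rY z)).reg rBest = max (u.reg rBest) (val z) := by
        rw [hex]
        simp only [Exp.eval, Exp.sub_def, BinOp.eval, hc, hb]
        split_ifs with h
        · rw [State.setReg_reg_self]; omega
        · rw [hb]; omega
      rw [hval]
      refine ⟨by omega, fun z' hz' => ?_, ?_⟩
      · rcases Nat.lt_succ_iff_lt_or_eq.mp hz' with h | rfl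
        · exact (u3 z' h).trans (le_max_left _ _)
        · exact le_max_right _ _
      · rcases le_total (val z) (u.reg rBest) with h | h
        · rw [max_eq_left h]
          rcases u4 with h' | ⟨z', hz', h'⟩
          exacts [Or.inl h', Or.inr ⟨z', by omega, h'⟩]
        · rw [max_eq_right h]
          exact Or.inr ⟨z, by omega, rfl⟩)
  have hev : verify.exec s = forIter (fun i s => inner.exec (s.setReg rY i)) P.N₃ s := by
    have h3 : (Exp.var rN₃).eval s = P.N₃ := hs.get (by simp [consts])
    have : verify.exec s = (Cmd.loopFor rY ‡rN₃ inner).exec s := if_pos h0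
    rw [this, ← h3]; rfl
  rw [hev]
  exact ⟨key.2.1, fun _ => key.2.2.1, key.2.2.2.imp_right fun h => ⟨h0, h⟩⟩

end MaxFlow.Gadget

namespace WordRAM

open MaxFlow

theorem Knows.mono {A A' : List (ℕ × ℕ)} {τ : ℕ → ℕ} {s : State} (h : Knows A τ s)
    (hA : ∀ p ∈ A', p ∈ A) : Knows A' τ s := ⟨fun p hp => h.1 p (hA p hp), h.2⟩

/-! ### The window of a round -/

/-- The command writes to array `3` only between `base` and `base + X`. -/
def InWindow (base X : ℕ) (c : Cmd) : Prop :=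
  ∀ s : State, s.reg rBase = base → s.reg rX = X → s.reg rPtr ≤ X →
    (c.exec s).reg rPtr ≤ X ∧ ∀ i, (i < base ∨ base + X < i) → (c.exec s).mem 3 i = s.mem 3 i

theorem InWindow.seq {base X : ℕ} {c c' : Cmd} (h : InWindow base X c) (h' : InWindow base X c')
    (h4 : c.NoReg rBase) (h3 : c.NoReg rX) : InWindow base X (c ;; c') := by
  intro s s4 s3 sp
  obtain ⟨h1, h2⟩ := h s s4 s3 sp
  obtain ⟨h5, h6⟩ := h' (c.exec s) (by rw [h4.exec, s4]) (by rw [h3.exec, s3]) h1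
  exact ⟨h5, fun i hi => (h6 i hi).trans (h2 i hi)⟩

theorem InWindow.loopFor {base X x : ℕ} {e : Exp} {c : Cmd} (h : InWindow base X c)
    (h4 : c.NoReg rBase) (h3 : c.NoReg rX) (hx : x ∉ [rBase, rX, rPtr]) :
    InWindow base X (.loopFor x e c) := by
  simp only [List.mem_cons, List.not_mem_nil, or_false, not_or] at hx
  intro s s4 s3 sp
  refine (forIter_inv (fun _ z => z.reg rBase = base ∧ z.reg rX = X ∧ z.reg rPtr ≤ X ∧
    ∀ i, (i < base ∨ base + X < i) → z.mem 3 i = s.mem 3 i) ⟨s4, s3, sp, fun _ _ => rfl⟩ ?_).2.2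
  rintro k - z ⟨z1, z2, z3, z4⟩
  have e1 : (z.setReg x k).reg rBase = base := by rw [State.setReg_reg_ne _ (Ne.symm hx.1), z1]
  have e2 : (z.setReg x k).reg rX = X := by rw [State.setReg_reg_ne _ (Ne.symm hx.2.1), z2]
  obtain ⟨h1, h2⟩ := h (z.setReg x k) e1 e2
    (by rwa [State.setReg_reg_ne _ (Ne.symm hx.2.2)])
  exact ⟨by rw [h4.exec, e1], by rw [h3.exec, e2], h1, fun i hi => (h2 i hi).trans (z4 i hi)⟩

theorem inWindow_satCmd {base X out x lo len : ℕ} (h : out ≠ rPtr) :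
    InWindow base X (satCmd out x lo len) := fun s _ _ sp =>
  ⟨by rwa [(satCmd_noReg (Ne.symm h) (by norm_num)).exec],
    fun i _ => by rw [satCmd_noArr.exec]⟩

theorem inWindow_emit {base X : ℕ} (e : Exp) : InWindow base X (emit e) := by
  intro s s4 s3 sp
  refine ⟨by simp [emit, Cmd.exec, Exp.eval, s3], fun i hi => ?_⟩
  simp only [emit, Cmd.exec, State.setReg_mem, State.setMem_mem, Exp.eval, Exp.add_def, BinOp.eval,
    s4, true_and]
  rw [if_neg (by omega)]

theorem inWindow_emitEdge {base X : ℕ} (u v c : Exp) : InWindow base X (emitEdge u v c) :=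
  (inWindow_emit u).seq ((inWindow_emit v).seq (inWindow_emit c)
    (by simp [emit, Cmd.NoReg]) (by simp [emit, Cmd.NoReg])) (by simp [emit, Cmd.NoReg])
    (by simp [emit, Cmd.NoReg])

theorem build_noReg {r : ℕ} (h : r ∉ [rPtr, rU, rV, rC, rY, rFl, rI]) : build.NoReg r := by
  simp only [List.mem_cons, List.not_mem_nil, or_false, not_or] at h
  simp [build, writeGraph, emit, emitEdge, satCmd, Cmd.NoReg, h]

theorem build_noArr {a : ℕ} (h : a ≠ 3) : build.NoArr a := by
  simp [build, writeGraph, emit, emitEdge, satCmd, Cmd.NoArr, h]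

theorem inWindow_writeGraph {base X : ℕ} : InWindow base X writeGraph := by
  unfold writeGraph
  repeat' first
    | with_reducible exact inWindow_emit _
    | with_reducible exact inWindow_emitEdge _ _ _
    | with_reducible exact inWindow_satCmd (by norm_num)
    | with_reducible refine InWindow.seq ?_ ?_ ?_ ?_
    | with_reducible refine InWindow.loopFor ?_ ?_ ?_ ?_
    | simp [emit, emitEdge, satCmd, Cmd.NoReg]

/-- `build` writes only within the window of the current round, even if the graph does not fit. -/
theorem build_local {s : State} {i : ℕ}
    (hi : i < s.reg rBase ∨ s.reg rBase + s.reg rX < i) :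
    (build.exec s).mem 3 i = s.mem 3 i := by
  have := (inWindow_writeGraph (base := s.reg rBase) (X := s.reg rX) (s.setReg rPtr 0)
    (by simp) (by simp) (by simp)).2 i hi
  simpa [build, Cmd.exec, Exp.eval] using this

theorem clear_exec : ∀ (R : ℕ) (s : State), (∀ x < R, ((clear R).exec s).reg (64 + x) = 0) ∧
    (∀ r < 64, ((clear R).exec s).reg r = s.reg r) ∧ ((clear R).exec s).mem = s.mem
  | 0, s => ⟨by simp, fun _ _ => rfl, rfl⟩
  | R + 1, s => by
    obtain ⟨h1, h2, h3⟩ := clear_exec R s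
    refine ⟨fun x hx => ?_, fun r hr => ?_, h3⟩
    · simp only [clear, Cmd.exec, Exp.eval, State.setReg_reg]
      split_ifs with h
      · rfl
      · exact h1 x (by omega)
    · simp only [clear, Cmd.exec, Exp.eval]
      rw [State.setReg_reg_ne _ (by omega), h2 r hr]

theorem launch_reg {q b R r : ℕ} (hr : r < 64) (h2 : r ≠ rFuel) (s : State) :
    ((launch q b R).exec s).reg r = s.reg r := by
  simp only [launch, Cmd.exec]
  rw [State.setReg_reg_ne _ h2, State.setReg_reg_ne _ (by omega), (clear_exec R s).2.1 r hr]

theorem launch_mem {q b R : ℕ} (s : State) : ((launch q b R).exec s).mem = s.mem :=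
  (clear_exec R s).2.2

theorem launch_fuel {q b R : ℕ} (s : State) : ((launch q b R).exec s).reg rFuel =
    2 ^ min (s.reg rNn - s.reg rNn / q + (3 * s.reg rL + b)) (s.reg 1) := by
  simp only [launch, Cmd.exec, State.setReg_reg_self, Exp.eval, Exp.add_def, Exp.sub_def,
    Exp.div_def, Exp.mul_def, BinOp.eval]
  rw [State.setReg_reg_ne _ (by norm_num), State.setReg_reg_ne _ (by norm_num),
    State.setReg_reg_ne _ (by norm_num), (clear_exec R s).2.1 _ (by norm_num),
    (clear_exec R s).2.1 _ (by norm_num), (clear_exec R s).2.1 _ (by norm_num)]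

theorem launch_input {q b R : ℕ} (s : State) (x : ℕ) (hx : x < R) :
    ((launch q b R).exec s).reg (64 + x) = if x = 0 then s.reg rPtr else 0 := by
  simp only [launch, Cmd.exec, Exp.eval]
  rw [State.setReg_reg_ne _ (by omega)]
  split_ifs with h
  · subst h
    rw [State.setReg_reg_self, (clear_exec R s).2.1 _ (by norm_num)]
  · rw [State.setReg_reg_ne _ (by omega), (clear_exec R s).1 x hx]

/-! ### One round -/

/-- The registers that stay fixed in the main loop. -/
def fixed (w X n M L Q : ℕ) : List (ℕ × ℕ) :=
  [(1, w), (rX, X), (rNn, n), (rMm, M), (rL, L), (rQ, Q)]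

/-- Admissible guesses: `n₁`, `n₂`, `n₃` variables in the three parts, `2 ^ e₁` sources and `2 ^ e₂`
sinks. -/
def Admissible (q n L n₁ n₂ n₃ e₁ e₂ : ℕ) : Prop :=
  n₁ + n₂ ≤ n ∧ n₁ ≤ n₃ ∧ n₂ ≤ n₃ ∧ n₁ ≤ e₁ ∧ n₂ ≤ e₂ ∧ e₁ ≤ n₃ + L ∧ e₂ ≤ n₃ + L ∧
    n₃ ≤ n - n / q

/-- The guess is written in base `Q`, with `B - 1` as the leading digit. -/
theorem decode_spec {τ : ℕ → ℕ} {w X n M L Q g : ℕ} {s : State}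
    (hs : Knows ((rG, g) :: fixed w X n M L Q) τ s) (hg : g < Q * Q * Q * Q * M) :
    Knows ([(rn₁, g % Q), (rn₂, g / Q % Q), (re₁, g / (Q * Q) % Q), (re₂, g / (Q * Q * Q) % Q),
      (rB, g / (Q * Q * Q * Q) + 1), (rn₃, n - (g % Q + g / Q % Q))] ++
      (rG, g) :: fixed w X n M L Q) τ (decode.exec s) := by
  have hQ : 0 < Q := Nat.pos_of_ne_zero fun h => by subst h; simp at hg
  have h1 : ∀ x, min (x % Q) Q = x % Q := fun x => min_eq_left (Nat.mod_lt _ hQ).le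
  have h2 : min (g / (Q * Q * Q * Q) + 1) M = g / (Q * Q * Q * Q) + 1 :=
    min_eq_left (Nat.div_lt_of_lt_mul hg)
  have g1 := hs.get (r := rG) List.mem_cons_self
  have g2 := hs.get (r := rQ) (v := Q) (by simp [fixed])
  have g3 := hs.get (r := rMm) (v := M) (by simp [fixed])
  have g4 := hs.get (r := rNn) (v := n) (by simp [fixed])
  have hex : decode.exec s = (((((s.setReg rn₁ (g % Q)).setReg rn₂ (g / Q % Q)).setReg re₁
      (g / (Q * Q) % Q)).setReg re₂ (g / (Q * Q * Q) % Q)).setReg rB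
      (g / (Q * Q * Q * Q) + 1)).setReg rn₃ (n - (g % Q + g / Q % Q)) := by
    simp only [decode, Cmd.exec, Exp.eval, Exp.add_def, Exp.sub_def, Exp.mul_def, Exp.div_def,
      Exp.mod_def, BinOp.eval, g1, g2, h1]
    simp only [State.setReg_reg, Nat.reduceEqDiff, if_false, g1, g2, g3, g4, h1, h2, if_true]
  rw [hex]
  have := ((((((hs.setReg (x := rn₁) (by simp [fixed]) (g % Q)).setReg (x := rn₂)
    (by simp [fixed]) (g / Q % Q)).setReg (x := re₁) (by simp [fixed])
    (g / (Q * Q) % Q)).setReg (x := re₂) (by simp [fixed]) (g / (Q * Q * Q) % Q)).setReg (x := rB)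
    (by simp [fixed]) (g / (Q * Q * Q * Q) + 1)).setReg (x := rn₃) (by simp [fixed])
    (n - (g % Q + g / Q % Q)))
  refine this.mono fun p hp => ?_
  simp only [List.cons_append, List.nil_append, List.mem_cons] at hp ⊢
  tauto

theorem guard_eval {q n L n₁ n₂ n₃ e₁ e₂ : ℕ} {s : State} (h0 : s.reg rNn = n)
    (h1 : s.reg rL = L) (h2 : s.reg rn₁ = n₁) (h3 : s.reg rn₂ = n₂) (h4 : s.reg rn₃ = n₃)
    (h5 : s.reg re₁ = e₁) (h6 : s.reg re₂ = e₂) :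
    (guard q).eval s = 0 ↔ Admissible q n L n₁ n₂ n₃ e₁ e₂ := by
  simp only [guard, Exp.eval, Exp.add_def, Exp.sub_def, Exp.div_def, BinOp.eval, h0, h1, h2, h3, h4,
    h5, h6, Admissible, Nat.add_eq_zero_iff, Nat.sub_eq_zero_iff_le, and_assoc]

/-- For an admissible guess the truncations of the exponents and of the offset have no effect. -/
theorem sizes_spec {τ : ℕ → ℕ} {q w X n M L Q g n₁ n₂ n₃ e₁ e₂ B : ℕ} {s : State}
    (hs : Knows ([(rn₁, n₁), (rn₂, n₂), (re₁, e₁), (re₂, e₂), (rB, B), (rn₃, n₃)] ++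
      (rG, g) :: fixed w X n M L Q) τ s) (hw : n + L ≤ w) (hA : Admissible q n L n₁ n₂ n₃ e₁ e₂)
    (hn : n₁ + n₂ + n₃ = n) :
    Knows ((Gadget.ofTable τ n n₁ n₂ n₃ e₁ e₂ M B).consts n n₁ n₂ n₃ X (g * (2 * X)) ++
      (rG, g) :: fixed w X n M L Q) τ (sizes.exec s) := by
  obtain ⟨a1, a2, a3, a4, a5, a6, a7, a8⟩ := hA
  have h1 : min n₁ w = n₁ := by omega
  have h2 : min n₂ w = n₂ := by omega
  have h3 : min n₃ w = n₃ := by omega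
  have h4 : min e₁ w = e₁ := by omega
  have h5 : min e₂ w = e₂ := by omega
  have h6 : min (n₁ + n₂) n = n₁ + n₂ := by omega
  simp [Knows, fixed] at hs
  simp [Knows, fixed, Gadget.consts, Gadget.ofTable, Gadget.size, sizes, Cmd.exec, Exp.eval,
    Exp.add_def, Exp.mul_def, BinOp.eval, hs, h1, h2, h3, h4, h5, h6]

end WordRAM

namespace WordRAM

open MaxFlow MaxFlow.Gadget Finset

/-- The flow program `p` solves the instance `G` within the word bound and the time limit. -/
def Succeeds (p : Program) (X fuel : ℕ) (G : Instance) : Prop :=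
  ∃ W t σ, W ≤ X ∧ G.encode.length < W ∧ (∀ v ∈ G.encode, v < W) ∧ t < fuel ∧
    Runs W p (initState G.encode) t σ ∧ STMaxFlow.Correct G (σ.mem 1)

theorem initState_bounded {W : ℕ} {l : List ℕ} (h : l.length < W) (hl : ∀ v ∈ l, v < W) :
    Bounded W (initState l) := by
  refine ⟨fun x => ?_, fun a i => ?_⟩
  · simp only [initState]; split_ifs <;> omega
  · simp only [initState]
    split_ifs
    · by_cases hi : i < l.length
      · rw [List.getD_eq_getElem _ _ hi]
        exact hl _ (List.getElem_mem hi)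
      · rw [List.getD_eq_default _ _ (by omega)]; omega
    · omega

/-- If the flow program succeeds, the reported values are the maximum flows. -/
theorem flow_values {p : Program} {P : Gadget} (h₁ : P.N₁ ≤ P.S₁) (h₂ : P.N₂ ≤ P.S₂) {w X base : ℕ}
    (hXw : X = 2 ^ w) {s : State} (hbase : s.reg rBase = base) (hX : s.reg rX = X)
    (hw : s.reg 1 = w)
    (hsucc : Succeeds p X (s.reg rFuel) (P.inst h₁ h₂)) (hlen : P.S₁ * P.S₂ ≤ X)
    (hin : ∀ x < p.bnd + 1, s.reg (64 + x) = if x = 0 then (P.inst h₁ h₂).encode.length else 0)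
    (hbuf : ∀ i, s.mem 3 (base + i) = (P.inst h₁ h₂).encode.getD i 0)
    (hfresh : ∀ a, 0 < a → ∀ i, s.mem (a + 3) (base + i) = 0) {u v : ℕ} (hu : u < P.N₁)
    (hv : v < P.N₂) :
    P.Bad (((limited p).exec s).mem 4) base u v ↔ ∃ z < P.N₃, #(P.unsat u v z) < P.B := by
  obtain ⟨W, t, σ, hW, hl, hvs, ht, hr, hc⟩ := hsucc
  have hrep : Rep (p.bnd + 1) X (initState (P.inst h₁ h₂).encode) s := by
    refine ⟨fun x hx => hin x hx, fun a i _ => ?_⟩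
    rw [hbase]
    rcases Nat.eq_zero_or_pos a with rfl | ha
    · rw [hbuf]; rfl
    · rw [hfresh a ha]; simp [initState, ha.ne']
  obtain ⟨-, hrep', -⟩ := limited_runs hW hXw hr (Nat.le_succ _) (initState_bounded hl hvs) s hrep
    hw hX ht
  have h4 : ((limited p).exec s).reg rBase = base := by
    rw [(limited_noReg (by norm_num) (by norm_num) p).exec, hbase]
  have hS : (P.inst h₁ h₂).S.length = P.S₁ := by simp [Gadget.inst]
  have hT : (P.inst h₁ h₂).T.length = P.S₂ := by simp [Gadget.inst]
  have hidx : u * P.S₂ + v < X := by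
    have : (u + 1) * P.S₂ ≤ P.S₁ * P.S₂ := Nat.mul_le_mul_right _ (by omega)
    rw [add_mul, one_mul] at this
    omega
  have hne : (P.inst h₁ h₂).S.get ⟨u, by omega⟩ ≠ (P.inst h₁ h₂).T.get ⟨v, by omega⟩ := by
    simp only [Gadget.inst, List.get_eq_getElem, List.getElem_map, List.getElem_range]
    intro h
    exact absurd (P.node_inj (u := .src u) (v := .snk v) (lt_of_lt_of_le hu h₁)
      (lt_of_lt_of_le hv h₂) h) (by simp)
  have hflow := hc ⟨u, by omega⟩ ⟨v, by omega⟩ hne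
  have hmem := hrep'.mem 1 _ hidx
  rw [h4] at hmem
  simp only [hT] at hflow
  rw [← hmem] at hflow
  have e1 : (P.inst h₁ h₂).S.get ⟨u, by omega⟩ = P.node (.src u) := by
    simp [Gadget.inst]
  have e2 : (P.inst h₁ h₂).T.get ⟨v, by omega⟩ = P.node (.snk v) := by
    simp [Gadget.inst]
  rw [e1, e2] at hflow
  rw [Gadget.Bad, ne_eq, P.maxFlow_eq_iff hu hv hflow]
  push Not
  rfl

theorem decode_noReg : decode.NoReg rBest := by simp [decode, Cmd.NoReg]

theorem sizes_noReg : sizes.NoReg rBest := by simp [sizes, Cmd.NoReg]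

set_option maxHeartbeats 1000000 in
/-- A round keeps the fixed registers and leaves the later windows untouched; the best value never
decreases and is always attained; with a successful call of the flow program it becomes as good as
the guess claims. -/
theorem round_spec (p : Program) (q b : ℕ) {τ : ℕ → ℕ} {w X n M L Q g : ℕ} {s : State}
    (hs : Knows ((rG, g) :: fixed w X n M L Q) τ s) (hg : g < Q * Q * Q * Q * M)
    (hw : 2 * (n + L) ≤ w) (hw' : n - n / q + (3 * L + b) ≤ w)
    (hX : X = 2 ^ w)
    (hfresh : ∀ a, 3 ≤ a → ∀ i, g * (2 * X) ≤ i → s.mem a i = 0) :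
    Knows ((rG, g) :: fixed w X n M L Q) τ ((round p q b).exec s) ∧
    (∀ a, 3 ≤ a → ∀ i, (g + 1) * (2 * X) ≤ i → ((round p q b).exec s).mem a i = 0) ∧
    s.reg rBest ≤ ((round p q b).exec s).reg rBest ∧
    (((round p q b).exec s).reg rBest = s.reg rBest ∨ ∃ n₁ n₂ n₃ x y z, n₁ + n₂ + n₃ = n ∧
      ((round p q b).exec s).reg rBest = SAT.satCount τ n M n₁ n₂ n₃ x y z) ∧
    ∀ n₁ n₂ n₃ e₁ e₂ B, g % Q = n₁ → g / Q % Q = n₂ → g / (Q * Q) % Q = e₁ →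
      g / (Q * Q * Q) % Q = e₂ → g / (Q * Q * Q * Q) + 1 = B → n₁ + n₂ + n₃ = n →
      Admissible q n L n₁ n₂ n₃ e₁ e₂ →
      (∀ P, P = Gadget.ofTable τ n n₁ n₂ n₃ e₁ e₂ M B → ∀ h₁ h₂,
        (P.inst h₁ h₂).encode.length ≤ X ∧
        Succeeds p X (2 ^ (n - n / q + (3 * L + b))) (P.inst h₁ h₂)) →
      (∃ x < 2 ^ n₁, ∃ y < 2 ^ n₂, ∃ z < 2 ^ n₃, M < SAT.satCount τ n M n₁ n₂ n₃ x y z + B) →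
      M < ((round p q b).exec s).reg rBest + B := by
  have d1 := decode_spec hs hg
  have hfr : ∀ a, 3 ≤ a → ∀ i, (g + 1) * (2 * X) ≤ i → s.mem a i = 0 := fun a ha i hi =>
    hfresh a ha i (le_trans (Nat.mul_le_mul_right _ (Nat.le_succ g)) hi)
  generalize hn₁ : g % Q = n₁ at *
  generalize hn₂ : g / Q % Q = n₂ at *
  generalize he₁ : g / (Q * Q) % Q = e₁ at *
  generalize he₂ : g / (Q * Q * Q) % Q = e₂ at *
  generalize hB : g / (Q * Q * Q * Q) + 1 = B at *
  set s₀ := decode.exec s with hs₀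
  have hmem₀ : s₀.mem = s.mem := rfl
  have hbest₀ : s₀.reg rBest = s.reg rBest := decode_noReg.exec s
  have hgd : (guard q).eval s₀ = 0 ↔ Admissible q n L n₁ n₂ (n - (n₁ + n₂)) e₁ e₂ :=
    guard_eval (d1.get (by simp [fixed])) (d1.get (by simp [fixed])) (d1.get (by simp))
      (d1.get (by simp)) (d1.get (by simp)) (d1.get (by simp)) (d1.get (by simp))
  have hdown : ∀ p ∈ (rG, g) :: fixed w X n M L Q, p ∈ [(rn₁, n₁), (rn₂, n₂), (re₁, e₁), (re₂, e₂),
      (rB, B), (rn₃, n - (n₁ + n₂))] ++ (rG, g) :: fixed w X n M L Q := fun p hp =>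
    List.mem_append_right _ hp
  have hex : (round p q b).exec s = if (guard q).eval s₀ ≠ 0 then s₀ else
      verify.exec (search.exec ((limited p).exec ((launch q b (p.bnd + 1)).exec
        (build.exec (sizes.exec s₀))))) := rfl
  by_cases hadm : Admissible q n L n₁ n₂ (n - (n₁ + n₂)) e₁ e₂
  swap
  · rw [hex, if_pos fun h => hadm (hgd.mp h)]
    refine ⟨d1.mono hdown, fun a ha i hi => by rw [hmem₀]; exact hfr a ha i hi, hbest₀.ge,
      Or.inl hbest₀, ?_⟩
    rintro n₁' n₂' n₃' e₁' e₂' B' rfl rfl rfl rfl rfl hn hA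
    exact absurd (by rwa [show n - (n₁ + n₂) = n₃' by omega]) hadm
  rw [hex, if_neg (not_not.mpr (hgd.mpr hadm))]
  obtain ⟨n₃, hn₃⟩ : ∃ n₃, n₃ = n - (n₁ + n₂) := ⟨_, rfl⟩
  rw [← hn₃] at hadm d1
  have hn : n₁ + n₂ + n₃ = n := by have := hadm.1; omega
  have d2 := sizes_spec d1 (by omega) hadm hn
  obtain ⟨P, hP⟩ : ∃ P, P = Gadget.ofTable τ n n₁ n₂ n₃ e₁ e₂ M B := ⟨_, rfl⟩
  rw [← hP] at d2
  obtain ⟨base, hbase⟩ : ∃ base, base = g * (2 * X) := ⟨_, rfl⟩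
  rw [← hbase] at d2 hfresh
  set s₁ := sizes.exec s₀ with hs₁
  set s₂ := build.exec s₁ with hs₂
  set s₃ := (launch q b (p.bnd + 1)).exec s₂ with hs₃
  set s₄ := (limited p).exec s₃ with hs₄
  set s₅ := search.exec s₄ with hs₅
  have hXpos : 0 < X := by rw [hX]; positivity
  have hbase' : base + X < (g + 1) * (2 * X) := by rw [add_mul, one_mul]; omega
  -- the registers that no later step assigns
  have keep₃ : ∀ r < 64, r ≠ rFuel → r ∉ [rPtr, rU, rV, rC, rY, rFl, rI] →
      s₃.reg r = s₁.reg r := by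
    intro r hr hr2 hr'
    rw [hs₃, launch_reg hr hr2, hs₂, (build_noReg hr').exec]
  have keep : ∀ r < 64, r ≠ rFuel → r ∉ [rPtr, rU, rV, rC, rY, rFl, rI] →
      s₄.reg r = s₁.reg r := by
    intro r hr hr2 hr'
    rw [hs₄, (limited_noReg hr hr2 p).exec, keep₃ r hr hr2 hr']
  have hregs : ∀ p ∈ P.consts n n₁ n₂ n₃ X base ++ (rG, g) :: fixed w X n M L Q,
      p.1 < 64 ∧ p.1 ≠ rFuel ∧ p.1 ∉ [rPtr, rU, rV, rC, rY, rFl, rI] ∧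
      p.1 ∉ [rCand, rU, rV, rCnt, rC, rFl, rI, rFl₂, rCa, rCb] ∧
      p.1 ∉ [rY, rCnt, rC, rFl, rI, rFl₂, rFl₃, rBest] := by
    simp [Gadget.consts, fixed]
  have d4 : Knows (P.consts n n₁ n₂ n₃ X base ++ (rG, g) :: fixed w X n M L Q) τ s₄ := by
    refine ⟨fun p hp => ?_, ?_⟩
    · obtain ⟨r1, r2, r3, -, -⟩ := hregs p hp
      rw [keep p.1 r1 r2 r3]
      exact d2.1 p hp
    · rw [hs₄, (limited_noArr (by norm_num) p).exec, hs₃, launch_mem, hs₂,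
        (build_noArr (by norm_num)).exec, d2.2]
  have dc : Knows (P.consts n n₁ n₂ n₃ X base) τ s₄ :=
    d4.mono fun p hp => List.mem_append_left _ hp
  have hbest₄ : s₄.reg rBest = s.reg rBest := by
    rw [keep _ (by norm_num) (by norm_num) (by simp), hs₁, sizes_noReg.exec, hbest₀]
  have hbest₅ : s₅.reg rBest = s.reg rBest := by rw [hs₅, (search_noReg (by simp)).exec, hbest₄]
  have d5 : Knows (P.consts n n₁ n₂ n₃ X base) τ s₅ :=
    dc.exec (fun p hp => search_noReg (hregs p (List.mem_append_left _ hp)).2.2.2.1) search_noArr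
  have hver := Gadget.verify_spec P hP d5
  have hsea := Gadget.search_spec P hP dc
  rw [← hs₅] at hsea
  -- writing the graph changes nothing outside the cells `base, …, base + X`, which is why windows
  -- that start at multiples of `2 X` are disjoint
  have hmem₂ : ∀ a, 3 ≤ a → ∀ i, (i < base ∨ base + X < i) → s₂.mem a i = s.mem a i := by
    intro a ha i hi
    rcases eq_or_ne a 3 with rfl | h3
    · have e1 : s₁.reg rBase = base := d2.get (by simp [Gadget.consts])
      have e2 : s₁.reg rX = X := d2.get (by simp [Gadget.consts])
      rw [hs₂, build_local (by rw [e1, e2]; exact hi)]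
      rfl
    · rw [hs₂, (build_noArr h3).exec]; rfl
  refine ⟨?_, ?_, ?_, ?_, ?_⟩
  · exact Knows.exec (Knows.exec (d4.mono fun p hp => List.mem_append_right _ hp)
      (fun p hp => search_noReg (hregs p (List.mem_append_right _ hp)).2.2.2.1) search_noArr)
      (fun p hp => verify_noReg (hregs p (List.mem_append_right _ hp)).2.2.2.2) verify_noArr
  · intro a ha i hi
    rw [verify_noArr.exec, search_noArr.exec, hs₄, limited_local, hs₃, launch_mem,
      hmem₂ a ha i (Or.inr (by omega))]
    · exact hfr a ha i hi
    · have e1 : s₃.reg rBase = base := by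
        rw [← dc.get (r := rBase) (v := base) (by simp [Gadget.consts]), hs₄,
          (limited_noReg (by norm_num) (by norm_num) p).exec]
      have e2 : s₃.reg rX = X := by
        rw [← dc.get (r := rX) (v := X) (by simp [Gadget.consts]), hs₄,
          (limited_noReg (by norm_num) (by norm_num) p).exec]
      rw [e1, e2]
      exact Or.inr (by omega)
  · rw [← hbest₅]; exact hver.1
  · rcases hver.2.2 with h | ⟨-, z, -, h⟩
    · exact Or.inl (h.trans hbest₅)
    · exact Or.inr ⟨n₁, n₂, n₃, _, _, z, hn, h⟩
  · rintro n₁' n₂' n₃' e₁' e₂' B' rfl rfl rfl rfl rfl hn' hA hor ⟨x, hx, y, hy, z, hz, hxyz⟩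
    obtain rfl : n₃' = n₃ := by omega
    have h₁ : P.N₁ ≤ P.S₁ := by rw [hP]; exact Nat.pow_le_pow_right (by norm_num) hadm.2.2.2.1
    have h₂ : P.N₂ ≤ P.S₂ := by rw [hP]; exact Nat.pow_le_pow_right (by norm_num) hadm.2.2.2.2.1
    obtain ⟨hlen, hsucc⟩ := hor P hP h₁ h₂
    obtain ⟨-, hbuf⟩ := P.emits_build hP h₁ h₂ (d2.mono fun p hp => List.mem_append_left _ hp)
      (fun i => hfresh 3 le_rfl _ (Nat.le_add_right _ _)) hlen
    have k2 : ∀ r v, r ∉ [rPtr, rU, rV, rC, rY, rFl, rI] →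
        (r, v) ∈ P.consts n n₁ n₂ n₃' X base ++ (rG, g) :: fixed w X n M L Q → s₂.reg r = v := by
      intro r v hr hm
      rw [hs₂, (build_noReg hr).exec, d2.get hm]
    have hfuel : s₃.reg rFuel = 2 ^ (n - n / q + (3 * L + b)) := by
      rw [hs₃, launch_fuel, k2 rNn n (by simp) (by simp [Gadget.consts]),
        k2 rL L (by simp) (by simp [Gadget.consts, fixed]),
        k2 1 w (by simp) (by simp [Gadget.consts, fixed]),
        min_eq_left hw']
    have hbad : ∀ u < P.N₁, ∀ v < P.N₂,
        (P.Bad (s₄.mem 4) base u v ↔ ∃ z < P.N₃, #(P.unsat u v z) < P.B) := by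
      intro u hu v hv
      refine flow_values h₁ h₂ hX (s := s₃) ?_ ?_ ?_ ?_ ?_ ?_ ?_ ?_ hu hv
      · rw [keep₃ _ (by norm_num) (by norm_num) (by simp),
          d2.get (v := base) (by simp [Gadget.consts])]
      · rw [keep₃ _ (by norm_num) (by norm_num) (by simp),
          d2.get (v := X) (by simp [Gadget.consts])]
      · rw [keep₃ _ (by norm_num) (by norm_num) (by simp),
          d2.get (v := w) (by simp [Gadget.consts, fixed])]
      · rw [hfuel]; exact hsucc
      · rw [show P.S₁ * P.S₂ = 2 ^ (e₁ + e₂) by rw [pow_add, hP]; rfl, hX]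
        refine Nat.pow_le_pow_right (by norm_num) ?_
        obtain ⟨a1, a2, a3, a4, a5, a6, a7, a8⟩ := hadm
        omega
      · intro x hx
        rw [hs₃, launch_input _ _ hx, hbuf.1]
      · intro i
        rw [hs₃, launch_mem]
        exact hbuf.2 i
      · intro a ha i
        rw [hs₃, launch_mem, hs₂, (build_noArr (by omega)).exec]
        exact hfresh (a + 3) (by omega) _ (Nat.le_add_right _ _)
    have hun := SAT.satCount_add_unsat P hP
    have hPB : P.B = B := by rw [hP]; rfl
    replace hx : x < P.N₁ := by rw [hP]; exact hx
    replace hy : y < P.N₂ := by rw [hP]; exact hy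
    replace hz : z < P.N₃ := by rw [hP]; exact hz
    have hcand : s₅.reg rCand ≠ 0 := by
      intro h0
      refine hsea.2 h0 x hx y hy ((hbad x hx y hy).mpr ⟨z, hz, ?_⟩)
      have := hun x y z
      omega
    obtain ⟨c1, c2, c3⟩ := hsea.1 hcand
    obtain ⟨z', hz', hlt⟩ := (hbad _ c1 _ c2).mp c3
    have h5 := hver.2.1 hcand z' hz'
    have := hun (s₅.reg rCa) (s₅.reg rCb) z'
    omega

theorem parse_noReg (r : ℕ) (h : r ∉ [rPos, rC, rLen, rJ]) : parse.NoReg r := by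
  simp only [List.mem_cons, List.not_mem_nil, or_false, not_or] at h
  simp [parse, Cmd.NoReg, h]

/-- The best value found by the main part is the optimum, provided that for every number `B` there
is a round with an admissible guess in which the call of the flow program succeeds. -/
theorem mainCmd_spec (F : SAT.CNF) (p : Program) (q b : ℕ) {w L : ℕ} {s : State}
    (h1 : s.reg 1 = w) (hn : s.reg rNn = F.n) (hM : s.reg rMm = F.clauses.length)
    (hL : s.reg rL = L) (h0 : s.reg rBest = 0) (hin : ∀ i, s.mem 0 i = F.encode.getD i 0)
    (hz : ∀ a i, 0 < a → s.mem a i = 0) (hlen : F.encode.length ≤ 2 ^ w)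
    (hQ : F.n + L + 2 ≤ 2 ^ w) (hw : 2 * (F.n + L) ≤ w) (hw' : F.n - F.n / q + (3 * L + b) ≤ w)
    (hgood : ∀ B, 1 ≤ B → B ≤ F.clauses.length → ∃ n₁ n₂ n₃ e₁ e₂, n₁ + n₂ + n₃ = F.n ∧
      Admissible q F.n L n₁ n₂ n₃ e₁ e₂ ∧ n₁ < F.n + L + 2 ∧ n₂ < F.n + L + 2 ∧
      e₁ < F.n + L + 2 ∧ e₂ < F.n + L + 2 ∧ ∀ τ P,
        P = Gadget.ofTable τ F.n n₁ n₂ n₃ e₁ e₂ F.clauses.length B → ∀ h₁ h₂,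
        (P.inst h₁ h₂).encode.length ≤ 2 ^ w ∧
        Succeeds p (2 ^ w) (2 ^ (F.n - F.n / q + (3 * L + b))) (P.inst h₁ h₂)) :
    IsGreatest (Set.range F.numSatisfied) (((mainCmd p q b).exec s).reg rBest) := by
  set n := F.n with hnn
  set M := F.clauses.length with hMM
  obtain ⟨X, hX⟩ : ∃ X, X = 2 ^ w := ⟨_, rfl⟩
  obtain ⟨Q, hQd⟩ : ∃ Q, Q = n + L + 2 := ⟨_, rfl⟩
  set u := (s.setReg rX X).setReg rQ Q with hu
  set v := parse.exec u with hv
  have parse_noArr : ∀ a, a ≠ 2 → parse.NoArr a := by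
    intro a ha; simp [parse, Cmd.NoArr, ha]
  have hex : (mainCmd p q b).exec s =
      forIter (fun i s => (round p q b).exec (s.setReg rG i)) (Q * Q * Q * Q * M) v := by
    have e1 : (Cmd.set rQ (.min (‡rNn + ‡rL + ♮2) ‡rX)).exec
        ((Cmd.set rX (.pow ‡1)).exec s) = u := by
      simp [Cmd.exec, Exp.eval, BinOp.eval, h1, hn, hL, hu, hX, hQd, hQ]
    have e2 : (‡rQ * ‡rQ * ‡rQ * ‡rQ * ‡rMm : Exp).eval v = Q * Q * Q * Q * M := by
      have e3 : v.reg rQ = Q := by rw [hv, (parse_noReg _ (by simp)).exec]; simp [hu]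
      have e4 : v.reg rMm = M := by rw [hv, (parse_noReg _ (by simp)).exec]; simp [hu, hM]
      simp [Exp.eval, BinOp.eval, e3, e4]
    rw [← e2, hv, ← e1]
    rfl
  have hKn : Knows (fixed w X n M L Q) (v.mem 2) v := by
    refine ⟨fun p hp => ?_, rfl⟩
    have : p.1 ∉ [rPos, rC, rLen, rJ] := by
      have : ∀ p ∈ fixed w X n M L Q, p.1 ∉ [rPos, rC, rLen, rJ] := by simp [fixed]
      exact this p hp
    rw [hv, (parse_noReg _ this).exec]
    revert p
    simp [fixed, hu, h1, hn, hM, hL]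
  have hTab : F.IsTable (v.mem 2) := by
    intro i
    refine parse_spec (p := [F.n, F.clauses.length]) rfl F.words_length_le (X := X) ?_ ?_ ?_ ?_ ?_
      ?_ i
    · simp [hu, hn, hnn]
    · simp [hu, hM, hMM, F.length_words]
    · simp [hu]
    · intro i; rw [← F.encode_eq]; exact hin i
    · rw [← F.encode_eq, hX]; exact hlen
    · intro i; exact hz 2 i (by norm_num)
  generalize hτ : v.mem 2 = τ at hKn hTab
  have hbest0 : v.reg rBest = 0 := by rw [hv, (parse_noReg _ (by simp)).exec]; simp [hu, h0]
  set best : State → ℕ := fun s => s.reg rBest with hbest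
  -- what holds after the first `g` rounds
  set I : ℕ → State → Prop := fun g z => Knows (fixed w X n M L Q) τ z ∧
    (∀ a, 3 ≤ a → ∀ i, g * (2 * X) ≤ i → z.mem a i = 0) ∧
    (z.reg rBest = 0 ∨ ∃ a, z.reg rBest = F.numSatisfied a) ∧
    ∀ g' < g, ∀ n₁ n₂ n₃ e₁ e₂ B, g' % Q = n₁ → g' / Q % Q = n₂ → g' / (Q * Q) % Q = e₁ →
      g' / (Q * Q * Q) % Q = e₂ → g' / (Q * Q * Q * Q) + 1 = B → n₁ + n₂ + n₃ = n →
      Admissible q n L n₁ n₂ n₃ e₁ e₂ →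
      (∀ P, P = Gadget.ofTable τ n n₁ n₂ n₃ e₁ e₂ M B → ∀ h₁ h₂,
        (P.inst h₁ h₂).encode.length ≤ X ∧
        Succeeds p X (2 ^ (n - n / q + (3 * L + b))) (P.inst h₁ h₂)) →
      (∃ x < 2 ^ n₁, ∃ y < 2 ^ n₂, ∃ z < 2 ^ n₃, M < SAT.satCount τ n M n₁ n₂ n₃ x y z + B) →
      M < z.reg rBest + B with hI
  have key : I (Q * Q * Q * Q * M) ((mainCmd p q b).exec s) := by
    rw [hex]
    refine forIter_inv I ⟨hKn, fun a ha i _ => ?_, Or.inl hbest0,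
      fun g' hg' => absurd hg' (by omega)⟩ ?_
    · rw [hv, (parse_noArr a (by omega)).exec]
      exact hz a i (by omega)
    · rintro g hg z ⟨z1, z2, z3, z4⟩
      obtain ⟨r1, r2, r3, r4, r5⟩ := round_spec p q b
        (z1.setReg (x := rG) (by simp [fixed]) g) hg hw hw' hX z2
      rw [State.setReg_reg_ne _ (by norm_num)] at r3 r4
      refine ⟨r1.tail, r2, ?_, fun g' hg' => ?_⟩
      · rcases r4 with h | ⟨n₁, n₂, n₃, x, y, c, h, h'⟩
        · rw [h]; exact z3
        · right
          rw [← hTab.numSatisfied_join h] at h'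
          exact ⟨_, h'⟩
      · rcases Nat.lt_succ_iff_lt_or_eq.mp hg' with h | rfl
        · intro n₁ n₂ n₃ e₁ e₂ B a1 a2 a3 a4 a5 a6 a7 a8 a9
          exact lt_of_lt_of_le (z4 g' h n₁ n₂ n₃ e₁ e₂ B a1 a2 a3 a4 a5 a6 a7 a8 a9)
            (Nat.add_le_add_right r3 _)
        · exact r5
  obtain ⟨-, -, k3, k4⟩ := key
  set best := ((mainCmd p q b).exec s).reg rBest with hbest
  -- for an optimal assignment `a`, the round with `B = M - numSatisfied a + 1` and the right sizes
  -- finds an assignment that leaves fewer than `B` clauses unsatisfied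
  have hle : ∀ a, F.numSatisfied a ≤ M := fun a => List.countP_le_length
  obtain ⟨a, ha⟩ : ∃ a, ∀ a', F.numSatisfied a' ≤ F.numSatisfied a :=
    Finite.exists_max F.numSatisfied
  have hopt : F.numSatisfied a ≤ best := by
    by_contra hlt
    push Not at hlt
    have hB := hle a
    obtain ⟨n₁, n₂, n₃, e₁, e₂, hs, hadm, q1, q2, q3, q4, hor⟩ :=
      hgood (M - F.numSatisfied a + 1) (by omega) (by omega)
    rw [← hQd] at q1 q2 q3 q4
    have hQ0 : 0 < Q := by omega
    obtain ⟨d, hd⟩ : ∃ d, d = M - F.numSatisfied a := ⟨_, rfl⟩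
    rw [← hd] at hor
    have hdM : d < M := by omega
    have D : ∀ x y, y < Q → (x * Q + y) % Q = y ∧ (x * Q + y) / Q = x := fun x y hy => by
      rw [mul_comm, Nat.mul_add_mod, Nat.mod_eq_of_lt hy, Nat.mul_add_div hQ0, Nat.div_eq_of_lt hy]
      exact ⟨rfl, rfl⟩
    -- the code of this guess; `decode` adds one to the leading digit `d`, since `B` is positive
    obtain ⟨g, hg⟩ : ∃ g, g = (((d * Q + e₂) * Q + e₁) * Q + n₂) * Q + n₁ := ⟨_, rfl⟩
    have g0 : g / Q = ((d * Q + e₂) * Q + e₁) * Q + n₂ := by rw [hg, (D _ _ q1).2]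
    have g1 : g / (Q * Q) = (d * Q + e₂) * Q + e₁ := by
      rw [← Nat.div_div_eq_div_mul, g0, (D _ _ q2).2]
    have g2 : g / (Q * Q * Q) = d * Q + e₂ := by
      rw [← Nat.div_div_eq_div_mul, g1, (D _ _ q3).2]
    have g3 : g / (Q * Q * Q * Q) = d := by
      rw [← Nat.div_div_eq_div_mul, g2, (D _ _ q4).2]
    have hgt : g < Q * Q * Q * Q * M := by
      rw [mul_comm]
      exact (Nat.div_lt_iff_lt_mul (by positivity)).mp (g3 ▸ hdM)
    obtain ⟨x, hx, y, hy, z, hz, hj⟩ := F.exists_join hs a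
    have := k4 g hgt n₁ n₂ n₃ e₁ e₂ (d + 1) (by rw [hg, (D _ _ q1).1]) (by rw [g0, (D _ _ q2).1])
      (by rw [g1, (D _ _ q3).1]) (by rw [g2, (D _ _ q4).1]) (by rw [g3]) hs hadm
      (fun P hP h₁ h₂ => by rw [hX]; exact hor τ P hP h₁ h₂)
      ⟨x, hx, y, hy, z, hz, by rw [← hTab.numSatisfied_join hs, hj]; omega⟩
    omega
  constructor
  · rcases k3 with h | ⟨a', h⟩
    · exact ⟨a, by omega⟩
    · exact ⟨a', h.symm⟩
  · rintro _ ⟨a', rfl⟩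
    exact (ha a').trans hopt

end WordRAM

namespace WordRAM

open MaxFlow MaxFlow.Gadget

/-! ### The running time of a round -/

/-- The sizes of the formula and of its parts are at most `Y`. -/
def Small (Y : ℕ) (s : State) : Prop :=
  1 ≤ Y ∧ s.reg rMm ≤ Y ∧ s.reg rNn ≤ Y ∧ s.reg rn₁ ≤ Y ∧ s.reg rn₂ ≤ Y ∧ s.reg rn₃ ≤ Y

/-- The static running time of the command is `O(U)`. -/
def Cmd.Time (c : Cmd) (U : ℕ → State → ℕ) : Prop :=
  ∃ K, ∀ Y s, Small Y s → 1 ≤ U Y s ∧ c.tb s ≤ K * U Y s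

theorem Cmd.Time.mono {c : Cmd} {U U' : ℕ → State → ℕ} (h : c.Time U)
    (hU : ∀ Y s, Small Y s → U Y s ≤ U' Y s) : c.Time U' := by
  obtain ⟨K, hK⟩ := h
  exact ⟨K, fun Y s hs => ⟨(hK Y s hs).1.trans (hU Y s hs),
    (hK Y s hs).2.trans (Nat.mul_le_mul_left _ (hU Y s hs))⟩⟩

theorem Cmd.time_skip : Cmd.skip.Time fun _ _ => 1 := ⟨1, fun _ _ _ => ⟨le_rfl, le_rfl⟩⟩

theorem Cmd.time_set (x : ℕ) (e : Exp) : (Cmd.set x e).Time fun _ _ => 1 :=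
  ⟨e.size + 1, fun _ _ _ => ⟨le_rfl, by simp [Cmd.tb]⟩⟩

theorem Cmd.time_put (a : ℕ) (i v : Exp) : (Cmd.put a i v).Time fun _ _ => 1 :=
  ⟨i.size + v.size + 1, fun _ _ _ => ⟨le_rfl, by simp [Cmd.tb]⟩⟩

theorem Cmd.Time.seq {c c' : Cmd} {U U' : ℕ → State → ℕ} (h : c.Time U) (h' : c'.Time U') :
    (c ;; c').Time fun Y s => U Y s + U' Y s := by
  obtain ⟨K, hK⟩ := h
  obtain ⟨K', hK'⟩ := h'
  refine ⟨K + K', fun Y s hs => ?_⟩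
  obtain ⟨h1, h2⟩ := hK Y s hs
  obtain ⟨h3, h4⟩ := hK' Y s hs
  refine ⟨Nat.le_add_right_of_le h1, ?_⟩
  simp only [Cmd.tb]
  calc c.tb s + c'.tb s ≤ K * U Y s + K' * U' Y s := add_le_add h2 h4
    _ ≤ (K + K') * (U Y s + U' Y s) := by
        nlinarith [Nat.zero_le (K * U' Y s), Nat.zero_le (K' * U Y s)]

theorem Cmd.Time.ite {c c' : Cmd} {U U' : ℕ → State → ℕ} (e : Exp) (h : c.Time U)
    (h' : c'.Time U') : (Cmd.ite e c c').Time fun Y s => U Y s + U' Y s := by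
  obtain ⟨K, hK⟩ := h.seq h'
  refine ⟨e.size + 1 + K, fun Y s hs => ?_⟩
  obtain ⟨h1, h2⟩ := hK Y s hs
  refine ⟨h1, ?_⟩
  simp only [Cmd.tb] at h2 ⊢
  nlinarith [Nat.zero_le e.size]

theorem Cmd.Time.loopFor {c : Cmd} {U : ℕ → State → ℕ} (x : ℕ) {e : Exp} {V : ℕ → State → ℕ}
    (hV : ∀ Y s, Small Y s → 1 ≤ V Y s ∧ e.eval s ≤ V Y s) (h : c.Time U) :
    (Cmd.loopFor x e c).Time fun Y s => V Y s * U Y s := by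
  obtain ⟨K, hK⟩ := h
  refine ⟨e.size + 3 + (K + 6), fun Y s hs => ?_⟩
  obtain ⟨h1, h2⟩ := hK Y s hs
  obtain ⟨h3, h4⟩ := hV Y s hs
  have h5 : 1 ≤ V Y s * U Y s := Nat.mul_pos h3 h1
  refine ⟨h5, ?_⟩
  simp only [Cmd.tb]
  have h6 : e.eval s * (c.tb s + 6) ≤ V Y s * ((K + 6) * U Y s) :=
    Nat.mul_le_mul h4 (by linarith)
  calc e.size + 3 + e.eval s * (c.tb s + 6)
      ≤ (e.size + 3) * (V Y s * U Y s) + V Y s * ((K + 6) * U Y s) :=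
        add_le_add (Nat.le_mul_of_pos_right _ h5) h6
    _ = _ := by ring

theorem satCmd_time (out x lo len : ℕ) (hlen : len ∈ [rn₁, rn₂, rn₃]) :
    (satCmd out x lo len).Time fun Y _ => Y := by
  have h : (satCmd out x lo len).Time fun Y _ => 1 + Y * (1 + 1) := by
    refine (Cmd.time_set _ _).seq (Cmd.Time.loopFor (V := fun Y _ => Y) _ (fun Y s hs => ?_)
      ((Cmd.time_set _ _).ite _ Cmd.time_skip))
    obtain ⟨h0, -, -, h1, h2, h3⟩ := hs
    simp only [List.mem_cons, List.not_mem_nil, or_false] at hlen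
    refine ⟨h0, ?_⟩
    rcases hlen with rfl | rfl | rfl <;> simpa [Exp.eval]
  obtain ⟨K, hK⟩ := h
  refine ⟨K * 3, fun Y s hs => ⟨hs.1, (hK Y s hs).2.trans ?_⟩⟩
  rw [mul_assoc]
  refine Nat.mul_le_mul_left _ ?_
  have := hs.1
  show 1 + Y * (1 + 1) ≤ 3 * Y
  omega

theorem emit_time (e : Exp) : (emit e).Time fun _ _ => 2 :=
  (Cmd.time_put _ _ _).seq (Cmd.time_set _ _)

theorem emitEdge_time (u v c : Exp) : (emitEdge u v c).Time fun _ _ => 6 :=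
  (emit_time u).seq ((emit_time v).seq (emit_time c))

theorem clauses_le (Y : ℕ) (s : State) (h : Small Y s) : 1 ≤ Y ∧ (Exp.var rMm).eval s ≤ Y :=
  ⟨h.1, h.2.1⟩

theorem reg_le_succ (r : ℕ) (Y : ℕ) (s : State) (_ : Small Y s) :
    1 ≤ s.reg r + 1 ∧ (Exp.var r).eval s ≤ s.reg r + 1 := ⟨Nat.le_add_left _ _, Nat.le_succ _⟩

theorem build_time : build.Time fun Y s =>
    9 + (((s.reg rN₁ + 1) * (6 + Y * (Y + 6)) + ((s.reg rN₃ + 1) * (6 + Y * (Y + 18)) +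
      (s.reg rN₂ + 1) * (Y * (Y + 6)))) + ((s.reg rS₁ + 1) * 2 + (s.reg rS₂ + 1) * 2)) := by
  have hs1 := satCmd_time rFl rU rZero rn₁ (by simp)
  have hs2 := satCmd_time rFl rY rLo rn₃ (by simp)
  have hs3 := satCmd_time rFl rV rn₁ rn₂ (by simp)
  refine Cmd.Time.mono ((Cmd.time_set _ _).seq
    (((emit_time _).seq ((emit_time _).seq ((emit_time _).seq (emit_time _)))).seq
    (((((emitEdge_time _ _ _).seq ((hs1.seq (emitEdge_time _ _ _)).loopFor _ clauses_le)).loopFor _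
      (reg_le_succ rN₁)).seq
    ((((emitEdge_time _ _ _).seq ((hs2.seq ((emitEdge_time _ _ _).seq ((emitEdge_time _ _ _).seq
      (emitEdge_time _ _ _)))).loopFor _ clauses_le)).loopFor _ (reg_le_succ rN₃)).seq
    (((hs3.seq (emitEdge_time _ _ _)).loopFor _ clauses_le).loopFor _ (reg_le_succ rN₂)))).seq
    (((emit_time _).loopFor _ (reg_le_succ rS₁)).seq
      ((emit_time _).loopFor _ (reg_le_succ rS₂)))))) fun Y s hs => ?_
  refine le_of_eq ?_
  ring

theorem search_time : search.Time fun Y s =>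
    1 + (s.reg rN₁ + 1) * ((s.reg rN₂ + 1) * (5 + Y * (Y + (Y + 1)))) := by
  have hs1 := satCmd_time rFl rU rZero rn₁ (by simp)
  have hs2 := satCmd_time rFl₂ rV rn₁ rn₂ (by simp)
  refine Cmd.Time.mono ((Cmd.time_set _ _).seq ((((Cmd.time_set _ _).seq
    (((hs1.seq (hs2.seq (Cmd.time_set _ _))).loopFor _ clauses_le).seq (Cmd.Time.ite _
      ((Cmd.time_set _ _).seq ((Cmd.time_set _ _).seq (Cmd.time_set _ _))) Cmd.time_skip))).loopFor
    _ (reg_le_succ rN₂)).loopFor _ (reg_le_succ rN₁))) fun Y s hs => ?_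
  refine Nat.add_le_add_left (Nat.mul_le_mul_left _ (Nat.mul_le_mul_left _ ?_)) _
  omega

theorem verify_time : verify.Time fun Y s =>
    (s.reg rN₃ + 1) * (3 + Y * (Y + (Y + (Y + 2)))) + 1 := by
  have hs1 := satCmd_time rFl rCa rZero rn₁ (by simp)
  have hs2 := satCmd_time rFl₂ rCb rn₁ rn₂ (by simp)
  have hs3 := satCmd_time rFl₃ rY rLo rn₃ (by simp)
  refine Cmd.Time.mono (Cmd.Time.ite _ (((Cmd.time_set _ _).seq
    (((hs1.seq (hs2.seq (hs3.seq ((Cmd.time_set _ _).ite _ Cmd.time_skip)))).loopFor _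
      clauses_le).seq ((Cmd.time_set _ _).ite _ Cmd.time_skip))).loopFor
    _ (reg_le_succ rN₃)) Cmd.time_skip) fun Y s hs => ?_
  refine le_of_eq ?_
  ring

theorem parse_time : parse.Time fun Y _ => 1 + Y * (2 + 2 * Y * 3) := by
  refine Cmd.Time.mono ((Cmd.time_set _ _).seq (((Cmd.time_set _ _).seq ((Cmd.time_set _ _).seq
    (Cmd.Time.loopFor (V := fun Y _ => 2 * Y) _ (fun Y s hs => ?_) (Cmd.Time.ite _
      ((Cmd.time_put _ _ _).seq (Cmd.time_set _ _)) Cmd.time_skip)))).loopFor _ clauses_le))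
    fun Y s hs => ?_
  · have h1 := hs.1
    have h2 := hs.2.2.1
    simp only [Exp.eval, BinOp.eval]
    omega
  · refine Nat.add_le_add_left (Nat.mul_le_mul_left _ ?_) _
    omega

theorem clear_time : ∀ R, ∃ k : ℕ, (clear R).Time fun _ _ => k
  | 0 => ⟨1, Cmd.time_skip⟩
  | R + 1 => by
    obtain ⟨k, hk⟩ := clear_time R
    exact ⟨_, hk.seq (Cmd.time_set _ _)⟩

theorem clear_stable (V : List ℕ) (hV : ∀ r ∈ V, r < 64) : ∀ R, (clear R).Stable V
  | 0 => trivial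
  | R + 1 => ⟨clear_stable V hV R, fun h => by have := hV _ h; omega⟩

/-- The registers that determine the running times. -/
def timing : List ℕ := [rMm, rNn, rn₁, rn₂, rn₃, rN₁, rN₂, rN₃, rS₁, rS₂]

/-- For commands whose loop bounds are not assigned, the static running time bounds the cost. -/
theorem Cmd.Time.cost_le {c : Cmd} {U : ℕ → State → ℕ} (h : c.Time U) (hc : c.Stable timing) :
    ∃ K, ∀ Y s, Small Y s → c.cost s ≤ K * U Y s := by
  obtain ⟨K, hK⟩ := h
  exact ⟨K, fun Y s hs => (hc.cost_le fun _ _ => rfl).trans (hK Y s hs).2⟩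

theorem build_stable : build.Stable timing := by
  simp [build, writeGraph, emit, emitEdge, satCmd, Cmd.Stable, timing, Exp.Over]

theorem search_stable : search.Stable timing := by
  simp [search, satCmd, Cmd.Stable, timing, Exp.Over]

theorem verify_stable : verify.Stable timing := by
  simp [verify, satCmd, Cmd.Stable, timing, Exp.Over]

theorem parse_stable : parse.Stable timing := by
  simp [parse, Cmd.Stable, timing, Exp.Over, Exp.mul_def]

theorem Cmd.Stable.cost_const {c : Cmd} (h : c.Stable []) : ∃ K, ∀ s, c.cost s ≤ K :=
  ⟨c.tb ⟨fun _ => 0, fun _ _ => 0⟩, fun _ => h.cost_le (by simp)⟩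

theorem clear_noReg {r : ℕ} (hr : r < 64) : ∀ R, (clear R).NoReg r
  | 0 => trivial
  | R + 1 => ⟨clear_noReg hr R, show r ≠ 64 + R by omega⟩

theorem clear_noArr (a : ℕ) : ∀ R, (clear R).NoArr a
  | 0 => trivial
  | R + 1 => ⟨clear_noArr a R, trivial⟩

theorem round_noReg (p : Program) (q b : ℕ) {r : ℕ} (hr : r ∈ [rG, 1, rX, rNn, rMm, rL, rQ]) :
    (round p q b).NoReg r := by
  have h1 : r < 64 ∧ r ≠ 2 ∧ r ∉ [rPtr, rU, rV, rC, rY, rFl, rI] ∧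
      r ∉ [rCand, rU, rV, rCnt, rC, rFl, rI, rFl₂, rCa, rCb] ∧
      r ∉ [rY, rCnt, rC, rFl, rI, rFl₂, rFl₃, rBest] ∧ decode.NoReg r ∧ sizes.NoReg r := by
    revert r; simp [decode, sizes, Cmd.NoReg]
  obtain ⟨h1, h2, h3, h4, h5, h6, h7⟩ := h1
  exact ⟨h6, trivial, h7, build_noReg h3,
    ⟨clear_noReg h1 _, show r ≠ 64 by omega, h2⟩, limited_noReg h1 h2 p, search_noReg h4,
    verify_noReg h5⟩

theorem round_knows (p : Program) (q b : ℕ) {τ : ℕ → ℕ} {w X n M L Q g : ℕ} {s : State}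
    (h : Knows ((rG, g) :: fixed w X n M L Q) τ s) :
    Knows ((rG, g) :: fixed w X n M L Q) τ ((round p q b).exec s) := by
  refine h.exec (fun x hx => round_noReg p q b ?_) ?_
  · revert x; simp [fixed]
  · exact ⟨by simp [decode, Cmd.NoArr], trivial, by simp [sizes, Cmd.NoArr],
      build_noArr (by norm_num), ⟨clear_noArr _ _, trivial, trivial⟩,
      limited_noArr (by norm_num) p, search_noArr, verify_noArr⟩

/-- A round takes `O(2 ^ (n - n / q) Y ^ 3)` steps, where `Y` bounds the numbers of variables and of
clauses. -/
theorem round_cost (p : Program) (q b : ℕ) (hq : 3 ≤ q) : ∃ K, ∀ {τ : ℕ → ℕ} {w X n M L Q g Y : ℕ}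
    {s : State}, Knows ((rG, g) :: fixed w X n M L Q) τ s → g < Q * Q * Q * Q * M → n + L ≤ w →
    2 ^ L ≤ Y → n ≤ Y → M ≤ Y → (round p q b).cost s ≤ K * (2 ^ (n - n / q) * Y ^ 3) := by
  obtain ⟨K₁, hK₁⟩ := build_time.cost_le build_stable
  obtain ⟨K₂, hK₂⟩ := search_time.cost_le search_stable
  obtain ⟨K₃, hK₃⟩ := verify_time.cost_le verify_stable
  obtain ⟨k, hk⟩ := clear_time (p.bnd + 1)
  obtain ⟨K₄, hK₄⟩ := hk.cost_le (clear_stable timing (by simp [timing]) _)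
  obtain ⟨K₅, hK₅⟩ := limited_cost p
  obtain ⟨kd, hkd⟩ : ∃ kd, ∀ s, decode.cost s ≤ kd :=
    Cmd.Stable.cost_const (by simp [decode, Cmd.Stable])
  obtain ⟨ks, hks⟩ : ∃ ks, ∀ s, sizes.cost s ≤ ks :=
    Cmd.Stable.cost_const (by simp [sizes, Cmd.Stable])
  obtain ⟨kl, hkl⟩ : ∃ kl, ∀ s, (Cmd.set 64 ‡rPtr ;;
    .set rFuel (.pow (‡rNn - ‡rNn / ♮q + (♮3 * ‡rL + ♮b)))).cost s ≤ kl :=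
    Cmd.Stable.cost_const (by simp [Cmd.Stable])
  refine ⟨kd + ((guard q).size + 2) + (ks + (110 * K₁ + ((K₄ * k + kl) + ((K₅ * 2 ^ b + K₅) +
    (33 * K₂ + 17 * K₃))))), ?_⟩
  intro τ w X n M L Q g Y s hs hg hw hL hnY hMY
  have hY : 1 ≤ Y := Nat.one_le_two_pow.trans hL
  have d1 := decode_spec hs hg
  generalize g % Q = n₁ at d1
  generalize g / Q % Q = n₂ at d1
  generalize g / (Q * Q) % Q = e₁ at d1
  generalize g / (Q * Q * Q) % Q = e₂ at d1
  generalize g / (Q * Q * Q * Q) + 1 = B at d1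
  obtain ⟨s₀, hs₀⟩ : ∃ s₀, s₀ = decode.exec s := ⟨_, rfl⟩
  rw [← hs₀] at d1
  obtain ⟨Z, hZ⟩ : ∃ Z, Z = 2 ^ (n - n / q) := ⟨_, rfl⟩
  rw [← hZ]
  have hZ1 : 1 ≤ Z := hZ ▸ Nat.one_le_two_pow
  obtain ⟨U, hU⟩ : ∃ U, U = Z * Y ^ 3 := ⟨_, rfl⟩
  rw [← hU]
  have hU1 : 1 ≤ U := hU ▸ Nat.mul_pos hZ1 (by positivity)
  have hgd : (guard q).eval s₀ = 0 ↔ Admissible q n L n₁ n₂ (n - (n₁ + n₂)) e₁ e₂ :=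
    guard_eval (d1.get (by simp [fixed])) (d1.get (by simp [fixed])) (d1.get (by simp))
      (d1.get (by simp)) (d1.get (by simp)) (d1.get (by simp)) (d1.get (by simp))
  set rest : Cmd := sizes ;; build ;; launch q b (p.bnd + 1) ;; limited p ;; search ;; verify
  have hc : (round p q b).cost s = decode.cost s + ((guard q).size + 1 +
      (if (guard q).eval s₀ ≠ 0 then 1 else rest.cost s₀)) := by rw [hs₀]; rfl
  suffices h : (guard q).eval s₀ = 0 → rest.cost s₀ ≤ (ks + (110 * K₁ + ((K₄ * k + kl) +
      ((K₅ * 2 ^ b + K₅) + (33 * K₂ + 17 * K₃))))) * U by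
    rw [hc]
    have hd := hkd s
    have : kd + ((guard q).size + 2) ≤ (kd + ((guard q).size + 2)) * U :=
      Nat.le_mul_of_pos_right _ hU1
    rw [add_mul (kd + ((guard q).size + 2))]
    by_cases h0 : (guard q).eval s₀ = 0
    · rw [if_neg (not_not.mpr h0)]
      have := h h0
      omega
    · rw [if_pos h0]
      omega
  intro h0
  have hadm := hgd.mp h0
  obtain ⟨n₃, hn₃⟩ : ∃ n₃, n₃ = n - (n₁ + n₂) := ⟨_, rfl⟩
  rw [← hn₃] at hadm d1
  have hn : n₁ + n₂ + n₃ = n := by have := hadm.1; omega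
  have d2 := sizes_spec d1 hw hadm hn
  obtain ⟨P, hP⟩ : ∃ P, P = Gadget.ofTable τ n n₁ n₂ n₃ e₁ e₂ M B := ⟨_, rfl⟩
  rw [← hP] at d2
  obtain ⟨base, hbase⟩ : ∃ base, base = g * (2 * X) := ⟨_, rfl⟩
  rw [← hbase] at d2
  have dc : Knows (P.consts n n₁ n₂ n₃ X base) τ (sizes.exec s₀) :=
    d2.mono fun p hp => List.mem_append_left _ hp
  have dL : (sizes.exec s₀).reg rL = L := d2.get (by simp [consts, fixed])
  obtain ⟨s₁, hs₁⟩ : ∃ s₁, s₁ = sizes.exec s₀ := ⟨_, rfl⟩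
  obtain ⟨s₂, hs₂⟩ : ∃ s₂, s₂ = build.exec s₁ := ⟨_, rfl⟩
  obtain ⟨s₃, hs₃⟩ : ∃ s₃, s₃ = (launch q b (p.bnd + 1)).exec s₂ := ⟨_, rfl⟩
  obtain ⟨s₄, hs₄⟩ : ∃ s₄, s₄ = (limited p).exec s₃ := ⟨_, rfl⟩
  obtain ⟨s₅, hs₅⟩ : ∃ s₅, s₅ = search.exec s₄ := ⟨_, rfl⟩
  rw [← hs₁] at dc dL
  have hrest : rest.cost s₀ = sizes.cost s₀ + (build.cost s₁ +
      ((launch q b (p.bnd + 1)).cost s₂ + ((limited p).cost s₃ + (search.cost s₄ +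
      verify.cost s₅)))) := by rw [hs₅, hs₄, hs₃, hs₂, hs₁]; rfl
  -- the registers that no later step assigns
  have hregs : ∀ p ∈ P.consts n n₁ n₂ n₃ X base,
      p.1 < 64 ∧ p.1 ≠ rFuel ∧ p.1 ∉ [rPtr, rU, rV, rC, rY, rFl, rI] ∧
      p.1 ∉ [rCand, rU, rV, rCnt, rC, rFl, rI, rFl₂, rCa, rCb] := by
    simp [consts]
  have d₂ : Knows (P.consts n n₁ n₂ n₃ X base) τ s₂ := by
    rw [hs₂]
    exact dc.exec (fun p hp => build_noReg (hregs p hp).2.2.1) (build_noArr (by norm_num))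
  have dL₂ : s₂.reg rL = L := by rw [hs₂, (build_noReg (by simp)).exec, dL]
  have d₄ : Knows (P.consts n n₁ n₂ n₃ X base) τ s₄ := by
    refine ⟨fun p' hp => ?_, ?_⟩
    · obtain ⟨r1, r2, -⟩ := hregs p' hp
      rw [hs₄, (limited_noReg r1 r2 p).exec, hs₃, launch_reg r1 r2]
      exact d₂.1 p' hp
    · rw [hs₄, (limited_noArr (by norm_num) p).exec, hs₃, launch_mem, d₂.2]
  have d₅ : Knows (P.consts n n₁ n₂ n₃ X base) τ s₅ := by
    rw [hs₅]
    exact d₄.exec (fun p hp => search_noReg (hregs p hp).2.2.2) search_noArr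
  have hsmall : ∀ s, Knows (P.consts n n₁ n₂ n₃ X base) τ s → Small Y s ∧ s.reg rN₁ = 2 ^ n₁ ∧
      s.reg rN₂ = 2 ^ n₂ ∧ s.reg rN₃ = 2 ^ n₃ ∧ s.reg rS₁ = 2 ^ e₁ ∧ s.reg rS₂ = 2 ^ e₂ := by
    intro s h
    simp only [Knows, consts, hP, ofTable, List.forall_mem_cons] at h
    obtain ⟨⟨-, -, a1, a2, a3, a4, a5, -, a6, a7, a8, a9, a10, -⟩, -⟩ := h
    exact ⟨⟨hY, by rw [a2]; exact hMY, by rw [a1]; exact hnY, by rw [a3]; omega,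
      by rw [a4]; omega, by rw [a5]; omega⟩, a6, a7, a8, a9, a10⟩
  obtain ⟨a1, a2, a3, a4, a5, a6, a7, a8⟩ := hadm
  -- the third part is the largest one, so the first two have at most `n - n / q` variables
  have hdiv : n / q ≤ n₃ := by
    have : n / q ≤ n / 3 := Nat.div_le_div_left hq (by norm_num)
    omega
  have le3 : 2 ^ n₃ ≤ Z := hZ ▸ Nat.pow_le_pow_right (by norm_num) a8
  have le1 : 2 ^ n₁ ≤ Z := (Nat.pow_le_pow_right (by norm_num) a2).trans le3
  have le2 : 2 ^ n₂ ≤ Z := (Nat.pow_le_pow_right (by norm_num) a3).trans le3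
  have le12 : 2 ^ n₁ * 2 ^ n₂ ≤ Z := by
    rw [← pow_add, hZ]; exact Nat.pow_le_pow_right (by norm_num) (by omega)
  have leS : ∀ e, e ≤ n₃ + L → 2 ^ e ≤ Z * Y := fun e he =>
    (Nat.pow_le_pow_right (by norm_num) he).trans (by rw [pow_add]; exact Nat.mul_le_mul le3 hL)
  have p1 : 1 ≤ 2 ^ n₁ := Nat.one_le_two_pow
  have p2 : 1 ≤ 2 ^ n₂ := Nat.one_le_two_pow
  have p3 : 1 ≤ 2 ^ n₃ := Nat.one_le_two_pow
  have u2 : Z * Y ^ 2 ≤ U := hU ▸ Nat.mul_le_mul_left _ (Nat.pow_le_pow_right hY (by norm_num))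
  have u1 : Z * Y ≤ U := hU ▸ Nat.mul_le_mul_left _ (Nat.le_self_pow (by norm_num) _)
  have yy : Y ≤ Y ^ 2 := Nat.le_self_pow (by norm_num) _
  have m1 : Y * (Y + 6) = Y ^ 2 + 6 * Y := by ring
  have m2 : Y * (Y + 18) = Y ^ 2 + 18 * Y := by ring
  have m3 : Y * (Y + (Y + 1)) = 2 * Y ^ 2 + Y := by ring
  have m4 : Y * (Y + (Y + (Y + 2))) = 3 * Y ^ 2 + 2 * Y := by ring
  have c1 : build.cost s₁ ≤ K₁ * (110 * U) := by
    obtain ⟨b0, b1, b2, b3, b4, b5⟩ := hsmall s₁ dc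
    refine (hK₁ Y s₁ b0).trans (Nat.mul_le_mul_left _ ?_)
    rw [b1, b2, b3, b4, b5]
    have f1 : (2 ^ n₁ + 1) * (6 + Y * (Y + 6)) ≤ (2 * Z) * (13 * Y ^ 2) :=
      Nat.mul_le_mul (by omega) (by omega)
    have f2 : (2 ^ n₃ + 1) * (6 + Y * (Y + 18)) ≤ (2 * Z) * (25 * Y ^ 2) :=
      Nat.mul_le_mul (by omega) (by omega)
    have f3 : (2 ^ n₂ + 1) * (Y * (Y + 6)) ≤ (2 * Z) * (7 * Y ^ 2) :=
      Nat.mul_le_mul (by omega) (by omega)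
    have f4 := leS e₁ a6
    have f5 := leS e₂ a7
    have g1 : (2 * Z) * (13 * Y ^ 2) = 26 * (Z * Y ^ 2) := by ring
    have g2 : (2 * Z) * (25 * Y ^ 2) = 50 * (Z * Y ^ 2) := by ring
    have g3 : (2 * Z) * (7 * Y ^ 2) = 14 * (Z * Y ^ 2) := by ring
    omega
  have c2 : (launch q b (p.bnd + 1)).cost s₂ ≤ K₄ * k + kl := by
    exact add_le_add (hK₄ Y s₂ (hsmall s₂ d₂).1) (hkl _)
  have c3 : (limited p).cost s₃ ≤ (K₅ * 2 ^ b + K₅) * U := by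
    have hf : s₃.reg rFuel ≤ 2 ^ b * U := by
      rw [hs₃, launch_fuel, d₂.get (r := rNn) (v := n) (by simp [consts]), dL₂]
      refine (Nat.pow_le_pow_right (by norm_num) (min_le_left _ _)).trans ?_
      rw [pow_add, pow_add, ← hZ, hU, mul_comm 3 L, pow_mul]
      calc Z * ((2 ^ L) ^ 3 * 2 ^ b) ≤ Z * (Y ^ 3 * 2 ^ b) :=
            Nat.mul_le_mul_left _ (Nat.mul_le_mul_right _ (Nat.pow_le_pow_left hL 3))
        _ = 2 ^ b * (Z * Y ^ 3) := by ring
    calc (limited p).cost s₃ ≤ K₅ * (s₃.reg rFuel - ((limited p).exec s₃).reg rFuel) + K₅ := hK₅ s₃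
      _ ≤ K₅ * (2 ^ b * U) + K₅ * U := add_le_add
          (Nat.mul_le_mul_left _ ((Nat.sub_le _ _).trans hf)) (Nat.le_mul_of_pos_right _ hU1)
      _ = _ := by ring
  have c4 : search.cost s₄ ≤ K₂ * (33 * U) := by
    obtain ⟨b0, b1, b2, -⟩ := hsmall s₄ d₄
    refine (hK₂ Y s₄ b0).trans (Nat.mul_le_mul_left _ ?_)
    rw [b1, b2]
    have f1 : 5 + Y * (Y + (Y + 1)) ≤ 8 * Y ^ 2 := by omega
    have f2 : (2 ^ n₁ + 1) * ((2 ^ n₂ + 1) * (5 + Y * (Y + (Y + 1)))) ≤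
        (2 * 2 ^ n₁) * ((2 * 2 ^ n₂) * (8 * Y ^ 2)) :=
      Nat.mul_le_mul (by omega) (Nat.mul_le_mul (by omega) f1)
    have f3 : (2 * 2 ^ n₁) * ((2 * 2 ^ n₂) * (8 * Y ^ 2)) = 32 * ((2 ^ n₁ * 2 ^ n₂) * Y ^ 2) := by
      ring
    have f4 := Nat.mul_le_mul_right (Y ^ 2) le12
    omega
  have c5 : verify.cost s₅ ≤ K₃ * (17 * U) := by
    obtain ⟨b0, -, -, b3, -⟩ := hsmall s₅ d₅
    refine (hK₃ Y s₅ b0).trans (Nat.mul_le_mul_left _ ?_)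
    rw [b3]
    have f1 : (2 ^ n₃ + 1) * (3 + Y * (Y + (Y + (Y + 2)))) ≤ (2 * Z) * (8 * Y ^ 2) :=
      Nat.mul_le_mul (by omega) (by omega)
    have f3 : (2 * Z) * (8 * Y ^ 2) = 16 * (Z * Y ^ 2) := by ring
    omega
  rw [hrest]
  calc sizes.cost s₀ + (build.cost s₁ + ((launch q b (p.bnd + 1)).cost s₂ +
        ((limited p).cost s₃ + (search.cost s₄ + verify.cost s₅))))
      ≤ ks * U + (K₁ * (110 * U) + ((K₄ * k + kl) * U + ((K₅ * 2 ^ b + K₅) * U +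
        (K₂ * (33 * U) + K₃ * (17 * U))))) := by
        gcongr
        · exact (hks s₀).trans (Nat.le_mul_of_pos_right _ hU1)
        · exact c2.trans (Nat.le_mul_of_pos_right _ hU1)
    _ = _ := by ring

/-- The main part takes `O(2 ^ (n - n / q) Y ^ 8)` steps. -/
theorem mainCmd_cost (p : Program) (q b : ℕ) (hq : 3 ≤ q) : ∃ K, ∀ {w n M L Y : ℕ} {s : State},
    s.reg 1 = w → s.reg rNn = n → s.reg rMm = M → s.reg rL = L → s.reg rn₁ = 0 → s.reg rn₂ = 0 →
    s.reg rn₃ = 0 → n + L ≤ w → n + L + 2 ≤ 2 ^ w → 2 ^ L ≤ Y → n + L + 2 ≤ Y → M ≤ Y →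
    (mainCmd p q b).cost s ≤ K * (2 ^ (n - n / q) * Y ^ 8) := by
  obtain ⟨K₁, hK₁⟩ := parse_time.cost_le parse_stable
  obtain ⟨K₂, hK₂⟩ := round_cost p q b hq
  obtain ⟨k, hk⟩ : ∃ k, ∀ s,
      (Cmd.set rX (.pow ‡1) ;; .set rQ (.min (‡rNn + ‡rL + ♮2) ‡rX)).cost s ≤ k :=
    Cmd.Stable.cost_const (by simp [Cmd.Stable])
  set e : Exp := ‡rQ * ‡rQ * ‡rQ * ‡rQ * ‡rMm with he
  refine ⟨k + K₁ * 9 + (e.size + 3) + (K₂ + 6), ?_⟩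
  intro w n M L Y s h1 hn hM hL z1 z2 z3 hw hQX hLY hnY hMY
  obtain ⟨X, hX⟩ : ∃ X, X = 2 ^ w := ⟨_, rfl⟩
  obtain ⟨Q, hQd⟩ : ∃ Q, Q = n + L + 2 := ⟨_, rfl⟩
  obtain ⟨u, hu⟩ : ∃ u, u = (s.setReg rX X).setReg rQ Q := ⟨_, rfl⟩
  obtain ⟨v, hv⟩ : ∃ v, v = parse.exec u := ⟨_, rfl⟩
  have e1 : (Cmd.set rX (.pow ‡1) ;; .set rQ (.min (‡rNn + ‡rL + ♮2) ‡rX)).exec s = u := by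
    simp [Cmd.exec, Exp.eval, BinOp.eval, h1, hn, hL, hu, hX, hQd, hQX]
  have hKn : Knows (fixed w X n M L Q) (v.mem 2) v := by
    refine ⟨fun p hp => ?_, rfl⟩
    have : p.1 ∉ [rPos, rC, rLen, rJ] := by
      have : ∀ p ∈ fixed w X n M L Q, p.1 ∉ [rPos, rC, rLen, rJ] := by simp [fixed]
      exact this p hp
    rw [hv, (parse_noReg _ this).exec]
    revert p
    simp [fixed, hu, h1, hn, hM, hL]
  generalize v.mem 2 = τ at hKn
  have e2 : e.eval v = Q * Q * Q * Q * M := by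
    simp only [he, Exp.eval, Exp.mul_def, BinOp.eval, hKn.get (r := rQ) (v := Q) (by simp [fixed]),
      hKn.get (r := rMm) (v := M) (by simp [fixed])]
  have hY1 : 1 ≤ Y := by omega
  have hsmall : Small Y u := by
    refine ⟨hY1, ?_, ?_, ?_, ?_, ?_⟩ <;> simp [hu, hM, hn, z1, z2, z3] <;> omega
  have hloop : forCost (fun i s => (round p q b).exec (s.setReg rG i))
      (fun i s => (round p q b).cost (s.setReg rG i) + 6) (Q * Q * Q * Q * M) v ≤
      (Q * Q * Q * Q * M) * (K₂ * (2 ^ (n - n / q) * Y ^ 3) + 6) := by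
    refine forCost_le (fun _ z => Knows (fixed w X n M L Q) τ z) hKn fun g hg z hz => ?_
    have hz' := hz.setReg (x := rG) (by simp [fixed]) g
    exact ⟨(round_knows p q b hz').tail,
      Nat.add_le_add_right (hK₂ hz' hg hw hLY (by omega) hMY) 6⟩
  have hcost : (mainCmd p q b).cost s = (Cmd.set rX (.pow ‡1) ;;
      .set rQ (.min (‡rNn + ‡rL + ♮2) ‡rX)).cost s + (parse.cost u + (e.size + 3 +
      forCost (fun i s => (round p q b).exec (s.setReg rG i))
      (fun i s => (round p q b).cost (s.setReg rG i) + 6) (e.eval v) v)) := by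
    rw [hv, ← e1]
    simp only [mainCmd, Cmd.cost, Cmd.exec, he, add_assoc]
  obtain ⟨V, hV⟩ : ∃ V, V = 2 ^ (n - n / q) * Y ^ 8 := ⟨_, rfl⟩
  have hZ : 1 ≤ 2 ^ (n - n / q) := Nat.one_le_two_pow
  have hV1 : 1 ≤ V := hV ▸ Nat.mul_pos hZ (by positivity)
  have hV2 : Y ^ 2 ≤ V := hV ▸ (Nat.pow_le_pow_right hY1 (by norm_num)).trans
    (Nat.le_mul_of_pos_left _ hZ)
  have c1 : parse.cost u ≤ K₁ * (9 * V) := by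
    refine (hK₁ Y u hsmall).trans (Nat.mul_le_mul_left _ ?_)
    have : 1 + Y * (2 + 2 * Y * 3) ≤ 9 * Y ^ 2 := by nlinarith
    omega
  have c2 : (Q * Q * Q * Q * M) * (K₂ * (2 ^ (n - n / q) * Y ^ 3) + 6) ≤ (K₂ + 6) * V := by
    have f1 : Q * Q * Q * Q * M ≤ Y ^ 5 := by
      calc Q * Q * Q * Q * M ≤ Y * Y * Y * Y * Y := by gcongr <;> omega
        _ = Y ^ 5 := by ring
    have f2 : 6 ≤ 6 * (2 ^ (n - n / q) * Y ^ 3) :=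
      Nat.le_mul_of_pos_right _ (Nat.mul_pos hZ (by positivity))
    calc (Q * Q * Q * Q * M) * (K₂ * (2 ^ (n - n / q) * Y ^ 3) + 6)
        ≤ Y ^ 5 * (K₂ * (2 ^ (n - n / q) * Y ^ 3) + 6 * (2 ^ (n - n / q) * Y ^ 3)) :=
          Nat.mul_le_mul f1 (Nat.add_le_add_left f2 _)
      _ = (K₂ + 6) * V := by rw [hV]; ring
  rw [hcost, e2, ← hV]
  calc _ ≤ k * V + (K₁ * (9 * V) + ((e.size + 3) * V + (K₂ + 6) * V)) := by
        gcongr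
        · exact (hk s).trans (Nat.le_mul_of_pos_right _ hV1)
        · exact Nat.le_mul_of_pos_right _ hV1
        · exact hloop.trans c2
    _ = _ := by ring

/-! ### The complete program -/

/-- The word length that the program works with. -/
def widthExp (a b' : ℕ) : Exp := ♮a * (‡rNn + ‡rL) + ♮b'

/-- The whole program: the flow program is `p`, and the output is `e`. -/
def reduction (p : Program) (q b a b' : ℕ) (e : Exp) : Program :=
  .seq (prologue.comp (65 + p.bnd)) (.seq (.seq ((widthExp a b').comp (65 + p.bnd))
    (.arith .land 1 (65 + p.bnd) (65 + p.bnd)))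
    ((mainCmd p q b ;; .put 1 ♮0 e).comp (65 + p.bnd)))

/-- The prologue takes time linear in the numbers of variables and of clauses. -/
theorem prologue_cost : ∃ K, ∀ s Y, 1 ≤ Y → s.mem 0 0 ≤ Y → s.mem 0 1 ≤ Y → s.reg rn₁ = 0 →
    s.reg rn₂ = 0 → s.reg rn₃ = 0 → prologue.cost s ≤ K * Y := by
  obtain ⟨c, hc⟩ : ∃ c, c = Cmd.loopFor rI ‡rMm
    (.ite (‡rMm >>> ‡rI) (.set rL (.min (‡rI + ♮1) ‡rMm)) .skip) := ⟨_, rfl⟩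
  have ht : c.Time fun Y _ => Y * 2 := by
    rw [hc]
    refine Cmd.Time.mono (Cmd.Time.loopFor _ clauses_le (Cmd.Time.ite _ (Cmd.time_set _ _)
      Cmd.time_skip)) fun Y s hs => le_of_eq ?_
    ring
  have hst : c.Stable timing := by
    rw [hc]
    simp [Cmd.Stable, timing, Exp.Over]
  obtain ⟨K, hK⟩ := ht.cost_le hst
  obtain ⟨k, hk⟩ : ∃ k, ∀ s, (Cmd.set rNn (.idx 0 ♮0) ;; .set rMm (.idx 0 ♮1)).cost s ≤ k :=
    Cmd.Stable.cost_const (by simp [Cmd.Stable])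
  refine ⟨k + 2 * K, fun s Y hY h0 h1 z1 z2 z3 => ?_⟩
  obtain ⟨u, hu⟩ : ∃ u, u = (Cmd.set rNn (.idx 0 ♮0) ;; .set rMm (.idx 0 ♮1)).exec s := ⟨_, rfl⟩
  have h2 : prologue.cost s =
      (Cmd.set rNn (.idx 0 ♮0) ;; .set rMm (.idx 0 ♮1)).cost s + c.cost u := by
    rw [hu, hc]
    simp only [prologue, Cmd.cost, Cmd.exec]
    ring
  have hS : Small Y u := by
    rw [hu]
    simp [Small, Cmd.exec, Exp.eval, z1, z2, z3, hY, h0, h1]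
  have h3 := hK Y u hS
  have h4 := hk s
  rw [h2]
  calc _ ≤ k * Y + K * (2 * Y) := add_le_add (h4.trans (Nat.le_mul_of_pos_right _ hY))
        (h3.trans (Nat.mul_le_mul_left _ (by omega)))
    _ = (k + 2 * K) * Y := by ring

theorem prologue_noReg {r : ℕ} (h : r ∉ [rNn, rMm, rI, rL]) : prologue.NoReg r := by
  simp only [List.mem_cons, List.not_mem_nil, or_false, not_or] at h
  simp [prologue, Cmd.NoReg, h]

theorem prologue_noArr (a : ℕ) : prologue.NoArr a := by simp [prologue, Cmd.NoArr]

theorem mainCmd_noReg (p : Program) (q b : ℕ) : (mainCmd p q b).NoReg rMm := by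
  refine ⟨by simp [Cmd.NoReg], by simp [Cmd.NoReg], by simp [parse, Cmd.NoReg], by norm_num, ?_⟩
  exact round_noReg p q b (by simp)

/-- The words of the input, and its length, have `n + L + 2` bits, because a clause has no repeated
literals. -/
theorem _root_.SAT.CNF.encode_le (F : SAT.CNF) {L : ℕ} (hL : F.clauses.length < 2 ^ L) :
    F.encode.length ≤ 2 ^ (F.n + L + 2) ∧ ∀ v ∈ F.encode, v ≤ 2 ^ (F.n + L + 2) := by
  have hn : F.n < 2 ^ F.n := Nat.lt_two_pow_self
  have h1 : 1 ≤ 2 ^ F.n := Nat.one_le_two_pow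
  have h2 : 1 ≤ 2 ^ L := Nat.one_le_two_pow
  have e1 : 2 ^ (F.n + L + 2) = 4 * (2 ^ F.n * 2 ^ L) := by rw [pow_add, pow_add]; ring
  have e2 : 2 ^ F.n ≤ 2 ^ F.n * 2 ^ L := Nat.le_mul_of_pos_right _ h2
  have e3 : 2 ^ L ≤ 2 ^ F.n * 2 ^ L := Nat.le_mul_of_pos_left _ h1
  have hlen : ∀ c ∈ F.words, c.length ≤ 2 * F.n := F.words_length_le
  have hlt : ∀ c ∈ F.words, ∀ l ∈ c, l < 2 * F.n := F.words_lt
  rw [F.encode_eq, e1]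
  constructor
  · have : (F.words.flatMap fun c => c.length :: c).length ≤ F.words.length * (1 + 2 * F.n) := by
      rw [List.length_flatMap]
      refine (List.sum_le_card_nsmul _ (1 + 2 * F.n) ?_).trans (by simp)
      intro x hx
      obtain ⟨c, hc, rfl⟩ := List.mem_map.mp hx
      have := hlen c hc
      simp only [List.length_cons]
      omega
    rw [F.length_words] at this
    simp only [List.length_append, List.length_cons, List.length_nil]
    have h3 : (F.clauses.length + 1) * (1 + 2 * F.n) ≤ 2 ^ L * (2 * 2 ^ F.n) :=
      Nat.mul_le_mul hL (by omega)
    have h4 : 2 ^ L * (2 * 2 ^ F.n) = 2 * (2 ^ F.n * 2 ^ L) := by ring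
    rw [add_mul, one_mul] at h3
    omega
  · intro v hv
    simp only [List.cons_append, List.nil_append, List.mem_cons, List.mem_flatMap] at hv
    rcases hv with rfl | rfl | ⟨c, hc, rfl | hv⟩
    · omega
    · omega
    · have := hlen c hc; omega
    · have := hlt c hc v hv; omega

/-- Correctness, running time and word length of the whole program. -/
theorem reduction_runs (p : Program) (q b a b' : ℕ) (e : Exp) (hq : 3 ≤ q) (ha : 3 ≤ a)
    (hb' : b + 2 ≤ b') (he : ∀ D E, 65 ≤ D → 60 ≤ E → e.Wf D regCls arrCls E)
    (heu : e.ub regCls arrCls ≤ 1) :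
    ∃ K E, ∀ F : SAT.CNF, (∀ L, F.clauses.length < 2 ^ L → 2 ^ L ≤ 2 * F.clauses.length + 1 →
      ∀ B, 1 ≤ B → B ≤ F.clauses.length → ∃ n₁ n₂ n₃ e₁ e₂, n₁ + n₂ + n₃ = F.n ∧
        Admissible q F.n L n₁ n₂ n₃ e₁ e₂ ∧ n₁ < F.n + L + 2 ∧ n₂ < F.n + L + 2 ∧
        e₁ < F.n + L + 2 ∧ e₂ < F.n + L + 2 ∧ ∀ τ P,
          P = Gadget.ofTable τ F.n n₁ n₂ n₃ e₁ e₂ F.clauses.length B → ∀ h₁ h₂,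
          (P.inst h₁ h₂).encode.length ≤ 2 ^ (a * (F.n + L) + b') ∧
          Succeeds p (2 ^ (a * (F.n + L) + b')) (2 ^ (F.n - F.n / q + (3 * L + b)))
            (P.inst h₁ h₂)) →
      ∃ L t z s', F.clauses.length < 2 ^ L ∧ 2 ^ L ≤ 2 * F.clauses.length + 1 ∧
        t ≤ K * (2 ^ (F.n - F.n / q) * (F.n + F.clauses.length + 1) ^ 8) ∧
        Runs ((2 ^ (a * (F.n + L) + b')) ^ E + 1) (reduction p q b a b' e) (initState F.encode) t
          s' ∧
        IsGreatest (Set.range F.numSatisfied) (z.reg rBest) ∧ z.reg rMm = F.clauses.length ∧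
        s'.mem 1 0 = e.eval z ∧ 1 ≤ E := by
  obtain ⟨K₀, hK₀⟩ := prologue_cost
  obtain ⟨K₁, hK₁⟩ := mainCmd_cost p q b hq
  obtain ⟨D, hD⟩ : ∃ D, D = 65 + p.bnd := ⟨_, rfl⟩
  obtain ⟨E, hE⟩ : ∃ E, E = 60 + q + b + p.bnd + a + b' := ⟨_, rfl⟩
  refine ⟨(K₀ + ((widthExp a b').size + 1) + (K₁ + ((Exp.lit 0).size + e.size + 1))) * 4 ^ 8, E,
    fun F hgood => ?_⟩
  obtain ⟨n, hn⟩ : ∃ n, n = F.n := ⟨_, rfl⟩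
  obtain ⟨M, hM⟩ : ∃ M, M = F.clauses.length := ⟨_, rfl⟩
  obtain ⟨s, hs⟩ : ∃ s, s = initState F.encode := ⟨_, rfl⟩
  have sreg : ∀ r, r ≠ 0 → s.reg r = 0 := fun r hr => by rw [hs]; simp [initState, hr]
  have smem0 : ∀ i, s.mem 0 i = F.encode.getD i 0 := fun i => by rw [hs]; simp [initState]
  have smem : ∀ a i, 0 < a → s.mem a i = 0 := fun a i ha => by
    rw [hs]; simp [initState, Nat.pos_iff_ne_zero.mp ha]
  have s0 : s.mem 0 0 = n := by rw [smem0, hn]; simp [SAT.CNF.encode]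
  have s1 : s.mem 0 1 = M := by rw [smem0, hM]; simp [SAT.CNF.encode]
  obtain ⟨L, hL1, hL2, pn, pM, pL⟩ := prologue_spec s (sreg _ (by norm_num))
  rw [s1] at hL1 hL2 pM
  rw [s0] at pn
  rw [hM] at hL1 hL2
  obtain ⟨hlen, hval⟩ := F.encode_le hL1
  specialize hgood L hL1 hL2
  rw [← hM] at hL1 hL2
  obtain ⟨w, hw⟩ : ∃ w, w = a * (n + L) + b' := ⟨_, rfl⟩
  have hw3 : 3 * (n + L) + b + 2 ≤ w := by
    rw [hw]
    have := Nat.mul_le_mul_right (n + L) ha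
    omega
  obtain ⟨X, hX⟩ : ∃ X, X = 2 ^ w := ⟨_, rfl⟩
  have hX4 : 2 ^ (n + L + 2) ≤ X := hX ▸ Nat.pow_le_pow_right (by norm_num) (by omega)
  have hnL : n + L + 2 < 2 ^ (n + L + 2) := Nat.lt_two_pow_self
  have hwX : w ≤ X := hX ▸ Nat.lt_two_pow_self.le
  have hX2 : 2 ≤ X := by omega
  have hXpow : ∀ k, 1 ≤ X ^ k := fun k => Nat.one_le_pow _ _ (by omega)
  rw [← hn] at hlen hval
  have good₀ : Good X regCls arrCls s := by
    refine ⟨hX2, fun r => ?_, fun c i => ?_, ?_⟩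
    · by_cases hr : r = 0
      · subst hr
        rw [hs]
        simpa [initState, regCls] using hlen.trans hX4
      · rw [sreg r hr]; exact Nat.zero_le _
    · rcases Nat.eq_zero_or_pos c with rfl | hc
      · rw [smem0]
        have : arrCls 0 = 1 := rfl
        rw [this, pow_one]
        rcases lt_or_ge i F.encode.length with hi | hi
        · rw [List.getD_eq_getElem _ _ hi]
          exact (hval _ (List.getElem_mem hi)).trans hX4
        · rw [List.getD_eq_default _ _ hi]; exact Nat.zero_le _
      · rw [smem c i hc]; exact Nat.zero_le _
    · rw [sreg 1 (by norm_num)]; simpa using (by omega : 1 ≤ X)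
  have wf₁ : prologue.Wf D regCls arrCls E := prologue_wf (by omega) (by omega)
  obtain ⟨t₁, ht₁, u₁, r₁, a₁, -⟩ := prologue.comp_runs wf₁ D s s le_rfl good₀ (Agree.refl D s)
  obtain ⟨y, hy⟩ : ∃ y, y = prologue.exec s := ⟨_, rfl⟩
  rw [← hy] at pn pM pL a₁
  have good₁ : Good X regCls arrCls y := hy ▸ wf₁.good good₀
  have wfw : (widthExp a b').Wf D regCls arrCls E := by
    simp [widthExp, Exp.Wf, Exp.ub, Exp.add_def, Exp.mul_def, regCls]
    omega
  have ew : (widthExp a b').eval y = w := by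
    simp [widthExp, Exp.eval, Exp.add_def, Exp.mul_def, BinOp.eval, pn, pL, hw]
  obtain ⟨ew', okw⟩ := (widthExp a b').eval_congr a₁ (wfw.ok good₁)
  obtain ⟨u₂, r₂, v₂, a₂⟩ := (widthExp a b').comp_runs D _ D u₁ le_rfl okw
  rw [ew', ew] at v₂
  obtain ⟨z, hz⟩ : ∃ z, z = y.setReg 1 w := ⟨_, rfl⟩
  have zreg : ∀ r, r ≠ 1 → z.reg r = y.reg r := fun r hr => by
    rw [hz, State.setReg_reg_ne _ hr]
  have yreg : ∀ r, r ≠ 0 → r ∉ [rNn, rMm, rI, rL] → y.reg r = 0 := fun r hr h => by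
    rw [hy, (prologue_noReg h).exec, sreg r hr]
  have z1 : z.reg 1 = w := by rw [hz, State.setReg_reg_self]
  have zmem : z.mem = s.mem := by
    rw [hz, State.setReg_mem, hy]
    funext c
    exact (prologue_noArr c).exec s
  have good₂ : Good X regCls arrCls z := by
    refine ⟨hX2, fun r => ?_, fun c i => ?_, ?_⟩
    · by_cases hr : r = 1
      · subst hr
        rw [z1]
        simpa [regCls] using hwX
      · rw [zreg r hr]; exact good₁.reg_le r
    · rw [zmem]; exact good₀.mem_le c i
    · rw [z1, hX]
  have hlandv : BinOp.eval .land (u₂.reg D) (u₂.reg D) = w := by simp [BinOp.eval, v₂]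
  have r₃ := Runs.arith (W := X ^ E + 1) u₂ .land 1 D D (by
    rw [hlandv]
    have : X ^ 1 ≤ X ^ E := Nat.pow_le_pow_right (by omega) (by omega)
    rw [pow_one] at this
    omega)
  rw [hlandv] at r₃
  have a₃ : Agree D z (u₂.setReg 1 w) := by
    rw [hz]
    exact (a₁.trans a₂).setReg 1 w
  have wf₃ : (mainCmd p q b ;; .put 1 ♮0 e).Wf D regCls arrCls E := by
    refine ⟨mainCmd_wf (by omega) (by omega), Nat.zero_le _, he D E (by omega) (by omega), heu⟩
  obtain ⟨t₄, ht₄, u₄, r₄, a₄, -⟩ := Cmd.comp_runs _ wf₃ D z _ le_rfl good₂ a₃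
  obtain ⟨x, hx⟩ : ∃ x, x = (mainCmd p q b).exec z := ⟨_, rfl⟩
  have spec := mainCmd_spec F p q b (w := w) (L := L) (s := z) z1
    (by rw [zreg _ (by norm_num), pn, hn]) (by rw [zreg _ (by norm_num), pM, hM])
    (by rw [zreg _ (by norm_num), pL])
    (by rw [zreg _ (by norm_num), yreg _ (by norm_num) (by simp)])
    (fun i => by rw [zmem, smem0]) (fun c i hc => by rw [zmem, smem c i hc])
    (by rw [← hX]; exact hlen.trans hX4) (by rw [← hn, ← hX]; omega) (by rw [← hn]; omega)
    (by rw [← hn]; have := Nat.sub_le n (n / q); omega) (by rw [hw, hn]; exact hgood)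
  have zz : ∀ r, r ∈ [rn₁, rn₂, rn₃] → z.reg r = 0 := fun r hr => by
    simp only [List.mem_cons, List.not_mem_nil, or_false] at hr
    rw [zreg r (by omega), yreg r (by omega) (by
      simp only [List.mem_cons, List.not_mem_nil, or_false]; omega)]
  obtain ⟨Y, hY⟩ : ∃ Y, Y = 4 * (n + M + 1) := ⟨_, rfl⟩
  have hLlt : L < 2 ^ L := Nat.lt_two_pow_self
  have c₁ := hK₀ s Y (by omega) (by omega) (by omega) (sreg _ (by norm_num)) (sreg _ (by norm_num))
    (sreg _ (by norm_num))
  have c₄ := hK₁ (w := w) (n := n) (M := M) (L := L) (Y := Y) (s := z) z1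
    (by rw [zreg _ (by norm_num), pn]) (by rw [zreg _ (by norm_num), pM])
    (by rw [zreg _ (by norm_num), pL]) (zz _ (by simp)) (zz _ (by simp)) (zz _ (by simp))
    (by omega) (by rw [← hX]; omega) (by omega) (by omega) (by omega)
  refine ⟨L, t₁ + ((widthExp a b').size + 1 + t₄), x, u₄, hM ▸ hL1, hM ▸ hL2, ?_, ?_,
    hx ▸ spec, ?_, ?_, by omega⟩
  rotate_left
  · rw [← hn, ← hs, ← hw, ← hX, reduction, ← hD]
    exact .seq r₁ (.seq (.seq r₂ r₃) r₄)
  · rw [hx, (mainCmd_noReg p q b).exec, zreg _ (by norm_num), pM, hM]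
  · rw [← a₄.1, hx]
    simp [Cmd.exec, State.setMem_mem, Exp.eval]
  · rw [← hM, ← hn]
    have h1 : Y ^ 8 = 4 ^ 8 * (n + M + 1) ^ 8 := by rw [hY, mul_pow]
    obtain ⟨T, hT⟩ : ∃ T, T = 2 ^ (n - n / q) * Y ^ 8 := ⟨_, rfl⟩
    have hp : 1 ≤ 2 ^ (n - n / q) := Nat.one_le_two_pow
    have h2 : Y ≤ T := by
      rw [hT]
      exact (Nat.le_self_pow (by norm_num) Y).trans (Nat.le_mul_of_pos_left _ hp)
    have h3 : (K₀ + ((widthExp a b').size + 1) + (K₁ + ((Exp.lit 0).size + e.size + 1))) * 4 ^ 8 *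
        (2 ^ (n - n / q) * (n + M + 1) ^ 8) =
        (K₀ + ((widthExp a b').size + 1) + (K₁ + ((Exp.lit 0).size + e.size + 1))) * T := by
      rw [hT, h1]; ring
    rw [← hT] at c₄
    have h4 : K₀ * Y ≤ K₀ * T := Nat.mul_le_mul_left _ h2
    have h5 : (mainCmd p q b ;; .put 1 ♮0 e).cost z =
        (mainCmd p q b).cost z + ((Exp.lit 0).size + e.size + 1) := rfl
    have h6 : ∀ k, k ≤ k * T := fun k => Nat.le_mul_of_pos_right _ (by omega)
    have h7 := h6 ((widthExp a b').size + 1)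
    have h8 := h6 ((Exp.lit 0).size + e.size + 1)
    rw [h3, add_mul (K₀ + _), add_mul K₀, add_mul K₁]
    omega

end WordRAM

namespace MaxFlow

/-! ### The sizes of the graphs -/

/-- Bounds without logarithmic factors suffice, as `1 ≤ log (f + 2)`. -/
theorem ThetaTilde.of_le {K : ℕ} {a f : ℝ} (ha : 0 ≤ a) (hf : 1 ≤ f) (h₁ : f ≤ K * a)
    (h₂ : a ≤ K * f) : ThetaTilde K a f := by
  have h3 : (1 : ℝ) ≤ Real.log (f + 2) := by
    rw [Real.le_log_iff_exp_le (by linarith)]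
    linarith [Real.exp_one_lt_d9]
  have h4 : (1 : ℝ) ≤ Real.log (f + 2) ^ K := one_le_pow₀ h3
  exact ⟨h₁.trans (le_mul_of_one_le_right (by positivity) h4),
    h₂.trans (le_mul_of_one_le_right (by positivity) h4)⟩

/-- Sizes within a factor of two of `Z ^ c` are within a constant factor of `n ^ c` when `Z` and `n`
are within constant factors of each other. -/
theorem thetaTilde_rpow {n Z S : ℕ} {c : ℝ} (hc : c ∈ Set.Icc (0 : ℝ) 1) (hn : 0 < n)
    (h₁ : Z ≤ 3 * n) (h₂ : n ≤ 9 * Z) (hS : (Z : ℝ) ^ c ≤ S) (hS' : (S : ℝ) ≤ 2 * (Z : ℝ) ^ c) :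
    ThetaTilde 10 S ((n : ℝ) ^ c) := by
  have key : ∀ {x y k : ℝ}, 0 ≤ x → 0 ≤ y → 1 ≤ k → x ≤ k * y → x ^ c ≤ k * y ^ c := by
    intro x y k hx hy hk h
    calc x ^ c ≤ (k * y) ^ c := Real.rpow_le_rpow hx h hc.1
      _ = k ^ c * y ^ c := Real.mul_rpow (by linarith) hy
      _ ≤ k * y ^ c := by
          refine mul_le_mul_of_nonneg_right ?_ (Real.rpow_nonneg hy c)
          exact (Real.rpow_le_rpow_of_exponent_le hk hc.2).trans_eq (Real.rpow_one k)
  have n1 : (1 : ℝ) ≤ n := by exact_mod_cast hn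
  have k1 := key (x := n) (y := Z) (k := 9) (by positivity) (by positivity) (by norm_num)
    (by exact_mod_cast h₂)
  have k2 := key (x := Z) (y := n) (k := 3) (by positivity) (by positivity) (by norm_num)
    (by exact_mod_cast h₁)
  have hf : 1 ≤ (n : ℝ) ^ c := Real.one_le_rpow n1 hc.1
  have hs : (0 : ℝ) ≤ S := by positivity
  refine ThetaTilde.of_le hs hf ?_ ?_
  · push_cast
    linarith
  · push_cast
    linarith

namespace Gadget

variable {P : Gadget} {h₁ : P.N₁ ≤ P.S₁} {h₂ : P.N₂ ≤ P.S₂} {Z : ℕ}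

theorem inst_edges_length : (P.inst h₁ h₂).edges.length =
    P.N₁ * (1 + P.M) + (P.N₃ * (1 + 3 * P.M) + P.N₂ * P.M) := by
  rw [← P.length_edges]
  exact List.length_map _

theorem inst_S_length : (P.inst h₁ h₂).S.length = P.S₁ := by simp [inst]

theorem inst_T_length : (P.inst h₁ h₂).T.length = P.S₂ := by simp [inst]

/-- The requirements on the parameters under which all sizes are governed by the number `Z`. -/
structure Balanced (P : Gadget) (Z : ℕ) : Prop where
  one_le_M : 1 ≤ P.M
  one_le_N₃ : 1 ≤ P.N₃
  N₁_le : P.N₁ ≤ P.N₃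
  N₂_le : P.N₂ ≤ P.N₃
  S₁_le : P.S₁ ≤ Z
  S₂_le : P.S₂ ≤ Z
  mul_le : P.N₃ * P.M ≤ Z
  le_mul : Z ≤ 3 * (P.N₃ * P.M)

/-- The number of nodes, the number of edges and the length of the encoding are linear in `Z`. -/
theorem Balanced.size_bounds (h : P.Balanced Z) : Z ≤ 3 * P.size ∧ P.size ≤ 9 * Z ∧
    (P.inst h₁ h₂).edges.length ≤ 7 * (P.N₃ * P.M) ∧
    3 * (P.N₃ * P.M) ≤ (P.inst h₁ h₂).edges.length ∧
    (P.inst h₁ h₂).encode.length ≤ 27 * Z := by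
  obtain ⟨hM, hN, a1, a2, b1, b2, c1, c2⟩ := h
  obtain ⟨x, hx⟩ : ∃ x, x = P.N₃ * P.M := ⟨_, rfl⟩
  have e1 : P.N₃ ≤ x := hx ▸ Nat.le_mul_of_pos_right _ hM
  have e2 : P.M ≤ x := hx ▸ Nat.le_mul_of_pos_left _ hN
  have e3 : P.N₁ * P.M ≤ x := hx ▸ Nat.mul_le_mul_right _ a1
  have e4 : P.N₂ * P.M ≤ x := hx ▸ Nat.mul_le_mul_right _ a2
  have e5 : P.N₁ * (1 + P.M) = P.N₁ + P.N₁ * P.M := by ring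
  have e6 : P.N₃ * (1 + 3 * P.M) = P.N₃ + 3 * x := by rw [hx]; ring
  have h1 : (P.inst h₁ h₂).edges.length = _ := inst_edges_length
  have h2 : (P.inst h₁ h₂).encode.length =
      4 + 3 * (P.inst h₁ h₂).edges.length + P.S₁ + P.S₂ := by
    rw [Instance.encode_eq]
    simp only [List.length_append, List.length_map, List.length_flatMap, List.length_cons,
      List.length_nil, inst_S_length, inst_T_length]
    simp
    ring
  rw [← hx] at c1 c2 ⊢
  rw [h2, h1, size, e5, e6, ← hx]
  omega

/-- Balanced graphs with about `Z ^ c₁` sources and `Z ^ c₂` sinks are admissible inputs of the flow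
program. -/
theorem Balanced.sparse (h : P.Balanced Z) {c₁ c₂ : ℝ} (hc₁ : c₁ ∈ Set.Icc (0 : ℝ) 1)
    (hc₂ : c₂ ∈ Set.Icc (0 : ℝ) 1) (hB : 1 ≤ P.B) (hB' : P.B ≤ P.M)
    (hS : (Z : ℝ) ^ c₁ ≤ P.S₁) (hS' : (P.S₁ : ℝ) ≤ 2 * (Z : ℝ) ^ c₁)
    (hT : (Z : ℝ) ^ c₂ ≤ P.S₂) (hT' : (P.S₂ : ℝ) ≤ 2 * (Z : ℝ) ^ c₂) :
    (P.inst h₁ h₂).Sparse c₁ c₂ 10 := by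
  obtain ⟨z1, z2, z3, z4, -⟩ := h.size_bounds (h₁ := h₁) (h₂ := h₂)
  have hx : P.N₃ * P.M ≤ P.size := by unfold size; omega
  have hZ : 0 < Z := by
    have := P.size_pos
    omega
  have hBs : P.B ≤ P.size := by unfold size; omega
  have pos : ∀ {S : ℕ} {c : ℝ}, (Z : ℝ) ^ c ≤ S → 0 < S := fun {S c} hS => by
    have : (0 : ℝ) < (Z : ℝ) ^ c := Real.rpow_pos_of_pos (by exact_mod_cast hZ) c
    exact_mod_cast this.trans_le hS
  refine ⟨?_, ?_, ?_, ?_, ?_, ?_, ?_⟩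
  · change _ ≤ 10 * P.size
    omega
  · change P.size ≤ 10 * _
    have := h.le_mul
    omega
  · intro e he
    obtain ⟨e', he', rfl⟩ := List.mem_map.mp he
    have := P.size_pos
    rcases P.mem_edges.mp he' with ⟨x, -, rfl | ⟨c, -, rfl⟩⟩ |
      ⟨y, -, rfl | ⟨c, -, rfl | rfl | rfl⟩⟩ | ⟨x, -, c, -, rfl⟩ <;> simp only [inst] <;> omega
  · rw [← List.length_pos_iff, inst_S_length]
    exact pos hS
  · rw [← List.length_pos_iff, inst_T_length]
    exact pos hT
  · rw [inst_S_length]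
    exact thetaTilde_rpow hc₁ P.size_pos z1 z2 hS hS'
  · rw [inst_T_length]
    exact thetaTilde_rpow hc₂ P.size_pos z1 z2 hT hT'

end Gadget

end MaxFlow

namespace WordRAM

open MaxFlow MaxFlow.Gadget

/-! ### The right guess -/

/-- The sizes for which all three parts of the graph are balanced, for the exponents `c₁`, `c₂`:
the third family has a share of `1 / (1 + c₁ + c₂)` of the variables. -/
theorem exists_sizes {ε c₁ c₂ : ℝ} {q : ℕ} (hqε : 1 / (q : ℝ) ≤ ε)
    (hc₁ : c₁ ∈ Set.Icc (0 : ℝ) 1) (hc₂ : c₂ ∈ Set.Icc (0 : ℝ) 1)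
    (hκ : 1 ≤ (1 + c₁ + c₂) * (1 - ε)) (n L : ℕ) :
    ∃ n₁ n₂ n₃ e₁ e₂ : ℕ, n₁ + n₂ + n₃ = n ∧ Admissible q n L n₁ n₂ n₃ e₁ e₂ ∧
      c₁ * (n₃ + L : ℕ) ≤ e₁ ∧ (e₁ : ℝ) ≤ c₁ * (n₃ + L : ℕ) + 1 ∧
      c₂ * (n₃ + L : ℕ) ≤ e₂ ∧ (e₂ : ℝ) ≤ c₂ * (n₃ + L : ℕ) + 1 ∧
      (1 + c₁ + c₂) * n₃ ≤ n + 3 := by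
  obtain ⟨a1, a2⟩ := hc₁
  obtain ⟨b1, b2⟩ := hc₂
  obtain ⟨κ, hκd⟩ : ∃ κ, κ = 1 / (1 + c₁ + c₂) := ⟨_, rfl⟩
  have hs : 0 < 1 + c₁ + c₂ := by linarith
  have κ0 : 0 ≤ κ := by rw [hκd]; positivity
  have κ1 : (1 + c₁ + c₂) * κ = 1 := by rw [hκd]; field_simp
  have κε : κ ≤ 1 - ε := by
    rw [hκd, div_le_iff₀ hs]
    linarith
  have hn0 : (0 : ℝ) ≤ n := by positivity
  have t0 : 0 ≤ κ * n := mul_nonneg κ0 hn0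
  obtain ⟨n₃, hn₃⟩ : ∃ n₃, n₃ = ⌈κ * n⌉₊ := ⟨_, rfl⟩
  have u1 : κ * n ≤ n₃ := hn₃ ▸ Nat.le_ceil _
  have u2 : (n₃ : ℝ) ≤ κ * n + 1 := hn₃ ▸ (Nat.ceil_lt_add_one t0).le
  have u3 : n₃ ≤ n - n / q := by
    rw [hn₃]
    refine Nat.ceil_le.mpr ?_
    rw [Nat.cast_sub (Nat.div_le_self n q)]
    have h1 : ((n / q : ℕ) : ℝ) ≤ n / q := Nat.cast_div_le
    have h2 : (n : ℝ) / q = n * (1 / q) := by ring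
    have h3 : (n : ℝ) * (1 / q) ≤ n * ε := mul_le_mul_of_nonneg_left hqε hn0
    have h4 : κ * n ≤ (1 - ε) * n := mul_le_mul_of_nonneg_right κε hn0
    linarith
  have u4 : n₃ ≤ n := u3.trans (Nat.sub_le _ _)
  have mono : ∀ {c : ℝ}, 0 ≤ c → c ≤ 1 → ⌈c * (κ * n)⌉₊ ≤ n₃ ∧
      ⌈c * (κ * n)⌉₊ ≤ ⌈c * (n₃ + L : ℕ)⌉₊ ∧ ⌈c * (n₃ + L : ℕ)⌉₊ ≤ n₃ + L := by
    intro c h0 h1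
    refine ⟨?_, Nat.ceil_mono (mul_le_mul_of_nonneg_left ?_ h0), Nat.ceil_le.mpr ?_⟩
    · rw [hn₃]
      exact Nat.ceil_mono (mul_le_of_le_one_left t0 h1)
    · push_cast
      have : (0 : ℝ) ≤ L := by positivity
      linarith
    · exact mul_le_of_le_one_left (by positivity) h1
  -- the minimum guards against rounding up when `c₂` is small
  obtain ⟨n₁, hn₁⟩ : ∃ n₁, n₁ = min ⌈c₁ * (κ * n)⌉₊ (n - n₃) := ⟨_, rfl⟩
  obtain ⟨n₂, hn₂⟩ : ∃ n₂, n₂ = n - n₃ - n₁ := ⟨_, rfl⟩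
  have v1 : n₁ ≤ ⌈c₁ * (κ * n)⌉₊ := hn₁ ▸ min_le_left _ _
  have v2 : n₁ ≤ n - n₃ := hn₁ ▸ min_le_right _ _
  have v3 : n₂ ≤ ⌈c₂ * (κ * n)⌉₊ := by
    rcases min_choice ⌈c₁ * (κ * n)⌉₊ (n - n₃) with h | h
    · have h1 : c₁ * (κ * n) ≤ n₁ := by
        rw [hn₁, h]
        exact Nat.le_ceil _
      have h2 : (n₂ : ℝ) = n - n₃ - n₁ := by
        rw [hn₂, Nat.cast_sub v2, Nat.cast_sub u4]
      have h3 : (n : ℝ) = κ * n + c₁ * (κ * n) + c₂ * (κ * n) := by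
        linear_combination (-n : ℝ) * κ1
      have h4 : (n₂ : ℝ) ≤ c₂ * (κ * n) := by linarith
      exact_mod_cast h4.trans (Nat.le_ceil _)
    · omega
  obtain ⟨w1, w2, w3⟩ := mono a1 a2
  obtain ⟨x1, x2, x3⟩ := mono b1 b2
  refine ⟨n₁, n₂, n₃, _, _, by omega, ⟨by omega, v1.trans w1, v3.trans x1, v1.trans w2,
    v3.trans x2, w3, x3, u3⟩, Nat.le_ceil _, (Nat.ceil_lt_add_one (by positivity)).le,
    Nat.le_ceil _, (Nat.ceil_lt_add_one (by positivity)).le, ?_⟩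
  have h1 : (1 + c₁ + c₂) * n₃ ≤ (1 + c₁ + c₂) * (κ * n + 1) :=
    mul_le_mul_of_nonneg_left u2 hs.le
  have h2 : (1 + c₁ + c₂) * (κ * n + 1) = n + (1 + c₁ + c₂) := by
    linear_combination (n : ℝ) * κ1
  linarith

/-- For the balanced sizes the flow program succeeds within the word bound and the time limit: the
product `|S| |T| m` is at most `2 ^ (n + 3 L + 8)`, whose power `1 - ε` is at most `2 ^ (n - n / q +
3 L + 8)`. -/
theorem right_guess {ε c₁ c₂ : ℝ} {q : ℕ} (hq : 0 < q) (hqε : 1 / (q : ℝ) ≤ ε)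
    (hc₁ : c₁ ∈ Set.Icc (0 : ℝ) 1) (hc₂ : c₂ ∈ Set.Icc (0 : ℝ) 1)
    (hκ : 1 ≤ (1 + c₁ + c₂) * (1 - ε)) {p : Program} {C : ℕ}
    (hp : ∀ G : Instance, G.Sparse c₁ c₂ 10 → ∃ (W t : ℕ) (s : State),
      (W : ℝ) ≤ C * (G.encode.length +
        ((G.S.length : ℝ) * (G.T.length : ℝ) * (G.edges.length : ℝ)) ^ (1 - ε) + 1) ^ C ∧
      G.encode.length < W ∧ (∀ v ∈ G.encode, v < W) ∧
      (t : ℝ) ≤ C * ((G.S.length : ℝ) * (G.T.length : ℝ) * (G.edges.length : ℝ)) ^ (1 - ε) ∧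
      Runs W p (initState G.encode) t s ∧ STMaxFlow.Correct G (s.mem 1)) (n : ℕ) {M L : ℕ}
    (hL : M < 2 ^ L) (hL' : 2 ^ L ≤ 2 * M + 1) {B : ℕ} (hB : 1 ≤ B) (hB' : B ≤ M) :
    ∃ n₁ n₂ n₃ e₁ e₂, n₁ + n₂ + n₃ = n ∧
        Admissible q n L n₁ n₂ n₃ e₁ e₂ ∧ n₁ < n + L + 2 ∧ n₂ < n + L + 2 ∧
        e₁ < n + L + 2 ∧ e₂ < n + L + 2 ∧ ∀ τ P,
          P = Gadget.ofTable τ n n₁ n₂ n₃ e₁ e₂ M B → ∀ h₁ h₂,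
          (P.inst h₁ h₂).encode.length ≤ 2 ^ ((3 * C + 3) * (n + L) + (10 * C + 10)) ∧
          Succeeds p (2 ^ ((3 * C + 3) * (n + L) + (10 * C + 10)))
            (2 ^ (n - n / q + (3 * L + (C + 8)))) (P.inst h₁ h₂) := by
  obtain ⟨n₁, n₂, n₃, e₁, e₂, hn, had, a1, a2, b1, b2, hs⟩ := exists_sizes hqε hc₁ hc₂ hκ n L
  have had' := had
  obtain ⟨g1, g2, g3, g4, g5, g6, g7, g8⟩ := had'
  refine ⟨n₁, n₂, n₃, e₁, e₂, hn, had, by omega, by omega, by omega, by omega,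
    fun τ P hP h₁ h₂ => ?_⟩
  have ε1 : 0 ≤ 1 - ε := by
    by_contra hc
    have := mul_neg_of_pos_of_neg (a := 1 + c₁ + c₂) (by linarith [hc₁.1, hc₂.1]) (not_le.mp hc)
    linarith
  obtain ⟨Z, hZ⟩ : ∃ Z, Z = 2 ^ (n₃ + L) := ⟨_, rfl⟩
  have hZ' : Z = 2 ^ n₃ * 2 ^ L := by rw [hZ, pow_add]
  have Z1 : 1 ≤ Z := hZ ▸ Nat.one_le_two_pow
  have hN : 1 ≤ 2 ^ n₃ := Nat.one_le_two_pow
  have pw : ∀ {x y : ℕ}, x ≤ y → 2 ^ x ≤ 2 ^ y := fun h => Nat.pow_le_pow_right (by norm_num) h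
  have bal : P.Balanced Z := by
    rw [hP]
    refine ⟨hB.trans hB', hN, pw g2, pw g3, hZ ▸ pw g6, hZ ▸ pw g7, ?_, ?_⟩
    · rw [hZ']
      exact Nat.mul_le_mul_left _ hL.le
    · change Z ≤ 3 * (2 ^ n₃ * M)
      rw [hZ']
      calc 2 ^ n₃ * 2 ^ L ≤ 2 ^ n₃ * (3 * M) := Nat.mul_le_mul_left _ (by omega)
        _ = 3 * (2 ^ n₃ * M) := by ring
  have hZc : ∀ c : ℝ, (Z : ℝ) ^ c = 2 ^ (c * (n₃ + L : ℕ)) := fun c => by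
    rw [hZ, mul_comm, Real.rpow_mul (by norm_num), Real.rpow_natCast, Nat.cast_pow, Nat.cast_ofNat]
  have hS : ∀ {c : ℝ} {e : ℕ}, c * (n₃ + L : ℕ) ≤ e → (e : ℝ) ≤ c * (n₃ + L : ℕ) + 1 →
      (Z : ℝ) ^ c ≤ (2 ^ e : ℕ) ∧ ((2 ^ e : ℕ) : ℝ) ≤ 2 * (Z : ℝ) ^ c := by
    intro c e h1 h2
    rw [hZc]
    rw [Nat.cast_pow, Nat.cast_ofNat, ← Real.rpow_natCast]
    refine ⟨Real.rpow_le_rpow_of_exponent_le (by norm_num) h1, ?_⟩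
    calc (2 : ℝ) ^ (e : ℝ) ≤ 2 ^ (c * (n₃ + L : ℕ) + 1) :=
          Real.rpow_le_rpow_of_exponent_le (by norm_num) h2
      _ = _ := by rw [Real.rpow_add (by norm_num), Real.rpow_one, mul_comm]
  have p1 : P.S₁ = 2 ^ e₁ := by rw [hP]; rfl
  have p2 : P.S₂ = 2 ^ e₂ := by rw [hP]; rfl
  have p3 : P.N₃ = 2 ^ n₃ := by rw [hP]; rfl
  have p4 : P.M = M := by rw [hP]; rfl
  have p5 : P.B = B := by rw [hP]; rfl
  obtain ⟨s1, s2⟩ := hS a1 a2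
  obtain ⟨s3, s4⟩ := hS b1 b2
  have sparse : (P.inst h₁ h₂).Sparse c₁ c₂ 10 := bal.sparse hc₁ hc₂ (by omega) (by omega)
    (p1 ▸ s1) (p1 ▸ s2) (p2 ▸ s3) (p2 ▸ s4)
  obtain ⟨-, -, z3, z4, z5⟩ := bal.size_bounds (h₁ := h₁) (h₂ := h₂)
  obtain ⟨W, t, σ, hW, hlen, hval, ht, hrun, hcor⟩ := hp _ sparse
  obtain ⟨m, hm⟩ : ∃ m, m = (P.inst h₁ h₂).edges.length := ⟨_, rfl⟩
  obtain ⟨l, hl⟩ : ∃ l, l = (P.inst h₁ h₂).encode.length := ⟨_, rfl⟩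
  rw [inst_S_length, inst_T_length, p1, p2, ← hm] at hW ht
  rw [← hm, p3, p4] at z3 z4
  rw [← hl] at hW z5 ⊢
  obtain ⟨w, hw⟩ : ∃ w, w = (3 * C + 3) * (n + L) + (10 * C + 10) := ⟨_, rfl⟩
  have hZn : Z ≤ 2 ^ (n + L) := hZ ▸ pw (by omega)
  have hwn : n + L + 10 ≤ w := by
    rw [hw]
    have := Nat.mul_le_mul_right (n + L) (show 1 ≤ 3 * C + 3 by omega)
    omega
  rw [← hw]
  have hlw : l ≤ 2 ^ w := by
    calc l ≤ 27 * Z := z5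
      _ ≤ 2 ^ 10 * 2 ^ (n + L) := Nat.mul_le_mul (by norm_num) hZn
      _ = 2 ^ (n + L + 10) := by rw [pow_add 2 (n + L) 10, mul_comm]
      _ ≤ 2 ^ w := pw hwn
  obtain ⟨T, hT⟩ : ∃ T, T = (((2 ^ e₁ : ℕ) : ℝ) * ((2 ^ e₂ : ℕ) : ℝ) * (m : ℝ)) ^ (1 - ε) :=
    ⟨_, rfl⟩
  rw [← hT] at hW ht
  have hmZ : (m : ℝ) ≤ 2 ^ 3 * (2 : ℝ) ^ (n₃ + L : ℕ) := by
    have h1 : 2 ^ n₃ * M ≤ 2 ^ (n₃ + L) := by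
      rw [pow_add]
      exact Nat.mul_le_mul_left _ hL.le
    have h2 : m ≤ 2 ^ 3 * 2 ^ (n₃ + L) := by omega
    exact_mod_cast h2
  have hq0 : (0 : ℝ) < 1 / q := by positivity
  obtain ⟨k, hk⟩ : ∃ k, k = n - n / q + (3 * L + 8) := ⟨_, rfl⟩
  have hTk : T ≤ 2 ^ k := by
    have h1 : ((2 ^ e₁ : ℕ) : ℝ) * ((2 ^ e₂ : ℕ) : ℝ) * (m : ℝ) ≤ 2 ^ ((n : ℝ) + 3 * L + 8) := by
      calc _ ≤ ((2 ^ e₁ : ℕ) : ℝ) * ((2 ^ e₂ : ℕ) : ℝ) * (2 ^ 3 * (2 : ℝ) ^ (n₃ + L : ℕ)) :=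
            mul_le_mul_of_nonneg_left hmZ (by positivity)
        _ = 2 ^ (e₁ + e₂ + (3 + (n₃ + L)) : ℕ) := by
            rw [pow_add, pow_add, pow_add _ 3]
            push_cast
            ring
        _ = (2 : ℝ) ^ ((e₁ + e₂ + (3 + (n₃ + L)) : ℕ) : ℝ) := (Real.rpow_natCast _ _).symm
        _ ≤ _ := by
            refine Real.rpow_le_rpow_of_exponent_le (by norm_num) ?_
            push_cast at a2 b2 ⊢
            have h2 : c₁ * L ≤ L := mul_le_of_le_one_left (by positivity) hc₁.2
            have h3 : c₂ * L ≤ L := mul_le_of_le_one_left (by positivity) hc₂.2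
            linarith
    have h2 : (n : ℝ) * (1 - ε) ≤ (n - n / q : ℕ) := by
      rw [Nat.cast_sub (Nat.div_le_self n q)]
      have h1 : ((n / q : ℕ) : ℝ) ≤ n / q := Nat.cast_div_le
      have h2 : (n : ℝ) / q = n * (1 / q) := by ring
      have h3 : (n : ℝ) * (1 / q) ≤ n * ε := mul_le_mul_of_nonneg_left hqε (by positivity)
      linarith
    have h3 : (3 * L + 8 : ℝ) * (1 - ε) ≤ 3 * L + 8 :=
      mul_le_of_le_one_right (by positivity) (by linarith)
    calc T ≤ (2 ^ ((n : ℝ) + 3 * L + 8)) ^ (1 - ε) := by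
          rw [hT]
          exact Real.rpow_le_rpow (by positivity) h1 ε1
      _ = 2 ^ (((n : ℝ) + 3 * L + 8) * (1 - ε)) := (Real.rpow_mul (by norm_num) _ _).symm
      _ ≤ 2 ^ (k : ℝ) := by
          refine Real.rpow_le_rpow_of_exponent_le (by norm_num) ?_
          rw [hk, Nat.cast_add]
          push_cast
          linarith
      _ = 2 ^ k := Real.rpow_natCast _ _
  have hC : C < 2 ^ C := Nat.lt_two_pow_self
  refine ⟨hlw, W, t, σ, ?_, hlen, hval, ?_, hrun, hcor⟩
  · have h1 : (l : ℝ) + T + 1 ≤ (2 ^ (9 + 3 * (n + L)) : ℕ) := by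
      have h2 : l ≤ 27 * 2 ^ (3 * (n + L)) :=
        z5.trans (Nat.mul_le_mul_left _ (hZn.trans (pw (by omega))))
      have h3 : (2 : ℕ) ^ k ≤ 2 ^ 8 * 2 ^ (3 * (n + L)) := by
        rw [← pow_add]
        exact pw (by have := Nat.sub_le n (n / q); omega)
      have h4 : 1 ≤ 2 ^ (3 * (n + L)) := Nat.one_le_two_pow
      have h5 : l + 2 ^ k + 1 ≤ 2 ^ (9 + 3 * (n + L)) := by
        rw [pow_add]
        omega
      have h6 : (l : ℝ) + 2 ^ k + 1 ≤ (2 ^ (9 + 3 * (n + L)) : ℕ) := by exact_mod_cast h5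
      linarith
    have hT0 : 0 ≤ T := by rw [hT]; positivity
    have h2 : (W : ℝ) ≤ ((C * (2 ^ (9 + 3 * (n + L))) ^ C : ℕ) : ℝ) := by
      rw [Nat.cast_mul, Nat.cast_pow (2 ^ _)]
      exact hW.trans (mul_le_mul_of_nonneg_left (pow_le_pow_left₀ (by positivity) h1 _)
        (by positivity))
    calc W ≤ C * (2 ^ (9 + 3 * (n + L))) ^ C := by exact_mod_cast h2
      _ ≤ 2 ^ C * (2 ^ (9 + 3 * (n + L))) ^ C := Nat.mul_le_mul_right _ hC.le
      _ = 2 ^ (C + (9 + 3 * (n + L)) * C) := by rw [← pow_mul, ← pow_add]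
      _ ≤ 2 ^ w := pw (by
          rw [hw]
          have : (3 * C + 3) * (n + L) + (10 * C + 10) =
            C + (9 + 3 * (n + L)) * C + (3 * (n + L) + 10) := by ring
          omega)
  · have h1 : (t : ℝ) ≤ ((C * 2 ^ k : ℕ) : ℝ) := by
      push_cast
      exact ht.trans (mul_le_mul_of_nonneg_left hTk (by positivity))
    have h2 : t ≤ C * 2 ^ k := by exact_mod_cast h1
    calc t ≤ C * 2 ^ k := h2
      _ < 2 ^ C * 2 ^ k := Nat.mul_lt_mul_of_pos_right hC (by positivity)
      _ = _ := by rw [← pow_add, hk]; congr 1; omega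

end WordRAM

namespace WordRAM

open MaxFlow SAT

/-! ### Maximum satisfiability and satisfiability -/

/-- Exponentials dominate powers. -/
theorem exists_pow_le_rpow {δ : ℝ} (hδ : 0 < δ) (k : ℕ) :
    ∃ c : ℕ, ∀ n : ℕ, ((n : ℝ) + 1) ^ k ≤ c * 2 ^ (δ * n) := by
  have hl : 0 < δ * Real.log 2 := mul_pos hδ (Real.log_pos (by norm_num))
  obtain ⟨c, hc⟩ := exists_nat_ge ((k.factorial : ℝ) * 2 ^ δ / (δ * Real.log 2) ^ k)
  refine ⟨c, fun n => ?_⟩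
  have h1 := Real.pow_div_factorial_le_exp (δ * Real.log 2 * (n + 1)) (by positivity) k
  have h2 : Real.exp (δ * Real.log 2 * (n + 1)) = 2 ^ δ * 2 ^ (δ * n) := by
    rw [← Real.rpow_add (by norm_num), Real.rpow_def_of_pos (by norm_num)]
    congr 1
    ring
  rw [h2, div_le_iff₀ (by positivity), mul_pow] at h1
  calc ((n : ℝ) + 1) ^ k ≤ (k.factorial : ℝ) * 2 ^ δ / (δ * Real.log 2) ^ k * 2 ^ (δ * n) := by
        rw [div_mul_eq_mul_div, le_div_iff₀ (by positivity)]
        linarith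
    _ ≤ c * 2 ^ (δ * n) := mul_le_mul_of_nonneg_right hc (by positivity)

theorem _root_.SAT.CNF.clauses_length_le (F : CNF) : F.clauses.length ≤ F.encode.length := by
  rw [F.encode_eq]
  have : F.words.length ≤ (F.words.flatMap fun c => c.length :: c).length := by
    rw [List.length_flatMap]
    refine (List.card_nsmul_le_sum _ 1 fun x hx => ?_).trans' (by simp)
    obtain ⟨c, -, rfl⟩ := List.mem_map.mp hx
    simp
  rw [F.length_words] at this
  simp only [List.length_append]
  omega

/-- If flows can be computed fast, then one program finds the largest number of clauses that can
be satisfied, with time to spare for polynomials. -/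
theorem exists_solver {ε c₁ c₂ : ℝ} {q : ℕ} (hq : 3 ≤ q) (hqε : 1 / (q : ℝ) ≤ ε)
    (hc₁ : c₁ ∈ Set.Icc (0 : ℝ) 1) (hc₂ : c₂ ∈ Set.Icc (0 : ℝ) 1)
    (hκ : 1 ≤ (1 + c₁ + c₂) * (1 - ε))
    (hp : SolvableInTime STMaxFlow (fun G : Instance => G.Sparse c₁ c₂ 10)
      (fun G : Instance =>
        ((G.S.length : ℝ) * (G.T.length : ℝ) * (G.edges.length : ℝ)) ^ (1 - ε)))
    {e : Exp} (he : ∀ D E, 65 ≤ D → 60 ≤ E → e.Wf D regCls arrCls E)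
    (heu : e.ub regCls arrCls ≤ 1) :
    ∃ (r : Program) (C : ℕ), ∀ (F : CNF) (T : ℝ), (2 : ℝ) ^ ((1 - 1 / (2 * q : ℝ)) * F.n) ≤ T →
      ∃ (W t : ℕ) (z s : State), (W : ℝ) ≤ C * (F.encode.length + T + 1) ^ C ∧
        F.encode.length < W ∧ (∀ v ∈ F.encode, v < W) ∧
        (t : ℝ) * (F.n + 1) ^ 8 ≤
          C * (2 ^ ((1 - 1 / (2 * q : ℝ)) * F.n) * (F.clauses.length + 1) ^ 8) ∧
        Runs W r (initState F.encode) t s ∧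
        IsGreatest (Set.range F.numSatisfied) (z.reg rBest) ∧ z.reg rMm = F.clauses.length ∧
        s.mem 1 0 = e.eval z := by
  obtain ⟨p, C, hp⟩ := hp
  have hq0 : (0 : ℝ) < q := by exact_mod_cast (by omega : 0 < q)
  obtain ⟨δ, hδ⟩ : ∃ δ : ℝ, δ = 1 / (2 * q) := ⟨_, rfl⟩
  have δ0 : 0 < δ := by rw [hδ]; positivity
  have δ2 : 1 / (q : ℝ) = 2 * δ := by rw [hδ]; field_simp
  have δ1 : 2 * δ ≤ 1 := by
    rw [← δ2, div_le_one hq0]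
    exact_mod_cast (by omega : 1 ≤ q)
  rw [← hδ]
  -- eight powers of `n` come from the running time, the other eight are what is to spare
  obtain ⟨c, hc⟩ := exists_pow_le_rpow δ0 16
  obtain ⟨a, ha⟩ : ∃ a, a = 3 * C + 3 := ⟨_, rfl⟩
  obtain ⟨b', hb'⟩ : ∃ b', b' = 10 * C + 10 := ⟨_, rfl⟩
  obtain ⟨K, E, hKE⟩ := reduction_runs p q (C + 8) a b' e hq (by omega) (by omega) he heu
  refine ⟨reduction p q (C + 8) a b' e,
    2 * 2 ^ ((a + b') * E) + 3 * a * E + K * 2 * c, fun F T hT => ?_⟩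
  obtain ⟨L, t, z, s, hL, hL', ht, hrun, hbest, hM, hout, hE⟩ := hKE F fun L hL hL' B hB hB' => by
    rw [ha, hb']
    exact right_guess (by omega) hqε hc₁ hc₂ hκ hp F.n hL hL' hB hB'
  obtain ⟨hlen, hval⟩ := F.encode_le hL
  obtain ⟨n, hn⟩ : ∃ n, n = F.n := ⟨_, rfl⟩
  obtain ⟨M, hMd⟩ : ∃ M, M = F.clauses.length := ⟨_, rfl⟩
  obtain ⟨N, hN⟩ : ∃ N, N = F.encode.length := ⟨_, rfl⟩
  have hMN : M ≤ N := by rw [hMd, hN]; exact F.clauses_length_le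
  rw [← hMd] at hL hL' ht hM ⊢
  rw [← hn] at hlen hval hrun ht hT
  rw [← hN] at hlen ⊢
  obtain ⟨X, hX⟩ : ∃ X, X = 2 ^ (a * (n + L) + b') := ⟨_, rfl⟩
  rw [← hX] at hrun
  have hX2 : 2 ^ (n + L + 2) ≤ X := by
    rw [hX]
    refine Nat.pow_le_pow_right (by norm_num) ?_
    have := Nat.mul_le_mul_right (n + L) (show 1 ≤ a by omega)
    omega
  have hXE : X ≤ X ^ E := Nat.le_self_pow (by omega) X
  refine ⟨X ^ E + 1, t, z, s, ?_, by omega, fun v hv => by have := hval v hv; omega, ?_, hrun,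
    hbest, hM, hout⟩
  · -- as `1 - δ ≥ 1 / 2`, the number `2 ^ n` is at most quadratic in the running time
    obtain ⟨V, hV⟩ : ∃ V : ℝ, V = N + T + 1 := ⟨_, rfl⟩
    rw [← hV]
    have hT0 : 0 ≤ T := le_trans (by positivity) hT
    have hN0 : (0 : ℝ) ≤ N := by positivity
    have V1 : 1 ≤ V := by linarith
    have h1 : (2 : ℝ) ^ n ≤ V ^ 2 := by
      have h2 : (2 : ℝ) ^ ((n : ℝ) / 2) ≤ V := by
        refine le_trans (Real.rpow_le_rpow_of_exponent_le (by norm_num) ?_)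
          (hT.trans (by linarith))
        have : (0 : ℝ) ≤ (1 - 2 * δ) * n := mul_nonneg (by linarith) (by positivity)
        linarith
      calc (2 : ℝ) ^ n = ((2 : ℝ) ^ ((n : ℝ) / 2)) ^ 2 := by
            rw [← Real.rpow_natCast, ← Real.rpow_natCast, ← Real.rpow_mul (by norm_num)]
            congr 1
            push_cast
            ring
        _ ≤ V ^ 2 := pow_le_pow_left₀ (by positivity) h2 2
    have h2 : (2 : ℝ) ^ L ≤ 2 * V := by
      have h3 : (2 : ℝ) ^ L ≤ 2 * M + 1 := by exact_mod_cast hL'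
      have h4 : (M : ℝ) ≤ N := by exact_mod_cast hMN
      linarith
    have h3 : (X : ℝ) ≤ (2 : ℝ) ^ (a + b') * V ^ (3 * a) := by
      calc (X : ℝ) = ((2 : ℝ) ^ n * 2 ^ L) ^ a * 2 ^ b' := by
            rw [hX]
            push_cast
            rw [pow_add, mul_comm a, pow_mul, pow_add]
        _ ≤ (V ^ 2 * (2 * V)) ^ a * 2 ^ b' := by gcongr
        _ = _ := by
            rw [pow_add, pow_mul, show V ^ 2 * (2 * V) = 2 * V ^ 3 by ring, mul_pow]
            ring
    obtain ⟨C', hC'⟩ : ∃ C', C' = 2 * 2 ^ ((a + b') * E) + 3 * a * E + K * 2 * c := ⟨_, rfl⟩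
    rw [← hC']
    have h4 : (1 : ℝ) ≤ (2 : ℝ) ^ ((a + b') * E) * V ^ (3 * a * E) :=
      one_le_mul_of_one_le_of_one_le (one_le_pow₀ (by norm_num)) (one_le_pow₀ V1)
    calc ((X ^ E + 1 : ℕ) : ℝ) = (X : ℝ) ^ E + 1 := by push_cast; ring
      _ ≤ ((2 : ℝ) ^ (a + b') * V ^ (3 * a)) ^ E + 1 := by gcongr
      _ = (2 : ℝ) ^ ((a + b') * E) * V ^ (3 * a * E) + 1 := by rw [mul_pow, ← pow_mul, ← pow_mul]
      _ ≤ (2 * 2 ^ ((a + b') * E)) * V ^ (3 * a * E) := by linarith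
      _ ≤ C' * V ^ C' := by
          refine mul_le_mul ?_ (pow_le_pow_right₀ V1 (by omega)) (by positivity) (by positivity)
          have : 2 * 2 ^ ((a + b') * E) ≤ C' := by omega
          exact_mod_cast this
  · rw [← hn]
    have h1 : ((2 ^ (n - n / q) : ℕ) : ℝ) ≤ 2 * 2 ^ ((1 - 2 * δ) * n) := by
      have h2 : ((n - n / q : ℕ) : ℝ) ≤ (1 - 2 * δ) * n + 1 := by
        rw [Nat.cast_sub (Nat.div_le_self n q)]
        have h3 : (n : ℝ) / q < (n / q : ℕ) + 1 := by
          rw [← Nat.floor_div_eq_div (K := ℝ)]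
          exact Nat.lt_floor_add_one _
        have h4 : (n : ℝ) / q = 2 * δ * n := by rw [← δ2]; ring
        linarith
      calc ((2 ^ (n - n / q) : ℕ) : ℝ) = (2 : ℝ) ^ ((n - n / q : ℕ) : ℝ) := by
            rw [Real.rpow_natCast, Nat.cast_pow, Nat.cast_ofNat]
        _ ≤ (2 : ℝ) ^ ((1 - 2 * δ) * n + 1) := Real.rpow_le_rpow_of_exponent_le (by norm_num) h2
        _ = _ := by rw [Real.rpow_add (by norm_num), Real.rpow_one, mul_comm]
    have h2 : ((n : ℝ) + M + 1) ≤ (n + 1) * (M + 1) := by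
      have : (0 : ℝ) ≤ n * M := by positivity
      linarith
    have h3 : (t : ℝ) ≤ K * (((2 ^ (n - n / q) : ℕ) : ℝ) * ((n : ℝ) + M + 1) ^ 8) := by
      exact_mod_cast ht
    have h4 : (2 : ℝ) ^ ((1 - 2 * δ) * n) * 2 ^ (δ * n) = 2 ^ ((1 - δ) * n) := by
      rw [← Real.rpow_add (by norm_num)]
      congr 1
      ring
    calc (t : ℝ) * (n + 1) ^ 8
        ≤ (K : ℝ) * ((2 * (2 : ℝ) ^ ((1 - 2 * δ) * n)) * ((n + 1) * (M + 1)) ^ 8) *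
          (n + 1) ^ 8 := by
          refine mul_le_mul_of_nonneg_right (h3.trans ?_) (by positivity)
          gcongr
      _ = (K : ℝ) * 2 * (((2 : ℝ) ^ ((1 - 2 * δ) * n)) * (n + 1) ^ 16) * (M + 1) ^ 8 := by ring
      _ ≤ (K : ℝ) * 2 * (((2 : ℝ) ^ ((1 - 2 * δ) * n)) * (c * 2 ^ (δ * n))) * (M + 1) ^ 8 := by
          have := hc n
          gcongr
      _ = (K * 2 * c : ℕ) * (2 ^ ((1 - δ) * n) * (M + 1) ^ 8) := by
          rw [← h4]
          push_cast
          ring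
      _ ≤ _ := by
          refine mul_le_mul_of_nonneg_right ?_ (by positivity)
          exact_mod_cast Nat.le_add_left _ _

theorem mul_pow_mono {C C' : ℕ} (h : C ≤ C') {V : ℝ} (hV : 1 ≤ V) :
    (C : ℝ) * V ^ C ≤ C' * V ^ C' :=
  mul_le_mul (by exact_mod_cast h) (pow_le_pow_right₀ hV h) (by positivity) (by positivity)

/-- The best value itself is the output. The `O(n)` clauses contribute a polynomial in `n`, which
`exists_solver` leaves room for. -/
theorem maxCNFSAT_solvable {ε c₁ c₂ : ℝ} {q : ℕ} (hq : 3 ≤ q) (hqε : 1 / (q : ℝ) ≤ ε)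
    (hc₁ : c₁ ∈ Set.Icc (0 : ℝ) 1) (hc₂ : c₂ ∈ Set.Icc (0 : ℝ) 1)
    (hκ : 1 ≤ (1 + c₁ + c₂) * (1 - ε))
    (hp : SolvableInTime STMaxFlow (fun G : Instance => G.Sparse c₁ c₂ 10)
      (fun G : Instance =>
        ((G.S.length : ℝ) * (G.T.length : ℝ) * (G.edges.length : ℝ)) ^ (1 - ε)))
    (K : ℕ) : SolvableInTime MaxCNFSAT
    (fun F : CNF => F.clauses.length ≤ K * F.n)
    (fun F : CNF => (2 : ℝ) ^ ((1 - 1 / (2 * q : ℝ)) * (F.n : ℝ))) := by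
  obtain ⟨r, C, hr⟩ := exists_solver hq hqε hc₁ hc₂ hκ hp (e := ‡rBest)
    (fun D E hD hE => ⟨by omega, by simp [regCls]; omega⟩) (by simp [Exp.ub, regCls])
  refine ⟨r, C * (K + 1) ^ 8, fun F hF => ?_⟩
  obtain ⟨W, t, z, s, hW, hlen, hval, ht, hrun, hbest, -, hout⟩ := hr F _ le_rfl
  refine ⟨W, t, s, hW.trans (mul_pow_mono ?_ ?_), hlen, hval, ?_, hrun, ?_⟩
  · exact Nat.le_mul_of_pos_right _ (by positivity)
  · have h1 : (0 : ℝ) ≤ (F.encode.length : ℝ) := by positivity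
    have h2 : (0 : ℝ) ≤ 2 ^ ((1 - 1 / (2 * q : ℝ)) * (F.n : ℝ)) := by positivity
    linarith
  · have h1 : ((F.clauses.length : ℝ) + 1) ≤ (K + 1) * (F.n + 1) := by
      have h2 : (F.clauses.length : ℝ) ≤ K * F.n := by exact_mod_cast hF
      have h3 : (0 : ℝ) ≤ K := by positivity
      have h4 : (0 : ℝ) ≤ F.n := by positivity
      linarith
    have h5 : (0 : ℝ) < ((F.n : ℝ) + 1) ^ 8 := by positivity
    refine le_of_mul_le_mul_right (ht.trans ?_) h5
    calc _ ≤ (C : ℝ) * (2 ^ ((1 - 1 / (2 * q : ℝ)) * (F.n : ℝ)) * ((K + 1) * (F.n + 1)) ^ 8) := by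
          gcongr
      _ = _ := by
          push_cast
          ring
  · change IsGreatest _ (s.mem 1 0)
    rw [hout]
    exact hbest

/-- A formula is satisfiable if and only if the optimum is the number of clauses; the output is `1`
in this case and `0` otherwise. -/
theorem kSATSolvable {ε c₁ c₂ : ℝ} {q : ℕ} (hq : 3 ≤ q) (hqε : 1 / (q : ℝ) ≤ ε)
    (hc₁ : c₁ ∈ Set.Icc (0 : ℝ) 1) (hc₂ : c₂ ∈ Set.Icc (0 : ℝ) 1)
    (hκ : 1 ≤ (1 + c₁ + c₂) * (1 - ε))
    (hp : SolvableInTime STMaxFlow (fun G : Instance => G.Sparse c₁ c₂ 10)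
      (fun G : Instance =>
        ((G.S.length : ℝ) * (G.T.length : ℝ) * (G.edges.length : ℝ)) ^ (1 - ε)))
    (k : ℕ) : KSATSolvable k (1 / (2 * q : ℝ)) := by
  obtain ⟨r, C, hr⟩ := exists_solver hq hqε hc₁ hc₂ hκ hp (e := ♮1 - (‡rMm - ‡rBest))
    (fun D E hD hE => by simp [Exp.Wf, Exp.ub, Exp.sub_def, regCls]; omega)
    (by simp [Exp.ub, Exp.sub_def])
  refine ⟨8, r, C, fun F _ => ?_⟩
  have h1 : (1 : ℝ) ≤ ((F.clauses.length : ℝ) + 1) ^ 8 := one_le_pow₀ (by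
    have : (0 : ℝ) ≤ F.clauses.length := by positivity
    linarith)
  obtain ⟨W, t, z, s, hW, hlen, hval, ht, hrun, hbest, hM, hout⟩ := hr F
    (2 ^ ((1 - 1 / (2 * q : ℝ)) * (F.n : ℝ)) * ((F.clauses.length : ℝ) + 1) ^ 8)
    (le_mul_of_one_le_right (by positivity) h1)
  refine ⟨W, t, s, hW, hlen, hval, le_trans ?_ ht, hrun, ?_⟩
  · refine le_mul_of_one_le_right (by positivity) (one_le_pow₀ ?_)
    have : (0 : ℝ) ≤ F.n := by positivity
    linarith
  · change s.mem 1 0 ≠ 0 ↔ _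
    have h2 : s.mem 1 0 = 1 - (F.clauses.length - z.reg rBest) := by
      rw [hout]
      simp [Exp.eval, Exp.sub_def, BinOp.eval, hM]
    have h3 : s.mem 1 0 ≠ 0 ↔ F.clauses.length ≤ z.reg rBest := by omega
    have h4 : ∀ a, F.numSatisfied a = F.clauses.length ↔ ∀ c ∈ F.clauses, SatisfiesClause a c := by
      intro a
      simp [CNF.numSatisfied, List.countP_eq_length]
    rw [h3]
    constructor
    · intro h
      obtain ⟨a, ha⟩ := hbest.1
      have h5 : F.numSatisfied a ≤ F.clauses.length := List.countP_le_length
      exact ⟨a, (h4 a).mp (by omega)⟩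
    · rintro ⟨a, ha⟩
      rw [← (h4 a).mpr ha]
      exact hbest.2 ⟨a, rfl⟩

end WordRAM

namespace WordRAM

open MaxFlow

/-! ### Programs that do not read their whole input -/

/-- The final state is unique, and it does not depend on the word bound. -/
theorem Runs.deterministic {W W' t t' : ℕ} {p : Program} {s s₁ s₂ : State}
    (h : Runs W p s t s₁) (h' : Runs W' p s t' s₂) : s₁ = s₂ := by
  induction h generalizing t' s₂ with
  | skip | const | arith | load | store => cases h'; rfl
  | seq _ _ ih₁ ih₂ =>
    cases h' with
    | seq g₁ g₂ =>
      obtain rfl := ih₁ g₁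
      exact ih₂ g₂
  | branch_true hx _ ih =>
    cases h' with
    | branch_true _ g => exact ih g
    | branch_false hx' _ => exact absurd hx' hx
  | branch_false hx _ ih =>
    cases h' with
    | branch_true hx' _ => exact absurd hx hx'
    | branch_false _ g => exact ih g
  | loop_true hx _ _ ih₁ ih₂ =>
    cases h' with
    | loop_true _ g₁ g₂ =>
      obtain rfl := ih₁ g₁
      exact ih₂ g₂
    | loop_false hx' => exact absurd hx' hx
  | loop_false hx =>
    cases h' with
    | loop_true hx' _ _ => exact absurd hx hx'
    | loop_false _ => rfl

theorem State.setMem_comm (s : State) {a b i j u v : ℕ} (h : a = b → i ≠ j) :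
    (s.setMem a i u).setMem b j v = (s.setMem b j v).setMem a i u := by
  have : ((s.setMem a i u).setMem b j v).mem = ((s.setMem b j v).setMem a i u).mem := by
    funext c k
    simp only [State.setMem_mem]
    split_ifs with h1 h2
    · exact absurd (h2.2.symm.trans h1.2) (h (h2.1.symm.trans h1.1))
    all_goals rfl
  exact congrArg₂ State.mk rfl this

/-- In `t` steps at most `t` input cells are touched; changing any other one does not affect the
run. -/
theorem Runs.exists_untouched {W t : ℕ} {p : Program} {s s' : State} (h : Runs W p s t s') :
    ∃ R : Finset ℕ, R.card ≤ t ∧ ∀ i ∉ R, ∀ v,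
      Runs W p (s.setMem 0 i v) t (s'.setMem 0 i v) := by
  induction h with
  | skip s => exact ⟨∅, by simp, fun i _ v => .skip _⟩
  | const s x k h => exact ⟨∅, by simp, fun i _ v => .const (s.setMem 0 i v) x k h⟩
  | arith s o x y z h => exact ⟨∅, by simp, fun i _ v => .arith (s.setMem 0 i v) o x y z h⟩
  | load s x a y =>
    refine ⟨{s.reg y}, by simp, fun i hi v => ?_⟩
    have h1 : (s.setMem 0 i v).mem a ((s.setMem 0 i v).reg y) = s.mem a (s.reg y) := by
      rw [State.setMem_mem]
      exact if_neg fun hc => hi (Finset.mem_singleton.mpr hc.2.symm)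
    have h2 := Runs.load (W := W) (s.setMem 0 i v) x a y
    rw [h1] at h2
    exact h2
  | store s a y x =>
    refine ⟨{s.reg y}, by simp, fun i hi v => ?_⟩
    have h2 := Runs.store (W := W) (s.setMem 0 i v) a y x
    have h3 : (s.setMem a (s.reg y) (s.reg x)).setMem 0 i v =
        (s.setMem 0 i v).setMem a (s.reg y) (s.reg x) :=
      s.setMem_comm fun _ hc => hi (by simp [← hc])
    rw [h3]
    exact h2
  | seq _ _ ih₁ ih₂ =>
    obtain ⟨R₁, c₁, h₁⟩ := ih₁
    obtain ⟨R₂, c₂, h₂⟩ := ih₂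
    refine ⟨R₁ ∪ R₂, (Finset.card_union_le _ _).trans (by omega), fun i hi v => ?_⟩
    rw [Finset.mem_union, not_or] at hi
    exact .seq (h₁ i hi.1 v) (h₂ i hi.2 v)
  | branch_true hx _ ih =>
    obtain ⟨R, c, h⟩ := ih
    exact ⟨R, by omega, fun i hi v => .branch_true hx (h i hi v)⟩
  | branch_false hx _ ih =>
    obtain ⟨R, c, h⟩ := ih
    exact ⟨R, by omega, fun i hi v => .branch_false hx (h i hi v)⟩
  | loop_true hx _ _ ih₁ ih₂ =>
    obtain ⟨R₁, c₁, h₁⟩ := ih₁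
    obtain ⟨R₂, c₂, h₂⟩ := ih₂
    refine ⟨R₁ ∪ R₂, (Finset.card_union_le _ _).trans (by omega), fun i hi v => ?_⟩
    rw [Finset.mem_union, not_or] at hi
    exact .loop_true hx (h₁ i hi.1 v) (h₂ i hi.2 v)
  | loop_false hx => exact ⟨∅, by simp, fun i _ v => .loop_false hx⟩

end WordRAM

namespace MaxFlow

/-! ### Graphs in which every capacity matters -/

/-- `N` paths of length two from node `0` to node `2 N`, where the first edge of path `j` has
capacity `α j` and the second one has capacity `2`. -/
def fanEdges (N : ℕ) (α : ℕ → ℕ) : List (ℕ × ℕ × ℕ) :=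
  (List.range N).map (fun j => (0, N + j, α j)) ++ (List.range N).map fun j => (N + j, 2 * N, 2)

/-- The nodes of a graph with `3 N` nodes. -/
def fanNode {N : ℕ} (hN : 0 < N) (x : ℕ) : Fin (3 * N) := ⟨x % (3 * N), Nat.mod_lt _ (by omega)⟩

theorem fanNode_inj {N : ℕ} {hN : 0 < N} {x y : ℕ} (hx : x < 3 * N) (hy : y < 3 * N)
    (h : fanNode hN x = fanNode hN y) : x = y := by
  have := congrArg Fin.val h
  simpa only [fanNode, Nat.mod_eq_of_lt hx, Nat.mod_eq_of_lt hy] using this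

theorem mem_fanEdges {N : ℕ} {α : ℕ → ℕ} {e : ℕ × ℕ × ℕ} : e ∈ fanEdges N α ↔
    (∃ j < N, e = (0, N + j, α j)) ∨ ∃ j < N, e = (N + j, 2 * N, 2) := by
  simp [fanEdges, eq_comm]

/-- The fan with `a` sources, among them node `0`, and `b` sinks, among them node `2 N`. -/
def fan {N a b : ℕ} (α : ℕ → ℕ) (hN : 0 < N) (ha : a ≤ N) (hb : b ≤ N) : Instance where
  n := 3 * N
  edges := (fanEdges N α).map fun e => (fanNode hN e.1, fanNode hN e.2.1, e.2.2)
  edges_nodup := by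
    have : ((fanEdges N α).map fun e => (fanNode hN e.1, fanNode hN e.2.1, e.2.2)).map
        (fun e => (e.1, e.2.1)) =
        ((fanEdges N α).map fun e => (e.1, e.2.1)).map
          fun e => (fanNode hN e.1, fanNode hN e.2) := by
      simp [List.map_map, Function.comp_def]
    rw [this]
    refine List.Nodup.map_on ?_ ?_
    · rintro u hu v hv huv
      obtain ⟨e, he, rfl⟩ := List.mem_map.mp hu
      obtain ⟨e', he', rfl⟩ := List.mem_map.mp hv
      simp only [Prod.mk.injEq] at huv ⊢
      rw [mem_fanEdges] at he he'
      refine ⟨fanNode_inj ?_ ?_ huv.1, fanNode_inj ?_ ?_ huv.2⟩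
      · obtain ⟨j, hj, rfl⟩ | ⟨j, hj, rfl⟩ := he <;> dsimp only <;> omega
      · obtain ⟨j, hj, rfl⟩ | ⟨j, hj, rfl⟩ := he' <;> dsimp only <;> omega
      · obtain ⟨j, hj, rfl⟩ | ⟨j, hj, rfl⟩ := he <;> dsimp only <;> omega
      · obtain ⟨j, hj, rfl⟩ | ⟨j, hj, rfl⟩ := he' <;> dsimp only <;> omega
    · rw [fanEdges, List.map_append, List.map_map, List.map_map]
      refine List.Nodup.append (List.nodup_range.map ?_) (List.nodup_range.map ?_) ?_
      · intro i j h
        simpa using h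
      · intro i j h
        simpa using h
      · intro x hx hx'
        obtain ⟨i, -, rfl⟩ := List.mem_map.mp hx
        obtain ⟨j, -, h⟩ := List.mem_map.mp hx'
        simp only [Function.comp_apply, Prod.mk.injEq] at h
        omega
  loopless := by
    intro e he
    obtain ⟨e', he', rfl⟩ := List.mem_map.mp he
    obtain ⟨j, hj, rfl⟩ | ⟨j, hj, rfl⟩ := mem_fanEdges.mp he'
    · intro h
      have := fanNode_inj (hN := hN) (x := 0) (y := N + j) (by omega) (by omega) h
      omega
    · intro h
      have := fanNode_inj (hN := hN) (x := N + j) (y := 2 * N) (by omega) (by omega) h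
      omega
  S := (List.range a).map (fanNode hN)
  S_nodup := List.Nodup.map_on (fun i hi j hj h => by
    rw [List.mem_range] at hi hj
    exact fanNode_inj (by omega) (by omega) h) List.nodup_range
  T := (List.range b).map fun j => fanNode hN (2 * N + j)
  T_nodup := List.Nodup.map_on (fun i hi j hj h => by
    rw [List.mem_range] at hi hj
    have := fanNode_inj (by omega) (by omega) h
    omega) List.nodup_range

variable {N a b : ℕ} {α : ℕ → ℕ} {hN : 0 < N} {ha : a ≤ N} {hb : b ≤ N}

theorem sum_fanEdges (h : ℕ × ℕ × ℕ → ℝ) : ((fanEdges N α).map h).sum =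
    ∑ j ∈ Finset.range N, h (0, N + j, α j) + ∑ j ∈ Finset.range N, h (N + j, 2 * N, 2) := by
  rw [fanEdges, List.map_append, List.sum_append, List.map_map, List.map_map, sum_map_range,
    sum_map_range]
  rfl

/-- The edges out of node `0` form a minimum cut, so the maximum flow is the sum of their
capacities. -/
theorem fan_maxFlow (hα : ∀ j < N, α j ≤ 2) {r : ℝ}
    (hr : (fan α hN ha hb).IsMaxFlow (fanNode hN 0) (fanNode hN (2 * N)) r) :
    r = ∑ j ∈ Finset.range N, (α j : ℝ) := by
  have hE : (fan α hN ha hb).edges =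
      (fanEdges N α).map fun e => (fanNode hN e.1, fanNode hN e.2.1, e.2.2) := rfl
  have ne : ∀ {x y : ℕ}, x < 3 * N → y < 3 * N → x ≠ y → fanNode hN x ≠ fanNode hN y :=
    fun hx hy h hc => h (fanNode_inj hx hy hc)
  classical
  refine le_antisymm ?_ (hr.2 ?_)
  · obtain ⟨f, hf, rfl⟩ := hr.1
    refine (Instance.flowValue_le_cut hE hf (fun v => v = fanNode hN 0) rfl
      (ne (by omega) (by omega) (by omega))).trans ?_
    rw [sum_fanEdges, add_comm, Finset.sum_eq_zero, zero_add]
    · refine Finset.sum_le_sum fun j hj => ?_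
      dsimp only
      split_ifs
      · exact le_rfl
      · positivity
    · intro j hj
      rw [Finset.mem_range] at hj
      exact if_neg fun hc => ne (by omega) (by omega) (by omega) hc.1
  · refine Instance.exists_flow hE (ne (by omega) (by omega) (by omega))
      (fun u v => if u = 0 then α (v - N) else α (u - N)) _ ?_ ?_ fun π => ?_
    · intro e he
      split_ifs <;> positivity
    · intro e he
      obtain ⟨j, hj, rfl⟩ | ⟨j, hj, rfl⟩ := mem_fanEdges.mp he
      · simp
      · have := hα j hj
        simp only [Nat.add_sub_cancel_left, show N + j ≠ 0 by omega, if_false]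
        exact_mod_cast this
    · rw [sum_fanEdges, ← Finset.sum_add_distrib, Finset.sum_mul]
      refine Finset.sum_congr rfl fun j _ => ?_
      simp only [Nat.add_sub_cancel_left, show N + j ≠ 0 by omega, if_false, if_true]
      ring

theorem getD_append_cons (A B : List ℕ) (u v x : ℕ) :
    (A ++ v :: B).getD x 0 = if x = A.length then v else (A ++ u :: B).getD x 0 := by
  rcases lt_trichotomy x A.length with h | rfl | h
  · rw [if_neg h.ne, List.getD_append _ _ _ _ h, List.getD_append _ _ _ _ h]
  · simp
  · rw [if_neg h.ne', List.getD_append_right _ _ _ _ h.le, List.getD_append_right _ _ _ _ h.le]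
    obtain ⟨k, hk⟩ : ∃ k, x - A.length = k + 1 := ⟨x - A.length - 1, by omega⟩
    rw [hk, List.getD_cons_succ, List.getD_cons_succ]

/-- The capacity of the first edge of path `i` is the word at position `6 + 3 i` of the encoding,
and it occurs nowhere else. -/
theorem fan_encode (α : ℕ → ℕ) {i : ℕ} (hi : i < N) : ∃ A B, A.length = 6 + 3 * i ∧
    ∀ v, (fan (Function.update α i v) hN ha hb).encode = A ++ v :: B := by
  obtain ⟨k, rfl⟩ : ∃ k, N = i + (k + 1) := ⟨N - i - 1, by omega⟩
  obtain ⟨N, hNd⟩ : ∃ N, N = i + (k + 1) := ⟨_, rfl⟩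
  obtain ⟨w, hw⟩ : ∃ w : ℕ × ℕ × ℕ → List ℕ, w = fun e =>
    [(fanNode hN e.1 : ℕ), (fanNode hN e.2.1 : ℕ), e.2.2] := ⟨_, rfl⟩
  refine ⟨[3 * (i + (k + 1)), 2 * (i + (k + 1)), a, b] ++
    ((List.range i).flatMap fun j => w (0, i + (k + 1) + j, α j)) ++
      [(fanNode hN 0 : ℕ), (fanNode hN (i + (k + 1) + i) : ℕ)],
    ((List.range k).flatMap fun j => w (0, i + (k + 1) + (i + (j + 1)), α (i + (j + 1)))) ++
      (((List.range (i + (k + 1))).flatMap fun j => w (i + (k + 1) + j, 2 * (i + (k + 1)), 2)) ++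
      ((List.range a).map fun j => (fanNode hN j : ℕ)) ++
      (List.range b).map fun j => (fanNode hN (2 * (i + (k + 1)) + j) : ℕ)), ?_, fun v => ?_⟩
  · simp [List.length_flatMap, hw]
    ring
  · have h1 : ((List.range i).flatMap fun j => w (0, i + (k + 1) + j, Function.update α i v j)) =
        (List.range i).flatMap fun j => w (0, i + (k + 1) + j, α j) := by
      refine List.flatMap_congr fun j hj => ?_
      rw [List.mem_range] at hj
      rw [Function.update_of_ne hj.ne]
    have h2 : ((List.range (i + (k + 1))).flatMap fun j =>
        w (0, i + (k + 1) + j, Function.update α i v j)) =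
        ((List.range i).flatMap fun j => w (0, i + (k + 1) + j, α j)) ++
        (w (0, i + (k + 1) + i, v) ++
        (List.range k).flatMap fun j => w (0, i + (k + 1) + (i + (j + 1)), α (i + (j + 1)))) := by
      rw [List.range_add, List.flatMap_append, h1, List.range_succ_eq_map, List.map_cons,
        List.flatMap_cons, List.map_map, List.flatMap_map]
      simp
    have h3 : (fan (Function.update α i v) hN ha hb).edges.flatMap
        (fun e => [(e.1 : ℕ), (e.2.1 : ℕ), e.2.2]) =
        ((List.range (i + (k + 1))).flatMap fun j =>
          w (0, i + (k + 1) + j, Function.update α i v j)) ++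
        (List.range (i + (k + 1))).flatMap fun j => w (i + (k + 1) + j, 2 * (i + (k + 1)), 2) := by
      rw [hw]
      simp only [fan, fanEdges, List.flatMap_map, List.map_append, List.flatMap_append]
    rw [Instance.encode_eq, h3, h2]
    simp [fan, fanEdges, hw, List.map_map, Function.comp_def]
    ring

/-- The fans are admissible inputs of the flow program. -/
theorem fan_sparse {c₁ c₂ : ℝ}
    (hc₁ : c₁ ∈ Set.Icc (0 : ℝ) 1) (hc₂ : c₂ ∈ Set.Icc (0 : ℝ) 1) (hα : ∀ j < N, 1 ≤ α j ∧ α j ≤ 2)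
    (ha₁ : (N : ℝ) ^ c₁ ≤ a) (ha₂ : (a : ℝ) ≤ 2 * (N : ℝ) ^ c₁)
    (hb₁ : (N : ℝ) ^ c₂ ≤ b) (hb₂ : (b : ℝ) ≤ 2 * (N : ℝ) ^ c₂) :
    (fan α hN ha hb).Sparse c₁ c₂ 10 := by
  have hm : (fan α hN ha hb).edges.length = 2 * N := by
    simp [fan, fanEdges]
    ring
  have hS : (fan α hN ha hb).S.length = a := by simp [fan]
  have hT : (fan α hN ha hb).T.length = b := by simp [fan]
  have pos : ∀ {S : ℕ} {c : ℝ}, (N : ℝ) ^ c ≤ S → 0 < S := fun {S c} hS => by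
    have : (0 : ℝ) < (N : ℝ) ^ c := Real.rpow_pos_of_pos (by exact_mod_cast hN) c
    exact_mod_cast this.trans_le hS
  refine ⟨?_, ?_, ?_, ?_, ?_, ?_, ?_⟩
  · rw [hm]
    change _ ≤ 10 * (3 * N)
    omega
  · rw [hm]
    change 3 * N ≤ _
    omega
  · intro e he
    obtain ⟨e', he', rfl⟩ := List.mem_map.mp he
    change 1 ≤ e'.2.2 ∧ e'.2.2 ≤ 3 * N
    obtain ⟨j, hj, rfl⟩ | ⟨j, hj, rfl⟩ := mem_fanEdges.mp he'
    · have := hα j hj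
      dsimp only
      omega
    · dsimp only
      omega
  · rw [← List.length_pos_iff, hS]
    exact pos ha₁
  · rw [← List.length_pos_iff, hT]
    exact pos hb₁
  · rw [hS]
    exact thetaTilde_rpow hc₁ (n := 3 * N) (by omega) (by omega) (by omega) ha₁ ha₂
  · rw [hT]
    exact thetaTilde_rpow hc₂ (n := 3 * N) (by omega) (by omega) (by omega) hb₁ hb₂

end MaxFlow

namespace WordRAM

open MaxFlow

/-- A program that solves the fans has to read all capacities. -/
theorem le_time_of_fan {p : Program} {N a b : ℕ} {hN : 0 < N} {ha : a ≤ N} {hb : b ≤ N}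
    (ha₀ : 0 < a) (hb₀ : 0 < b) {W t : ℕ} {s : State}
    (hrun : Runs W p (initState (fan (fun _ => 1) hN ha hb).encode) t s)
    (hcor : STMaxFlow.Correct (fan (fun _ => 1) hN ha hb) (s.mem 1))
    (h : ∀ i < N, ∃ W t s, Runs W p
      (initState (fan (Function.update (fun _ => 1) i 2) hN ha hb).encode) t s ∧
      STMaxFlow.Correct (fan (Function.update (fun _ => 1) i 2) hN ha hb) (s.mem 1)) :
    N ≤ t := by
  by_contra ht
  obtain ⟨R, hR, hR'⟩ := hrun.exists_untouched
  obtain ⟨i, hi, hiR⟩ : ∃ i < N, 6 + 3 * i ∉ R := by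
    by_contra! hc
    have h1 : (Finset.range N).image (fun i => 6 + 3 * i) ⊆ R := by
      intro x hx
      obtain ⟨i, hi, rfl⟩ := Finset.mem_image.mp hx
      exact hc i (Finset.mem_range.mp hi)
    have h2 := Finset.card_le_card h1
    rw [Finset.card_image_of_injective _ fun i j hij => by simpa using hij,
      Finset.card_range] at h2
    omega
  -- doubling the capacity in an untouched cell changes the maximum flow but not the output
  obtain ⟨W', t', s', hrun', hcor'⟩ := h i hi
  obtain ⟨A, B, hA, hAB⟩ := fan_encode (N := N) (a := a) (b := b) (hN := hN) (ha := ha) (hb := hb)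
    (fun _ => 1) hi
  have h1 := hAB 1
  rw [Function.update_eq_self] at h1
  have h2 : initState (fan (Function.update (fun _ => 1) i 2) hN ha hb).encode =
      (initState (fan (fun _ => 1) hN ha hb).encode).setMem 0 (6 + 3 * i) 2 := by
    rw [h1, hAB 2]
    have e1 : (initState (A ++ 2 :: B)).mem =
        ((initState (A ++ 1 :: B)).setMem 0 (6 + 3 * i) 2).mem := by
      funext c k
      rw [State.setMem_mem, ← hA]
      simp only [initState]
      by_cases hc : c = 0
      · simp only [hc, if_true, true_and]
        exact getD_append_cons A B 1 2 k
      · simp [hc]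
    have e2 : (initState (A ++ 2 :: B)).reg =
        ((initState (A ++ 1 :: B)).setMem 0 (6 + 3 * i) 2).reg := by
      simp [initState]
    exact congrArg₂ State.mk e2 e1
  have h3 := hR' _ hiR 2
  rw [← h2] at h3
  have h4 := hrun'.deterministic h3
  have h5 : s'.mem 1 = s.mem 1 := by
    rw [h4]
    funext k
    rw [State.setMem_mem]
    exact if_neg fun hc => absurd hc.1 (by norm_num)
  have key : ∀ {α : ℕ → ℕ} {out : ℕ → ℕ}, (∀ j < N, α j ≤ 2) →
      STMaxFlow.Correct (fan α hN ha hb) out → (out 0 : ℝ) = ∑ j ∈ Finset.range N, (α j : ℝ) := by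
    intro α out hα hc
    have g1 : (fan α hN ha hb).S.length = a := by simp [fan]
    have g2 : (fan α hN ha hb).T.length = b := by simp [fan]
    have g3 := hc ⟨0, by rw [g1]; exact ha₀⟩ ⟨0, by rw [g2]; exact hb₀⟩
    have g4 : (fan α hN ha hb).S.get ⟨0, by rw [g1]; exact ha₀⟩ = fanNode hN 0 := by simp [fan]
    have g5 : (fan α hN ha hb).T.get ⟨0, by rw [g2]; exact hb₀⟩ = fanNode hN (2 * N) := by
      simp [fan]
    rw [g4, g5] at g3
    have g6 := fan_maxFlow hα (g3 fun hc => by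
      have := fanNode_inj (hN := hN) (x := 0) (y := 2 * N) (by omega) (by omega) hc
      omega)
    simpa using g6
  have k1 := key (α := fun _ => 1) (fun _ _ => by norm_num) hcor
  have k2 := key (α := Function.update (fun _ => 1) i 2) (fun j _ => by
    rw [Function.update_apply]; split_ifs <;> norm_num) hcor'
  rw [h5, k1] at k2
  refine absurd k2 (ne_of_lt (Finset.sum_lt_sum (fun j _ => ?_) ⟨i, Finset.mem_range.mpr hi, ?_⟩))
  · rw [Function.update_apply]
    split_ifs <;> norm_num
  · rw [Function.update_self]
    norm_num

/-- The flow problem takes at least linear time. -/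
theorem one_le_exponent {ε c₁ c₂ : ℝ} (hε : 0 < ε) (hc₁ : c₁ ∈ Set.Icc (0 : ℝ) 1)
    (hc₂ : c₂ ∈ Set.Icc (0 : ℝ) 1)
    (hp : SolvableInTime STMaxFlow (fun G : Instance => G.Sparse c₁ c₂ 10)
      (fun G : Instance =>
        ((G.S.length : ℝ) * (G.T.length : ℝ) * (G.edges.length : ℝ)) ^ (1 - ε))) :
    1 ≤ (1 + c₁ + c₂) * (1 - ε) := by
  by_contra! hlt
  obtain ⟨p, C, hp⟩ := hp
  -- the maximum with `0` covers `ε > 1`, where the time bound decreases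
  obtain ⟨γ, hγ⟩ : ∃ γ, γ = max ((1 + c₁ + c₂) * (1 - ε)) 0 := ⟨_, rfl⟩
  have hγ1 : γ < 1 := hγ ▸ max_lt hlt one_pos
  have hγ0 : 0 ≤ γ := hγ ▸ le_max_right _ _
  -- the fan on `N` paths allows at most `8 C N ^ γ` steps, which is less than `N`
  obtain ⟨N, hNC, hN⟩ : ∃ N : ℕ, (C : ℝ) * 8 < (N : ℝ) ^ (1 - γ) ∧ 0 < N :=
    (((tendsto_rpow_atTop (by linarith : 0 < 1 - γ)).comp
      tendsto_natCast_atTop_atTop).eventually_gt_atTop _ |>.and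
      (Filter.eventually_gt_atTop 0)).exists
  have N1 : (1 : ℝ) ≤ N := by exact_mod_cast hN
  have ceil : ∀ {c : ℝ}, c ∈ Set.Icc (0 : ℝ) 1 → ⌈(N : ℝ) ^ c⌉₊ ≤ N ∧ 0 < ⌈(N : ℝ) ^ c⌉₊ ∧
      (⌈(N : ℝ) ^ c⌉₊ : ℝ) ≤ 2 * (N : ℝ) ^ c := by
    intro c hc
    have h1 : 1 ≤ (N : ℝ) ^ c := Real.one_le_rpow N1 hc.1
    refine ⟨Nat.ceil_le.mpr ?_, Nat.ceil_pos.mpr (by linarith), ?_⟩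
    · exact (Real.rpow_le_rpow_of_exponent_le N1 hc.2).trans_eq (Real.rpow_one _)
    · linarith [Nat.ceil_lt_add_one (by linarith : 0 ≤ (N : ℝ) ^ c)]
  obtain ⟨a, had⟩ : ∃ a, a = ⌈(N : ℝ) ^ c₁⌉₊ := ⟨_, rfl⟩
  obtain ⟨b, hbd⟩ : ∃ b, b = ⌈(N : ℝ) ^ c₂⌉₊ := ⟨_, rfl⟩
  obtain ⟨ha, ha₀, ha₂⟩ := ceil hc₁
  obtain ⟨hb, hb₀, hb₂⟩ := ceil hc₂
  have ha₁ := Nat.le_ceil ((N : ℝ) ^ c₁)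
  have hb₁ := Nat.le_ceil ((N : ℝ) ^ c₂)
  rw [← had] at ha ha₀ ha₁ ha₂
  rw [← hbd] at hb hb₀ hb₁ hb₂
  obtain ⟨W, t, s, -, -, -, ht, hrun, hcor⟩ := hp (fan (fun _ => 1) hN ha hb)
    (fan_sparse hc₁ hc₂ (fun _ _ => by norm_num) ha₁ ha₂ hb₁ hb₂)
  have hNt := le_time_of_fan ha₀ hb₀ hrun hcor fun i _ => by
    obtain ⟨W, t, s, -, -, -, -, hrun, hcor⟩ := hp (fan (Function.update (fun _ => 1) i 2) hN ha hb)
      (fan_sparse hc₁ hc₂ (fun j _ => by rw [Function.update_apply]; split_ifs <;> norm_num)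
        ha₁ ha₂ hb₁ hb₂)
    exact ⟨W, t, s, hrun, hcor⟩
  have hm : (fan (fun _ => 1) hN ha hb).edges.length = 2 * N := by
    simp [fan, fanEdges]
    ring
  have hS : (fan (fun _ => 1) hN ha hb).S.length = a := by simp [fan]
  have hT : (fan (fun _ => 1) hN ha hb).T.length = b := by simp [fan]
  dsimp only at ht
  rw [hm, hS, hT] at ht
  have a1 : (1 : ℝ) ≤ a := by exact_mod_cast ha₀
  have b1 : (1 : ℝ) ≤ b := by exact_mod_cast hb₀
  have N0 : (0 : ℝ) < N := by linarith
  have hbound : ((a : ℝ) * b * (2 * N : ℕ)) ^ (1 - ε) ≤ 8 * (N : ℝ) ^ γ := by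
    have hg : 1 ≤ (N : ℝ) ^ γ := Real.one_le_rpow N1 hγ0
    rcases le_total (1 - ε) 0 with h0 | h0
    · refine (Real.rpow_le_one_of_one_le_of_nonpos ?_ h0).trans (by linarith)
      push_cast
      exact one_le_mul_of_one_le_of_one_le (one_le_mul_of_one_le_of_one_le a1 b1) (by linarith)
    · have h1 : (a : ℝ) * b * (2 * N : ℕ) ≤ 8 * (N : ℝ) ^ (1 + c₁ + c₂) := by
        rw [Real.rpow_add N0, Real.rpow_add N0, Real.rpow_one]
        push_cast
        calc (a : ℝ) * b * (2 * N) ≤ (2 * (N : ℝ) ^ c₁) * (2 * (N : ℝ) ^ c₂) * (2 * N) := by gcongr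
          _ = _ := by ring
      calc _ ≤ (8 * (N : ℝ) ^ (1 + c₁ + c₂)) ^ (1 - ε) := Real.rpow_le_rpow (by positivity) h1 h0
        _ = 8 ^ (1 - ε) * (N : ℝ) ^ ((1 + c₁ + c₂) * (1 - ε)) := by
            rw [Real.mul_rpow (by norm_num) (by positivity), ← Real.rpow_mul N0.le]
        _ ≤ 8 * (N : ℝ) ^ γ := by
            refine mul_le_mul ?_ ?_ (by positivity) (by norm_num)
            · exact (Real.rpow_le_rpow_of_exponent_le (by norm_num) (by linarith)).trans_eq
                (Real.rpow_one _)
            · exact Real.rpow_le_rpow_of_exponent_le N1 (hγ ▸ le_max_left _ _)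
  have h1 : (N : ℝ) ≤ C * (8 * (N : ℝ) ^ γ) :=
    (by exact_mod_cast hNt : (N : ℝ) ≤ t).trans (ht.trans (mul_le_mul_of_nonneg_left hbound
      (by positivity)))
  have h2 : (C : ℝ) * 8 * (N : ℝ) ^ γ < (N : ℝ) ^ (1 - γ) * (N : ℝ) ^ γ :=
    mul_lt_mul_of_pos_right hNC (Real.rpow_pos_of_pos N0 _)
  rw [← Real.rpow_add N0, sub_add_cancel, Real.rpow_one] at h2
  linarith

end WordRAM

theorem theorem1 (ε : ℝ) (hε : 0 < ε) :
    ∃ δ : ℝ, 0 < δ ∧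
      ∀ c₁ c₂ : ℝ, c₁ ∈ Set.Icc (0 : ℝ) 1 → c₂ ∈ Set.Icc (0 : ℝ) 1 →
        (∀ K : ℕ, WordRAM.SolvableInTime MaxFlow.STMaxFlow
          (fun G : MaxFlow.Instance => G.Sparse c₁ c₂ K)
          (fun G : MaxFlow.Instance =>
            ((G.S.length : ℝ) * (G.T.length : ℝ) * (G.edges.length : ℝ)) ^ (1 - ε))) →
        (∀ K : ℕ, WordRAM.SolvableInTime SAT.MaxCNFSAT
          (fun F : SAT.CNF => F.clauses.length ≤ K * F.n)
          (fun F : SAT.CNF => (2 : ℝ) ^ ((1 - δ) * (F.n : ℝ)))) ∧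
        ¬ SAT.SETH := by
  obtain ⟨q, hq, hqε⟩ : ∃ q : ℕ, 3 ≤ q ∧ 1 / (q : ℝ) ≤ ε := by
    obtain ⟨k, hk⟩ := exists_nat_one_div_lt hε
    refine ⟨k + 3, by omega, le_trans ?_ hk.le⟩
    push_cast
    exact one_div_le_one_div_of_le (by positivity) (by linarith)
  have hδ : (0 : ℝ) < 1 / (2 * q : ℝ) := by
    have : (0 : ℝ) < q := by exact_mod_cast (by omega : 0 < q)
    positivity
  refine ⟨1 / (2 * q : ℝ), hδ, fun c₁ c₂ hc₁ hc₂ hp => ?_⟩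
  have hκ := WordRAM.one_le_exponent hε hc₁ hc₂ (hp 10)
  refine ⟨WordRAM.maxCNFSAT_solvable hq hqε hc₁ hc₂ hκ (hp 10), fun hSETH => ?_⟩
  obtain ⟨k, -, hk⟩ := hSETH _ hδ
  exact hk (WordRAM.kSATSolvable hq hqε hc₁ hc₂ hκ (hp 10) k)
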